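/- **Conventions.** Let $k$ be a commutative ring and let $\mathcal A$ be a small DG category over $k$ (differentials have degree $+1$). A *right DG $\mathcal A$-module* is a DG functor from $\mathcal A^\circ$ to complexes of $k$-modules; for $X\in\mathcal A$ put $h_X:=\operatorname{Hom}(?,X)$. A right DG module is *free* if it is isomorphic to a direct sum of modules $h_X[n]$, and *semi-free* if it is the union of an increasing sequence of DG submodules $0=F_0\subset F_1\subset F_2\subset\dots$ with all quotients $F_i/F_{i-1}$ free. Let $\mathcal A_{\to}$ be the DG category of semi-free right DG $\mathcal A$-modules (the ind-version of $\mathcal A$), and let $\mathcal A_{\leftarrow}:=((\mathcal A^\circ)_{\to})^\circ$ (the pro-version). The Yoneda embeddings give fully faithful DG functors $\mathcal A_{\leftarrow}\leftarrow\mathcal A\to\mathcal A_{\to}$. For a DG category $\mathcal C$ let $\mathcal C^{\mathrm{pretr}}$ be the DG category of one-sided twisted complexes over $\mathcal C$ (formal finite sums $\bigoplus_{i=1}^n C_i[r_i]$ with a strictly upper triangular matrix $q$ of degree $1$ satisfying $dq+q^2=0$), and let $\mathcal C^{\mathrm{tr}}:=\operatorname{Ho}(\mathcal C^{\mathrm{pretr}})$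 (same objects, morphisms $H^0\operatorname{Hom}$). This is a triangulated category: its distinguished triangles are those isomorphic to $X\xrightarrow{f}Y\to\operatorname{Cone}(f)\to X[1]$ for closed $f$ of degree $0$ in $\mathcal C^{\mathrm{pretr}}$. For a triangulated category $\mathcal T$ and a class of objects $\mathcal Q$, the right (left) orthogonal complement $\mathcal Q^\perp$ (resp. ${}^\perp\mathcal Q$) consists of the objects $X$ with $\operatorname{Hom}(Y,X)=0$ (resp. $\operatorname{Hom}(X,Y)=0$) for all $Y\in\mathcal Q$. A strictly full triangulated subcategory $\mathcal Q\subset\mathcal T$ is *right-admissible* (resp. *left-admissible*) if every $X\in\mathcal T$ fits into a distinguished triangle $X'\to X\to X''\to X'[1]$ with $X'\in\mathcal Q$, $X''\in\mathcal Q^\perp$ (resp. $X'\in{}^\perp\mathcal Q$, $X''\in\mathcal Q$). $\mathcal T/\mathcal Q$ denotes the Verdier quotient, the localization of $\mathcal T$ at the morphisms whose cone is isomorphic to an object of $\mathcal Q$. Let $\mathcal B\subset\mathcal A$ be a full DG subcategory. The induction functors $N\mapsto N\otimes_{\mathcal B}\operatorname{Hom}_{\mathcal A}(?,\cdot)$ give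 functors $\mathcal B_{\to}\to\mathcal A_{\to}$ and, dually, $\mathcal B_{\leftarrow}\to\mathcal A_{\leftarrow}$. Let $\mathcal B^\perp$ be the full DG subcategory of $\mathcal A_{\to}$ of all $X$ such that the complex $\operatorname{Hom}(b,X)$ is acyclic for every $b\in\mathcal B$, and ${}^\perp\mathcal B$ the full DG subcategory of $\mathcal A_{\leftarrow}$ of all $X$ such that $\operatorname{Hom}(X,b)$ is acyclic for every $b\in\mathcal B$. When a quotient by $\mathcal B^{\mathrm{tr}}$, $(\mathcal B_{\to})^{\mathrm{tr}}$ or $(\mathcal B_{\leftarrow})^{\mathrm{tr}}$ is taken below, it is the quotient by the essential image. **Proposition.** (i) The essential image of $(\mathcal B_{\to})^{\mathrm{tr}}$ in $(\mathcal A_{\to})^{\mathrm{tr}}$ is right-admissible; in particular it is a strictly full triangulated subcategory. (ii) The right orthogonal complement of $(\mathcal B_{\to})^{\mathrm{tr}}$ in $(\mathcal A_{\to})^{\mathrm{tr}}$ equals $(\mathcal B^\perp)^{\mathrm{tr}}$, i.e. the functor $(\mathcal B^\perp)^{\mathrm{tr}}\to(\mathcal A_{\to})^{\mathrm{tr}}$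 induced by the inclusion is fully faithful and its essential image is this orthogonal complement. (iii) The composite functor $(\mathcal B^\perp)^{\mathrm{tr}}\to(\mathcal A_{\to})^{\mathrm{tr}}\to(\mathcal A_{\to})^{\mathrm{tr}}/(\mathcal B_{\to})^{\mathrm{tr}}$ is an equivalence. (iv) The functor $\mathcal A^{\mathrm{tr}}\to(\mathcal A_{\to})^{\mathrm{tr}}$ induced by the Yoneda embedding descends (up to isomorphism) to a functor $\mathcal A^{\mathrm{tr}}/\mathcal B^{\mathrm{tr}}\to(\mathcal A_{\to})^{\mathrm{tr}}/(\mathcal B_{\to})^{\mathrm{tr}}$, and this functor is fully faithful. (i$^\circ$) The essential image of $(\mathcal B_{\leftarrow})^{\mathrm{tr}}$ in $(\mathcal A_{\leftarrow})^{\mathrm{tr}}$ is left-admissible; in particular it is a strictly full triangulated subcategory. (ii$^\circ$) The functor $({}^\perp\mathcal B)^{\mathrm{tr}}\to(\mathcal A_{\leftarrow})^{\mathrm{tr}}$ is fully faithful and its essential image is the left orthogonal complement of $(\mathcal B_{\leftarrow})^{\mathrm{tr}}$ in $(\mathcal A_{\leftarrow})^{\mathrm{tr}}$. (iii$^\circ$)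 The composite functor $({}^\perp\mathcal B)^{\mathrm{tr}}\to(\mathcal A_{\leftarrow})^{\mathrm{tr}}\to(\mathcal A_{\leftarrow})^{\mathrm{tr}}/(\mathcal B_{\leftarrow})^{\mathrm{tr}}$ is an equivalence. (iv$^\circ$) The functor $\mathcal A^{\mathrm{tr}}\to(\mathcal A_{\leftarrow})^{\mathrm{tr}}$ induced by $\mathcal A\to\mathcal A_{\leftarrow}$ descends (up to isomorphism) to a functor $\mathcal A^{\mathrm{tr}}/\mathcal B^{\mathrm{tr}}\to(\mathcal A_{\leftarrow})^{\mathrm{tr}}/(\mathcal B_{\leftarrow})^{\mathrm{tr}}$, and this functor is fully faithful. -/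

import Mathlib

open CategoryTheory

universe v u v' u' v'' u'' w

namespace DG

/-- The sign `(-1)^n` as an element of the ground ring. -/
def sgn (k : Type w) [CommRing k] (n : ℤ) : k := ((n.negOnePow : ℤ) : k)

section sgn

variable (k : Type w) [CommRing k]

theorem sgn_zero : sgn k 0 = 1 := by simp [sgn]

theorem sgn_add (m n : ℤ) : sgn k (m + n) = sgn k m * sgn k n := by
  simp [sgn, Int.negOnePow_add]

theorem sgn_succ (n : ℤ) : sgn k (n + 1) = -sgn k n := by
  simp [sgn, Int.negOnePow_succ]

theorem sgn_mul_self (n : ℤ) : sgn k n * sgn k n = 1 := by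
  rw [← sgn_add]
  simp [sgn, Int.negOnePow_even _ (Even.add_self n)]

end sgn

/-- A differential graded `k`-category structure on a type `C` of objects: `Hom X Y` is a complex of
`k`-modules with homogeneous components `Hom X Y n` and differential of degree `1`, and
`comp h g f` is the composition `g ∘ f`, which satisfies the graded Leibniz rule
`d (g ∘ f) = d g ∘ f + (-1)^|g| g ∘ d f`. Degrees of results are matched by equations, so that no
casts are needed. -/
class DGCategory (k : Type w) [CommRing k] (C : Type u) where
  Hom : C → C → ℤ → Type v
  [addCommGroup : ∀ X Y n, AddCommGroup (Hom X Y n)]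
  [module : ∀ X Y n, Module k (Hom X Y n)]
  d : ∀ {X Y : C} {m n : ℤ}, m + 1 = n → (Hom X Y m →ₗ[k] Hom X Y n)
  id : ∀ X : C, Hom X X 0
  comp : ∀ {X Y Z : C} {q p r : ℤ}, q + p = r → (Hom Y Z q →ₗ[k] Hom X Y p →ₗ[k] Hom X Z r)
  d_d : ∀ {X Y : C} {m n l : ℤ} (h : m + 1 = n) (h' : n + 1 = l) (f : Hom X Y m), d h' (d h f) = 0
  id_comp : ∀ {X Y : C} {p : ℤ} (h : 0 + p = p) (f : Hom X Y p), comp h (id Y) f = f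
  comp_id : ∀ {X Y : C} {p : ℤ} (h : p + 0 = p) (f : Hom X Y p), comp h f (id X) = f
  assoc : ∀ {X Y Z W : C} {p q r pq qr n : ℤ} (h₁ : r + q = qr) (h₂ : qr + p = n)
    (h₃ : q + p = pq) (h₄ : r + pq = n) (h : Hom Z W r) (g : Hom Y Z q) (f : Hom X Y p),
    comp h₂ (comp h₁ h g) f = comp h₄ h (comp h₃ g f)
  d_comp : ∀ {X Y Z : C} {q p r q' p' s : ℤ} (h : q + p = r) (hr : r + 1 = s) (hq : q + 1 = q')
    (hp : p + 1 = p') (h₁ : q' + p = s) (h₂ : q + p' = s) (g : Hom Y Z q) (f : Hom X Y p),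
    d hr (comp h g f) = comp h₁ (d hq g) f + sgn k q • comp h₂ g (d hp f)

attribute [reducible, instance] DGCategory.addCommGroup DGCategory.module

/-- The degree `n` component of the complex of morphisms from `X` to `Y`. -/
abbrev Hom (k : Type w) [CommRing k] {C : Type u} [DGCategory.{v} k C] (X Y : C) (n : ℤ) : Type v :=
  DGCategory.Hom (k := k) X Y n

section basic

variable {k : Type w} [CommRing k] {C : Type u} [DGCategory.{v} k C]

/-- The differential on morphisms. -/
abbrev d {X Y : C} {m n : ℤ} (h : m + 1 = n) : Hom k X Y m →ₗ[k] Hom k X Y n := DGCategory.d h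

/-- The composition `g ∘ f`. -/
abbrev comp {X Y Z : C} {q p r : ℤ} (h : q + p = r) :
    Hom k Y Z q →ₗ[k] Hom k X Y p →ₗ[k] Hom k X Z r := DGCategory.comp h

variable (k) in
/-- The identity, closed of degree `0`. -/
abbrev idd (X : C) : Hom k X X 0 := DGCategory.id X

theorem d_id (X : C) {n : ℤ} (h : 0 + 1 = n) : d h (idd k X) = 0 := by
  have h1 := DGCategory.d_comp (k := k) (add_zero 0) h h h (by omega) (by omega) (idd k X) (idd k X)
  obtain rfl : n = 1 := by omega
  rw [DGCategory.id_comp] at h1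
  have h2 := DGCategory.comp_id (k := k) (add_zero 1) (d h (idd k X))
  have h3 := DGCategory.id_comp (k := k) (zero_add 1) (d h (idd k X))
  rw [h2, h3, sgn_zero, one_smul] at h1
  simpa using h1

/-- The identity, viewed in a degree that is equal to `0`. -/
def idAt (X : C) {n : ℤ} (h : n = 0) : Hom k X X n := h.symm ▸ idd k X

theorem idAt_comp {X Y : C} {n p : ℤ} (h : n = 0) (hp : n + p = p)
    (f : Hom k X Y p) : comp hp (idAt (k := k) Y h) f = f := by
  subst h
  exact DGCategory.id_comp _ _

theorem comp_idAt {X Y : C} {n p : ℤ} (h : n = 0) (hp : p + n = p)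
    (f : Hom k X Y p) : comp hp f (idAt (k := k) X h) = f := by
  subst h
  exact DGCategory.comp_id _ _

theorem d_idAt (X : C) {n m : ℤ} (h : n = 0) (hm : n + 1 = m) :
    d hm (idAt (k := k) X h) = 0 := by
  subst h
  exact d_id _ _

end basic

/-- A DG functor. -/
structure DGFunctor (k : Type w) [CommRing k] (C : Type u) [DGCategory.{v} k C]
    (D : Type u') [DGCategory.{v'} k D] where
  obj : C → D
  map : ∀ {X Y : C} {n : ℤ}, Hom k X Y n →ₗ[k] Hom k (obj X) (obj Y) n
  map_d : ∀ {X Y : C} {m n : ℤ} (h : m + 1 = n) (f : Hom k X Y m), map (d h f) = d h (map f)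
  map_id : ∀ X : C, map (idd k X) = idd k (obj X)
  map_comp : ∀ {X Y Z : C} {q p r : ℤ} (h : q + p = r) (g : Hom k Y Z q) (f : Hom k X Y p),
    map (comp h g f) = comp h (map g) (map f)

/-- Composition of DG functors, `F` first. -/
def DGFunctor.trans {k : Type w} [CommRing k] {C : Type u} [DGCategory.{v} k C]
    {D : Type u'} [DGCategory.{v'} k D] {E : Type u''} [DGCategory.{v''} k E]
    (F : DGFunctor k C D) (G : DGFunctor k D E) : DGFunctor k C E where
  obj X := G.obj (F.obj X)
  map := G.map ∘ₗ F.map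
  map_d h f := by simp [F.map_d, G.map_d]
  map_id X := by simp [F.map_id, G.map_id]
  map_comp h g f := by simp [F.map_comp, G.map_comp]

/-- The full DG subcategory on the objects satisfying `P`. -/
structure FullSub {C : Type u} (P : C → Prop) where
  obj : C
  property : P obj

section fullSub

variable {k : Type w} [CommRing k] {C : Type u} [DGCategory.{v} k C]

instance (P : C → Prop) : DGCategory.{v} k (FullSub P) where
  Hom X Y n := Hom k X.obj Y.obj n
  d h := DGCategory.d h
  id X := DGCategory.id X.obj
  comp h := DGCategory.comp h
  d_d := DGCategory.d_d
  id_comp := DGCategory.id_comp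
  comp_id := DGCategory.comp_id
  assoc := DGCategory.assoc
  d_comp := DGCategory.d_comp

variable (k) in
/-- The inclusion of a full DG subcategory. -/
def FullSub.incl (P : C → Prop) : DGFunctor k (FullSub P) C where
  obj X := X.obj
  map := LinearMap.id
  map_d _ _ := rfl
  map_id _ := rfl
  map_comp _ _ _ := rfl

end fullSub

/-- Objects of the dual DG category `C°`. -/
structure DGOp (C : Type u) where
  unop : C

section op

variable {k : Type w} [CommRing k]

/-- The dual DG category: the composite of `g` and `f` in `C°` is `(-1)^{|g||f|} f ∘ g`. -/
instance (C : Type u) [DGCategory.{v} k C] : DGCategory.{v} k (DGOp C) where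
  Hom X Y n := Hom k Y.unop X.unop n
  d h := DGCategory.d h
  id X := DGCategory.id X.unop
  comp {_ _ _ q p _} h := sgn k (q * p) • (DGCategory.comp ((add_comm p q).trans h)).flip
  d_d := DGCategory.d_d
  id_comp h f := by simp [sgn_zero, DGCategory.comp_id]
  comp_id h f := by simp [sgn_zero, DGCategory.id_comp]
  assoc {_ _ _ _ p q r pq qr n} h₁ h₂ h₃ h₄ h g f := by
    subst h₁ h₃
    simp only [LinearMap.smul_apply, LinearMap.flip_apply, map_smul, smul_smul]
    rw [← DGCategory.assoc (qr := q + p) (by omega) (by omega) (by omega) (by omega)]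
    congr 1
    simp only [add_mul, mul_add, sgn_add]
    ring
  d_comp {_ _ _ q p r q' p' s} h hr hq hp h₁ h₂ g f := by
    subst hq hp
    simp only [LinearMap.smul_apply, LinearMap.flip_apply, map_smul, smul_smul]
    rw [DGCategory.d_comp _ _ rfl rfl (by omega) (by omega), smul_add, smul_smul]
    rw [add_comm]
    have e : sgn k q * sgn k q = 1 := sgn_mul_self k q
    congr 2
    · simp only [add_mul, sgn_add, one_mul]
    · simp only [mul_add, sgn_add, mul_one]
      linear_combination (-sgn k (q * p)) * e

/-- The dual of a DG functor. -/
def DGFunctor.op {C : Type u} [DGCategory.{v} k C] {D : Type u'} [DGCategory.{v'} k D]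
    (F : DGFunctor k C D) : DGFunctor k (DGOp C) (DGOp D) where
  obj X := ⟨F.obj X.unop⟩
  map := F.map
  map_d h f := F.map_d h f
  map_id X := F.map_id X.unop
  map_comp {_ _ _ q p _} h g f := by
    refine (map_smul F.map (sgn k (q * p)) _).trans (congrArg (sgn k (q * p) • ·) ?_)
    exact F.map_comp _ _ _

/-- The canonical isomorphism from `C` to `C°°`. -/
def toOpOp (k : Type w) [CommRing k] (C : Type u) [DGCategory.{v} k C] :
    DGFunctor k C (DGOp (DGOp C)) where
  obj X := ⟨⟨X⟩⟩
  map := LinearMap.id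
  map_d _ _ := rfl
  map_id _ := rfl
  map_comp {_ _ _ q p _} h g f := by
    change _ = sgn k (q * p) • sgn k (p * q) • DGCategory.comp h g f
    rw [smul_smul, mul_comm p q, sgn_mul_self, one_smul]
    rfl

end op

/-! ### DG modules -/

/-- A right DG module over `A`, i.e. a DG `A°`-module: complexes `obj X` of `k`-modules and a right
action of the morphisms of `A`. -/
structure DGModule (k : Type w) [CommRing k] (A : Type u) [DGCategory.{u} k A] where
  obj : A → ℤ → Type u
  [addCommGroup : ∀ X n, AddCommGroup (obj X n)]
  [module : ∀ X n, Module k (obj X n)]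
  d : ∀ {X : A} {m n : ℤ}, m + 1 = n → (obj X m →ₗ[k] obj X n)
  act : ∀ {X Y : A} {q p r : ℤ}, q + p = r → (obj Y q →ₗ[k] Hom k X Y p →ₗ[k] obj X r)
  d_d : ∀ {X : A} {m n l : ℤ} (h : m + 1 = n) (h' : n + 1 = l) (x : obj X m), d h' (d h x) = 0
  act_id : ∀ {X : A} {p : ℤ} (h : p + 0 = p) (x : obj X p), act h x (idd k X) = x
  act_act : ∀ {X Y Z : A} {p q r pq qr n : ℤ} (h₁ : r + q = qr) (h₂ : qr + p = n)
    (h₃ : q + p = pq) (h₄ : r + pq = n) (x : obj Z r) (g : Hom k Y Z q) (f : Hom k X Y p),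
    act h₂ (act h₁ x g) f = act h₄ x (comp h₃ g f)
  d_act : ∀ {X Y : A} {q p r q' p' s : ℤ} (h : q + p = r) (hr : r + 1 = s) (hq : q + 1 = q')
    (hp : p + 1 = p') (h₁ : q' + p = s) (h₂ : q + p' = s) (x : obj Y q) (f : Hom k X Y p),
    d hr (act h x f) = act h₁ (d hq x) f + sgn k q • act h₂ x (DG.d hp f)

attribute [instance] DGModule.addCommGroup DGModule.module

namespace DGModule

section

variable {k : Type w} [CommRing k] {A : Type u} [DGCategory.{u} k A]

/-- Morphisms of degree `n` of right DG modules: maps raising the degree by `n` that commute with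
the right action (not necessarily with the differentials). -/
def homs (M N : DGModule k A) (n : ℤ) :
    Submodule k (∀ (X : A) (p : ℤ) (q : { q : ℤ // p + n = q }), M.obj X p →ₗ[k] N.obj X q) where
  carrier := { φ | ∀ (X Y : A) (p q s t r : ℤ) (hq : p + n = q) (ht : p + s = t) (hr : t + n = r)
    (hr' : q + s = r) (x : M.obj Y p) (a : Hom k X Y s),
    φ X t ⟨r, hr⟩ (M.act ht x a) = N.act hr' (φ Y p ⟨q, hq⟩ x) a }
  add_mem' h₁ h₂ X Y p q s t r hq ht hr hr' x a := by
    simp [h₁ X Y p q s t r hq ht hr hr' x a, h₂ X Y p q s t r hq ht hr hr' x a]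
  zero_mem' X Y p q s t r hq ht hr hr' x a := by simp
  smul_mem' c φ h X Y p q s t r hq ht hr hr' x a := by
    simp [h X Y p q s t r hq ht hr hr' x a]

theorem homs_act {M N : DGModule k A} {n : ℤ} (φ : homs M N n) {X Y : A} {p q s t r : ℤ}
    (hq : p + n = q) (ht : p + s = t) (hr : t + n = r)
    (hr' : q + s = r) (x : M.obj Y p) (a : Hom k X Y s) :
    φ.1 X t ⟨r, hr⟩ (M.act ht x a) = N.act hr' (φ.1 Y p ⟨q, hq⟩ x) a :=
  φ.2 X Y p q s t r hq ht hr hr' x a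

/-- The differential `φ ↦ d ∘ φ - (-1)^|φ| φ ∘ d`. -/
def homsD {M N : DGModule k A} {m n : ℤ} (h : m + 1 = n) : homs M N m →ₗ[k] homs M N n where
  toFun φ := ⟨fun X p q => N.d (show p + m + 1 = q.1 by rw [← q.2, ← h]; ring) ∘ₗ φ.1 X p ⟨p + m, rfl⟩ -
      sgn k m • (φ.1 X (p + 1) ⟨q.1, by rw [← q.2, ← h]; ring⟩ ∘ₗ M.d rfl), by
    intro X Y p q s t r hq ht hr hr' x a
    subst h ht
    simp only [LinearMap.sub_apply, LinearMap.smul_apply, LinearMap.comp_apply]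
    rw [homs_act φ (q := p + m) rfl rfl rfl (by omega),
      N.d_act (q' := q) (p' := s + 1) _ _ (by omega) rfl (by omega) (by omega),
      M.d_act (q' := p + 1) (p' := s + 1) _ _ (by omega) rfl (by omega) (by omega),
      map_add, map_smul, homs_act φ (q := q) (by omega) (by omega) (by omega) (by omega),
      homs_act φ (q := p + m) (by omega) (by omega) (by omega) (by omega)]
    simp only [map_sub, map_smul, LinearMap.sub_apply, LinearMap.smul_apply, sgn_add]
    module⟩
  map_add' φ ψ := by
    ext X p q x
    simp
    module
  map_smul' c φ := by
    ext X p q x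
    simp
    module

theorem homsD_apply {M N : DGModule k A} {m n : ℤ} (h : m + 1 = n) (φ : homs M N m) {X : A}
    {p q s t : ℤ} (hpq : p + n = q) (hs : p + m = s) (hs' : s + 1 = q) (ht : p + 1 = t)
    (ht' : t + m = q) (x : M.obj X p) :
    (homsD h φ).1 X p ⟨q, hpq⟩ x = N.d hs' (φ.1 X p ⟨s, hs⟩ x) - sgn k m • φ.1 X t ⟨q, ht'⟩ (M.d ht x) := by
  subst hs ht
  rfl

/-- Composition of morphisms of DG modules. -/
def homsComp {M N L : DGModule k A} {q p r : ℤ} (h : q + p = r) :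
    homs N L q →ₗ[k] homs M N p →ₗ[k] homs M L r :=
  LinearMap.mk₂ k
    (fun g f => ⟨fun X a b => g.1 X (a + p) ⟨b, by have := b.2; omega⟩ ∘ₗ
      f.1 X a ⟨a + p, rfl⟩, by
      intro X Y a b s t c hb ht hc hc' x e
      subst ht
      simp only [LinearMap.comp_apply]
      rw [homs_act f (q := a + p) rfl rfl rfl (by omega),
        homs_act g (q := b) (by omega) (by omega) (by omega) (by omega)]⟩)
    (fun _ _ _ => by ext; simp) (fun _ _ _ => by ext; simp)
    (fun _ _ _ => by ext; simp) (fun _ _ _ => by ext; simp)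

theorem homsComp_apply {M N L : DGModule k A} {q p r : ℤ} (h : q + p = r) (g : homs N L q)
    (f : homs M N p) {X : A} {a b c : ℤ} (hab : a + r = c) (h₁ : a + p = b) (h₂ : b + q = c)
    (x : M.obj X a) : (homsComp h g f).1 X a ⟨c, hab⟩ x = g.1 X b ⟨c, h₂⟩ (f.1 X a ⟨b, h₁⟩ x) := by
  subst h₁
  rfl

/-- The identity of a DG module. -/
def homsId (M : DGModule k A) : homs M M 0 :=
  ⟨fun X p q => by
      obtain ⟨q, h⟩ := q
      obtain rfl : p = q := by omega
      exact LinearMap.id, by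
    intro X Y p q s t r hq ht hr hr' x a
    obtain rfl : p = q := by omega
    obtain rfl : t = r := by omega
    rfl⟩

theorem homsId_apply (M : DGModule k A) {X : A} {p : ℤ} (h : p + 0 = p) (x : M.obj X p) :
    (homsId M).1 X p ⟨p, h⟩ x = x := rfl

theorem homs_ext {M N : DGModule k A} {n : ℤ} {φ ψ : homs M N n}
    (h : ∀ (X : A) (p q : ℤ) (hpq : p + n = q) (x : M.obj X p),
      φ.1 X p ⟨q, hpq⟩ x = ψ.1 X p ⟨q, hpq⟩ x) : φ = ψ := by
  ext X p q x
  exact h X p q.1 q.2 x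

/-- The DG category of right DG `A`-modules. -/
instance : DGCategory.{u} k (DGModule k A) where
  Hom M N n := homs M N n
  d h := homsD h
  id M := homsId M
  comp h := homsComp h
  d_d {M N m n l} h h' φ := by
    subst h h'
    apply homs_ext
    intro X p q hpq x
    rw [homsD_apply (s := p + m + 1) (t := p + 1) _ _ _ (by omega) (by omega) (by omega) (by omega),
      homsD_apply (s := p + m) (t := p + 1) _ _ _ (by omega) (by omega) (by omega) (by omega),
      homsD_apply (s := p + m + 1) (t := p + 1 + 1) _ _ _ (by omega) (by omega) (by omega)
        (by omega), M.d_d, map_sub, N.d_d]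
    simp [sgn_succ]
  id_comp {M N p} h f := by
    apply homs_ext
    intro X a b hab x
    rw [homsComp_apply (b := b) _ _ _ _ (by omega) (by omega), homsId_apply]
  comp_id {M N p} h f := by
    apply homs_ext
    intro X a b hab x
    rw [homsComp_apply (b := a) _ _ _ _ (by omega) (by omega), homsId_apply]
  assoc {M N L K p q r pq qr n} h₁ h₂ h₃ h₄ h g f := by
    apply homs_ext
    intro X a b hab x
    rw [homsComp_apply (b := a + p) _ _ _ _ (by omega) (by omega),
      homsComp_apply (b := a + p + q) _ _ _ _ (by omega) (by omega),
      homsComp_apply (b := a + p + q) _ _ _ _ (by omega) (by omega),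
      homsComp_apply (b := a + p) _ _ _ _ (by omega) (by omega)]
  d_comp {M N L q p r q' p' s} h hr hq hp h₁ h₂ g f := by
    subst hq hp
    apply homs_ext
    intro X a b hab x
    have e : ∀ (y : homs M L s) (z : homs M L s) (c : k), (y + c • z).1 X a ⟨b, hab⟩ x =
      y.1 X a ⟨b, hab⟩ x + c • z.1 X a ⟨b, hab⟩ x := fun _ _ _ => rfl
    rw [e, homsD_apply (s := a + p + q) (t := a + 1) _ _ _ (by omega) (by omega) (by omega)
        (by omega),
      homsComp_apply (b := a + p) _ _ _ _ (by omega) (by omega),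
      homsComp_apply (b := a + p + 1) _ _ _ _ (by omega) (by omega),
      homsComp_apply (b := a + p) _ _ _ _ (by omega) (by omega),
      homsComp_apply (b := a + p + 1) _ _ _ _ (by omega) (by omega),
      homsD_apply (s := a + p + q) (t := a + p + 1) _ _ _ (by omega) (by omega) (by omega)
        (by omega),
      homsD_apply (s := a + p) (t := a + 1) _ _ _ (by omega) (by omega) (by omega) (by omega),
      map_sub, map_smul]
    obtain rfl : q + p = r := h
    rw [sgn_add]
    module

end

end DGModule

/-! ### Semi-free DG modules -/

section semifree

variable {k : Type w} [CommRing k] {A : Type u} [DGCategory.{u} k A]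

open scoped DirectSum

open Classical in
/-- For homogeneous elements `e i ∈ M (pt i)` of degree `deg i`, the map
`(cᵢ)ᵢ ↦ ∑ᵢ eᵢ cᵢ` from `⨁ᵢ Hom (X, pt i)[-deg i]` to `M (X)`, in degree `n`. -/
noncomputable def linComb (M : DGModule k A) {ι : Type u} (pt : ι → A) (deg : ι → ℤ)
    (e : ∀ i, M.obj (pt i) (deg i)) (X : A) (n : ℤ) :
    (⨁ i, Hom k X (pt i) (n - deg i)) →ₗ[k] M.obj X n :=
  DirectSum.toModule k ι (M.obj X n)
    (fun i => M.act (add_sub_cancel (deg i) n) (e i))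

/-- A semi-free basis of a right DG module `M`: homogeneous elements `e i ∈ M (pt i)` that form a
basis of the underlying graded module, each with a level, such that `d (e i)` is a combination of
basis elements of smaller level. Equivalently, the submodules `M_j` spanned by the `e i` of level
`< j` form an exhaustive increasing filtration of `M` by DG submodules with `M_0 = 0`, such that
each `M_{j+1} / M_j` is free, i.e. a direct sum of shifts of representable modules. -/
structure SemiFreeBasis (M : DGModule k A) where
  ι : Type u
  pt : ι → A
  deg : ι → ℤ
  level : ι → ℕ
  e : ∀ i, M.obj (pt i) (deg i)
  bijective : ∀ (X : A) (n : ℤ), Function.Bijective (linComb M pt deg e X n)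
  d_e : ∀ i, ∃ c : ⨁ j, Hom k (pt i) (pt j) (deg i + 1 - deg j),
    M.d rfl (e i) = linComb M pt deg e (pt i) (deg i + 1) c ∧ ∀ j, c j ≠ 0 → level j < level i

/-- Semi-free right DG modules. -/
def IsSemiFree (M : DGModule k A) : Prop := Nonempty (SemiFreeBasis M)

variable (k A) in
/-- The DG category of semi-free right DG `A`-modules, the DG version of the category of
ind-objects. -/
abbrev IndCat := FullSub (IsSemiFree (k := k) (A := A))

variable (k A) in
/-- The DG version of the category of pro-objects: the dual of the DG category of semi-free
right DG modules over `A°`. -/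
abbrev ProCat := DGOp (IndCat k (DGOp A))

/-- The right DG module `Hom (?, X)`. -/
def repr (X : A) : DGModule k A where
  obj Y n := Hom k Y X n
  d h := DG.d h
  act h := DG.comp h
  d_d := DGCategory.d_d
  act_id := DGCategory.comp_id
  act_act := DGCategory.assoc
  d_act := DGCategory.d_comp

theorem isSemiFree_repr (X : A) : IsSemiFree (repr (k := k) X) := by
  refine ⟨⟨PUnit, fun _ => X, fun _ => 0, fun _ => 0, fun _ => idd k X, fun Y n => ?_, fun _ =>
    ⟨0, ?_, by simp⟩⟩⟩
  · have key : ∀ c, linComb (repr X) (fun _ : PUnit.{u + 1} => X) (fun _ => 0)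
        (fun _ => idd k X) Y n c =
        DGCategory.comp (add_sub_cancel 0 n) (idd k X) (c PUnit.unit) := by
      intro c
      induction c using DirectSum.induction_on with
      | zero => rw [map_zero]; exact (map_zero _).symm
      | of i x =>
        rw [DirectSum.of_eq_same]
        exact DirectSum.toModule_lof ..
      | add x y hx hy =>
        rw [map_add, hx, hy, DirectSum.add_apply]
        exact (map_add _ _ _).symm
    have bij : Function.Bijective
        (fun x : Hom k Y X (n - 0) => DGCategory.comp (add_sub_cancel 0 n) (idd k X) x) := by
      have : ∀ (m : ℤ) (h : 0 + m = n), Function.Bijective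
        (fun x : Hom k Y X m => (DGCategory.comp h (idd k X) x : Hom k Y X n)) := by
        intro m h
        obtain rfl : m = n := by omega
        convert Function.bijective_id using 2 with x
        exact DGCategory.id_comp h x
      exact this _ _
    refine ⟨fun a b hab => ?_, fun y => ?_⟩
    · rw [key, key] at hab
      have := bij.1 hab
      refine DFinsupp.ext fun _ => this
    · obtain ⟨x, hx⟩ := bij.2 y
      refine ⟨DirectSum.of (fun i : PUnit.{u + 1} => Hom k Y X (n - 0)) PUnit.unit x, ?_⟩
      rw [key, DirectSum.of_eq_same]
      exact hx
  · rw [map_zero]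
    exact d_id X rfl

/-- Postcomposition `f ∘ ?` as a morphism of representable modules. -/
def reprMap {X Y : A} {n : ℤ} : Hom k X Y n →ₗ[k] DGModule.homs (repr (k := k) X) (repr Y) n where
  toFun f := ⟨fun _ p q => DGCategory.comp (show n + p = q.1 by rw [← q.2, add_comm]) f,
    fun _ _ _ _ _ _ _ _ _ _ _ _ _ => (DGCategory.assoc _ _ _ _ _ _ _).symm⟩
  map_add' f g := by
    apply DGModule.homs_ext
    intro Z p q hpq x
    exact LinearMap.map_add₂ (DGCategory.comp _) f g x
  map_smul' c f := by
    apply DGModule.homs_ext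
    intro Z p q hpq x
    exact LinearMap.map_smul₂ (DGCategory.comp _) c f x

variable (k A) in
/-- The Yoneda embedding of `A` into semi-free modules. -/
def toInd : DGFunctor k A (IndCat k A) where
  obj X := ⟨repr X, isSemiFree_repr X⟩
  map := reprMap
  map_d {X Y m n} h f := by
    apply DGModule.homs_ext
    intro Z p q hpq x
    refine Eq.trans ?_ (DGModule.homsD_apply (s := p + m) (t := p + 1) h _ hpq rfl (by omega) rfl
      (by omega) x).symm
    refine eq_sub_of_add_eq ?_
    have h1 : p + m + 1 = q := by omega
    have h2 : n + p = q := by omega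
    have h3 : m + (p + 1) = q := by omega
    exact (DGCategory.d_comp (k := k) (X := Z) (Y := X) (Z := Y) (add_comm m p) h1 h rfl h2 h3 f x).symm
  map_id X := by
    apply DGModule.homs_ext
    intro Z p q hpq x
    obtain rfl : p = q := by omega
    exact DGCategory.id_comp _ _
  map_comp h g f := by
    apply DGModule.homs_ext
    intro Z p q hpq x
    refine Eq.trans ?_ (DGModule.homsComp_apply h _ _ hpq rfl (by omega) x).symm
    exact DGCategory.assoc _ _ _ _ _ _ _

variable (k A) in
/-- The embedding of `A` into pro-objects, dual to the Yoneda embedding of `A°`. -/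
def toPro : DGFunctor k A (ProCat k A) := (toOpOp k A).trans (toInd k (DGOp A)).op

end semifree

/-! ### Induction -/

section induction

variable {k : Type w} [CommRing k] {B : Type u} [DGCategory.{u} k B] {A : Type u}
  [DGCategory.{u} k A]

open scoped DirectSum TensorProduct

namespace Ind

/-- Indices of the summands `N (b)^p ⊗ Hom (Y, F b)^q` of degree `n`. -/
structure Idx (B : Type u) (n : ℤ) where
  b : B
  p : ℤ
  q : ℤ
  h : p + q = n

variable (F : DGFunctor k B A) (N : DGModule k B)

/-- The degree `n` component of `⨁_b N (b) ⊗ Hom (Y, F b)`. -/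
abbrev Raw (Y : A) (n : ℤ) : Type u :=
  ⨁ i : Idx B n, N.obj i.b i.p ⊗[k] Hom k Y (F.obj i.b) i.q

open Classical in
/-- The element `m ⊗ f` of `⨁_b N (b) ⊗ Hom (Y, F b)`. -/
noncomputable def rawMk {Y : A} {b : B} {p q n : ℤ} (h : p + q = n) :
    N.obj b p →ₗ[k] Hom k Y (F.obj b) q →ₗ[k] Raw F N Y n :=
  (TensorProduct.mk k _ _).compr₂
    (DirectSum.lof k (Idx B n) (fun i => N.obj i.b i.p ⊗[k] Hom k Y (F.obj i.b) i.q) ⟨b, p, q, h⟩)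

/-- The relations `m g ⊗ f = m ⊗ F(g) f`. -/
def rel (Y : A) (n : ℤ) : Submodule k (Raw F N Y n) :=
  Submodule.span k { x | ∃ (b b' : B) (p s t q r : ℤ) (h₁ : p + s = t) (h₂ : t + q = n)
    (h₃ : s + q = r) (h₄ : p + r = n) (m : N.obj b p) (g : Hom k b' b s)
    (f : Hom k Y (F.obj b') q),
    x = rawMk F N h₂ (N.act h₁ m g) f - rawMk F N h₄ m (comp h₃ (F.map g) f) }

/-- The degree `n` component of the tensor product `N ⊗_B Hom (Y, F ?)`. -/
abbrev Obj (Y : A) (n : ℤ) : Type u := Raw F N Y n ⧸ rel F N Y n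

/-- The class of `m ⊗ f` in `N ⊗_B Hom (Y, F ?)`. -/
noncomputable def mk {Y : A} {b : B} {p q n : ℤ} (h : p + q = n) :
    N.obj b p →ₗ[k] Hom k Y (F.obj b) q →ₗ[k] Obj F N Y n :=
  (rawMk F N h).compr₂ (rel F N Y n).mkQ

variable {F N}

theorem mk_act {Y : A} {n : ℤ} {b b' : B} {p s t q r : ℤ} (h₁ : p + s = t) (h₂ : t + q = n)
    (h₃ : s + q = r) (h₄ : p + r = n) (m : N.obj b p) (g : Hom k b' b s)
    (f : Hom k Y (F.obj b') q) :
    mk F N h₂ (N.act h₁ m g) f = mk F N h₄ m (comp h₃ (F.map g) f) := by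
  refine (Submodule.Quotient.eq _).2 (Submodule.subset_span ?_)
  exact ⟨b, b', p, s, t, q, r, h₁, h₂, h₃, h₄, m, g, f, rfl⟩

open Classical in
/-- The universal property of `N ⊗_B Hom (Y, F ?)`. -/
noncomputable def lift {Y : A} {n : ℤ} {L : Type u} [AddCommGroup L] [Module k L]
    (β : ∀ (b : B) (p q : ℤ), p + q = n → (N.obj b p →ₗ[k] Hom k Y (F.obj b) q →ₗ[k] L))
    (hβ : ∀ (b b' : B) (p s t q r : ℤ) (h₁ : p + s = t) (h₂ : t + q = n)
      (h₃ : s + q = r) (h₄ : p + r = n) (m : N.obj b p) (g : Hom k b' b s)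
      (f : Hom k Y (F.obj b') q),
      β b' t q h₂ (N.act h₁ m g) f = β b p r h₄ m (comp h₃ (F.map g) f)) :
    Obj F N Y n →ₗ[k] L :=
  (rel F N Y n).liftQ
    (DirectSum.toModule k _ L (fun i => TensorProduct.lift (β i.b i.p i.q i.h))) (by
      refine Submodule.span_le.2 ?_
      rintro _ ⟨b, b', p, s, t, q, r, h₁, h₂, h₃, h₄, m, g, f, rfl⟩
      simp only [SetLike.mem_coe, LinearMap.mem_ker, map_sub, rawMk, LinearMap.compr₂_apply,
        DirectSum.toModule_lof, TensorProduct.mk_apply, TensorProduct.lift.tmul]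
      rw [hβ b b' p s t q r h₁ h₂ h₃ h₄ m g f, sub_self])

theorem lift_mk {Y : A} {n : ℤ} {L : Type u} [AddCommGroup L] [Module k L]
    (β : ∀ (b : B) (p q : ℤ), p + q = n → (N.obj b p →ₗ[k] Hom k Y (F.obj b) q →ₗ[k] L)) (hβ)
    {b : B} {p q : ℤ} (h : p + q = n) (m : N.obj b p) (f : Hom k Y (F.obj b) q) :
    lift β hβ (mk F N h m f) = β b p q h m f := by
  refine (Submodule.liftQ_apply _ _ _).trans ?_
  simp only [rawMk, LinearMap.compr₂_apply, DirectSum.toModule_lof, TensorProduct.mk_apply,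
    TensorProduct.lift.tmul]

theorem hom_ext {Y : A} {n : ℤ} {L : Type*} [AddCommGroup L] [Module k L]
    {φ ψ : Obj F N Y n →ₗ[k] L}
    (h : ∀ (b : B) (p q : ℤ) (h : p + q = n) (m : N.obj b p) (f : Hom k Y (F.obj b) q),
      φ (mk F N h m f) = ψ (mk F N h m f)) : φ = ψ := by
  classical
  refine Submodule.linearMap_qext _ (DirectSum.linearMap_ext _ ?_)
  rintro ⟨b, p, q, hpq⟩
  exact TensorProduct.ext' fun m f => h b p q hpq m f

/-- The differential `d (m ⊗ f) = d m ⊗ f + (-1)^|m| m ⊗ d f`. -/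
noncomputable def diff {Y : A} {n n' : ℤ} (hn : n + 1 = n') :
    Obj F N Y n →ₗ[k] Obj F N Y n' :=
  lift (fun b p q h =>
    (mk F N (show p + 1 + q = n' by omega)) ∘ₗ (N.d (X := b) rfl) +
      sgn k p • (mk F N (show p + (q + 1) = n' by omega)).compl₂ (d rfl)) (by
    intro b b' p s t q r h₁ h₂ h₃ h₄ m g f
    subst h₁ h₃
    simp only [LinearMap.add_apply, LinearMap.comp_apply, LinearMap.smul_apply,
      LinearMap.compl₂_apply]
    rw [N.d_act (q' := p + 1) (p' := s + 1) _ _ rfl rfl (by omega) (by omega),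
      DGCategory.d_comp (q' := s + 1) (p' := q + 1) _ _ rfl rfl (by omega) (by omega),
      map_add, map_smul, LinearMap.add_apply, LinearMap.smul_apply, ← F.map_d,
      mk_act (r := s + q) (by omega) (by omega) (by omega) (by omega),
      mk_act (r := s + q + 1) (by omega) (by omega) (by omega) (by omega),
      mk_act (r := s + q + 1) (by omega) (by omega) (by omega) (by omega), map_add, map_smul,
      sgn_add]
    module)

theorem diff_mk {Y : A} {n n' : ℤ} (hn : n + 1 = n') {b : B} {p q p' q' : ℤ} (h : p + q = n)
    (hp : p + 1 = p') (hq : q + 1 = q') (h₁ : p' + q = n') (h₂ : p + q' = n')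
    (m : N.obj b p) (f : Hom k Y (F.obj b) q) :
    diff hn (mk F N h m f) = mk F N h₁ (N.d hp m) f + sgn k p • mk F N h₂ m (d hq f) := by
  subst hp hq
  exact lift_mk _ _ h m f

/-- The right action `(m ⊗ f) a = m ⊗ f a`. -/
noncomputable def action {X Y : A} {q p r : ℤ} (h : q + p = r) :
    Obj F N Y q →ₗ[k] Hom k X Y p →ₗ[k] Obj F N X r :=
  lift (fun b s t hst => LinearMap.mk₂ k
      (fun m f => (mk F N (show s + (t + p) = r by omega) m) ∘ₗ (comp rfl f))
      (fun _ _ _ => by ext; simp) (fun _ _ _ => by ext; simp)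
      (fun _ _ _ => by ext; simp) (fun _ _ _ => by ext; simp)) (by
    intro b b' p s t q r h₁ h₂ h₃ h₄ m g f
    ext a
    simp only [LinearMap.mk₂_apply, LinearMap.comp_apply]
    rw [DGCategory.assoc (qr := r) h₃ rfl rfl (by omega)]
    exact mk_act ..)

theorem action_mk {X Y : A} {q p r : ℤ} (h : q + p = r) {b : B} {s t t' : ℤ} (hst : s + t = q)
    (ht : t + p = t') (h' : s + t' = r) (m : N.obj b s) (f : Hom k Y (F.obj b) t)
    (a : Hom k X Y p) :
    action h (mk F N hst m f) a = mk F N h' m (comp ht f a) := by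
  subst ht
  exact LinearMap.congr_fun (lift_mk _ _ hst m f) a

variable (F N) in
/-- The induced right DG `A`-module `Y ↦ N ⊗_B Hom (Y, F ?)`. -/
noncomputable def ind : DGModule k A where
  obj Y n := Obj F N Y n
  d h := diff h
  act h := action h
  d_d {X m n l} h h' x := by
    suffices H : diff h' ∘ₗ diff h = (0 : Obj F N X m →ₗ[k] _) from LinearMap.congr_fun H x
    apply hom_ext
    intro b p q hpq x f
    rw [LinearMap.comp_apply,
      diff_mk (p' := p + 1) (q' := q + 1) _ _ rfl rfl (by omega) (by omega), map_add, map_smul,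
      diff_mk (p' := p + 1 + 1) (q' := q + 1) _ _ rfl rfl (by omega) (by omega),
      diff_mk (p' := p + 1) (q' := q + 1 + 1) _ _ rfl rfl (by omega) (by omega),
      N.d_d, DGCategory.d_d, sgn_succ]
    simp
  act_id {X p} h x := by
    suffices H : (action h).flip (idd k X) = (LinearMap.id : Obj F N X p →ₗ[k] _) from
      LinearMap.congr_fun H x
    apply hom_ext
    intro b p q hpq x f
    rw [LinearMap.flip_apply, action_mk (t' := q) _ _ (by omega) (by omega), DGCategory.comp_id,
      LinearMap.id_apply]
  act_act {X Y Z p q r pq qr n} h₁ h₂ h₃ h₄ x g f := by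
    suffices H : (action h₂).flip f ∘ₗ (action h₁).flip g =
        ((action h₄).flip (comp h₃ g f) : Obj F N Z r →ₗ[k] _) from LinearMap.congr_fun H x
    apply hom_ext
    intro b s t hst m a
    simp only [LinearMap.comp_apply, LinearMap.flip_apply]
    rw [action_mk (t' := t + q) _ _ (by omega) (by omega),
      action_mk (t' := t + q + p) _ _ (by omega) (by omega),
      action_mk (t' := t + q + p) _ _ (by omega) (by omega), DGCategory.assoc]
  d_act {X Y q p r q' p' s} h hr hq hp h₁ h₂ x f := by
    suffices H : diff hr ∘ₗ (action h).flip f =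
        (action h₁).flip f ∘ₗ diff hq + (sgn k q • (action h₂).flip (DG.d hp f) :
          Obj F N Y q →ₗ[k] _) from LinearMap.congr_fun H x
    apply hom_ext
    intro b a c hac m g
    subst hp
    have e : sgn k q = sgn k a * sgn k c := by rw [← sgn_add, hac]
    simp only [LinearMap.comp_apply, LinearMap.flip_apply, LinearMap.add_apply,
      LinearMap.smul_apply]
    rw [action_mk (t' := c + p) _ _ (by omega) (by omega),
      diff_mk (p' := a + 1) (q' := c + p + 1) _ _ rfl rfl (by omega) (by omega),
      diff_mk (p' := a + 1) (q' := c + 1) _ _ rfl rfl (by omega) (by omega),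
      map_add, map_smul, LinearMap.add_apply, LinearMap.smul_apply,
      action_mk (t' := c + p) _ _ (by omega) (by omega),
      action_mk (t' := c + p + 1) _ _ (by omega) (by omega),
      action_mk (t' := c + p + 1) _ _ (by omega) (by omega),
      DGCategory.d_comp (q' := c + 1) (p' := p + 1) _ _ rfl rfl (by omega) (by omega), map_add,
      map_smul, e]
    module

/-- The morphism `φ ⊗ id` of induced modules. -/
noncomputable def indMapAux {N N' : DGModule k B} {n : ℤ} (φ : DGModule.homs N N' n) (Y : A)
    (p q : ℤ) (hpq : p + n = q) : Obj F N Y p →ₗ[k] Obj F N' Y q :=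
  lift (fun b s t h => (mk F N' (show s + n + t = q by omega)) ∘ₗ φ.1 b s ⟨s + n, rfl⟩) (by
    intro b b' p s t q r h₁ h₂ h₃ h₄ m g f
    simp only [LinearMap.comp_apply]
    rw [DGModule.homs_act φ (q := p + n) rfl h₁ rfl (by omega)]
    exact mk_act ..)

theorem indMapAux_mk {N N' : DGModule k B} {n : ℤ} (φ : DGModule.homs N N' n) {Y : A}
    {p q : ℤ} (hpq : p + n = q) {b : B} {s s' t : ℤ} (h : s + t = p) (hs : s + n = s')
    (h' : s' + t = q) (m : N.obj b s) (f : Hom k Y (F.obj b) t) :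
    indMapAux φ Y p q hpq (mk F N h m f) = mk F N' h' (φ.1 b s ⟨s', hs⟩ m) f := by
  subst hs
  exact lift_mk _ _ h m f

variable (F) in
/-- The action of induction on morphisms. -/
noncomputable def indMap {N N' : DGModule k B} {n : ℤ} :
    DGModule.homs N N' n →ₗ[k] DGModule.homs (ind F N) (ind F N') n where
  toFun φ := ⟨fun Y p q => indMapAux φ Y p q.1 q.2, by
    intro X Y p q s t r hq ht hr hr' x a
    suffices H : indMapAux φ X t r hr ∘ₗ (action ht).flip a =
        ((action hr').flip a ∘ₗ indMapAux φ Y p q hq : Obj F N Y p →ₗ[k] _) from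
      LinearMap.congr_fun H x
    apply hom_ext
    intro b c e hce m g
    simp only [LinearMap.comp_apply, LinearMap.flip_apply]
    rw [action_mk (t' := e + s) _ _ (by omega) (by omega),
      indMapAux_mk (s' := c + n) _ _ _ rfl (by omega),
      indMapAux_mk (s' := c + n) _ _ _ rfl (by omega),
      action_mk (t' := e + s) _ _ (by omega) (by omega)]⟩
  map_add' φ ψ := by
    apply DGModule.homs_ext
    intro Y p q hpq x
    suffices H : indMapAux (φ + ψ) Y p q hpq =
        (indMapAux φ Y p q hpq + indMapAux ψ Y p q hpq : Obj F N Y p →ₗ[k] _) from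
      LinearMap.congr_fun H x
    apply hom_ext
    intro b c e hce m g
    rw [LinearMap.add_apply, indMapAux_mk (s' := c + n) _ _ _ rfl (by omega),
      indMapAux_mk (s' := c + n) _ _ _ rfl (by omega),
      indMapAux_mk (s' := c + n) _ _ _ rfl (by omega)]
    simp
  map_smul' a φ := by
    apply DGModule.homs_ext
    intro Y p q hpq x
    suffices H : indMapAux (a • φ) Y p q hpq =
        (a • indMapAux φ Y p q hpq : Obj F N Y p →ₗ[k] _) from
      LinearMap.congr_fun H x
    apply hom_ext
    intro b c e hce m g
    rw [LinearMap.smul_apply, indMapAux_mk (s' := c + n) _ _ _ rfl (by omega),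
      indMapAux_mk (s' := c + n) _ _ _ rfl (by omega)]
    simp

theorem indMap_d {N N' : DGModule k B} {m n : ℤ} (h : m + 1 = n) (φ : DGModule.homs N N' m) :
    indMap F (DGModule.homsD h φ) = DGModule.homsD h (indMap F φ) := by
  apply DGModule.homs_ext
  intro Y p q hpq x
  rw [DGModule.homsD_apply (s := p + m) (t := p + 1) h _ hpq rfl (by omega) rfl (by omega)]
  have h₁ : p + m + 1 = q := by omega
  have h₂ : p + 1 + m = q := by omega
  suffices H : indMapAux (DGModule.homsD h φ) Y p q hpq =
      diff h₁ ∘ₗ indMapAux φ Y p (p + m) rfl -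
        (sgn k m • indMapAux φ Y (p + 1) q h₂ ∘ₗ diff rfl : Obj F N Y p →ₗ[k] _) from
    LinearMap.congr_fun H x
  apply hom_ext
  intro b c e hce x f
  simp only [LinearMap.sub_apply, LinearMap.smul_apply, LinearMap.comp_apply]
  rw [indMapAux_mk (s' := c + n) _ _ _ rfl (by omega),
    indMapAux_mk (s' := c + m) _ _ _ rfl (by omega),
    diff_mk (p' := c + n) (q' := e + 1) _ _ (by omega) rfl (by omega) (by omega),
    diff_mk (p' := c + 1) (q' := e + 1) _ _ (by omega) rfl (by omega) (by omega), map_add,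
    map_smul, indMapAux_mk (s' := c + n) _ _ _ (by omega) (by omega),
    indMapAux_mk (s' := c + m) _ _ _ (by omega) (by omega),
    DGModule.homsD_apply (s := c + m) (t := c + 1) h _ _ rfl (by omega) rfl (by omega),
    map_sub, map_smul, sgn_add]
  simp only [LinearMap.sub_apply, LinearMap.smul_apply]
  module

theorem indMap_id (N : DGModule k B) :
    indMap F (DGModule.homsId N) = DGModule.homsId (ind F N) := by
  apply DGModule.homs_ext
  intro Y p q hpq x
  obtain rfl : p = q := by omega
  suffices H : indMapAux (DGModule.homsId N) Y p p hpq =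
      (LinearMap.id : Obj F N Y p →ₗ[k] _) from LinearMap.congr_fun H x
  apply hom_ext
  intro b c e hce x f
  rw [indMapAux_mk (s' := c) _ _ _ (by omega) (by omega)]
  rfl

theorem indMap_comp {N N' N'' : DGModule k B} {q p r : ℤ} (h : q + p = r)
    (ψ : DGModule.homs N' N'' q) (φ : DGModule.homs N N' p) :
    indMap F (DGModule.homsComp h ψ φ) = DGModule.homsComp h (indMap F ψ) (indMap F φ) := by
  apply DGModule.homs_ext
  intro Y a b hab x
  rw [DGModule.homsComp_apply (b := a + p) h _ _ hab rfl (by omega)]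
  have h₁ : a + p + q = b := by omega
  suffices H : indMapAux (DGModule.homsComp h ψ φ) Y a b hab =
      (indMapAux ψ Y (a + p) b h₁ ∘ₗ indMapAux φ Y a (a + p) rfl : Obj F N Y a →ₗ[k] _) from
    LinearMap.congr_fun H x
  apply hom_ext
  intro c s t hst x f
  simp only [LinearMap.comp_apply]
  rw [indMapAux_mk (s' := s + r) _ _ _ rfl (by omega),
    indMapAux_mk (s' := s + p) _ _ _ rfl (by omega),
    indMapAux_mk (s' := s + r) _ _ _ (by omega) (by omega),
    DGModule.homsComp_apply (b := s + p) h _ _ rfl rfl (by omega)]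

end Ind

end induction

section induction

variable {k : Type w} [CommRing k] {B : Type u} [DGCategory.{u} k B] {A : Type u}
  [DGCategory.{u} k A]

open scoped DirectSum TensorProduct

open Classical in
theorem linComb_lof (M : DGModule k A) {ι : Type u} (pt : ι → A) (deg : ι → ℤ)
    (e : ∀ i, M.obj (pt i) (deg i)) (X : A) (n : ℤ) (i : ι) (c : Hom k X (pt i) (n - deg i)) :
    linComb M pt deg e X n (DirectSum.lof k ι (fun i => Hom k X (pt i) (n - deg i)) i c) =
      M.act (add_sub_cancel (deg i) n) (e i) c :=
  DirectSum.toModule_lof ..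

namespace Ind

theorem comp_map_idAt (F : DGFunctor k B A) {X : B} {Y : A} {n p : ℤ} (h : n = 0) (hp : n + p = p)
    (f : Hom k Y (F.obj X) p) : comp hp (F.map (idAt (k := k) X h)) f = f := by
  subst h
  refine (congrArg (fun g => comp hp g f) (F.map_id X)).trans (DGCategory.id_comp _ _)

theorem act_idAt (M : DGModule k B) {X : B} {n p : ℤ} (h : n = 0) (hp : p + n = p)
    (x : M.obj X p) : M.act hp x (idAt (k := k) X h) = x := by
  subst h
  exact M.act_id _ _

variable (F : DGFunctor k B A) {N : DGModule k B} (S : SemiFreeBasis N)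

/-- The induced homogeneous elements `e i ⊗ id`. -/
noncomputable def basisElt (i : S.ι) : (ind F N).obj (F.obj (S.pt i)) (S.deg i) :=
  mk F N (add_zero _) (S.e i) (idd k _)

/-- Coordinates with respect to a semi-free basis. -/
noncomputable def coord (X : B) (n : ℤ) :
    (⨁ i, Hom k X (S.pt i) (n - S.deg i)) ≃ₗ[k] N.obj X n :=
  LinearEquiv.ofBijective _ (S.bijective X n)

open Classical in
theorem coord_lof (X : B) (n : ℤ) (i : S.ι) (c : Hom k X (S.pt i) (n - S.deg i)) :
    coord S X n (DirectSum.lof k S.ι (fun i => Hom k X (S.pt i) (n - S.deg i)) i c) =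
      N.act (add_sub_cancel (S.deg i) n) (S.e i) c :=
  linComb_lof ..

open Classical in
/-- The map `(cᵢ)ᵢ ⊗ f ↦ (F(cᵢ) f)ᵢ`. -/
noncomputable def pushCoord {Y : A} {b : B} {p q n : ℤ} (h : p + q = n) :
    (⨁ i, Hom k b (S.pt i) (p - S.deg i)) →ₗ[k] Hom k Y (F.obj b) q →ₗ[k]
      ⨁ i, Hom k Y (F.obj (S.pt i)) (n - S.deg i) :=
  DirectSum.toModule k S.ι _ (fun i =>
    ((comp (show p - S.deg i + q = n - S.deg i by omega)).compr₂
      (DirectSum.lof k S.ι (fun i => Hom k Y (F.obj (S.pt i)) (n - S.deg i)) i)) ∘ₗ F.map)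

open Classical in
theorem pushCoord_lof {Y : A} {b : B} {p q n : ℤ} (h : p + q = n) (i : S.ι)
    (c : Hom k b (S.pt i) (p - S.deg i)) (f : Hom k Y (F.obj b) q)
    (h' : p - S.deg i + q = n - S.deg i) :
    pushCoord F S h (DirectSum.lof k S.ι (fun i => Hom k b (S.pt i) (p - S.deg i)) i c) f =
      DirectSum.lof k S.ι (fun i => Hom k Y (F.obj (S.pt i)) (n - S.deg i)) i
        (comp h' (F.map c) f) := by
  rw [pushCoord, DirectSum.toModule_lof]
  rfl

/-- The inverse of the linear combination map of the induced basis. -/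
noncomputable def indCoord (Y : A) (n : ℤ) :
    (ind F N).obj Y n →ₗ[k] ⨁ i, Hom k Y (F.obj (S.pt i)) (n - S.deg i) :=
  lift (fun b p _ h => pushCoord F S h ∘ₗ (coord S b p).symm.toLinearMap) (by
    classical
    intro b b' p s t q r h₁ h₂ h₃ h₄ m g f
    obtain ⟨c, rfl⟩ := (coord S b p).surjective m
    simp only [LinearMap.comp_apply, LinearEquiv.coe_coe, LinearEquiv.symm_apply_apply]
    induction c using DirectSum.induction_on with
    | zero => simp
    | of i c =>
      change pushCoord F S h₂ ((coord S b' t).symm (N.act h₁ (coord S b p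
        (DirectSum.lof k S.ι (fun i => Hom k b (S.pt i) (p - S.deg i)) i c)) g)) f =
        pushCoord F S h₄ (DirectSum.lof k S.ι (fun i => Hom k b (S.pt i) (p - S.deg i)) i c) _
      rw [coord_lof, N.act_act (pq := t - S.deg i) _ _ (by omega) (by omega), ← coord_lof,
        LinearEquiv.symm_apply_apply, pushCoord_lof _ _ _ _ _ _ (by omega),
        pushCoord_lof _ _ _ _ _ _ (by omega), F.map_comp, DGCategory.assoc]
    | add x y hx hy =>
      simp only [map_add, LinearMap.add_apply, hx, hy])

theorem indCoord_mk {Y : A} {n : ℤ} {b : B} {p q : ℤ} (h : p + q = n)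
    (c : ⨁ i, Hom k b (S.pt i) (p - S.deg i)) (f : Hom k Y (F.obj b) q) :
    indCoord F S Y n (mk F N h (coord S b p c) f) = pushCoord F S h c f := by
  refine (lift_mk _ _ h _ f).trans ?_
  simp

open Classical in
theorem linComb_basisElt_lof (Y : A) (n : ℤ) (i : S.ι)
    (c : Hom k Y (F.obj (S.pt i)) (n - S.deg i)) :
    linComb (ind F N) (fun i => F.obj (S.pt i)) S.deg (basisElt F S) Y n
      (DirectSum.lof k S.ι (fun i => Hom k Y (F.obj (S.pt i)) (n - S.deg i)) i c) =
      mk F N (add_sub_cancel (S.deg i) n) (S.e i) c := by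
  rw [linComb_lof]
  refine (action_mk (t' := n - S.deg i) (add_sub_cancel _ _) _ (by omega) (by omega) _ _ _).trans ?_
  rw [DGCategory.id_comp]

theorem indCoord_linComb (Y : A) (n : ℤ) (c : ⨁ i, Hom k Y (F.obj (S.pt i)) (n - S.deg i)) :
    indCoord F S Y n
      (linComb (ind F N) (fun i => F.obj (S.pt i)) S.deg (basisElt F S) Y n c) = c := by
  classical
  suffices H : indCoord F S Y n ∘ₗ
      linComb (ind F N) (fun i => F.obj (S.pt i)) S.deg (basisElt F S) Y n = LinearMap.id from
    LinearMap.congr_fun H c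
  refine DirectSum.linearMap_ext _ fun i => ?_
  ext c
  rw [LinearMap.comp_apply, LinearMap.comp_apply, linComb_basisElt_lof]
  have e : S.e i = coord S (S.pt i) (S.deg i) (DirectSum.lof k S.ι
      (fun j => Hom k (S.pt i) (S.pt j) (S.deg i - S.deg j)) i (idAt (S.pt i) (sub_self _))) := by
    rw [coord_lof, act_idAt]
  rw [e, indCoord_mk, pushCoord_lof _ _ _ _ _ _ (by omega), comp_map_idAt]
  rfl

theorem linComb_pushCoord {Y : A} {n : ℤ} {b : B} {p q : ℤ} (h : p + q = n)
    (c : ⨁ i, Hom k b (S.pt i) (p - S.deg i)) (f : Hom k Y (F.obj b) q) :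
    linComb (ind F N) (fun i => F.obj (S.pt i)) S.deg (basisElt F S) Y n (pushCoord F S h c f) =
      mk F N h (coord S b p c) f := by
  classical
  induction c using DirectSum.induction_on with
  | zero =>
    simp only [map_zero, LinearMap.zero_apply]
    rfl
  | of i c =>
    change linComb (ind F N) (fun i => F.obj (S.pt i)) S.deg (basisElt F S) Y n (pushCoord F S h
      (DirectSum.lof k S.ι (fun i => Hom k b (S.pt i) (p - S.deg i)) i c) f) = mk F N h
        (coord S b p (DirectSum.lof k S.ι (fun i => Hom k b (S.pt i) (p - S.deg i)) i c)) f
    rw [pushCoord_lof _ _ _ _ _ _ (by omega), linComb_basisElt_lof, coord_lof]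
    exact (mk_act ..).symm
  | add x y hx hy =>
    simp only [map_add, LinearMap.add_apply, hx, hy]
    rfl

theorem linComb_indCoord (Y : A) (n : ℤ) (x : (ind F N).obj Y n) :
    linComb (ind F N) (fun i => F.obj (S.pt i)) S.deg (basisElt F S) Y n (indCoord F S Y n x) =
      x := by
  suffices H : linComb (ind F N) (fun i => F.obj (S.pt i)) S.deg (basisElt F S) Y n ∘ₗ
      indCoord F S Y n = (LinearMap.id : Obj F N Y n →ₗ[k] _) from LinearMap.congr_fun H x
  apply hom_ext
  intro b p q h m f
  obtain ⟨c, rfl⟩ := (coord S b p).surjective m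
  exact (congrArg (linComb (ind F N) (fun i => F.obj (S.pt i)) S.deg (basisElt F S) Y n)
    (indCoord_mk F S h c f)).trans (linComb_pushCoord F S h c f)

/-- Induction preserves semi-free modules. -/
theorem isSemiFree_ind (hN : IsSemiFree N) : IsSemiFree (ind F N) := by
  obtain ⟨S⟩ := hN
  refine ⟨⟨S.ι, fun i => F.obj (S.pt i), S.deg, S.level, basisElt F S, fun X n =>
    Function.bijective_iff_has_inverse.2 ⟨_, indCoord_linComb F S X n, linComb_indCoord F S X n⟩,
    fun i => ?_⟩⟩
  obtain ⟨c, hc, hl⟩ := S.d_e i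
  refine ⟨DirectSum.lmap (fun j => F.map) c, ?_, fun j hj => hl j fun h0 => hj ?_⟩
  · refine (diff_mk rfl _ rfl rfl (by omega) (by omega) _ _).trans ?_
    rw [d_id, map_zero, smul_zero, add_zero, hc]
    refine (linComb_pushCoord F S (add_zero _) c (idd k _)).symm.trans (congrArg _ ?_)
    clear hc hl
    classical
    induction c using DirectSum.induction_on with
    | zero => simp
    | of j c =>
      refine (pushCoord_lof _ _ _ _ _ _ (by omega)).trans ?_
      rw [DGCategory.comp_id]
      exact (DirectSum.lmap_lof (R := k) (fun j => (F.map :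
        Hom k (S.pt i) (S.pt j) (S.deg i + 1 - S.deg j) →ₗ[k] _)) j c).symm
    | add x y hx hy =>
      simp only [map_add, LinearMap.add_apply, hx, hy]
  · rw [DirectSum.lmap_apply, h0, map_zero]

end Ind

/-- The induction DG functor on semi-free modules. -/
noncomputable def indFunctor (F : DGFunctor k B A) : DGFunctor k (IndCat k B) (IndCat k A) where
  obj N := ⟨Ind.ind F N.obj, Ind.isSemiFree_ind F N.property⟩
  map := Ind.indMap F
  map_d h φ := Ind.indMap_d h φ
  map_id N := Ind.indMap_id N.obj
  map_comp h ψ φ := Ind.indMap_comp h ψ φ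

/-- The dual induction DG functor on pro-objects. -/
noncomputable def proFunctor (F : DGFunctor k B A) : DGFunctor k (ProCat k B) (ProCat k A) :=
  (indFunctor F.op).op

end induction

/-! ### One-sided twisted complexes -/

/-- A formal finite direct sum `⨁ᵢ Cᵢ[rᵢ]` indexed by a finite totally ordered set. -/
structure Tuple (C : Type u) where
  ι : Type
  [fintype : Fintype ι]
  [linearOrder : LinearOrder ι]
  obj : ι → C
  sh : ι → ℤ

attribute [instance] Tuple.fintype Tuple.linearOrder

section pretr

variable {k : Type w} [CommRing k] {C : Type u} [DGCategory.{v} k C]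

/-- The possible degrees of the `(i, j)` entry of a matrix of degree `l`: this type has one element,
`Y.sh i - X.sh j + l`. -/
abbrev EntryDeg (X Y : Tuple C) (l : ℤ) (i : Y.ι) (j : X.ι) : Type :=
  { p : ℤ // p + X.sh j = Y.sh i + l }

instance (X Y : Tuple C) (l : ℤ) (i : Y.ι) (j : X.ι) : Subsingleton (EntryDeg X Y l i j) :=
  ⟨fun p q => Subtype.ext (by have := p.2; have := q.2; omega)⟩

variable (k) in
/-- Matrices of degree `l`: the entry `f i j` lies in `Hom (X.obj j, Y.obj i)[Y.sh i - X.sh j]^l`. -/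
abbrev Mat (X Y : Tuple C) (l : ℤ) : Type v :=
  ∀ (i : Y.ι) (j : X.ι) (p : EntryDeg X Y l i j), Hom k (X.obj j) (Y.obj i) p

theorem Mat.comp_congr {X Y Z : Tuple C} {l m : ℤ} (g : Mat k Y Z l) (f : Mat k X Y m) {i : Z.ι}
    {j : X.ι} {s : Y.ι} {n : ℤ} {p p' : EntryDeg Y Z l i s} {q q' : EntryDeg X Y m s j}
    (h : p.1 + q.1 = n) (h' : p'.1 + q'.1 = n) :
    comp h (g i s p) (f s j q) = comp h' (g i s p') (f s j q') := by
  have e : p = p' := Subtype.ext (by have := p.2; have := p'.2; omega)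
  have e' : q = q' := Subtype.ext (by have := q.2; have := q'.2; omega)
  subst e e'
  rfl

theorem Mat.d_congr {X Y : Tuple C} {l : ℤ} (f : Mat k X Y l) {i : Y.ι}
    {j : X.ι} {n : ℤ} {p p' : EntryDeg X Y l i j} (h : p.1 + 1 = n) (h' : p'.1 + 1 = n) :
    d h (f i j p) = d h' (f i j p') := by
  have e : p = p' := Subtype.ext (by omega)
  subst e
  rfl

/-- The naive differential of a matrix: the differential of `Hom (X.obj j, Y.obj i)[Y.sh i - X.sh j]`
applied entrywise, with the sign `(-1)^(Y.sh i)` coming from the shift of the target. -/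
def dNaive {X Y : Tuple C} {m n : ℤ} (h : m + 1 = n) : Mat k X Y m →ₗ[k] Mat k X Y n where
  toFun f i j p := sgn k (Y.sh i) •
    d (sub_add_cancel p.1 1) (f i j ⟨p.1 - 1, by have := p.2; omega⟩)
  map_add' f g := by
    ext i j p
    simp
  map_smul' c f := by
    ext i j p
    simp [smul_smul, mul_comm]

theorem dNaive_apply {X Y : Tuple C} {m n : ℤ} (h : m + 1 = n) (f : Mat k X Y m) (i : Y.ι)
    (j : X.ι) (p : EntryDeg X Y n i j) (p' : EntryDeg X Y m i j) (hp : p'.1 + 1 = p.1) :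
    dNaive h f i j p = sgn k (Y.sh i) • d hp (f i j p') := by
  change sgn k (Y.sh i) • d (sub_add_cancel p.1 1) (f i j ⟨p.1 - 1, _⟩) = _
  exact congrArg (fun x => sgn k (Y.sh i) • x)
    (Mat.d_congr f (p := ⟨p.1 - 1, by have := p.2; omega⟩) _ hp)

/-- The canonical degree of an entry. -/
def entryDeg (X Y : Tuple C) (l : ℤ) (i : Y.ι) (j : X.ι) : EntryDeg X Y l i j :=
  ⟨Y.sh i + l - X.sh j, sub_add_cancel _ _⟩

theorem entryDeg_add {X Y Z : Tuple C} {q p r : ℤ} (h : q + p = r) {i : Z.ι} {j : X.ι} (s : Y.ι)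
    (a : EntryDeg Y Z q i s) (b : EntryDeg X Y p s j) (c : EntryDeg X Z r i j) :
    a.1 + b.1 = c.1 := by
  have := a.2
  have := b.2
  have := c.2
  omega

/-- Matrix multiplication. -/
def matMul {X Y Z : Tuple C} {q p r : ℤ} (h : q + p = r) :
    Mat k Y Z q →ₗ[k] Mat k X Y p →ₗ[k] Mat k X Z r :=
  LinearMap.mk₂ k
    (fun g f i j c => ∑ s : Y.ι, comp (entryDeg_add h s (entryDeg Y Z q i s) (entryDeg X Y p s j) c)
      (g i s (entryDeg Y Z q i s)) (f s j (entryDeg X Y p s j)))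
    (fun _ _ _ => by ext; simp [Finset.sum_add_distrib])
    (fun _ _ _ => by ext; simp [Finset.smul_sum])
    (fun _ _ _ => by ext; simp [Finset.sum_add_distrib])
    (fun _ _ _ => by ext; simp [Finset.smul_sum])

theorem matMul_apply {X Y Z : Tuple C} {q p r : ℤ} (h : q + p = r) (g : Mat k Y Z q)
    (f : Mat k X Y p) (i : Z.ι) (j : X.ι) (c : EntryDeg X Z r i j)
    (a : ∀ s, EntryDeg Y Z q i s) (b : ∀ s, EntryDeg X Y p s j) :
    matMul h g f i j c = ∑ s : Y.ι, comp (entryDeg_add h s (a s) (b s) c)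
      (g i s (a s)) (f s j (b s)) :=
  Finset.sum_congr rfl fun _ _ => Mat.comp_congr g f _ _

/-- The identity matrix. -/
def matId (X : Tuple C) : Mat k X X 0 := fun i j p =>
  if h : i = j then by
    subst h
    exact idAt (X.obj i) (show p.1 = 0 by have := p.2; omega)
  else 0

theorem matId_self (X : Tuple C) (i : X.ι) (p : EntryDeg X X 0 i i) (hp : p.1 = 0) :
    matId (k := k) X i i p = idAt (X.obj i) hp := by
  simp [matId]

theorem matId_ne (X : Tuple C) {i j : X.ι} (h : i ≠ j) (p : EntryDeg X X 0 i j) :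
    matId (k := k) X i j p = 0 := by
  simp [matId, h]

theorem matId_mul {X Y : Tuple C} {p : ℤ} (h : 0 + p = p) (f : Mat k X Y p) :
    matMul h (matId Y) f = f := by
  funext i j c
  rw [matMul_apply h _ _ i j c (fun s => entryDeg _ _ _ _ _) (fun s => entryDeg _ _ _ _ _),
    Finset.sum_eq_single i]
  · have e : entryDeg X Y p i j = c := Subsingleton.elim _ _
    subst e
    rw [matId_self (hp := by simp [entryDeg])]
    exact idAt_comp _ _ _
  · intro s _ hs
    rw [matId_ne Y hs.symm, map_zero, LinearMap.zero_apply]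
  · simp

theorem mul_matId {X Y : Tuple C} {p : ℤ} (h : p + 0 = p) (f : Mat k X Y p) :
    matMul h f (matId X) = f := by
  funext i j c
  rw [matMul_apply h _ _ i j c (fun s => entryDeg _ _ _ _ _) (fun s => entryDeg _ _ _ _ _),
    Finset.sum_eq_single j]
  · have e : entryDeg X Y p i j = c := Subsingleton.elim _ _
    subst e
    rw [matId_self (hp := by simp [entryDeg])]
    exact comp_idAt _ _ _
  · intro s _ hs
    rw [matId_ne X hs, map_zero]
  · simp

theorem matMul_assoc {X Y Z W : Tuple C} {p q r pq qr n : ℤ}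
    (h₁ : r + q = qr) (h₂ : qr + p = n) (h₃ : q + p = pq) (h₄ : r + pq = n) (h : Mat k Z W r)
    (g : Mat k Y Z q) (f : Mat k X Y p) :
    matMul h₂ (matMul h₁ h g) f = matMul h₄ h (matMul h₃ g f) := by
  funext i j c
  rw [matMul_apply h₂ _ _ i j c (fun s => entryDeg _ _ _ _ _) (fun s => entryDeg _ _ _ _ _),
    matMul_apply h₄ _ _ i j c (fun s => entryDeg _ _ _ _ _) (fun s => entryDeg _ _ _ _ _)]
  simp only [matMul_apply h₁ h g i _ _ (fun s => entryDeg _ _ _ _ _)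
    (fun s => entryDeg _ _ _ _ _), matMul_apply h₃ g f _ j _ (fun s => entryDeg _ _ _ _ _)
    (fun s => entryDeg _ _ _ _ _), map_sum, LinearMap.sum_apply]
  rw [Finset.sum_comm]
  refine Finset.sum_congr rfl fun s _ => Finset.sum_congr rfl fun t _ => ?_
  exact DGCategory.assoc _ _ _ _ _ _ _

theorem dNaive_dNaive {X Y : Tuple C} {m n l : ℤ} (h : m + 1 = n) (h' : n + 1 = l)
    (f : Mat k X Y m) : dNaive h' (dNaive h f) = 0 := by
  funext i j c
  rw [dNaive_apply h' _ i j c (entryDeg _ _ _ _ _) (by have := c.2; simp [entryDeg]; omega),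
    dNaive_apply h _ i j _ (entryDeg _ _ _ _ _) (by simp [entryDeg]; omega), map_smul,
    DGCategory.d_d, smul_zero, smul_zero]
  rfl

theorem dNaive_matId (X : Tuple C) {n : ℤ} (h : 0 + 1 = n) : dNaive (k := k) h (matId X) = 0 := by
  funext i j c
  rw [dNaive_apply h _ i j c (entryDeg _ _ _ _ _) (by have := c.2; simp [entryDeg]; omega)]
  by_cases hij : i = j
  · subst hij
    rw [matId_self (hp := by simp [entryDeg]), d_idAt, smul_zero]
    rfl
  · rw [matId_ne X hij, map_zero, smul_zero]
    rfl

theorem dNaive_matMul {X Y Z : Tuple C} {q p r q' p' s : ℤ} (h : q + p = r) (hr : r + 1 = s)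
    (hq : q + 1 = q') (hp : p + 1 = p') (h₁ : q' + p = s) (h₂ : q + p' = s) (g : Mat k Y Z q)
    (f : Mat k X Y p) :
    dNaive hr (matMul h g f) =
      matMul h₁ (dNaive hq g) f + sgn k q • matMul h₂ g (dNaive hp f) := by
  funext i j c
  rw [Pi.add_apply, Pi.add_apply, Pi.add_apply, Pi.smul_apply, Pi.smul_apply, Pi.smul_apply,
    dNaive_apply hr _ i j c (entryDeg _ _ _ _ _) (by have := c.2; simp [entryDeg]; omega),
    matMul_apply h _ _ i j _ (fun s => entryDeg _ _ _ _ _) (fun s => entryDeg _ _ _ _ _),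
    matMul_apply h₁ _ _ i j c (fun s => entryDeg _ _ _ _ _) (fun s => entryDeg _ _ _ _ _),
    matMul_apply h₂ _ _ i j c (fun s => entryDeg _ _ _ _ _) (fun s => entryDeg _ _ _ _ _),
    map_sum, Finset.smul_sum, Finset.smul_sum, ← Finset.sum_add_distrib]
  refine Finset.sum_congr rfl fun t _ => ?_
  have e₁ : (entryDeg Y Z q i t).1 + 1 = (entryDeg Y Z q' i t).1 := by simp [entryDeg]; omega
  have e₂ : (entryDeg X Y p t j).1 + 1 = (entryDeg X Y p' t j).1 := by simp [entryDeg]; omega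
  rw [dNaive_apply hq _ i t _ (entryDeg _ _ _ _ _) e₁,
    dNaive_apply hp _ t j _ (entryDeg _ _ _ _ _) e₂,
    DGCategory.d_comp _ _ e₁ e₂ (entryDeg_add h₁ _ _ _ _) (entryDeg_add h₂ _ _ _ _)]
  have e₃ : sgn k (entryDeg Y Z q i t).1 * sgn k (Y.sh t) = sgn k (Z.sh i) * sgn k q := by
    rw [← sgn_add, ← sgn_add, (entryDeg Y Z q i t).2]
  have e₄ := sgn_mul_self k (Z.sh i)
  have e₅ := sgn_mul_self k (Y.sh t)
  have e₆ : sgn k (Z.sh i) * sgn k (entryDeg Y Z q i t).1 = sgn k q * sgn k (Y.sh t) := by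
    linear_combination (sgn k (Z.sh i) * sgn k (Y.sh t)) * e₃ -
      sgn k (Z.sh i) * sgn k (entryDeg Y Z q i t).1 * e₅ + sgn k q * sgn k (Y.sh t) * e₄
  simp only [map_smul, LinearMap.smul_apply, smul_add, smul_smul]
  rw [e₆]

variable (k C) in
/-- Objects of `C^pretr`: one-sided twisted complexes `(⨁ᵢ Cᵢ[rᵢ], q)`, where `q` is a strictly
upper triangular matrix of degree `1` with `d q + q² = 0`. -/
structure Pretr extends Tuple C where
  q : Mat k toTuple toTuple 1
  triangular : ∀ i j p, j ≤ i → q i j p = 0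
  maurerCartan : dNaive one_add_one_eq_two q + matMul one_add_one_eq_two q q = 0

namespace Pretr

/-- The differential `f ↦ d_naive f + q' f - (-1)^|f| f q`. -/
def diff {X Y : Pretr k C} {m n : ℤ} (h : m + 1 = n) :
    Mat k X.toTuple Y.toTuple m →ₗ[k] Mat k X.toTuple Y.toTuple n :=
  dNaive h + matMul ((add_comm 1 m).trans h) Y.q - sgn k m • (matMul h).flip X.q

theorem diff_apply {X Y : Pretr k C} {m n : ℤ} (h : m + 1 = n) (h' : 1 + m = n)
    (f : Mat k X.toTuple Y.toTuple m) :
    diff h f = dNaive h f + matMul h' Y.q f - sgn k m • matMul h f X.q := rfl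

theorem dNaive_q (X : Pretr k C) {n : ℤ} (h : 1 + 1 = n) :
    dNaive h X.q = - matMul h X.q X.q := by
  obtain rfl : (2 : ℤ) = n := by omega
  exact eq_neg_of_add_eq_zero_left X.maurerCartan

instance : DGCategory.{v} k (Pretr k C) where
  Hom X Y n := Mat k X.toTuple Y.toTuple n
  d h := diff h
  id X := matId X.toTuple
  comp h := matMul h
  d_d {X Y m n l} h h' f := by
    subst h h'
    have e := sgn_mul_self k m
    rw [diff_apply _ (by omega), diff_apply _ (by omega)]
    simp only [map_add, map_sub, map_smul, LinearMap.add_apply, LinearMap.sub_apply,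
      LinearMap.smul_apply]
    rw [dNaive_dNaive, dNaive_matMul (q' := 2) (p' := m + 1) _ _ (by omega) (by omega) (by omega)
        (by omega),
      dNaive_matMul (q' := m + 1) (p' := 2) _ _ (by omega) (by omega) (by omega)
        (by omega), dNaive_q, dNaive_q, map_neg, map_neg, LinearMap.neg_apply,
      matMul_assoc (pq := m + 1) _ _ (by omega) (by omega) Y.q Y.q,
      matMul_assoc (pq := m + 1) _ _ (by omega) (by omega) Y.q f,
      matMul_assoc (pq := 2) _ _ (by omega) (by omega) f X.q X.q, sgn_succ]
    have e1 : sgn k (1 : ℤ) = -1 := by have := sgn_succ k 0; simpa [sgn_zero] using this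
    rw [e1]
    module
  id_comp := matId_mul
  comp_id := mul_matId
  assoc := matMul_assoc
  d_comp {X Y Z q p r q' p' s} h hr hq hp h₁ h₂ g f := by
    rw [diff_apply _ (by omega), diff_apply _ (by omega), diff_apply _ (by omega),
      dNaive_matMul h hr hq hp h₁ h₂]
    simp only [map_add, map_sub, map_smul, LinearMap.add_apply, LinearMap.sub_apply,
      LinearMap.smul_apply]
    rw [matMul_assoc (pq := r) (n := s) _ h₁ h (by omega) Z.q g f,
      matMul_assoc (pq := p') (n := s) _ h₁ (by omega) (by omega) g Y.q f,
      matMul_assoc (pq := p') (n := s) _ hr (by omega) (by omega) g f X.q]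
    obtain rfl := h
    rw [sgn_add]
    module

/-! #### Functoriality -/

end Pretr

section functoriality

variable {D : Type u'} [DGCategory.{v'} k D] (F : DGFunctor k C D)

/-- A DG functor applied to a formal direct sum of shifts. -/
abbrev Tuple.map (X : Tuple C) : Tuple D := ⟨X.ι, fun i => F.obj (X.obj i), X.sh⟩

/-- A DG functor applied entrywise to a matrix. -/
def Mat.map {X Y : Tuple C} {l : ℤ} : Mat k X Y l →ₗ[k] Mat k (X.map F) (Y.map F) l where
  toFun f i j p := F.map (f i j p)
  map_add' f g := by
    ext i j p
    simp
  map_smul' c f := by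
    ext i j p
    simp

theorem Mat.map_apply {X Y : Tuple C} {l : ℤ} (f : Mat k X Y l) (i j p) :
    Mat.map F f i j p = F.map (f i j p) := rfl

theorem Mat.map_dNaive {X Y : Tuple C} {m n : ℤ} (h : m + 1 = n) (f : Mat k X Y m) :
    Mat.map F (dNaive h f) = dNaive h (Mat.map F f) := by
  funext i j p
  exact (map_smul F.map _ _).trans (congrArg _ (F.map_d _ _))

theorem Mat.map_matMul {X Y Z : Tuple C} {q p r : ℤ} (h : q + p = r) (g : Mat k Y Z q)
    (f : Mat k X Y p) : Mat.map F (matMul h g f) = matMul h (Mat.map F g) (Mat.map F f) := by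
  funext i j c
  exact (map_sum F.map _ _).trans (Finset.sum_congr rfl fun s _ => F.map_comp _ _ _)

theorem map_idAt {X : C} {n : ℤ} (h : n = 0) :
    F.map (idAt (k := k) X h) = idAt (F.obj X) h := by
  subst h
  exact F.map_id X

theorem Mat.map_matId (X : Tuple C) : Mat.map F (matId (k := k) X) = matId (X.map F) := by
  funext i j p
  rw [Mat.map_apply]
  by_cases h : i = j
  · subst h
    have hp : p.1 = 0 := by have := p.2; omega
    refine (congrArg F.map (matId_self X i p hp)).trans ?_
    rw [map_idAt]
    exact (matId_self (X.map F) i p hp).symm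
  · refine (congrArg F.map (matId_ne X h p)).trans ?_
    rw [map_zero]
    exact (matId_ne (X.map F) h p).symm

/-- A DG functor applied to a twisted complex. -/
def DGFunctor.pretrObj (X : Pretr k C) : Pretr k D where
  toTuple := X.toTuple.map F
  q := Mat.map F X.q
  triangular i j p h := (congrArg F.map (X.triangular i j p h)).trans (map_zero _)
  maurerCartan := by
    rw [← Mat.map_dNaive, ← Mat.map_matMul, ← map_add, X.maurerCartan, map_zero]

theorem Mat.map_diff {X Y : Pretr k C} {m n : ℤ} (h : m + 1 = n)
    (f : Mat k X.toTuple Y.toTuple m) :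
    Mat.map F (Pretr.diff h f) =
      Pretr.diff (X := F.pretrObj X) (Y := F.pretrObj Y) h (Mat.map F f) := by
  have h' : 1 + m = n := (add_comm 1 m).trans h
  have key : Mat.map F (Pretr.diff h f) = dNaive h (Mat.map F f) +
      matMul h' (Mat.map F Y.q) (Mat.map F f) -
      sgn k m • matMul h (Mat.map F f) (Mat.map F X.q) := by
    rw [Pretr.diff_apply _ h', map_sub, map_add, map_smul, Mat.map_dNaive, Mat.map_matMul,
      Mat.map_matMul]
  exact key

/-- The DG functor `C^pretr → D^pretr` induced by a DG functor `C → D`. -/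
def DGFunctor.pretr : DGFunctor k (Pretr k C) (Pretr k D) where
  obj := F.pretrObj
  map := Mat.map F
  map_d h f := Mat.map_diff F h f
  map_id X := Mat.map_matId F X.toTuple
  map_comp h g f := Mat.map_matMul F h g f

end functoriality

/-! #### The shift -/

/-- The shift by one of a formal direct sum. -/
abbrev Tuple.shift (X : Tuple C) : Tuple C := ⟨X.ι, X.obj, fun i => X.sh i + 1⟩

/-- The matrix `f` viewed as a matrix between the shifts. -/
def Mat.shift {X Y : Tuple C} {l : ℤ} : Mat k X Y l →ₗ[k] Mat k X.shift Y.shift l where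
  toFun f i j p := f i j ⟨p.1, by have h : p.1 + (X.sh j + 1) = Y.sh i + 1 + l := p.2; omega⟩
  map_add' f g := rfl
  map_smul' c f := rfl

theorem Mat.shift_dNaive {X Y : Tuple C} {m n : ℤ} (h : m + 1 = n) (f : Mat k X Y m) :
    dNaive h (Mat.shift f) = - Mat.shift (dNaive h f) := by
  funext i j p
  refine Eq.trans ?_ (neg_smul _ _)
  rw [← sgn_succ]
  rfl

theorem Mat.shift_matMul {X Y Z : Tuple C} {q p r : ℤ} (h : q + p = r) (g : Mat k Y Z q)
    (f : Mat k X Y p) : matMul h (Mat.shift g) (Mat.shift f) = Mat.shift (matMul h g f) := by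
  funext i j c
  refine Finset.sum_congr rfl fun s _ => ?_
  have h₁ : (entryDeg Y.shift Z.shift q i s).1 + Y.sh s = Z.sh i + q := by
    simp only [entryDeg]; omega
  have h₂ : (entryDeg X.shift Y.shift p s j).1 + X.sh j = Y.sh s + p := by
    simp only [entryDeg]; omega
  exact Mat.comp_congr g f (p := ⟨_, h₁⟩) (q := ⟨_, h₂⟩) _ _

theorem Mat.shift_matId (X : Tuple C) : Mat.shift (matId (k := k) X) = matId X.shift := by
  funext i j p
  by_cases h : i = j
  · subst h
    have hp : p.1 = 0 := by have := p.2; omega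
    exact (matId_self X i _ hp).trans (matId_self X.shift i p hp).symm
  · exact (matId_ne X h _).trans (matId_ne X.shift h p).symm

namespace Pretr

/-- The shift of a twisted complex. -/
def shift (X : Pretr k C) : Pretr k C where
  toTuple := X.toTuple.shift
  q := - Mat.shift X.q
  triangular i j p h := neg_eq_zero.2 (X.triangular i j _ h)
  maurerCartan := by
    rw [map_neg, map_neg, map_neg, LinearMap.neg_apply, neg_neg, Mat.shift_dNaive, neg_neg,
      Mat.shift_matMul, ← map_add, X.maurerCartan, map_zero]

variable (k C) in
/-- The shift DG functor, with the usual sign on morphisms of odd degree. -/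
def shiftFunctor : DGFunctor k (Pretr k C) (Pretr k C) where
  obj := shift
  map {_ _ n} := sgn k n • Mat.shift
  map_d {X Y m n} h f := by
    change sgn k n • Mat.shift (diff h f) = dNaive h (sgn k m • Mat.shift f) +
      matMul _ (-Mat.shift Y.q) (sgn k m • Mat.shift f) -
      sgn k m • matMul h (sgn k m • Mat.shift f) (-Mat.shift X.q)
    rw [diff_apply _ ((add_comm 1 m).trans h)]
    simp only [map_add, map_sub, map_smul, map_neg, LinearMap.neg_apply, LinearMap.smul_apply]
    rw [Mat.shift_dNaive, Mat.shift_matMul, Mat.shift_matMul, show sgn k n = -sgn k m by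
      rw [← h, sgn_succ]]
    module
  map_id X := by
    refine (congrArg (fun c : k => c • Mat.shift (matId (k := k) X.toTuple)) (sgn_zero k)).trans ?_
    exact (one_smul _ _).trans (Mat.shift_matId _)
  map_comp {X Y Z q p r} h g f := by
    change sgn k r • Mat.shift (matMul h g f) =
      matMul h (sgn k q • Mat.shift g) (sgn k p • Mat.shift f)
    rw [map_smul, map_smul, LinearMap.smul_apply, Mat.shift_matMul, smul_smul, ← sgn_add,
      show p + q = r by omega]

/-! #### Cones -/

/-- The index tuple of the cone of a morphism from `X` to `Y`: the sum of `Y` and `X[1]`, where the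
indices of `Y` come first. -/
abbrev coneTuple (X Y : Tuple C) : Tuple C where
  ι := Y.ι ⊕ X.ι
  linearOrder := inferInstanceAs (LinearOrder (Y.ι ⊕ₗ X.ι))
  obj := Sum.elim Y.obj X.obj
  sh := Sum.elim Y.sh (fun j => X.sh j + 1)

/-- The block matrix with blocks `q_Y`, `f`, `0` and `-q_X`. -/
def coneQ (X Y : Pretr k C) (f : Mat k X.toTuple Y.toTuple 0) :
    Mat k (coneTuple X.toTuple Y.toTuple) (coneTuple X.toTuple Y.toTuple) 1
  | .inl i, .inl j, p => Y.q i j ⟨p.1, p.2⟩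
  | .inl i, .inr j, p => f i j ⟨p.1, by
      have h : p.1 + (X.sh j + 1) = Y.sh i + 1 := p.2
      omega⟩
  | .inr _, .inl _, _ => 0
  | .inr i, .inr j, p => - X.q i j ⟨p.1, by
      have h : p.1 + (X.sh j + 1) = X.sh i + 1 + 1 := p.2
      omega⟩

theorem maurerCartan_apply (X : Pretr k C) (i j : X.ι) {n : ℤ}
    (a : EntryDeg X.toTuple X.toTuple 1 i j) (ha : a.1 + 1 = n)
    (b : ∀ s, EntryDeg X.toTuple X.toTuple 1 i s) (c : ∀ s, EntryDeg X.toTuple X.toTuple 1 s j)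
    (hbc : ∀ s, (b s).1 + (c s).1 = n) :
    sgn k (X.sh i) • d ha (X.q i j a) + ∑ s, comp (hbc s) (X.q i s (b s)) (X.q s j (c s)) = 0 := by
  have h := congrFun (congrFun (congrFun X.maurerCartan i) j)
    ⟨n, by have := a.2; omega⟩
  rw [Pi.add_apply, Pi.add_apply, Pi.add_apply, dNaive_apply _ _ i j _ a ha,
    matMul_apply _ _ _ i j _ b c] at h
  exact h

theorem diff_entry {X Y : Pretr k C} (f : Mat k X.toTuple Y.toTuple 0) (i : Y.ι) (j : X.ι)
    (p : EntryDeg X.toTuple Y.toTuple 1 i j)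
    (a : EntryDeg X.toTuple Y.toTuple 0 i j) (ha : a.1 + 1 = p.1)
    (b : ∀ s, EntryDeg Y.toTuple Y.toTuple 1 i s) (c : ∀ s, EntryDeg X.toTuple Y.toTuple 0 s j)
    (b' : ∀ s, EntryDeg X.toTuple Y.toTuple 0 i s) (c' : ∀ s, EntryDeg X.toTuple X.toTuple 1 s j)
    (hbc : ∀ s, (b s).1 + (c s).1 = p.1) (hbc' : ∀ s, (b' s).1 + (c' s).1 = p.1) :
    diff (X := X) (Y := Y) (zero_add 1) f i j p =
    sgn k (Y.sh i) • d ha (f i j a) + ∑ s, comp (hbc s) (Y.q i s (b s)) (f s j (c s)) -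
      ∑ s, comp (hbc' s) (f i s (b' s)) (X.q s j (c' s)) := by
  rw [diff_apply _ (add_zero 1), sgn_zero, one_smul, Pi.sub_apply, Pi.sub_apply, Pi.sub_apply,
    Pi.add_apply, Pi.add_apply, Pi.add_apply, dNaive_apply _ _ i j _ a ha,
    matMul_apply _ _ _ i j _ b c, matMul_apply _ _ _ i j _ b' c']

theorem diff_apply_apply {X Y : Pretr k C} (f : Mat k X.toTuple Y.toTuple 0) (i : Y.ι) (j : X.ι)
    {n : ℤ} (a : EntryDeg X.toTuple Y.toTuple 0 i j) (ha : a.1 + 1 = n)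
    (b : ∀ s, EntryDeg Y.toTuple Y.toTuple 1 i s) (c : ∀ s, EntryDeg X.toTuple Y.toTuple 0 s j)
    (b' : ∀ s, EntryDeg X.toTuple Y.toTuple 0 i s) (c' : ∀ s, EntryDeg X.toTuple X.toTuple 1 s j)
    (hbc : ∀ s, (b s).1 + (c s).1 = n) (hbc' : ∀ s, (b' s).1 + (c' s).1 = n)
    (hf : diff (X := X) (Y := Y) (zero_add 1) f = 0) :
    sgn k (Y.sh i) • d ha (f i j a) + ∑ s, comp (hbc s) (Y.q i s (b s)) (f s j (c s)) -
      ∑ s, comp (hbc' s) (f i s (b' s)) (X.q s j (c' s)) = 0 := by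
  have h := congrFun (congrFun (congrFun hf i) j) ⟨n, by have := a.2; omega⟩
  rwa [diff_entry f i j _ a ha b c b' c' hbc hbc'] at h

theorem diff_eq_zero {X Y : Pretr k C} (f : Mat k X.toTuple Y.toTuple 0)
    (H : ∀ (i : Y.ι) (j : X.ι) (n : ℤ)
      (a : EntryDeg X.toTuple Y.toTuple 0 i j) (ha : a.1 + 1 = n)
      (b : ∀ s, EntryDeg Y.toTuple Y.toTuple 1 i s) (c : ∀ s, EntryDeg X.toTuple Y.toTuple 0 s j)
      (b' : ∀ s, EntryDeg X.toTuple Y.toTuple 0 i s) (c' : ∀ s, EntryDeg X.toTuple X.toTuple 1 s j)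
      (hbc : ∀ s, (b s).1 + (c s).1 = n) (hbc' : ∀ s, (b' s).1 + (c' s).1 = n),
      sgn k (Y.sh i) • d ha (f i j a) + ∑ s, comp (hbc s) (Y.q i s (b s)) (f s j (c s)) -
        ∑ s, comp (hbc' s) (f i s (b' s)) (X.q s j (c' s)) = 0) :
    diff (X := X) (Y := Y) (zero_add 1) f = 0 := by
  funext i j p
  have ha : (entryDeg X.toTuple Y.toTuple 0 i j).1 + 1 = p.1 := by
    have := p.2
    simp only [entryDeg]
    omega
  have hbc : ∀ s, (entryDeg Y.toTuple Y.toTuple 1 i s).1 +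
      (entryDeg X.toTuple Y.toTuple 0 s j).1 = p.1 :=
    fun s => entryDeg_add (add_zero 1) s _ _ p
  have hbc' : ∀ s, (entryDeg X.toTuple Y.toTuple 0 i s).1 +
      (entryDeg X.toTuple X.toTuple 1 s j).1 = p.1 :=
    fun s => entryDeg_add (zero_add 1) s _ _ p
  rw [diff_entry f i j p _ ha (fun s => entryDeg _ _ _ _ _) (fun s => entryDeg _ _ _ _ _)
    (fun s => entryDeg _ _ _ _ _) (fun s => entryDeg _ _ _ _ _) hbc hbc']
  exact H i j p.1 _ ha _ _ _ _ hbc hbc'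

theorem coneQ_maurerCartan {X Y : Pretr k C} (f : Mat k X.toTuple Y.toTuple 0)
    (hf : diff (X := X) (Y := Y) (zero_add 1) f = 0) :
    dNaive one_add_one_eq_two (coneQ X Y f) +
      matMul one_add_one_eq_two (coneQ X Y f) (coneQ X Y f) = 0 := by
  funext i j p
  obtain ⟨a, ha⟩ : ∃ a : EntryDeg (coneTuple X.toTuple Y.toTuple) (coneTuple X.toTuple Y.toTuple)
      1 i j, a.1 + 1 = p.1 := by
    refine ⟨entryDeg _ _ _ _ _, ?_⟩
    have := p.2
    have := (entryDeg (coneTuple X.toTuple Y.toTuple) (coneTuple X.toTuple Y.toTuple) 1 i j).2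
    omega
  obtain ⟨b⟩ : Nonempty (∀ s, EntryDeg (coneTuple X.toTuple Y.toTuple)
    (coneTuple X.toTuple Y.toTuple) 1 i s) := ⟨fun s => entryDeg _ _ _ _ _⟩
  obtain ⟨c⟩ : Nonempty (∀ s, EntryDeg (coneTuple X.toTuple Y.toTuple)
    (coneTuple X.toTuple Y.toTuple) 1 s j) := ⟨fun s => entryDeg _ _ _ _ _⟩
  have hd : ∀ s, (b s).1 + (c s).1 = p.1 := fun s => entryDeg_add one_add_one_eq_two s _ _ p
  rw [Pi.add_apply, Pi.add_apply, Pi.add_apply, matMul_apply _ _ _ i j p b c,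
    dNaive_apply _ _ i j p a ha, Fintype.sum_sum_type]
  rcases i with i | i <;> rcases j with j | j
  · refine Eq.trans ?_ (maurerCartan_apply Y i j (n := p.1) ⟨a.1, a.2⟩ ha
      (fun s => ⟨(b (.inl s)).1, (b (.inl s)).2⟩) (fun s => ⟨(c (.inl s)).1, (c (.inl s)).2⟩)
      (fun s => hd (.inl s)))
    refine congrArg₂ (· + ·) rfl ((congrArg₂ (· + ·) rfl ?_).trans (add_zero _))
    exact Finset.sum_eq_zero fun s _ => map_zero _
  · have h₁ : a.1 + X.sh j = Y.sh i + 0 := by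
      have h : a.1 + (X.sh j + 1) = Y.sh i + 1 := a.2
      omega
    have h₂ : ∀ s, (c (.inl s)).1 + X.sh j = Y.sh s + 0 := fun s => by
      have h : (c (.inl s)).1 + (X.sh j + 1) = Y.sh s + 1 := (c (.inl s)).2
      omega
    have h₃ : ∀ s, (b (.inr s)).1 + X.sh s = Y.sh i + 0 := fun s => by
      have h : (b (.inr s)).1 + (X.sh s + 1) = Y.sh i + 1 := (b (.inr s)).2
      omega
    have h₄ : ∀ s, (c (.inr s)).1 + X.sh j = X.sh s + 1 := fun s => by
      have h : (c (.inr s)).1 + (X.sh j + 1) = X.sh s + 1 + 1 := (c (.inr s)).2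
      omega
    refine Eq.trans ?_ (diff_apply_apply f i j (n := p.1) ⟨a.1, h₁⟩ ha
      (fun s => ⟨(b (.inl s)).1, (b (.inl s)).2⟩) (fun s => ⟨_, h₂ s⟩) (fun s => ⟨_, h₃ s⟩)
      (fun s => ⟨_, h₄ s⟩) (fun s => hd (.inl s)) (fun s => hd (.inr s)) hf)
    rw [add_sub_assoc, sub_eq_add_neg, ← Finset.sum_neg_distrib]
    refine congrArg₂ (· + ·) rfl (congrArg₂ (· + ·) rfl ?_)
    exact Finset.sum_congr rfl fun s _ => map_neg _ _
  · refine (congrArg₂ (· + ·) ((congrArg _ (map_zero _)).trans (smul_zero _))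
      (congrArg₂ (· + ·) (Finset.sum_eq_zero fun s _ => ?_)
        (Finset.sum_eq_zero fun s _ => map_zero _))).trans ?_
    · exact LinearMap.map_zero₂ _ _
    · rw [add_zero, add_zero]
      rfl
  · have h₁ : a.1 + X.sh j = X.sh i + 1 := by
      have h : a.1 + (X.sh j + 1) = X.sh i + 1 + 1 := a.2
      omega
    have h₃ : ∀ s, (b (.inr s)).1 + X.sh s = X.sh i + 1 := fun s => by
      have h : (b (.inr s)).1 + (X.sh s + 1) = X.sh i + 1 + 1 := (b (.inr s)).2
      omega
    have h₄ : ∀ s, (c (.inr s)).1 + X.sh j = X.sh s + 1 := fun s => by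
      have h : (c (.inr s)).1 + (X.sh j + 1) = X.sh s + 1 + 1 := (c (.inr s)).2
      omega
    refine Eq.trans ?_ (maurerCartan_apply X i j (n := p.1) ⟨a.1, h₁⟩ ha
      (fun s => ⟨_, h₃ s⟩) (fun s => ⟨_, h₄ s⟩) (fun s => hd (.inr s)))
    refine congrArg₂ (· + ·) ?_ ((congrArg₂ (· + ·) (Finset.sum_eq_zero fun s _ => ?_)
      (Finset.sum_congr rfl fun s _ => ?_)).trans (zero_add _))
    · refine (congrArg₂ (· • ·) (sgn_succ k _) (map_neg _ _)).trans ?_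
      exact (neg_smul_neg _ _)
    · exact LinearMap.map_zero₂ _ _
    · refine (map_neg _ _).trans ?_
      refine (congrArg _ (LinearMap.map_neg₂ _ _ _)).trans (neg_neg _)

/-- The cone of a closed morphism of degree `0`. -/
def cone {X Y : Pretr k C} (f : Hom k X Y 0) (hf : d (zero_add 1) f = 0) : Pretr k C where
  toTuple := coneTuple X.toTuple Y.toTuple
  q := coneQ X Y f
  triangular := by
    rintro (i | i) (j | j) p h
    · exact Y.triangular i j _ (Sum.Lex.inl_le_inl_iff.1 h)
    · exact absurd h Sum.Lex.not_inr_le_inl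
    · rfl
    · exact neg_eq_zero.2 (X.triangular i j _ (Sum.Lex.inr_le_inr_iff.1 h))
  maurerCartan := coneQ_maurerCartan f hf

/-- The natural morphism `Y → Cone f`. -/
def coneIn {X Y : Pretr k C} (f : Hom k X Y 0) (hf : d (zero_add 1) f = 0) :
    Hom k Y (cone f hf) 0 :=
  show Mat k Y.toTuple (coneTuple X.toTuple Y.toTuple) 0 from fun i j p => match i, p with
  | .inl i, p => matId Y.toTuple i j ⟨p.1, p.2⟩
  | .inr _, _ => 0

/-- The natural morphism `Cone f → X[1]`. -/
def coneOut {X Y : Pretr k C} (f : Hom k X Y 0) (hf : d (zero_add 1) f = 0) :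
    Hom k (cone f hf) X.shift 0 :=
  show Mat k (coneTuple X.toTuple Y.toTuple) X.toTuple.shift 0 from fun i j p => match j, p with
  | .inl _, _ => 0
  | .inr j, p => matId X.toTuple.shift i j ⟨p.1, p.2⟩

theorem d_coneIn {X Y : Pretr k C} (f : Hom k X Y 0) (hf : d (zero_add 1) f = 0) :
    d (zero_add 1) (coneIn f hf) = 0 := by
  refine diff_eq_zero (X := Y) (Y := cone f hf) _ ?_
  intro i j n a ha b c b' c' hbc hbc'
  have e := Fintype.sum_sum_type (fun s : (cone f hf).ι =>
    comp (hbc s) ((cone f hf).q i s (b s)) (coneIn f hf s j (c s)))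
  refine (congrArg (fun x => _ + x - _) e).trans ?_
  rcases i with i | i
  · refine Eq.trans ?_ (diff_apply_apply (X := Y) (Y := Y) (matId Y.toTuple) i j (n := n)
      ⟨a.1, a.2⟩ ha (fun s => ⟨(b (.inl s)).1, (b (.inl s)).2⟩)
      (fun s => ⟨(c (.inl s)).1, (c (.inl s)).2⟩) (fun s => ⟨(b' s).1, (b' s).2⟩) c'
      (fun s => hbc (.inl s)) hbc' (d_id Y rfl))
    refine congrArg₂ (· - ·) (congrArg₂ (· + ·) rfl
      ((congrArg₂ (· + ·) rfl ?_).trans (add_zero _))) rfl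
    exact Finset.sum_eq_zero fun s _ => map_zero _
  · have h₁ : ∀ s, comp (hbc (.inl s)) ((cone f hf).q (.inr i) (.inl s) (b (.inl s)))
      (coneIn f hf (.inl s) j (c (.inl s))) = 0 := fun s => LinearMap.map_zero₂ _ _
    have h₂ : ∀ s, comp (hbc (.inr s)) ((cone f hf).q (.inr i) (.inr s) (b (.inr s)))
      (coneIn f hf (.inr s) j (c (.inr s))) = 0 := fun s => map_zero _
    have h₃ : ∀ s, comp (hbc' s) (coneIn f hf (.inr i) s (b' s)) (Y.q s j (c' s)) = 0 :=
      fun s => LinearMap.map_zero₂ _ _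
    have h₄ : d ha (coneIn f hf (.inr i) j a) = 0 := map_zero _
    rw [Finset.sum_eq_zero fun s _ => h₁ s, Finset.sum_eq_zero fun s _ => h₂ s,
      Finset.sum_eq_zero fun s _ => h₃ s, h₄]
    simp

theorem d_coneOut {X Y : Pretr k C} (f : Hom k X Y 0) (hf : d (zero_add 1) f = 0) :
    d (zero_add 1) (coneOut f hf) = 0 := by
  refine diff_eq_zero (X := cone f hf) (Y := X.shift) _ ?_
  intro i j n a ha b c b' c' hbc hbc'
  have e := Fintype.sum_sum_type (fun s : (cone f hf).ι =>
    comp (hbc' s) (coneOut f hf i s (b' s)) ((cone f hf).q s j (c' s)))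
  refine (congrArg (fun x => _ + _ - x) e).trans ?_
  rcases j with j | j
  · have h₁ : ∀ s, comp (hbc' (.inl s)) (coneOut f hf i (.inl s) (b' (.inl s)))
      ((cone f hf).q (.inl s) (.inl j) (c' (.inl s))) = 0 := fun s => LinearMap.map_zero₂ _ _
    have h₂ : ∀ s, comp (hbc' (.inr s)) (coneOut f hf i (.inr s) (b' (.inr s)))
      ((cone f hf).q (.inr s) (.inl j) (c' (.inr s))) = 0 := fun s => map_zero _
    have h₃ : ∀ s, comp (hbc s) (X.shift.q i s (b s)) (coneOut f hf s (.inl j) (c s)) = 0 :=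
      fun s => map_zero _
    have h₄ : d ha (coneOut f hf i (.inl j) a) = 0 := map_zero _
    rw [Finset.sum_eq_zero fun s _ => h₁ s, Finset.sum_eq_zero fun s _ => h₂ s,
      Finset.sum_eq_zero fun s _ => h₃ s, h₄]
    simp
  · refine Eq.trans ?_ (diff_apply_apply (X := X.shift) (Y := X.shift) (matId X.toTuple.shift) i j
      (n := n) ⟨a.1, a.2⟩ ha b (fun s => ⟨(c s).1, (c s).2⟩)
      (fun s => ⟨(b' (.inr s)).1, (b' (.inr s)).2⟩)
      (fun s => ⟨(c' (.inr s)).1, (c' (.inr s)).2⟩) hbc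
      (fun s => hbc' (.inr s)) (d_id X.shift rfl))
    refine congrArg₂ (· - ·) rfl ((congrArg₂ (· + ·) ?_ rfl).trans (zero_add _))
    exact Finset.sum_eq_zero fun s _ => LinearMap.map_zero₂ _ _

end Pretr

end pretr

/-! ### Homotopy categories -/

section ho

variable (k : Type w) [CommRing k] (C : Type u) [DGCategory.{v} k C]

/-- The category with the same objects as `C` and the closed morphisms of degree `0`. -/
structure Z0 (k : Type w) (C : Type u) where
  /-- The underlying object of `C`. -/
  obj : C

variable {k C} in
/-- Closed morphisms of degree `0`. -/
abbrev closed (X Y : C) : Submodule k (Hom k X Y 0) := LinearMap.ker (d (zero_add 1))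

variable {k C} in
theorem closed.comp_mem {X Y Z : C} (g : closed (k := k) Y Z) (f : closed (k := k) X Y) :
    comp (zero_add 0) g.1 f.1 ∈ closed (k := k) X Z := by
  have hf := LinearMap.mem_ker.1 f.2
  have hg := LinearMap.mem_ker.1 g.2
  rw [LinearMap.mem_ker, DGCategory.d_comp (s := 1) (zero_add 0) (zero_add 1) (zero_add 1)
    (zero_add 1) (by omega) (by omega), hf, hg]
  simp

instance : Category.{v} (Z0 k C) where
  Hom X Y := closed (k := k) X.obj Y.obj
  id X := ⟨idd k X.obj, d_id _ _⟩
  comp f g := ⟨comp (zero_add 0) g.1 f.1, closed.comp_mem g f⟩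
  id_comp _ := Subtype.ext (DGCategory.comp_id _ _)
  comp_id _ := Subtype.ext (DGCategory.id_comp _ _)
  assoc _ _ _ := Subtype.ext (DGCategory.assoc _ _ _ _ _ _ _).symm

instance : Preadditive (Z0 k C) where
  homGroup X Y := inferInstanceAs (AddCommGroup (closed (k := k) X.obj Y.obj))
  add_comp _ _ _ f f' g := Subtype.ext (map_add (comp (zero_add 0) g.1) f.1 f'.1)
  comp_add _ _ _ f g g' := Subtype.ext (LinearMap.map_add₂ (comp (zero_add 0)) g.1 g'.1 f.1)

/-- Two closed morphisms of degree `0` are homotopic if they differ by a coboundary. -/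
def homotopic : HomRel (Z0 k C) := fun X Y f g =>
  ∃ h : Hom k X.obj Y.obj (-1), d (neg_add_cancel 1) h = f.1 - g.1

instance : Congruence (homotopic k C) where
  comp_left := by
    rintro X Y Z f g g' ⟨h, hh⟩
    refine ⟨comp (add_zero (-1)) h f.1, ?_⟩
    rw [DGCategory.d_comp (p' := 1) (add_zero (-1)) (neg_add_cancel 1) (neg_add_cancel 1)
      (zero_add 1) (by omega) (by omega), hh, LinearMap.mem_ker.1 f.2, map_zero, smul_zero,
      add_zero]
    exact LinearMap.map_sub₂ _ _ _ _
  comp_right := by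
    rintro X Y Z f f' g ⟨h, hh⟩
    refine ⟨comp (zero_add (-1)) g.1 h, ?_⟩
    rw [DGCategory.d_comp (q' := 1) (zero_add (-1)) (neg_add_cancel 1) (zero_add 1)
      (neg_add_cancel 1) (by omega) (by omega), hh, LinearMap.mem_ker.1 g.2, map_zero,
      LinearMap.zero_apply, zero_add, sgn_zero, one_smul]
    exact map_sub _ _ _
  equivalence :=
    { refl := fun f => ⟨0, by simp⟩
      symm := by
        rintro f g ⟨h, hh⟩
        exact ⟨-h, by rw [map_neg, hh, neg_sub]⟩
      trans := by
        rintro f g l ⟨h, hh⟩ ⟨h', hh'⟩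
        exact ⟨h + h', by rw [map_add, hh, hh', sub_add_sub_cancel]⟩ }

/-- The homotopy category: objects of `C`, and the degree `0` cohomology of the complexes of
morphisms. -/
abbrev Ho := CategoryTheory.Quotient (homotopic k C)

instance : Preadditive (Ho k C) :=
  CategoryTheory.Quotient.preadditive _ (by
    rintro X Y f₁ f₂ g₁ g₂ ⟨h, hh⟩ ⟨h', hh'⟩
    exact ⟨h + h', by rw [map_add, hh, hh']; exact (add_sub_add_comm _ _ _ _).symm⟩)

variable {k C}
variable {D : Type u'} [DGCategory.{v'} k D]

/-- The functor on closed morphisms of degree `0` induced by a DG functor. -/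
def DGFunctor.z0 (F : DGFunctor k C D) : Z0 k C ⥤ Z0 k D where
  obj X := ⟨F.obj X.obj⟩
  map f := ⟨F.map f.1, by
    rw [LinearMap.mem_ker, ← F.map_d, LinearMap.mem_ker.1 f.2, map_zero]⟩
  map_id X := Subtype.ext (F.map_id X.obj)
  map_comp f g := Subtype.ext (F.map_comp (zero_add 0) g.1 f.1)

/-- The functor between homotopy categories induced by a DG functor. -/
def DGFunctor.ho (F : DGFunctor k C D) : Ho k C ⥤ Ho k D :=
  CategoryTheory.Quotient.lift _ (F.z0 ⋙ CategoryTheory.Quotient.functor _) (by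
    rintro X Y f g ⟨h, hh⟩
    refine CategoryTheory.Quotient.sound _ ⟨F.map h, ?_⟩
    refine (F.map_d (neg_add_cancel 1) h).symm.trans ?_
    rw [hh]
    exact map_sub _ _ _)

/-- A complex of morphisms is acyclic: each cocycle is a coboundary. -/
def AcyclicHom (k : Type w) [CommRing k] {C : Type u} [DGCategory.{v} k C] (X Y : C) : Prop :=
  ∀ (m n l : ℤ) (h : m + 1 = n) (h' : n + 1 = l) (f : Hom k X Y n), d h' f = 0 →
    ∃ g : Hom k X Y m, d h g = f

end ho

/-! ### The triangulated category `C^tr` -/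

section tr

/-- The category `C^tr`: the homotopy category of `C^pretr`. -/
abbrev Tr (k : Type w) [CommRing k] (C : Type u) [DGCategory.{v} k C] := Ho k (Pretr k C)

variable {k : Type w} [CommRing k] {C : Type u} [DGCategory.{v} k C]

/-- The functor `C^tr ⥤ D^tr` induced by a DG functor. -/
abbrev DGFunctor.tr {D : Type u'} [DGCategory.{v'} k D] (F : DGFunctor k C D) :
    Tr k C ⥤ Tr k D := F.pretr.ho

namespace Tr

variable (k C) in
/-- The shift functor `X ↦ X[1]` of `C^tr`. -/
abbrev shift : Tr k C ⥤ Tr k C := (Pretr.shiftFunctor k C).ho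

/-- The class in `C^tr` of a closed morphism of degree `0`. -/
abbrev mk {X Y : Pretr k C} (f : Hom k X Y 0) (hf : d (zero_add 1) f = 0) :
    (⟨⟨X⟩⟩ : Tr k C) ⟶ ⟨⟨Y⟩⟩ :=
  (CategoryTheory.Quotient.functor (homotopic k (Pretr k C))).map (X := ⟨X⟩) (Y := ⟨Y⟩) ⟨f, hf⟩

/-- A triangle `X → Y → Z → X[1]` in `C^tr` is distinguished if it is isomorphic to the triangle
`X' → Y' → Cone f → X'[1]` of a closed morphism `f : X' → Y'` of degree `0` in `C^pretr`. -/
def Distinguished {X Y Z : Tr k C} (u : X ⟶ Y) (v : Y ⟶ Z) (t : Z ⟶ (shift k C).obj X) : Prop :=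
  ∃ (X' Y' : Pretr k C) (f : Hom k X' Y' 0) (hf : d (zero_add 1) f = 0)
    (a : X ≅ ⟨⟨X'⟩⟩) (b : Y ≅ ⟨⟨Y'⟩⟩) (c : Z ≅ ⟨⟨Pretr.cone f hf⟩⟩),
    u ≫ b.hom = a.hom ≫ mk f hf ∧
    v ≫ c.hom = b.hom ≫ mk (Pretr.coneIn f hf) (Pretr.d_coneIn f hf) ∧
    t ≫ (shift k C).map a.hom = c.hom ≫ mk (Pretr.coneOut f hf) (Pretr.d_coneOut f hf)

/-- Strictly full triangulated subcategories of `C^tr`: nonempty classes of objects closed under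
isomorphisms, under the shift in both directions, and under cones. -/
structure IsTriangulatedSubcategory (Q : ObjectProperty (Tr k C)) : Prop where
  nonempty : ∃ X, Q X
  iso : ∀ {X Y : Tr k C}, (X ≅ Y) → Q X → Q Y
  shift_iff : ∀ X, Q ((shift k C).obj X) ↔ Q X
  cone : ∀ {X Y Z : Tr k C} (u : X ⟶ Y) (v : Y ⟶ Z) (t : Z ⟶ (shift k C).obj X),
    Distinguished u v t → Q X → Q Y → Q Z

/-- A strictly full triangulated subcategory `Q` is right-admissible if each object `X` fits into a
distinguished triangle `X' → X → X'' → X'[1]` with `X'` in `Q` and `X''` in `Q^⊥`. -/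
structure RightAdmissible (Q : ObjectProperty (Tr k C)) : Prop where
  triangulated : IsTriangulatedSubcategory Q
  exists_triangle : ∀ X : Tr k C, ∃ (X' X'' : Tr k C) (u : X' ⟶ X) (v : X ⟶ X'')
    (t : X'' ⟶ (shift k C).obj X'), Distinguished u v t ∧ Q X' ∧ Q.rightOrthogonal X''

/-- A strictly full triangulated subcategory `Q` is left-admissible if each object `X` fits into a
distinguished triangle `X' → X → X'' → X'[1]` with `X'` in `^⊥Q` and `X''` in `Q`. -/
structure LeftAdmissible (Q : ObjectProperty (Tr k C)) : Prop where
  triangulated : IsTriangulatedSubcategory Q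
  exists_triangle : ∀ X : Tr k C, ∃ (X' X'' : Tr k C) (u : X' ⟶ X) (v : X ⟶ X'')
    (t : X'' ⟶ (shift k C).obj X'), Distinguished u v t ∧ Q.leftOrthogonal X' ∧ Q X''

/-- The morphisms of `C^tr` whose cone is isomorphic to an object satisfying `Q`. -/
def isoMod (Q : ObjectProperty (Tr k C)) : MorphismProperty (Tr k C) := fun X Y u =>
  ∃ (Z : Tr k C) (v : Y ⟶ Z) (t : Z ⟶ (shift k C).obj X), Distinguished u v t ∧ Q Z

/-- The Verdier quotient `C^tr / Q`: the localization at the morphisms with cone in `Q`. -/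
abbrev VerdierQuotient (Q : ObjectProperty (Tr k C)) := (isoMod Q).Localization

/-- The quotient functor `C^tr ⥤ C^tr / Q`. -/
abbrev verdierQ (Q : ObjectProperty (Tr k C)) : Tr k C ⥤ VerdierQuotient Q := (isoMod Q).Q

end Tr

end tr

/-! ### The situation of a full DG subcategory -/

section subcategory

variable (k : Type w) [CommRing k] {A : Type u} [DGCategory.{u} k A] (P : A → Prop)

/-- The essential image of `B^tr` in `A^tr`, for the full DG subcategory `B` given by `P`. -/
abbrev subTr : ObjectProperty (Tr k A) := (FullSub.incl k P).tr.essImage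

/-- The essential image of the ind-version of `B^tr` in the ind-version of `A^tr`. -/
abbrev subIndTr : ObjectProperty (Tr k (IndCat k A)) :=
  (indFunctor (FullSub.incl k P)).tr.essImage

/-- The essential image of the pro-version of `B^tr` in the pro-version of `A^tr`. -/
abbrev subProTr : ObjectProperty (Tr k (ProCat k A)) :=
  (proFunctor (FullSub.incl k P)).tr.essImage

/-- `B^⊥`: the objects `X` of the ind-version of `A` with `Hom (b, X)` acyclic for all `b` in
`B`. -/
def perp (X : IndCat k A) : Prop := ∀ b : A, P b → AcyclicHom k ((toInd k A).obj b) X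

/-- `^⊥B`: the objects `X` of the pro-version of `A` with `Hom (X, b)` acyclic for all `b` in
`B`. -/
def coperp (X : ProCat k A) : Prop := ∀ b : A, P b → AcyclicHom k X ((toPro k A).obj b)

end subcategory

end DG

/-! The ind half rests on two facts about a fully faithful DG functor `F : B → A`; the rest is
formal.

Resolution (`exists_ext_acyclicHom`). Every semi-free `M` sits in a graded split extension `M → Z →
ind N` with `N` semi-free over `B` and `Z` acyclic on all objects of `B`. Instead of a countable
tower of cell attachments, all cells are made at once. The inductive type `Cell` contains every
formal cell given by an element of `M` and a finite combination of earlier cells, its intended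
boundary. The good cells are those for which these data, at every stage, form a cocycle. They span a
semi-free `B`-module with a map of degree 1 to `M`, which is the class of the extension. Since `F`
is fully faithful, an element of `Z(F b)` is a pair of an element of `M(F b)` and a combination of
good cells. If it is a cocycle, it is itself the datum of a good cell and hence a boundary
(`Cell.exists_good`). Dévissage along the levels of a semi-free basis (`SemiFreeBasis.acyclicHom`)
extends acyclicity from the generators to all induced modules, so `Z` is right orthogonal to them.
This gives the admissibility triangle, and it shows that the orthogonal complement is described by
the acyclicity condition defining `perp`. The maps `M → Z` make the orthogonal objects reflective,
and the reflector is the Verdier localization (`exists_reflector`); hence the equivalence with the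
quotient.

Compactness (`factorsThrough_inducedProp`). A morphism from a finite twisted complex over `A` to an
induced module meets finitely many basis elements. These lie in a finite set stable under the
differential, which spans a finite iterated extension of shifts of representables coming from `B`.
So the morphism factors, up to homotopy, through the image of `B^tr`. Now let `X`, `Y` be in `A^tr`
and let `Y → Z → ind N` be the resolution. Morphisms from `X` to `Y` in the large quotient are maps
`X → Z`. Factoring `X → ind N` through `B^tr` and pulling the extension back gives a fraction `X →
Y' ← Y` with cone in `B^tr`: this is fullness. The same argument applied to a homotopy instead of a
map gives faithfulness. The categorical frame is `exists_fullyFaithful_lift`, together with an Ore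
condition that comes from pushouts of extensions.

Framework. Triangles are replaced by graded split extensions with a class `δ` (`Ext`), in DG
categories that have a zero object, shifts and an extension for each closed class (`SPretr`).
Twisted complexes, semi-free modules and their duals are of this kind. The rotation lemmas show that
a morphism has its cone in `Q` iff up to homotopy equivalence it is the inclusion of an extension
with quotient in `Q`, and iff it is the projection of an extension with subobject in `Q`
(`isoMod_eq_extW`, `isoMod_eq_coextW`). So the axioms of triangulated categories are never needed.

Duality. `Ext` is self-dual: passing to `C°` exchanges inclusions and projections, and right with
left orthogonals. The pro half is therefore the ind half for `A°`. To permit this, the ind arguments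
are made for an arbitrary fully faithful `J : IndCat k A → E`. On one side `E` is the DG category of
twisted complexes of semi-free modules, on the other it is the dual of the twisted complexes of
pro-objects.

Calculus. Identities between homogeneous morphisms are checked on the operators `act f`, which live
in a preadditive category without degrees. There they reduce to `simp` with a normal form that moves
the differential to the left, followed by `abel`. -/

namespace DG

/-! ### Homogeneous morphisms as natural operators on graded morphism groups -/

section graded

variable (k : Type w) [CommRing k] (C : Type u) [DGCategory.{v} k C]

/-- The objects of `C`, regarded as objects of the category of all additive operators between
the graded groups of morphisms. -/
structure Gr (k : Type w) (C : Type u) where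
  obj : C

/-- The total group of morphisms from `W` to `X`. -/
abbrev TotHom {C : Type u} [DGCategory.{v} k C] (W X : C) : Type v := ∀ p : ℤ, Hom k W X p

/-- Naturality in `W` is deliberately not required: by the Leibniz rule the differential does not
commute with precomposition, and it has to be a morphism here. -/
instance : Category (Gr k C) where
  Hom X Y := ∀ W : C, TotHom k W X.obj →+ TotHom k W Y.obj
  id _ _ := AddMonoidHom.id _
  comp f g W := (g W).comp (f W)

theorem Gr.comp_apply {X Y Z : Gr k C} (f : X ⟶ Y) (g : Y ⟶ Z) (W : C) (x : TotHom k W X.obj) :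
    (f ≫ g) W x = g W (f W x) := rfl

instance : Preadditive (Gr k C) where
  homGroup X Y := inferInstanceAs (AddCommGroup (∀ W : C, TotHom k W X.obj →+ TotHom k W Y.obj))
  add_comp _ _ _ f f' g := by
    funext W; ext x
    exact congrFun (map_add (g W) _ _) _
  comp_add _ _ _ f g g' := rfl

variable {k C}

theorem comp_congr_deg {W X Y : C} {n p p' q : ℤ} (f : Hom k X Y n) (x : TotHom k W X)
    (e : p = p') (h : n + p = q) (h' : n + p' = q) :
    comp h f (x p) = comp h' f (x p') := by
  subst e; rfl

theorem d_congr_deg {W X : C} {p p' q : ℤ} (x : TotHom k W X)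
    (e : p = p') (h : p + 1 = q) (h' : p' + 1 = q) : d h (x p) = d h' (x p') := by
  subst e; rfl

/-- The operator of composition with a homogeneous morphism. -/
def act {X Y : C} {n : ℤ} (f : Hom k X Y n) : (⟨X⟩ : Gr k C) ⟶ ⟨Y⟩ := fun W =>
  { toFun := fun x p => comp (show n + (p - n) = p by ring) f (x (p - n))
    map_zero' := by funext p; exact map_zero _
    map_add' := fun x y => by funext p; exact map_add _ _ _ }

theorem act_apply {X Y : C} {n : ℤ} (f : Hom k X Y n) (W : C) (x : TotHom k W X) (p q : ℤ)
    (h : n + q = p) : act f W x p = comp h f (x q) :=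
  comp_congr_deg f x (by omega) _ _

variable (k) in
/-- The differential as an operator. -/
def dOp (X : C) : (⟨X⟩ : Gr k C) ⟶ ⟨X⟩ := fun W =>
  { toFun := fun x p => d (sub_add_cancel p 1) (x (p - 1))
    map_zero' := by funext p; exact map_zero _
    map_add' := fun x y => by funext p; exact map_add _ _ _ }

theorem dOp_apply (X : C) (W : C) (x : TotHom k W X) (p q : ℤ)
    (h : q + 1 = p) : dOp k X W x p = d h (x q) :=
  d_congr_deg x (by omega) _ _

/-- `f` is recovered by letting the operator act on the identity of `X`, placed in degree `0`. -/
theorem act_injective {X Y : C} {n : ℤ} {f g : Hom k X Y n} (h : act f = act g) : f = g := by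
  classical
  have h1 := congrFun (congrArg (fun F : (⟨X⟩ : Gr k C) ⟶ ⟨Y⟩ => F X (Pi.single 0 (idd k X))) h) n
  dsimp only at h1
  rw [act_apply f X _ n 0 (add_zero n), act_apply g X _ n 0 (add_zero n)] at h1
  simpa [DGCategory.comp_id] using h1

theorem act_inj {X Y : C} {n : ℤ} {f g : Hom k X Y n} : act f = act g ↔ f = g :=
  ⟨act_injective, fun h => h ▸ rfl⟩

theorem act_comp {X Y Z : C} {q p r : ℤ} (h : q + p = r) (g : Hom k Y Z q) (f : Hom k X Y p) :
    act (comp h g f) = act f ≫ act g := by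
  funext W; ext x n
  rw [Gr.comp_apply, act_apply _ W x n (n - r) (by ring), act_apply g W _ n (n - q) (by ring),
    act_apply f W x (n - q) (n - r) (by omega)]
  exact DGCategory.assoc _ _ _ _ _ _ _

theorem act_zero {X Y : C} {n : ℤ} : act (0 : Hom k X Y n) = 0 := by
  funext W; ext x p
  exact LinearMap.map_zero₂ _ _

theorem act_add {X Y : C} {n : ℤ} (f g : Hom k X Y n) : act (f + g) = act f + act g := by
  funext W; ext x p
  exact LinearMap.map_add₂ _ _ _ _

theorem act_neg {X Y : C} {n : ℤ} (f : Hom k X Y n) : act (-f) = -act f := by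
  funext W; ext x p
  exact LinearMap.map_neg₂ _ _ _

theorem act_sub {X Y : C} {n : ℤ} (f g : Hom k X Y n) : act (f - g) = act f - act g := by
  rw [sub_eq_add_neg, act_add, act_neg, sub_eq_add_neg]

theorem act_idAt (X : C) {n : ℤ} (h : n = 0) : act (idAt (k := k) X h) = 𝟙 _ := by
  funext W; ext x p
  rw [act_apply _ W x p p (by omega), idAt_comp]
  rfl

theorem act_idd (X : C) : act (idd k X) = 𝟙 _ := act_idAt X rfl

theorem sgn_smul_eq {M : Type*} [AddCommGroup M] [Module k M] (n : ℤ) (x : M) :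
    sgn k n • x = n.negOnePow • x := by
  rw [sgn, Units.smul_def, Int.cast_smul_eq_zsmul]

theorem act_negOnePow_smul {X Y : C} {n m : ℤ} (f : Hom k X Y n) :
    act (m.negOnePow • f) = m.negOnePow • act f := by
  rcases Int.even_or_odd m with h | h
  · simp [Int.negOnePow_even _ h]
  · simp [Int.negOnePow_odd _ h, act_neg]

/-- The Leibniz rule: `d f` acts as the graded commutator of `f` with the differential. The sign is
an integral unit because the operators form only an additive group. -/
theorem act_d {X Y : C} {m n : ℤ} (h : m + 1 = n) (f : Hom k X Y m) :
    act (d h f) = act f ≫ dOp k Y - m.negOnePow • (dOp k X ≫ act f) := by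
  funext W; ext x p
  have e : ∀ (a b : (⟨X⟩ : Gr k C) ⟶ ⟨Y⟩), (a - m.negOnePow • b) W x p =
      a W x p - m.negOnePow • b W x p := by
    intro a b
    rcases Int.even_or_odd m with h | h
    · simp only [Int.negOnePow_even _ h, one_smul]; rfl
    · simp only [Int.negOnePow_odd _ h, Units.neg_smul, one_smul]; rfl
  rw [e, Gr.comp_apply, Gr.comp_apply, dOp_apply Y W _ p (p - 1) (by ring),
    act_apply f W x (p - 1) (p - n) (by omega), act_apply f W _ p (p - m) (by ring),
    act_apply _ W x p (p - n) (by omega), dOp_apply X W x (p - m) (p - n) (by omega),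
    DGCategory.d_comp (q' := n) (p' := p - m) _ _ h (by omega) (by omega) (by omega),
    sgn_smul_eq, add_sub_cancel_right]

theorem dOp_dOp (X : C) : dOp k X ≫ dOp k X = 0 := by
  funext W; ext x p
  rw [Gr.comp_apply, dOp_apply X W _ p (p - 1) (by ring),
    dOp_apply X W x (p - 1) (p - 2) (by ring), DGCategory.d_d]
  rfl

theorem dOp_dOp_assoc (X : C) {V : Gr k C} (g : (⟨X⟩ : Gr k C) ⟶ V) :
    dOp k X ≫ dOp k X ≫ g = 0 := by
  rw [← Category.assoc, dOp_dOp, Limits.zero_comp]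

theorem act_d_zero {X Y : C} {n : ℤ} (h : 0 + 1 = n) (f : Hom k X Y 0) :
    act (d h f) = act f ≫ dOp k Y - dOp k X ≫ act f := by
  rw [act_d]; simp

theorem act_d_neg_one {X Y : C} {n : ℤ} (h : -1 + 1 = n) (f : Hom k X Y (-1)) :
    act (d h f) = act f ≫ dOp k Y + dOp k X ≫ act f := by
  rw [act_d]; simp

theorem closed_iff {X Y : C} {m n : ℤ} (h : m + 1 = n) (f : Hom k X Y m) :
    d h f = 0 ↔ act f ≫ dOp k Y = m.negOnePow • (dOp k X ≫ act f) := by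
  rw [← act_inj, act_d, act_zero, sub_eq_zero]

theorem closed_zero_iff {X Y : C} {n : ℤ} (h : 0 + 1 = n) (f : Hom k X Y 0) :
    d h f = 0 ↔ act f ≫ dOp k Y = dOp k X ≫ act f := by
  rw [closed_iff]; simp

theorem closed_one_iff {X Y : C} {n : ℤ} (h : 1 + 1 = n) (f : Hom k X Y 1) :
    d h f = 0 ↔ act f ≫ dOp k Y = -(dOp k X ≫ act f) := by
  rw [closed_iff]; simp

end graded

/-! ### Graded split extensions and shifts in a DG category -/

section ext

variable (k : Type w) [CommRing k] {C : Type u} [DGCategory.{v} k C]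

/-- A graded split extension `Y → Z → X` with its splitting `r`, `s` and its class `δ`. -/
structure Ext (Y Z X : C) where
  i : Hom k Y Z 0
  π : Hom k Z X 0
  r : Hom k Z Y 0
  s : Hom k X Z 0
  δ : Hom k X Y 1
  d_i : d (zero_add 1) i = 0
  d_π : d (zero_add 1) π = 0
  d_s : d (zero_add 1) s = comp (zero_add 1) i δ
  d_r : d (zero_add 1) r = -comp (add_zero 1) δ π
  i_r : comp (zero_add 0) r i = idd k Y
  s_π : comp (zero_add 0) π s = idd k X
  i_π : comp (zero_add 0) π i = 0
  s_r : comp (zero_add 0) r s = 0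
  sum : comp (zero_add 0) i r + comp (zero_add 0) s π = idd k Z

/-- A closed invertible morphism of degree `n`, whose inverse has degree `m = -n`. -/
structure HIso (n m : ℤ) (X S : C) where
  a : Hom k X S n
  b : Hom k S X m
  h : n + m = 0
  d_a : ∀ {l : ℤ} (h : n + 1 = l), d h a = 0
  d_b : ∀ {l : ℤ} (h : m + 1 = l), d h b = 0
  a_b : comp (show m + n = 0 by omega) b a = idd k X
  b_a : comp h a b = idd k S

end ext
end DG

namespace DG

section ext

variable {k : Type w} [CommRing k] {C : Type u} [DGCategory.{v} k C]

namespace Ext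

variable {X Y Z : C} (e : Ext k Y Z X)

@[simp] theorem act_i_r : act e.i ≫ act e.r = 𝟙 _ := by
  rw [← act_comp (zero_add 0), e.i_r, act_idd]
@[simp] theorem act_s_π : act e.s ≫ act e.π = 𝟙 _ := by
  rw [← act_comp (zero_add 0), e.s_π, act_idd]
@[simp] theorem act_i_π : act e.i ≫ act e.π = 0 := by
  rw [← act_comp (zero_add 0), e.i_π, act_zero]
@[simp] theorem act_s_r : act e.s ≫ act e.r = 0 := by
  rw [← act_comp (zero_add 0), e.s_r, act_zero]
-- The orientation of this and the following rules fixes the normal form: `act r ≫ act i` is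
-- eliminated, and the differential is moved to the left of the structure maps.
@[simp] theorem act_r_i : act e.r ≫ act e.i = 𝟙 _ - act e.π ≫ act e.s := by
  rw [eq_sub_iff_add_eq, ← act_comp (zero_add 0), ← act_comp (zero_add 0), ← act_add, e.sum, act_idd]
@[simp] theorem act_i_d : act e.i ≫ dOp k Z = dOp k Y ≫ act e.i :=
  (closed_zero_iff _ _).1 e.d_i
@[simp] theorem act_π_d : act e.π ≫ dOp k X = dOp k Z ≫ act e.π :=
  (closed_zero_iff _ _).1 e.d_π
@[simp] theorem act_s_d : act e.s ≫ dOp k Z = dOp k X ≫ act e.s + act e.δ ≫ act e.i := by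
  rw [← sub_eq_iff_eq_add', ← act_d_zero (zero_add 1), e.d_s, act_comp]
@[simp] theorem act_r_d : act e.r ≫ dOp k Y = dOp k Z ≫ act e.r - act e.π ≫ act e.δ := by
  have h := act_d_zero (zero_add 1) e.r
  rw [e.d_r, act_neg, act_comp] at h
  rw [sub_eq_add_neg, h]
  abel

section assoc

variable {V : Gr k C}

@[simp] theorem act_i_r_assoc (f : _ ⟶ V) : act e.i ≫ act e.r ≫ f = f := by
  simp [reassoc_of% e.act_i_r]
@[simp] theorem act_s_π_assoc (f : _ ⟶ V) : act e.s ≫ act e.π ≫ f = f := by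
  simp [reassoc_of% e.act_s_π]
@[simp] theorem act_i_π_assoc (f : _ ⟶ V) : act e.i ≫ act e.π ≫ f = 0 := by
  simp [reassoc_of% e.act_i_π]
@[simp] theorem act_s_r_assoc (f : _ ⟶ V) : act e.s ≫ act e.r ≫ f = 0 := by
  simp [reassoc_of% e.act_s_r]
@[simp] theorem act_r_i_assoc (f : _ ⟶ V) :
    act e.r ≫ act e.i ≫ f = f - act e.π ≫ act e.s ≫ f := by
  rw [← Category.assoc, act_r_i, Preadditive.sub_comp, Category.id_comp, Category.assoc]
@[simp] theorem act_i_d_assoc (f : _ ⟶ V) :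
    act e.i ≫ dOp k Z ≫ f = dOp k Y ≫ act e.i ≫ f := by
  rw [← Category.assoc, act_i_d, Category.assoc]
@[simp] theorem act_π_d_assoc (f : _ ⟶ V) :
    act e.π ≫ dOp k X ≫ f = dOp k Z ≫ act e.π ≫ f := by
  rw [← Category.assoc, act_π_d, Category.assoc]
@[simp] theorem act_s_d_assoc (f : _ ⟶ V) :
    act e.s ≫ dOp k Z ≫ f = dOp k X ≫ act e.s ≫ f + act e.δ ≫ act e.i ≫ f := by
  rw [← Category.assoc, act_s_d, Preadditive.add_comp, Category.assoc, Category.assoc]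
@[simp] theorem act_r_d_assoc (f : _ ⟶ V) :
    act e.r ≫ dOp k Y ≫ f = dOp k Z ≫ act e.r ≫ f - act e.π ≫ act e.δ ≫ f := by
  rw [← Category.assoc, act_r_d, Preadditive.sub_comp, Category.assoc, Category.assoc]

end assoc

-- Closedness of the class is no axiom: it follows from `d² = 0` applied to `d s = i δ`, after
-- projecting by `r`.
@[simp] theorem act_δ_d : act e.δ ≫ dOp k Y = -(dOp k X ≫ act e.δ) := by
  have h := congrArg (· ≫ dOp k Z ≫ act e.r) e.act_s_d
  simp only [Category.assoc, Preadditive.add_comp, dOp_dOp_assoc, Limits.comp_zero, e.act_s_d_assoc,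
    e.act_i_d_assoc, Preadditive.comp_add, act_i_r, Category.comp_id, zero_add] at h
  exact eq_neg_of_add_eq_zero_right h.symm

@[simp] theorem act_δ_d_assoc {V : Gr k C} (f : _ ⟶ V) :
    act e.δ ≫ dOp k Y ≫ f = -(dOp k X ≫ act e.δ ≫ f) := by
  rw [← Category.assoc, act_δ_d, Preadditive.neg_comp, Category.assoc]

theorem d_δ {l : ℤ} (h : 1 + 1 = l) : d h e.δ = 0 := (closed_one_iff _ _).2 e.act_δ_d

/-- A biproduct decomposition of graded objects with closed inclusion and projection is a graded
split extension. -/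
def ofSplit (i : Hom k Y Z 0) (π : Hom k Z X 0) (r : Hom k Z Y 0) (s : Hom k X Z 0)
    (d_i : d (zero_add 1) i = 0) (d_π : d (zero_add 1) π = 0)
    (i_r : comp (zero_add 0) r i = idd k Y) (s_π : comp (zero_add 0) π s = idd k X)
    (i_π : comp (zero_add 0) π i = 0) (s_r : comp (zero_add 0) r s = 0)
    (sum : comp (zero_add 0) i r + comp (zero_add 0) s π = idd k Z) : Ext k Y Z X where
  i := i
  π := π
  r := r
  s := s
  δ := comp (zero_add 1) r (d (zero_add 1) s)
  d_i := d_i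
  d_π := d_π
  i_r := i_r
  s_π := s_π
  i_π := i_π
  s_r := s_r
  sum := sum
  -- As `π` is closed and `π s = 1`, the composite `π (d s)` vanishes; hence `d s = i r (d s)`.
  d_s := by
    rw [closed_zero_iff] at d_i d_π
    simp only [← act_inj, act_comp, act_d_zero, act_add, act_idd, act_zero, Preadditive.sub_comp,
      Category.assoc] at *
    have h : act r ≫ act i = 𝟙 _ - act π ≫ act s := eq_sub_of_add_eq sum
    simp [h, reassoc_of% s_π, ← reassoc_of% d_π]
  -- Similarly `(d r) i = 0`, so `d r = (d r) s π`, and `(d r) s = -r (d s)` because `r s = 0`.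
  d_r := by
    rw [closed_zero_iff] at d_i d_π
    simp only [← act_inj, act_comp, act_d_zero, act_add, act_idd, act_zero, Preadditive.sub_comp,
      act_neg, Category.assoc] at *
    have h : act π ≫ act s = 𝟙 _ - act r ≫ act i := eq_sub_of_add_eq' sum
    have h' : act π ≫ dOp k X ≫ act s ≫ act r = 0 := by rw [s_r]; simp
    simp [reassoc_of% h, s_r, i_r, reassoc_of% d_i]

/-- The image of a graded split extension under a DG functor. -/
def map {D : Type u'} [DGCategory.{v'} k D] (F : DGFunctor k C D) :
    Ext k (F.obj Y) (F.obj Z) (F.obj X) where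
  i := F.map e.i
  π := F.map e.π
  r := F.map e.r
  s := F.map e.s
  δ := F.map e.δ
  d_i := by rw [← F.map_d, e.d_i, map_zero]
  d_π := by rw [← F.map_d, e.d_π, map_zero]
  d_s := by rw [← F.map_d, e.d_s, F.map_comp]
  d_r := by rw [← F.map_d, e.d_r, map_neg, F.map_comp]
  i_r := by rw [← F.map_comp, e.i_r, F.map_id]
  s_π := by rw [← F.map_comp, e.s_π, F.map_id]
  i_π := by rw [← F.map_comp, e.i_π, map_zero]
  s_r := by rw [← F.map_comp, e.s_r, map_zero]
  sum := by rw [← F.map_comp, ← F.map_comp, ← map_add, e.sum, F.map_id]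

theorem op_comp {X Y Z : DGOp C} {q p r : ℤ} (h : q + p = r) (g : Hom k Y Z q) (f : Hom k X Y p) :
    comp h g f = sgn k (q * p) • (DGCategory.comp (k := k) (C := C) ((add_comm p q).trans h) f g :
      Hom k Z.unop X.unop r) := rfl

theorem op_comp_zero_left {X Y Z : DGOp C} {p r : ℤ} (h : 0 + p = r) (g : Hom k Y Z 0)
    (f : Hom k X Y p) : comp h g f = (DGCategory.comp (k := k) (C := C) ((add_comm p 0).trans h) f g :
      Hom k Z.unop X.unop r) := by
  rw [op_comp, zero_mul, sgn_zero, one_smul]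

theorem op_comp_zero_right {X Y Z : DGOp C} {q r : ℤ} (h : q + 0 = r) (g : Hom k Y Z q)
    (f : Hom k X Y 0) : comp h g f = (DGCategory.comp (k := k) (C := C) ((add_comm 0 q).trans h) f g :
      Hom k Z.unop X.unop r) := by
  rw [op_comp, mul_zero, sgn_zero, one_smul]

/-- The dual of a graded split extension. -/
def op : Ext k (⟨X⟩ : DGOp C) ⟨Z⟩ ⟨Y⟩ where
  i := e.π
  π := e.i
  r := e.s
  s := e.r
  -- Dualizing turns `d r = -δ π` into the equation for `d s`; this is the origin of the sign.
  δ := show Hom k X Y 1 from -e.δ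
  d_i := e.d_π
  d_π := e.d_i
  d_s := by
    rw [op_comp_zero_left]
    refine (show _ = _ from e.d_r).trans ?_
    exact (LinearMap.map_neg₂ _ _ _).symm
  d_r := by
    rw [op_comp_zero_right]
    refine (show _ = _ from e.d_s).trans ?_
    refine (neg_eq_iff_eq_neg.2 ?_).symm
    exact map_neg _ _
  i_r := by rw [op_comp_zero_left]; exact e.s_π
  s_π := by rw [op_comp_zero_left]; exact e.i_r
  i_π := by rw [op_comp_zero_left]; exact e.i_π
  s_r := by rw [op_comp_zero_left]; exact e.s_r
  sum := by rw [op_comp_zero_left, op_comp_zero_left, add_comm]; exact e.sum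

/-- The converse of `Ext.op`. -/
def unop {X Y Z : DGOp C} (e : Ext k Y Z X) : Ext k X.unop Z.unop Y.unop where
  i := e.π
  π := e.i
  r := e.s
  s := e.r
  δ := show Hom k Y.unop X.unop 1 from -e.δ
  d_i := e.d_π
  d_π := e.d_i
  d_s := by
    refine (show _ = _ from e.d_r).trans ?_
    rw [op_comp_zero_right]
    exact (map_neg _ _).symm
  d_r := by
    refine (show _ = _ from e.d_s).trans ?_
    rw [op_comp_zero_left]
    refine (neg_eq_iff_eq_neg.2 ?_).symm
    exact LinearMap.map_neg₂ _ _ _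
  i_r := (op_comp_zero_left _ _ _).symm.trans e.s_π
  s_π := (op_comp_zero_left _ _ _).symm.trans e.i_r
  i_π := (op_comp_zero_left _ _ _).symm.trans e.i_π
  s_r := (op_comp_zero_left _ _ _).symm.trans e.s_r
  sum := by
    have h := e.sum
    rw [op_comp_zero_left, op_comp_zero_left, add_comm] at h
    exact h

end Ext

namespace HIso

variable {n m : ℤ} {X S : C} (e : HIso k n m X S)

@[simp] theorem act_a_b : act e.a ≫ act e.b = 𝟙 _ := by
  rw [← act_comp (show m + n = 0 by have := e.h; omega), e.a_b, act_idd]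
@[simp] theorem act_b_a : act e.b ≫ act e.a = 𝟙 _ := by
  rw [← act_comp e.h, e.b_a, act_idd]
@[simp] theorem act_a_b_assoc {V : Gr k C} (f : _ ⟶ V) : act e.a ≫ act e.b ≫ f = f := by
  simp [reassoc_of% e.act_a_b]
@[simp] theorem act_b_a_assoc {V : Gr k C} (f : _ ⟶ V) : act e.b ≫ act e.a ≫ f = f := by
  simp [reassoc_of% e.act_b_a]
theorem act_a_d : act e.a ≫ dOp k S = n.negOnePow • (dOp k X ≫ act e.a) :=
  (closed_iff rfl _).1 (e.d_a _)
theorem act_b_d : act e.b ≫ dOp k X = m.negOnePow • (dOp k S ≫ act e.b) :=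
  (closed_iff rfl _).1 (e.d_b _)

/-- The inverse. -/
def symm : HIso k m n S X where
  a := e.b
  b := e.a
  h := by have := e.h; omega
  d_a := e.d_b
  d_b := e.d_a
  a_b := e.b_a
  b_a := e.a_b

theorem d_comp_closed {X Y Z : C} {q p r l : ℤ} (h : q + p = r) (g : Hom k Y Z q) (f : Hom k X Y p)
    (hg : d rfl g = 0) (hf : d rfl f = 0) (hl : r + 1 = l) : d hl (comp h g f) = 0 := by
  rw [DGCategory.d_comp (q' := q + 1) (p' := p + 1) h hl rfl rfl (by omega) (by omega)]
  have h1 : DGCategory.d (k := k) rfl g = 0 := hg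
  have h2 : DGCategory.d (k := k) rfl f = 0 := hf
  rw [h1, h2]
  simp

/-- Composition of closed invertible morphisms. -/
def trans {n' m' n'' m'' : ℤ} {T : C} (e' : HIso k n' m' S T) (h : n' + n = n'') (h' : m + m' = m'') :
    HIso k n'' m'' X T where
  a := comp h e'.a e.a
  b := comp h' e.b e'.b
  h := by have := e.h; have := e'.h; omega
  d_a _ := d_comp_closed _ _ _ (e'.d_a _) (e.d_a _) _
  d_b _ := d_comp_closed _ _ _ (e.d_b _) (e'.d_b _) _
  a_b := by
    rw [← act_inj]; simp [act_comp, act_idd]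
  b_a := by
    rw [← act_inj]; simp [act_comp, act_idd]

/-- The image of a closed invertible morphism under a DG functor. -/
def map {D : Type u'} [DGCategory.{v'} k D] (F : DGFunctor k C D) :
    HIso k n m (F.obj X) (F.obj S) where
  a := F.map e.a
  b := F.map e.b
  h := e.h
  d_a h := by rw [← F.map_d, e.d_a, map_zero]
  d_b h := by rw [← F.map_d, e.d_b, map_zero]
  a_b := by rw [← F.map_comp, e.a_b, F.map_id]
  b_a := by rw [← F.map_comp, e.b_a, F.map_id]

theorem sgn_smul_closed {X Y : C} {p l : ℤ} (h : p + 1 = l) {f : Hom k X Y p} (c : k)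
    (hf : d h f = 0) : d h (c • f) = 0 := by
  rw [map_smul, hf, smul_zero]

/-- The dual of a closed invertible morphism. -/
def op : HIso k n m (⟨S⟩ : DGOp C) ⟨X⟩ where
  a := e.a
  -- The composition of the dual category has the sign `(-1)^{nm}`, which has to be absorbed into
  -- the inverse.
  b := show Hom k S X m from sgn k (n * m) • e.b
  h := e.h
  d_a h := e.d_a h
  d_b h := sgn_smul_closed h _ (e.d_b h)
  a_b := by
    have h0 := e.h
    refine (Ext.op_comp _ _ _).trans ?_
    refine (congrArg (fun x => sgn k (m * n) • x) (map_smul _ (sgn k (n * m)) e.b)).trans ?_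
    rw [smul_smul, mul_comm n m, sgn_mul_self, one_smul]
    exact e.b_a
  b_a := by
    have h0 := e.h
    refine (Ext.op_comp _ _ _).trans ?_
    refine (congrArg (fun x => sgn k (n * m) • x)
      (LinearMap.map_smul₂ _ (sgn k (n * m)) e.b e.a)).trans ?_
    rw [smul_smul, sgn_mul_self, one_smul]
    exact e.a_b

/-- The converse of `HIso.op`. -/
def unop {X S : DGOp C} (e : HIso k n m X S) : HIso k n m S.unop X.unop where
  a := e.a
  b := show Hom k X.unop S.unop m from sgn k (n * m) • e.b
  h := e.h
  d_a h := e.d_a h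
  d_b h := sgn_smul_closed h _ (e.d_b h)
  a_b := by
    refine (LinearMap.map_smul₂ _ (sgn k (n * m)) (e.b : Hom k X.unop S.unop m) e.a).trans ?_
    exact e.b_a
  b_a := by
    refine (map_smul _ (sgn k (n * m)) (e.b : Hom k X.unop S.unop m)).trans ?_
    rw [mul_comm]
    exact e.a_b

end HIso

end ext
end DG

namespace DG

/-! ### Morphisms and isomorphisms in the homotopy category -/

section hoBasics

variable {k : Type w} [CommRing k] {C : Type u} [DGCategory.{v} k C]

/-- The class in the homotopy category of a closed morphism of degree `0`. -/
abbrev hm {X Y : C} (f : Hom k X Y 0) (hf : d (zero_add 1) f = 0) :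
    (⟨⟨X⟩⟩ : Ho k C) ⟶ ⟨⟨Y⟩⟩ :=
  (CategoryTheory.Quotient.functor (homotopic k C)).map (X := ⟨X⟩) (Y := ⟨Y⟩) ⟨f, hf⟩

theorem hm_surjective {X Y : C} (u : (⟨⟨X⟩⟩ : Ho k C) ⟶ ⟨⟨Y⟩⟩) : ∃ f hf, u = hm f hf := by
  let F := CategoryTheory.Quotient.functor (homotopic k C)
  obtain ⟨f, hf⟩ := F.map_surjective (show F.obj ⟨X⟩ ⟶ F.obj ⟨Y⟩ from u)
  exact ⟨f.1, f.2, hf.symm⟩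

theorem hm_eq_iff {X Y : C} {f g : Hom k X Y 0} {hf : d (zero_add 1) f = 0}
    {hg : d (zero_add 1) g = 0} :
    hm f hf = hm g hg ↔ ∃ h : Hom k X Y (-1), d (neg_add_cancel 1) h = f - g :=
  CategoryTheory.Quotient.functor_map_eq_iff (homotopic k C) _ _

theorem hm_eq_of_act {X Y : C} {f g : Hom k X Y 0} {hf : d (zero_add 1) f = 0}
    {hg : d (zero_add 1) g = 0} (h : Hom k X Y (-1))
    (H : act h ≫ dOp k Y + dOp k X ≫ act h = act f - act g) : hm f hf = hm g hg :=
  hm_eq_iff.2 ⟨h, by rw [← act_inj, act_d_neg_one, act_sub, H]⟩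

theorem act_of_hm_eq {X Y : C} {f g : Hom k X Y 0} {hf : d (zero_add 1) f = 0}
    {hg : d (zero_add 1) g = 0} (h : hm f hf = hm g hg) :
    ∃ h : Hom k X Y (-1), act h ≫ dOp k Y = act f - act g - dOp k X ≫ act h := by
  obtain ⟨h, hh⟩ := hm_eq_iff.1 h
  exact ⟨h, by rw [← act_inj, act_d_neg_one, act_sub] at hh; rw [← hh]; abel⟩

theorem closed_comp {X Y Z : C} {g : Hom k Y Z 0} {f : Hom k X Y 0} (hg : d (zero_add 1) g = 0)
    (hf : d (zero_add 1) f = 0) : d (zero_add 1) (comp (zero_add 0) g f) = 0 :=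
  HIso.d_comp_closed _ _ _ hg hf _

theorem hm_comp {X Y Z : C} (f : Hom k X Y 0) (g : Hom k Y Z 0) (hf : d (zero_add 1) f = 0)
    (hg : d (zero_add 1) g = 0) :
    hm f hf ≫ hm g hg = hm (comp (zero_add 0) g f) (closed_comp hg hf) := rfl

theorem hm_id (X : C) : hm (idd k X) (d_id X _) = 𝟙 _ := rfl

theorem hm_zero (X Y : C) : hm (0 : Hom k X Y 0) (map_zero _) = 0 := rfl

/-- The isomorphism in the homotopy category given by a homotopy equivalence. -/
def hoIso {X Y : C} (f : Hom k X Y 0) (hf : d (zero_add 1) f = 0) (g : Hom k Y X 0)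
    (hg : d (zero_add 1) g = 0) (h₁ : hm f hf ≫ hm g hg = 𝟙 _) (h₂ : hm g hg ≫ hm f hf = 𝟙 _) :
    (⟨⟨X⟩⟩ : Ho k C) ≅ ⟨⟨Y⟩⟩ := ⟨hm f hf, hm g hg, h₁, h₂⟩

/-- A closed invertible morphism of degree `0` induces an isomorphism in the homotopy category. -/
def HIso.iso {X S : C} (e : HIso k 0 0 X S) : (⟨⟨X⟩⟩ : Ho k C) ≅ ⟨⟨S⟩⟩ :=
  hoIso e.a (e.d_a _) e.b (e.d_b _) ((hm_comp _ _ _ _).trans (by simp only [e.a_b]; rfl))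
    ((hm_comp _ _ _ _).trans (by simp only [e.b_a]; rfl))

theorem isZero_of_idd {X : C} (h : idd k X = 0) : Limits.IsZero (⟨⟨X⟩⟩ : Ho k C) := by
  rw [Limits.IsZero.iff_id_eq_zero, ← hm_id]
  simp only [h]
  rfl

/-- Identities of morphisms up to homotopy. -/
theorem hm_comp_eq_id_of_act {X Y : C} {f : Hom k X Y 0} {g : Hom k Y X 0}
    {hf : d (zero_add 1) f = 0} {hg : d (zero_add 1) g = 0} (h : Hom k X X (-1))
    (H : act h ≫ dOp k X + dOp k X ≫ act h = act f ≫ act g - 𝟙 _) : hm f hf ≫ hm g hg = 𝟙 _ := by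
  rw [hm_comp, ← hm_id]
  exact hm_eq_of_act h (by rw [H, act_comp, act_idd])

theorem hm_comp_eq_id_of_act_eq {X Y : C} {f : Hom k X Y 0} {g : Hom k Y X 0}
    {hf : d (zero_add 1) f = 0} {hg : d (zero_add 1) g = 0}
    (H : act f ≫ act g = 𝟙 _) : hm f hf ≫ hm g hg = 𝟙 _ :=
  hm_comp_eq_id_of_act 0 (by simp [H, act_zero])

variable (k C) in
/-- A DG category with a zero object, shifts, and an extension for each class. -/
structure SPretr : Prop where
  zero : ∃ X : C, idd k X = 0
  shift : ∀ (X : C) (n m : ℤ), n + m = 0 → ∃ S : C, Nonempty (HIso k n m X S)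
  ext : ∀ (X Y : C) (δ : Hom k X Y 1), d one_add_one_eq_two δ = 0 →
    ∃ (Z : C) (e : Ext k Y Z X), e.δ = δ

theorem SPretr.op (h : SPretr k C) : SPretr k (DGOp C) where
  zero := by
    obtain ⟨X, hX⟩ := h.zero
    exact ⟨⟨X⟩, hX⟩
  shift X n m hnm := by
    obtain ⟨S, ⟨e⟩⟩ := h.shift X.unop m n (by omega)
    exact ⟨⟨S⟩, ⟨e.symm.op⟩⟩
  ext X Y δ hδ := by
    -- Dualizing an extension negates its class.
    obtain ⟨Z, e, he⟩ := h.ext Y.unop X.unop (-δ)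
      ((map_neg _ _).trans (neg_eq_zero.2 hδ))
    refine ⟨⟨Z⟩, e.op, ?_⟩
    change -e.δ = δ
    rw [he, neg_neg]

/-! ### Rotation of extensions -/

section rotation

/-- If `Y → K → X₁` has the class `f σ`, where `σ : X₁ → X` has degree `1`, then `f : X → Y` is
isomorphic to the inclusion of an extension of `K` by `X`. -/
theorem exists_iso_inclusion {X Y K X₁ Z : C} (σ : HIso k 1 (-1) X₁ X) (e : Ext k Y K X₁)
    (f : Hom k X Y 0) (hf : d (zero_add 1) f = 0) (he : e.δ = comp (zero_add 1) f σ.a)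
    (e' : Ext k X Z K) (he' : e'.δ = -comp (add_zero 1) σ.a e.π) :
    ∃ c : (⟨⟨Y⟩⟩ : Ho k C) ≅ ⟨⟨Z⟩⟩, hm f hf ≫ c.hom = hm e'.i e'.d_i := by
  have hf' := (closed_zero_iff _ _).1 hf
  have hσ := σ.act_a_d
  have hσ' := σ.act_b_d
  have a₁ : act e.δ = act σ.a ≫ act f := by rw [he, act_comp]
  have a₂ : act e'.δ = -(act e.π ≫ act σ.a) := by rw [he', act_neg, act_comp]
  simp at hσ hσ'
  -- As a graded object, `Z` is `X ⊕ Y ⊕ X₁`, the mapping cylinder of `f`. The map `g` is `f` on `X`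
  -- and the identity on `Y`; `h` is the inclusion of `Y`.
  let g : Hom k Z Y 0 := comp (zero_add 0) f e'.r + comp (zero_add 0) e.r e'.π
  have hg : d (zero_add 1) g = 0 := by
    rw [closed_zero_iff]
    simp [g, act_add, act_comp, hf', a₁, a₂]
  let h : Hom k Y Z 0 := comp (zero_add 0) e'.s e.i
  have hh : d (zero_add 1) h = 0 := by
    rw [closed_zero_iff]
    simp [h, act_comp, a₂]
  have h₁ : hm h hh ≫ hm g hg = 𝟙 _ :=
    hm_comp_eq_id_of_act_eq (by simp [g, h, act_add, act_comp])
  -- The homotopy contracts the summand `X` against `X₁` by means of the inverse of `σ`.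
  have h₂ : hm g hg ≫ hm h hh = 𝟙 _ :=
    hm_comp_eq_id_of_act (comp (by norm_num : (0 : ℤ) + (0 + -1) = -1) e'.s
      (comp (by norm_num) e.s (comp (add_zero (-1)) σ.b e'.r))) (by
      simp [g, h, act_add, act_comp, a₁, a₂, reassoc_of% hσ']
      abel)
  refine ⟨hoIso h hh g hg h₁ h₂, ?_⟩
  have : hm e'.i e'.d_i ≫ hm g hg = hm f hf := by
    rw [hm_comp]
    exact hm_eq_of_act 0 (by simp [g, act_add, act_comp, act_zero])
  change _ ≫ hm h hh = _
  rw [← this, Category.assoc, h₂, Category.comp_id]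

/-- If `Y → K → X₁` has the class `f σ`, where `σ : X₁ → X` has degree `1`, then `f : X → Y` is
isomorphic to the projection of an extension of `Y` by a shift of `K`. -/
theorem exists_iso_projection {X Y K X₁ K' Z : C} (σ : HIso k 1 (-1) X₁ X) (ρ : HIso k 1 (-1) K K')
    (e : Ext k Y K X₁) (f : Hom k X Y 0) (hf : d (zero_add 1) f = 0)
    (he : e.δ = comp (zero_add 1) f σ.a)
    (e' : Ext k K' Z Y) (he' : e'.δ = comp (add_zero 1) ρ.a e.i) :
    ∃ c : (⟨⟨X⟩⟩ : Ho k C) ≅ ⟨⟨Z⟩⟩, c.hom ≫ hm e'.π e'.d_π = hm f hf := by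
  have hf' := (closed_zero_iff _ _).1 hf
  have hσ := σ.act_a_d
  have hσ' := σ.act_b_d
  have hρ := ρ.act_a_d
  have hρ' := ρ.act_b_d
  have a₁ : act e.δ = act σ.a ≫ act f := by rw [he, act_comp]
  have a₂ : act e'.δ = act e.i ≫ act ρ.a := by rw [he', act_comp]
  simp at hσ hσ' hρ hρ'
  -- As a graded object, `Z` consists of `Y` and of shifts of the two parts `Y` and `X₁` of `K`.
  -- Here `X` is embedded as the graph of `f`, with first component the copy of `X` inside `K'`. The
  -- two copies of `Y` are contracted against each other in `h₂`.
  let p : Hom k X K' 0 := comp (by norm_num) ρ.a (comp (zero_add (-1)) e.s σ.b)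
  let g : Hom k X Z 0 := comp (zero_add 0) e'.i p + comp (zero_add 0) e'.s f
  have hg : d (zero_add 1) g = 0 := by
    rw [closed_zero_iff]
    simp [g, p, act_add, act_comp, reassoc_of% hf', a₁, a₂, reassoc_of% hσ', reassoc_of% hρ]
    abel
  let q : Hom k K' X 0 := comp (by norm_num) σ.a (comp (zero_add (-1)) e.π ρ.b)
  let h : Hom k Z X 0 := comp (zero_add 0) q e'.r
  have hh : d (zero_add 1) h = 0 := by
    rw [closed_zero_iff]
    simp [h, q, act_comp, a₂, hσ, reassoc_of% hρ']
  have h₁ : hm g hg ≫ hm h hh = 𝟙 _ :=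
    hm_comp_eq_id_of_act_eq (by simp [g, h, p, q, act_add, act_comp])
  have h₂ : hm h hh ≫ hm g hg = 𝟙 _ :=
    hm_comp_eq_id_of_act (-comp (by norm_num : (0 : ℤ) + (0 + -1) = -1) e'.s
      (comp (by norm_num) e.r (comp (add_zero (-1)) ρ.b e'.r))) (by
      simp [g, h, p, q, act_add, act_comp, act_neg, a₁, a₂, reassoc_of% hρ']
      abel)
  refine ⟨hoIso g hg h hh h₁ h₂, ?_⟩
  change hm g hg ≫ _ = _
  rw [hm_comp]
  exact hm_eq_of_act 0 (by simp [g, act_add, act_comp, act_zero])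

/-- The cone of the inclusion of an extension is the quotient. -/
theorem nonempty_iso_of_cone_inclusion {X Y Z Y₁ K : C} (e : Ext k Y Z X) (σ : HIso k 1 (-1) Y₁ Y)
    (e' : Ext k Z K Y₁) (he' : e'.δ = comp (zero_add 1) e.i σ.a) :
    Nonempty ((⟨⟨K⟩⟩ : Ho k C) ≅ ⟨⟨X⟩⟩) := by
  have hσ := σ.act_a_d
  have hσ' := σ.act_b_d
  have a₂ : act e'.δ = act σ.a ≫ act e.i := by rw [he', act_comp]
  simp at hσ hσ'
  let g : Hom k K X 0 := comp (zero_add 0) e.π e'.r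
  have hg : d (zero_add 1) g = 0 := by
    rw [closed_zero_iff]
    simp [g, act_comp, a₂]
  -- The splitting `s` is not closed. Its differential `i δ` bounds in the cone, and the second term
  -- subtracts a primitive.
  let h : Hom k X K 0 := comp (zero_add 0) e'.i e.s -
    comp (zero_add 0) e'.s (comp (by norm_num) σ.b e.δ)
  have hh : d (zero_add 1) h = 0 := by
    rw [closed_zero_iff]
    simp [h, act_comp, act_sub, a₂, reassoc_of% hσ']
  have h₁ : hm g hg ≫ hm h hh = 𝟙 _ :=
    hm_comp_eq_id_of_act (-comp (by norm_num : (0 : ℤ) + (0 + -1) = -1) e'.s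
      (comp (by norm_num) σ.b (comp (zero_add 0) e.r e'.r)) ) (by
      simp [g, h, act_sub, act_comp, act_neg, a₂, reassoc_of% hσ']
      abel)
  have h₂ : hm h hh ≫ hm g hg = 𝟙 _ :=
    hm_comp_eq_id_of_act_eq (by simp [g, h, act_sub, act_comp])
  exact ⟨hoIso g hg h hh h₁ h₂⟩

/-- The cone of the projection of an extension is a shift of the subobject. -/
theorem nonempty_iso_of_cone_projection {X Y Z Y₁ Z₁ K : C} (e : Ext k Y Z X)
    (σ : HIso k 1 (-1) Z₁ Z) (τ : HIso k 1 (-1) Y₁ Y)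
    (e' : Ext k X K Z₁) (he' : e'.δ = comp (zero_add 1) e.π σ.a) :
    Nonempty ((⟨⟨K⟩⟩ : Ho k C) ≅ ⟨⟨Y₁⟩⟩) := by
  have hσ := σ.act_a_d
  have hσ' := σ.act_b_d
  have hτ := τ.act_a_d
  have hτ' := τ.act_b_d
  have a₂ : act e'.δ = act σ.a ≫ act e.π := by rw [he', act_comp]
  simp at hσ hσ' hτ hτ'
  -- As a graded object, `K` is `X ⊕ Y₁ ⊕ X₁`, where `X` and `X₁` cancel. The component on `X` given
  -- by the class makes the projection to `Y₁` closed.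
  let g : Hom k K Y₁ 0 := comp (by norm_num) τ.b (comp (add_zero 1) e.δ e'.r) +
    comp (zero_add 0) (comp (by norm_num) τ.b (comp (zero_add 1) e.r σ.a)) e'.π
  have hg : d (zero_add 1) g = 0 := by
    rw [closed_zero_iff]
    simp [g, act_comp, a₂, act_add, reassoc_of% hσ, hτ']
    abel
  let h : Hom k Y₁ K 0 := comp (zero_add 0) e'.s (comp (by norm_num) σ.b (comp (zero_add 1) e.i τ.a))
  have hh : d (zero_add 1) h = 0 := by
    rw [closed_zero_iff]
    simp [h, act_comp, a₂, reassoc_of% hσ', reassoc_of% hτ]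
  have h₁ : hm g hg ≫ hm h hh = 𝟙 _ :=
    hm_comp_eq_id_of_act (-comp (by norm_num : (0 : ℤ) + (0 + -1) = -1) e'.s
      (comp (by norm_num) σ.b (comp (zero_add 0) e.s e'.r)) ) (by
      simp [g, h, act_add, act_comp, act_neg, a₂, reassoc_of% hσ']
      abel)
  have h₂ : hm h hh ≫ hm g hg = 𝟙 _ :=
    hm_comp_eq_id_of_act_eq (by simp [g, h, act_add, act_comp])
  exact ⟨hoIso g hg h hh h₁ h₂⟩

end rotation

end hoBasics
end DG

/-! ### Localizations and local objects -/

namespace CategoryTheory.Localization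

section reflection

variable {T : Type*} [Category T] (P : ObjectProperty T) (W : MorphismProperty T)

/-- If each object has a morphism in `W` to an object in `P` and the objects in `P` are `W`-local,
then the full subcategory of these objects is reflective, and the reflector is a localization. -/
theorem exists_reflector (hP : P ≤ W.isLocal) (h : ∀ X, ∃ (K : T) (η : X ⟶ K), P K ∧ W η) :
    ∃ (G : T ⥤ P.FullSubcategory) (_ : G ⊣ P.ι), G.IsLocalization W := by
  choose K η hK hη using h
  let e : ∀ (X : T) (Y : P.FullSubcategory),
      ((⟨K X, hK X⟩ : P.FullSubcategory) ⟶ Y) ≃ (X ⟶ P.ι.obj Y) := fun X Y =>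
    P.fullyFaithfulι.homEquiv.trans (Equiv.ofBijective _ (hP _ Y.property (η X) (hη X)))
  have he : ∀ X Y Y' g h, e X Y' (h ≫ g) = e X Y h ≫ P.ι.map g := by
    intro X Y Y' g h
    simp [e, Functor.FullyFaithful.homEquiv]
  let adj := Adjunction.adjunctionOfEquivLeft e he
  -- The unit has to be known explicitly: that it lies in `W` is what makes the reflector a
  -- localization at `W`.
  have hadj : ∀ X, adj.unit.app X = η X := by
    intro X
    rw [← adj.homEquiv_id]
    have h1 : ∀ Y, adj.homEquiv X Y = e X Y := fun Y => by
      simp [adj, Adjunction.adjunctionOfEquivLeft]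
    rw [h1]
    exact Category.comp_id _
  refine ⟨_, adj, adj.isLocalization_leftAdjoint W (fun X Y f hf => ?_) (fun X => ?_)⟩
  · refine (ObjectProperty.isLocal_iff_isIso_map adj f).1 ?_
    rintro _ ⟨Z, rfl⟩
    exact hP _ Z.property f hf
  · rw [hadj]
    exact hη X

/-- The composition of the inclusion of the local objects with a localization functor is an
equivalence. -/
theorem isEquivalence_of_local {T' E : Type*} [Category T'] [Category E] (N : T' ⥤ T) [N.Full]
    [N.Faithful] (hN : N.essImage = P) (hP : P ≤ W.isLocal)
    (h : ∀ X, ∃ (K : T) (η : X ⟶ K), P K ∧ W η) (L : T ⥤ E) [L.IsLocalization W] :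
    (N ⋙ L).IsEquivalence := by
  obtain ⟨G, adj, hG⟩ := exists_reflector P W hP h
  have hN' : ∀ X, P (N.obj X) := fun X => hN ▸ N.obj_mem_essImage X
  let M := P.lift N hN'
  have : M.EssSurj := ⟨fun Y => by
    have h : N.essImage Y.obj := hN ▸ Y.property
    exact ⟨h.witness, ⟨P.isoMk h.getIso⟩⟩⟩
  have : M.IsEquivalence := {}
  -- `N` is the equivalence `M` followed by the inclusion of `P`, on which the reflector `G` is the
  -- identity, and `G` and `L` agree by uniqueness of localizations.
  let e : N ⋙ L ≅ M ⋙ (Localization.uniq G L W).functor :=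
    Functor.isoWhiskerLeft N (Localization.compUniqFunctor G L W).symm ≪≫
      (Functor.associator M (P.ι ⋙ G) (Localization.uniq G L W).functor) ≪≫
      Functor.isoWhiskerLeft M (Functor.isoWhiskerRight (asIso adj.counit) _ ≪≫
        Functor.leftUnitor _)
  exact Functor.isEquivalence_of_iso e.symm

end reflection

section fullyFaithful

variable {T₀ T : Type*} [Category T₀] [Category T] (Φ : T₀ ⥤ T) (W₀ : MorphismProperty T₀)
  (W : MorphismProperty T) (P : ObjectProperty T)

/-- The Ore condition for a class of morphisms. -/
def OreCondition : Prop :=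
  ∀ ⦃X Y X' : T₀⦄ (s : X ⟶ Y) (f : X ⟶ X'), W₀ s →
    ∃ (Y' : T₀) (s' : X' ⟶ Y') (f' : Y ⟶ Y'), W₀ s' ∧ s ≫ f' = f ≫ s'

-- Ore squares are pasted along a factorization. Passing to the multiplicative closure spares a
-- proof that the class itself is stable under composition.
variable {W₀} in
theorem OreCondition.multiplicativeClosure (h : OreCondition W₀) :
    OreCondition W₀.multiplicativeClosure := by
  intro X Y X' s f hs
  induction hs with
  | of s hs =>
    obtain ⟨Y', s', f', hs', e⟩ := h s f hs
    exact ⟨Y', s', f', .of _ hs', e⟩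
  | id X => exact ⟨_, 𝟙 _, f, .id _, by simp⟩
  | comp_of s t _ ht ih =>
    obtain ⟨Y', s', f', hs', e⟩ := ih f
    obtain ⟨Y'', s'', f'', hs'', e'⟩ := h t f' ht
    exact ⟨Y'', s' ≫ s'', f'', .comp_of _ _ hs' hs'', by simp [e', reassoc_of% e]⟩

variable {W₀} in
theorem isIso_Q_map_of_multiplicativeClosure {X Y : T₀} (s : X ⟶ Y)
    (hs : W₀.multiplicativeClosure s) : IsIso (W₀.Q.map s) := by
  induction hs with
  | of s hs => exact Localization.inverts W₀.Q W₀ s hs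
  | id X => infer_instance
  | comp_of s t _ ht ih =>
    have := Localization.inverts W₀.Q W₀ t ht
    rw [Functor.map_comp]
    infer_instance

-- Morphisms of the localization that become images after composition with a denominator include all
-- images and all formal inverses, and Ore squares make them stable under composition; so they are
-- all morphisms.
variable {W₀} in
theorem OreCondition.exists_fraction (h : OreCondition W₀) {X Y : T₀}
    (φ : W₀.Q.obj X ⟶ W₀.Q.obj Y) :
    ∃ (Y' : T₀) (s : Y ⟶ Y') (f : X ⟶ Y'), W₀.multiplicativeClosure s ∧
      φ ≫ W₀.Q.map s = W₀.Q.map f := by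
  -- The induction principle concerns morphisms between arbitrary objects of the localization,
  -- whereas fractions need objects of `T₀`. The quotient functor is bijective on objects, so the
  -- equalities and `HEq` can be eliminated.
  let R : MorphismProperty W₀.Localization := fun A B φ => ∀ (X Y : T₀) (φ' : W₀.Q.obj X ⟶ W₀.Q.obj Y),
    A = W₀.Q.obj X → B = W₀.Q.obj Y → HEq φ φ' →
    ∃ (Y' : T₀) (s : Y ⟶ Y') (f : X ⟶ Y'), W₀.multiplicativeClosure s ∧
      φ' ≫ W₀.Q.map s = W₀.Q.map f
  have hobj : ∀ {X Y : T₀}, W₀.Q.obj X = W₀.Q.obj Y → X = Y := fun {X Y} h =>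
    (Construction.objEquiv W₀).injective h
  have : R.IsStableUnderComposition := ⟨by
    intro A B C φ ψ hφ hψ X Z χ hA hC hχ
    obtain ⟨Y, rfl⟩ := (Construction.objEquiv W₀).surjective B
    subst hA hC
    obtain rfl := eq_of_heq hχ
    obtain ⟨Y₁, s, f, hs, e⟩ := hφ X Y φ rfl rfl HEq.rfl
    obtain ⟨Y₂, t, g, ht, e'⟩ := hψ Y Z ψ rfl rfl HEq.rfl
    obtain ⟨V, s', g', hs', e''⟩ := h.multiplicativeClosure s g hs
    refine ⟨V, t ≫ s', f ≫ g', W₀.multiplicativeClosure.comp_mem _ _ ht hs', ?_⟩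
    rw [Functor.map_comp, Functor.map_comp, ← e]
    have e₃ : ψ ≫ W₀.Q.map t ≫ W₀.Q.map s' = W₀.Q.map s ≫ W₀.Q.map g' := by
      refine (Category.assoc _ _ _).symm.trans ((congrArg (· ≫ W₀.Q.map s') e').trans ?_)
      rw [← Functor.map_comp, ← Functor.map_comp, e'']
    exact (Category.assoc φ ψ _).trans ((congrArg (φ ≫ ·) e₃).trans (Category.assoc _ _ _).symm)⟩
  have hR : R = ⊤ := by
    refine Construction.morphismProperty_eq_top R ?_ ?_
    · intro X Y f X' Y' φ' hX hY hφ
      obtain rfl := hobj hX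
      obtain rfl := hobj hY
      obtain rfl := eq_of_heq hφ
      refine ⟨_, 𝟙 _, f, .id _, ?_⟩
      rw [Functor.map_id]
      exact Category.comp_id _
    · intro X Y w hw X' Y' φ' hX hY hφ
      obtain rfl := hobj hX
      obtain rfl := hobj hY
      obtain rfl := eq_of_heq hφ
      refine ⟨_, w, 𝟙 _, .of _ hw, ?_⟩
      rw [Functor.map_id]
      exact (Construction.wIso w hw).inv_hom_id
  have : R φ := by rw [hR]; trivial
  exact this X Y φ rfl rfl HEq.rfl

/-- A criterion for a functor between localized categories to be fully faithful. -/
theorem exists_fullyFaithful_lift {E₀ E : Type*} [Category E₀] [Category E] (L₀ : T₀ ⥤ E₀)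
    [L₀.IsLocalization W₀] (L : T ⥤ E) [L.IsLocalization W]
    (hP : P ≤ W.isLocal) (hex : ∀ X, ∃ (K : T) (η : X ⟶ K), P K ∧ W η)
    (hΦ : W₀ ≤ P.isLocal.inverseImage Φ) (hore : OreCondition W₀)
    (H : ∀ Y, ∃ (K : T) (η : Φ.obj Y ⟶ K), P K ∧ W η ∧
      (∀ (X : T₀) (f : Φ.obj X ⟶ K), ∃ (Y' : T₀) (s : Y ⟶ Y') (g : X ⟶ Y') (h : Φ.obj Y' ⟶ K),
        W₀ s ∧ Φ.map s ≫ h = η ∧ Φ.map g ≫ h = f) ∧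
      (∀ (X : T₀) (f g : X ⟶ Y), Φ.map f ≫ η = Φ.map g ≫ η →
        ∃ (Y' : T₀) (s : Y ⟶ Y'), W₀ s ∧ f ≫ s = g ≫ s)) :
    ∃ G : E₀ ⥤ E, Nonempty (L₀ ⋙ G ≅ Φ ⋙ L) ∧ G.Full ∧ G.Faithful := by
  obtain ⟨R, adj, hR⟩ := exists_reflector P W hP hex
  have hloc : ∀ {X Y : T} (f : X ⟶ Y), P.isLocal f → IsIso (R.map f) := by
    intro X Y f hf
    refine (ObjectProperty.isLocal_iff_isIso_map adj f).1 ?_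
    rintro _ ⟨Z, rfl⟩
    exact hf _ Z.property
  -- Morphisms to a local object are unchanged by the reflection; this is how morphisms of the
  -- quotient become morphisms of `T`.
  have hbij : ∀ {X K : T}, P K → Function.Bijective (R.map : (X ⟶ K) → _) := by
    intro X K hK
    have hu : IsIso (adj.unit.app K) := by
      have : IsIso (adj.unit.app (P.ι.obj ⟨K, hK⟩)) := inferInstance
      exact this
    have e : (R.map : (X ⟶ K) → _) = fun f => (adj.homEquiv _ _).symm (f ≫ adj.unit.app K) := by
      funext f
      rw [Equiv.eq_symm_apply, adj.homEquiv_unit]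
      exact (adj.unit_naturality f).symm ▸ rfl
    rw [e]
    exact (adj.homEquiv _ _).symm.bijective.comp (Iso.homToEquiv (asIso (adj.unit.app K))).bijective
  have hinv : W₀.IsInvertedBy (Φ ⋙ R) := fun X Y s hs => hloc _ (hΦ _ hs)
  let G₀ : W₀.Localization ⥤ P.FullSubcategory := Localization.lift (Φ ⋙ R) hinv W₀.Q
  let ι : W₀.Q ⋙ G₀ ≅ Φ ⋙ R := Localization.fac (Φ ⋙ R) hinv W₀.Q
  have : W₀.Q.EssSurj := Localization.essSurj W₀.Q W₀
  have hι : ∀ {X Y : T₀} (f : X ⟶ Y),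
      G₀.map (W₀.Q.map f) ≫ ι.hom.app Y = ι.hom.app X ≫ R.map (Φ.map f) :=
    fun f => ι.hom.naturality f
  have hfull : G₀.Full := by
    refine G₀.full_of_comp_essSurj W₀.Q fun X Y φ => ?_
    -- Fullness: followed by `Φ Y → K`, the given morphism comes from some `f : Φ X → K`. By
    -- hypothesis `f` lifts to a fraction `X → Y' ← Y`, which is the preimage.
    obtain ⟨K, η, hK, hη, h₁, -⟩ := H Y
    obtain ⟨f, hf⟩ := (hbij hK).2 (ι.inv.app X ≫ φ ≫ ι.hom.app Y ≫ R.map η)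
    obtain ⟨Y', s, g, h, hs, e₁, e₂⟩ := h₁ X f
    have hQ := Localization.inverts W₀.Q W₀ s hs
    have i₁ : IsIso (R.map η) := Localization.inverts R W η hη
    have i₂ : IsIso (R.map (Φ.map s)) := hinv s hs
    -- Two out of three, since `η` and `Φ s` are both inverted.
    have i₃ : IsIso (R.map h) := by
      rw [← e₁, R.map_comp] at i₁
      exact IsIso.of_isIso_comp_left (R.map (Φ.map s)) (R.map h)
    refine ⟨W₀.Q.map g ≫ inv (W₀.Q.map s), ?_⟩
    rw [G₀.map_comp, Functor.map_inv, IsIso.comp_inv_eq, ← cancel_mono (ι.hom.app Y'),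
      ← cancel_mono (R.map h), Category.assoc, Category.assoc, Category.assoc, reassoc_of% hι g,
      reassoc_of% hι s, ← R.map_comp, ← R.map_comp, e₁, e₂, hf]
    simp
  have hfaithful : G₀.Faithful := by
    refine G₀.faithful_of_comp_essSurj W₀.Q fun X Y a b hab => ?_
    -- Faithfulness on morphisms coming from `T₀`: they agree after `Φ Y → K`, hence after some
    -- denominator.
    have key : ∀ {Y : T₀} (f g : X ⟶ Y), G₀.map (W₀.Q.map f) = G₀.map (W₀.Q.map g) →
        W₀.Q.map f = W₀.Q.map g := by
      intro Y f g hfg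
      obtain ⟨K, η, hK, hη, -, h₂⟩ := H Y
      obtain ⟨Y', s, hs, e⟩ := h₂ X f g ((hbij hK).1 (by
        rw [R.map_comp, R.map_comp, ← cancel_epi (ι.hom.app X), ← Category.assoc, ← hι,
          ← Category.assoc (ι.hom.app X), ← hι, hfg]))
      have hQ := Localization.inverts W₀.Q W₀ s hs
      rw [← cancel_mono (W₀.Q.map s), ← Functor.map_comp, ← Functor.map_comp, e]
    -- Two applications of the Ore condition bring both morphisms over a common denominator, which
    -- reduces faithfulness to `key`.
    obtain ⟨Y₁, s, f, hs, e₁⟩ := hore.exists_fraction a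
    have := isIso_Q_map_of_multiplicativeClosure s hs
    obtain ⟨Y₂, t, g, ht, e₂⟩ := hore.exists_fraction (b ≫ W₀.Q.map s)
    have := isIso_Q_map_of_multiplicativeClosure t ht
    have h := key (f ≫ t) g (by
      rw [Functor.map_comp, ← e₁, ← e₂]
      simp only [Functor.map_comp, hab])
    rw [Functor.map_comp, ← e₁, ← e₂, cancel_mono, cancel_mono] at h
    exact h
  refine ⟨(Localization.uniq L₀ W₀.Q W₀).functor ⋙ G₀ ⋙ (Localization.uniq R L W).functor,
    ⟨?_⟩, inferInstance, inferInstance⟩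
  exact Functor.isoWhiskerRight (Localization.compUniqFunctor L₀ W₀.Q W₀)
      (G₀ ⋙ (Localization.uniq R L W).functor) ≪≫
    Functor.isoWhiskerRight ι (Localization.uniq R L W).functor ≪≫
    Functor.isoWhiskerLeft Φ (Localization.compUniqFunctor R L W)

end fullyFaithful

end CategoryTheory.Localization

namespace DG

/-! ### Homotopy invariance of extensions and shifts; classes closed under extensions -/

section extensions

variable {k : Type w} [CommRing k] {C : Type u} [DGCategory.{v} k C]

/-- A homotopy from closed morphisms representing the identity. -/
theorem act_of_hm_comp_eq_id {X Y : C} {f : Hom k X Y 0} {g : Hom k Y X 0}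
    {hf : d (zero_add 1) f = 0} {hg : d (zero_add 1) g = 0} (H : hm f hf ≫ hm g hg = 𝟙 _) :
    ∃ h : Hom k X X (-1), act f ≫ act g = 𝟙 _ + (dOp k X ≫ act h + act h ≫ dOp k X) := by
  rw [hm_comp, ← hm_id] at H
  obtain ⟨h, hh⟩ := act_of_hm_eq H
  rw [act_comp, act_idd] at hh
  exact ⟨h, by rw [hh]; abel⟩

/-- Representatives of an isomorphism in the homotopy category. -/
theorem exists_representatives {X Y : C} (a : (⟨⟨X⟩⟩ : Ho k C) ≅ ⟨⟨Y⟩⟩) :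
    ∃ (f : Hom k X Y 0) (g : Hom k Y X 0) (hf : d (zero_add 1) f = 0) (hg : d (zero_add 1) g = 0),
      a.hom = hm f hf ∧ a.inv = hm g hg ∧ hm f hf ≫ hm g hg = 𝟙 _ ∧ hm g hg ≫ hm f hf = 𝟙 _ := by
  obtain ⟨f, hf, e⟩ := hm_surjective a.hom
  obtain ⟨g, hg, e'⟩ := hm_surjective a.inv
  exact ⟨f, g, hf, hg, e, e', by rw [← e, ← e', a.hom_inv_id], by rw [← e, ← e', a.inv_hom_id]⟩

namespace Ext

/-- A morphism of extensions, given by morphisms of the outer terms that are compatible with the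
classes up to homotopy. -/
theorem exists_map {Y Z X Y' Z' X' : C} (e : Ext k Y Z X) (e' : Ext k Y' Z' X') (y : Hom k Y Y' 0)
    (x : Hom k X X' 0) (hy : d (zero_add 1) y = 0) (hx : d (zero_add 1) x = 0) (h : Hom k X Y' 0)
    (H : act h ≫ dOp k Y' = dOp k X ≫ act h + act e.δ ≫ act y - act x ≫ act e'.δ) :
    ∃ z : Hom k Z Z' 0, d (zero_add 1) z = 0 ∧ act e.i ≫ act z = act y ≫ act e'.i ∧
      act z ≫ act e'.π = act e.π ≫ act x := by
  rw [closed_zero_iff] at hx hy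
  -- The triangular matrix with diagonal entries `y`, `x` and off-diagonal entry `h`; the equation
  -- `H` is exactly its closedness.
  refine ⟨comp (zero_add 0) e'.i (comp (zero_add 0) y e.r) +
    comp (zero_add 0) e'.s (comp (zero_add 0) x e.π) +
    comp (zero_add 0) e'.i (comp (zero_add 0) h e.π), ?_, ?_, ?_⟩
  · rw [closed_zero_iff]
    simp [act_add, act_comp, reassoc_of% hx, reassoc_of% hy, reassoc_of% H]
    abel
  · simp [act_add, act_comp]
  · simp [act_add, act_comp]

/-- An endomorphism of an extension that is homotopic to the identity on the outer terms is a
homotopy equivalence. -/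
theorem isIso_of_unipotent {Y Z X : C} (e : Ext k Y Z X) (u : Hom k Z Z 0)
    (hu : d (zero_add 1) u = 0) (α : Hom k Y Y (-1)) (β : Hom k X X (-1))
    (hα : act e.i ≫ act u = act e.i + (dOp k Y ≫ act α + act α ≫ dOp k Y) ≫ act e.i)
    (hβ : act u ≫ act e.π = act e.π + act e.π ≫ (dOp k X ≫ act β + act β ≫ dOp k X)) :
    IsIso (hm u hu) := by
  have hu' := (closed_zero_iff _ _).1 hu
  -- The homotopies of the outer terms are assembled on the diagonal. Subtracting the boundary of
  -- `η` gives `u₁`, which is strictly the identity on the outer terms.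
  let η : Hom k Z Z (-1) := comp (zero_add (-1)) e.i (comp (add_zero (-1)) α e.r) +
    comp (zero_add (-1)) e.s (comp (add_zero (-1)) β e.π)
  let u₁ : Hom k Z Z 0 := u - d (neg_add_cancel 1) η
  have hu₁ : d (zero_add 1) u₁ = 0 := by
    rw [map_sub, hu]
    exact (zero_sub _).trans (neg_eq_zero.2 (DGCategory.d_d _ _ _))
  have e₁ : hm u hu = hm u₁ hu₁ := hm_eq_iff.2 ⟨η, by simp [u₁]⟩
  have i₁ : act e.i ≫ act u₁ = act e.i := by
    simp [u₁, η, act_sub, act_d_neg_one, act_comp, act_add, hα]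
    abel
  have p₁ : act u₁ ≫ act e.π = act e.π := by
    simp [u₁, η, act_sub, act_d_neg_one, act_comp, act_add, hβ]
    abel
  -- `n` kills the subobject and lands in it, so `n² = 0` and `1 - n` is the inverse of `1 + n`.
  let n : Hom k Z Z 0 := u₁ - idd k Z
  have hn : d (zero_add 1) n = 0 := by rw [map_sub, hu₁, d_id, sub_zero]
  have n₂ : act n ≫ act n = 0 := by
    have a₁ : act n = act e.π ≫ act e.s ≫ act n := by
      have h : act n = (act e.r ≫ act e.i + act e.π ≫ act e.s) ≫ act n := by simp
      have h' : act e.i ≫ act n = 0 := by simp [n, act_sub, act_idd, i₁]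
      rwa [Preadditive.add_comp, Category.assoc, h', Limits.comp_zero, zero_add,
        Category.assoc] at h
    have a₂ : act n ≫ act e.π = 0 := by simp [n, act_sub, act_idd, p₁]
    nth_rw 2 [a₁]
    rw [reassoc_of% a₂, Limits.zero_comp]
  have hu₁n : act u₁ = 𝟙 _ + act n := by simp [n, act_sub, act_idd]
  have hv : d (zero_add 1) (idd k Z - n) = 0 := by rw [map_sub, hn, d_id, sub_zero]
  rw [e₁]
  have h₃ : act (idd k Z - n) = 𝟙 _ - act n := by rw [act_sub, act_idd]
  clear_value n
  refine ⟨hm (idd k Z - n) hv, hm_comp_eq_id_of_act_eq ?_, hm_comp_eq_id_of_act_eq ?_⟩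
  · simp [hu₁n, h₃, n₂]
  · simp [hu₁n, h₃, n₂]

/-- Extensions with homotopy equivalent outer terms and corresponding classes are homotopy
equivalent. -/
theorem nonempty_iso_of_conj {Y Z X Y' Z' X' : C} (e : Ext k Y Z X) (e' : Ext k Y' Z' X')
    {y : Hom k Y Y' 0} {y' : Hom k Y' Y 0} {x : Hom k X X' 0} {x' : Hom k X' X 0}
    {hy : d (zero_add 1) y = 0} {hy' : d (zero_add 1) y' = 0} {hx : d (zero_add 1) x = 0}
    {hx' : d (zero_add 1) x' = 0} (y₁ : hm y hy ≫ hm y' hy' = 𝟙 _) (y₂ : hm y' hy' ≫ hm y hy = 𝟙 _)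
    (x₁ : hm x hx ≫ hm x' hx' = 𝟙 _) (x₂ : hm x' hx' ≫ hm x hx = 𝟙 _)
    (H : act e'.δ = act x' ≫ act e.δ ≫ act y) : Nonempty ((⟨⟨Z⟩⟩ : Ho k C) ≅ ⟨⟨Z'⟩⟩) := by
  obtain ⟨α, hα⟩ := act_of_hm_comp_eq_id y₁
  obtain ⟨α', hα'⟩ := act_of_hm_comp_eq_id y₂
  obtain ⟨β, hβ⟩ := act_of_hm_comp_eq_id x₁
  obtain ⟨β', hβ'⟩ := act_of_hm_comp_eq_id x₂
  have cy := (closed_zero_iff _ _).1 hy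
  have cx' := (closed_zero_iff _ _).1 hx'
  -- The two classes correspond only up to the homotopy between `x' x` and the identity; `y δ β`
  -- accounts for the difference.
  obtain ⟨z, hz, zi, zπ⟩ := e.exists_map e' y x hy hx
    (comp (zero_add 0) y (comp (by norm_num) e.δ β)) (by
      simp [act_comp, H, reassoc_of% hβ, cy]; abel)
  obtain ⟨z', hz', zi', zπ'⟩ := e'.exists_map e y' x' hy' hx'
    (comp (by norm_num) α (comp (add_zero 1) e.δ x')) (by
      simp [act_comp, H, hα, reassoc_of% cx']; abel)
  -- The maps need not be mutually inverse. Each composite is unipotent up to homotopy, hence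
  -- invertible, and this makes `z` split mono and split epi.
  have h₁ : IsIso (hm z hz ≫ hm z' hz') := by
    rw [hm_comp]
    refine e.isIso_of_unipotent _ _ α β ?_ ?_
    · simp [act_comp, reassoc_of% zi, zi', reassoc_of% hα]
    · simp [act_comp, reassoc_of% zπ, zπ', hβ]
  have h₂ : IsIso (hm z' hz' ≫ hm z hz) := by
    rw [hm_comp]
    refine e'.isIso_of_unipotent _ _ α' β' ?_ ?_
    · simp [act_comp, reassoc_of% zi', zi, reassoc_of% hα']
    · simp [act_comp, reassoc_of% zπ', zπ, hβ']
  have : IsIso (hm z hz) := by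
    have : IsSplitMono (hm z hz) := ⟨⟨⟨hm z' hz' ≫ inv (hm z hz ≫ hm z' hz'), by
      rw [← Category.assoc, IsIso.hom_inv_id]⟩⟩⟩
    have : IsSplitEpi (hm z hz) := ⟨⟨⟨inv (hm z' hz' ≫ hm z hz) ≫ hm z' hz', by
      rw [Category.assoc, IsIso.inv_hom_id]⟩⟩⟩
    exact isIso_of_epi_of_isSplitMono _
  exact ⟨asIso (hm z hz)⟩

end Ext

/-- Shifts of homotopy equivalent objects are homotopy equivalent. -/
theorem HIso.nonempty_iso {n m : ℤ} {X S X' S' : C} (e : HIso k n m X S) (e' : HIso k n m X' S')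
    (a : (⟨⟨X⟩⟩ : Ho k C) ≅ ⟨⟨X'⟩⟩) : Nonempty ((⟨⟨S⟩⟩ : Ho k C) ≅ ⟨⟨S'⟩⟩) := by
  obtain ⟨x, x', hx, hx', -, -, x₁, x₂⟩ := exists_representatives a
  have hnm := e.h
  have key : ∀ {X S X' S' : C} (e : HIso k n m X S) (e' : HIso k n m X' S') (x : Hom k X X' 0)
      (x' : Hom k X' X 0) (hx : d (zero_add 1) x = 0) (hx' : d (zero_add 1) x' = 0),
      hm x hx ≫ hm x' hx' = 𝟙 _ → ∀ hs hs',
      hm (comp e'.h e'.a (comp (zero_add m) x e.b)) hs ≫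
        hm (comp e.h e.a (comp (zero_add m) x' e'.b)) hs' = 𝟙 _ := by
    intro X S X' S' e e' x x' hx hx' x₁ hs hs'
    obtain ⟨α, hα⟩ := act_of_hm_comp_eq_id x₁
    obtain rfl : m = -n := by omega
    -- Conjugation by a closed map of degree `n` commutes with the differential up to `(-1)^n`,
    -- which the sign of the homotopy compensates.
    refine hm_comp_eq_id_of_act (n.negOnePow •
      comp (by ring : n + (-1 + -n) = -1) e.a (comp rfl α e.b)) ?_
    have h₁ := e.act_a_d
    have h₂ := e.act_b_d
    rw [act_negOnePow_smul]
    simp only [act_comp, Category.assoc, e'.act_a_b_assoc]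
    rw [reassoc_of% hα]
    simp only [Preadditive.add_comp, Preadditive.comp_add, Category.assoc]
    rcases Int.even_or_odd n with h | h
    · simp [Int.negOnePow_even _ h, h₁, reassoc_of% h₂]; abel
    · simp [Int.negOnePow_odd _ h, h₁, reassoc_of% h₂]; abel
  have c₁ : d (zero_add 1) (comp e'.h e'.a (comp (zero_add m) x e.b)) = 0 :=
    HIso.d_comp_closed _ _ _ (e'.d_a _) (HIso.d_comp_closed _ _ _ hx (e.d_b _) _) _
  have c₂ : d (zero_add 1) (comp e.h e.a (comp (zero_add m) x' e'.b)) = 0 :=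
    HIso.d_comp_closed _ _ _ (e.d_a _) (HIso.d_comp_closed _ _ _ hx' (e'.d_b _) _) _
  exact ⟨hoIso _ c₁ _ c₂ (key e e' x x' hx hx' x₁ _ _) (key e' e x' x hx' hx x₂ _ _)⟩

/-- Classes of objects of the homotopy category that contain the zero objects and are closed under
isomorphisms, shifts and extensions. -/
structure ExtClosed (Q : ObjectProperty (Ho k C)) : Prop where
  zero : ∀ {X : C}, idd k X = 0 → Q ⟨⟨X⟩⟩
  iso : ∀ {X Y : Ho k C}, (X ≅ Y) → Q X → Q Y
  shift : ∀ {n m : ℤ} {X S : C}, HIso k n m X S → Q ⟨⟨X⟩⟩ → Q ⟨⟨S⟩⟩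
  ext : ∀ {Y Z X : C}, Ext k Y Z X → Q ⟨⟨Y⟩⟩ → Q ⟨⟨X⟩⟩ → Q ⟨⟨Z⟩⟩

/-- A DG functor is fully faithful if it is bijective on morphisms of each degree. -/
def DGFunctor.FF {D : Type u'} [DGCategory.{v'} k D] (F : DGFunctor k C D) : Prop :=
  ∀ (X Y : C) (n : ℤ), Function.Bijective (F.map : Hom k X Y n → Hom k (F.obj X) (F.obj Y) n)

theorem DGFunctor.FF.op {D : Type u'} [DGCategory.{v'} k D] {F : DGFunctor k C D} (hF : F.FF) :
    F.op.FF := fun X Y n => hF Y.unop X.unop n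

theorem DGFunctor.FF.trans {D : Type u'} [DGCategory.{v'} k D] {E : Type u''} [DGCategory.{v''} k E]
    {F : DGFunctor k C D} {G : DGFunctor k D E} (hF : F.FF) (hG : G.FF) :
    (F.trans G).FF := fun X Y n => (hG _ _ n).comp (hF X Y n)

theorem DGFunctor.FF.d_eq_zero {D : Type u'} [DGCategory.{v'} k D] {F : DGFunctor k C D}
    (hF : F.FF) {X Y : C} {n m : ℤ} (h : n + 1 = m) {f : Hom k X Y n} (hf : d h (F.map f) = 0) :
    d h f = 0 :=
  (hF X Y m).1 (by rw [F.map_d, hf, map_zero])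

theorem DGFunctor.FF.full {D : Type u'} [DGCategory.{v'} k D] {F : DGFunctor k C D}
    (hF : F.FF) : F.ho.Full where
  map_surjective {X Y} u := by
    obtain ⟨⟨X⟩⟩ := X
    obtain ⟨⟨Y⟩⟩ := Y
    obtain ⟨f, hf, rfl⟩ := hm_surjective (X := F.obj X) (Y := F.obj Y) u
    obtain ⟨f, rfl⟩ := (hF X Y 0).2 f
    exact ⟨hm f (hF.d_eq_zero _ hf), rfl⟩

theorem DGFunctor.FF.faithful {D : Type u'} [DGCategory.{v'} k D] {F : DGFunctor k C D}
    (hF : F.FF) : F.ho.Faithful where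
  map_injective {X Y} a b hab := by
    obtain ⟨⟨X⟩⟩ := X
    obtain ⟨⟨Y⟩⟩ := Y
    obtain ⟨f, hf, rfl⟩ := hm_surjective a
    obtain ⟨g, hg, rfl⟩ := hm_surjective b
    obtain ⟨h, hh⟩ := hm_eq_iff.1 (show hm (F.map f) _ = hm (F.map g) _ from hab)
    obtain ⟨h, rfl⟩ := (hF X Y (-1)).2 h
    exact hm_eq_iff.2 ⟨h, (hF X Y 0).1 (by rw [F.map_d, hh, map_sub])⟩

/-- The essential image of a fully faithful DG functor. -/
theorem ExtClosed.essImage {D : Type u'} [DGCategory.{v'} k D] {F : DGFunctor k C D} (hF : F.FF)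
    (hC : SPretr k C) : ExtClosed F.ho.essImage where
  zero {X} hX := by
    obtain ⟨X₀, h₀⟩ := hC.zero
    have h₁ : idd k (F.obj X₀) = 0 := by rw [← F.map_id, h₀, map_zero]
    exact ⟨⟨⟨X₀⟩⟩, ⟨(isZero_of_idd h₁).iso (isZero_of_idd hX)⟩⟩
  iso e h := F.ho.essImage.prop_of_iso e h
  shift {n m X S} e h := by
    obtain ⟨⟨⟨X₀⟩⟩, ⟨a⟩⟩ := h
    obtain ⟨S₀, ⟨e₀⟩⟩ := hC.shift X₀ n m e.h
    obtain ⟨b⟩ := (e₀.map F).nonempty_iso e a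
    exact ⟨⟨⟨S₀⟩⟩, ⟨b⟩⟩
  ext {Y Z X} e hY hX := by
    obtain ⟨⟨⟨Y₀⟩⟩, ⟨a⟩⟩ := hY
    obtain ⟨⟨⟨X₀⟩⟩, ⟨b⟩⟩ := hX
    obtain ⟨y, y', hy, hy', -, -, y₁, y₂⟩ := exists_representatives (X := F.obj Y₀) a
    obtain ⟨x, x', hx, hx', -, -, x₁, x₂⟩ := exists_representatives (X := F.obj X₀) b
    -- The class is transported to the images of `Y₀` and `X₀` along the equivalences and descends
    -- to `C` by full faithfulness; its extension there has an image homotopy equivalent to `Z`.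
    obtain ⟨δ, hδ⟩ := (hF X₀ Y₀ 1).2 (comp (zero_add 1) y' (comp (add_zero 1) e.δ x))
    have hδ' : d one_add_one_eq_two δ = 0 := by
      refine hF.d_eq_zero _ ?_
      rw [hδ]
      exact HIso.d_comp_closed _ _ _ hy' (HIso.d_comp_closed _ _ _ (e.d_δ _) hx _) _
    obtain ⟨Z₀, e₀, rfl⟩ := hC.ext X₀ Y₀ δ hδ'
    obtain ⟨c⟩ := e.nonempty_iso_of_conj (e₀.map F) y₂ y₁ x₂ x₁ (by
      change act (F.map e₀.δ) = _
      rw [hδ, act_comp, act_comp, Category.assoc])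
    exact ⟨⟨⟨Z₀⟩⟩, ⟨c.symm⟩⟩

end extensions
end DG

namespace DG

/-! ### Acyclic complexes of morphisms and orthogonality -/

section acyclic

variable {k : Type w} [CommRing k] {C : Type u} [DGCategory.{v} k C]

theorem d_comp_left {X Y Z : C} {q n m n' m' : ℤ} {a : Hom k Y Z q} (ha : d rfl a = 0) (h : n + 1 = m)
    (h' : n' + 1 = m') (hn : q + n = n') (hm : q + m = m') (f : Hom k X Y n) :
    d h' (comp hn a f) = sgn k q • comp hm a (d h f) := by
  rw [DGCategory.d_comp (q' := q + 1) (p' := m) hn h' rfl h (by omega) hm,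
    show DGCategory.d (k := k) rfl a = 0 from ha, LinearMap.map_zero₂, zero_add]

theorem d_comp_left_zero {X Y Z : C} {n m : ℤ} {a : Hom k Y Z 0} (ha : d (zero_add 1) a = 0)
    (h : n + 1 = m) (hn : 0 + n = n) (hm : 0 + m = m) (f : Hom k X Y n) :
    d h (comp hn a f) = comp hm a (d h f) := by
  rw [d_comp_left ha h h hn hm, sgn_zero, one_smul]

theorem d_comp_right {X Y Z : C} {q n m n' m' : ℤ} {f : Hom k X Y q} (hf : d rfl f = 0) (h : n + 1 = m)
    (h' : n' + 1 = m') (hn : n + q = n') (hm : m + q = m') (a : Hom k Y Z n) :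
    d h' (comp hn a f) = comp hm (d h a) f := by
  rw [DGCategory.d_comp (q' := m) (p' := q + 1) hn h' h rfl hm (by omega),
    show DGCategory.d (k := k) rfl f = 0 from hf, map_zero, smul_zero, add_zero]

/-- A property of objects of the homotopy category of the dual DG category. -/
def opProp (Q : ObjectProperty (Ho k C)) : ObjectProperty (Ho k (DGOp C)) :=
  fun X => Q ⟨⟨X.as.obj.unop⟩⟩

/-- Homotopy equivalences in the dual DG category. -/
theorem nonempty_iso_unop {X Y : DGOp C} (a : (⟨⟨X⟩⟩ : Ho k (DGOp C)) ≅ ⟨⟨Y⟩⟩) :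
    Nonempty ((⟨⟨X.unop⟩⟩ : Ho k C) ≅ ⟨⟨Y.unop⟩⟩) := by
  obtain ⟨f, g, hf, hg, -, -, h₁, h₂⟩ := exists_representatives a
  have key : ∀ {X Y : DGOp C} {f : Hom k X Y 0} {g : Hom k Y X 0} {hf : d (zero_add 1) f = 0}
      {hg : d (zero_add 1) g = 0}, hm f hf ≫ hm g hg = 𝟙 _ →
      hm (X := X.unop) (Y := Y.unop) g hg ≫ hm (X := Y.unop) (Y := X.unop) f hf = 𝟙 _ := by
    intro X Y f g hf hg h
    rw [hm_comp, ← hm_id] at h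
    obtain ⟨α, hα⟩ := hm_eq_iff.1 h
    rw [hm_comp, ← hm_id]
    refine hm_eq_iff.2 ⟨α, ?_⟩
    refine Eq.trans hα ?_
    rw [Ext.op_comp_zero_left]
    rfl
  exact ⟨hoIso g hg f hf (key h₁) (key h₂)⟩

theorem ExtClosed.op {Q : ObjectProperty (Ho k C)} (hQ : ExtClosed Q) : ExtClosed (opProp Q) where
  zero h := hQ.zero h
  iso {X Y} e h := hQ.iso (nonempty_iso_unop (X := X.as.obj) (Y := Y.as.obj) e).some h
  shift e h := hQ.shift e.unop.symm h
  ext e hY hX := hQ.ext e.unop hX hY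

/-- The converse of `ExtClosed.op`. -/
theorem ExtClosed.unop {Q : ObjectProperty (Ho k (DGOp C))} (hQ : ExtClosed Q) :
    ExtClosed (fun X : Ho k C => Q ⟨⟨⟨X.as.obj⟩⟩⟩) where
  zero h := hQ.zero h
  iso {X Y} e h := hQ.iso (nonempty_iso_unop (X := (⟨⟨X.as.obj⟩⟩ : DGOp (DGOp C)))
    (Y := ⟨⟨Y.as.obj⟩⟩) (((toOpOp k C).ho.mapIso e))).some h
  shift e h := hQ.shift e.op.symm h
  ext e hY hX := hQ.ext e.op hX hY

/-- Acyclicity of the complexes of morphisms from a fixed object. -/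
theorem extClosed_acyclicHom (V : C) :
    ExtClosed (fun X : Ho k C => AcyclicHom k V X.as.obj) where
  zero {X} hX m n l h h' f _ := by
    refine ⟨0, ?_⟩
    rw [map_zero, ← DGCategory.id_comp (k := k) (zero_add n) f]
    have : DGCategory.id (k := k) X = 0 := hX
    rw [this, LinearMap.map_zero₂]
  iso {X Y} e hX m n l h h' f hf := by
    obtain ⟨⟨X⟩⟩ := X
    obtain ⟨⟨Y⟩⟩ := Y
    obtain ⟨x, x', hx, hx', -, -, -, x₂⟩ := exists_representatives e
    rw [hm_comp, ← hm_id] at x₂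
    obtain ⟨α, hα⟩ := hm_eq_iff.1 x₂
    obtain ⟨u, hu⟩ := hX m n l h h' (comp (zero_add n) x' f) (by
      rw [d_comp_left_zero hx' h' _ (zero_add l), hf, map_zero])
    obtain rfl : n + 1 = l := h'
    -- `d (x u) = x x' f`, and the homotopy `α` between `x x'` and the identity corrects this to
    -- `f`.
    refine ⟨comp (zero_add m) x u - comp (by omega : -1 + n = m) α f, ?_⟩
    rw [map_sub, d_comp_left_zero hx h _ (zero_add n), hu,
      d_comp_right hf (neg_add_cancel 1) h _ (zero_add n), hα, ← act_inj]
    simp [act_sub, act_comp, act_idd]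
  shift {n' m' X S} e hX m n l h h' f hf := by
    obtain rfl : n + 1 = l := h'
    obtain ⟨u, hu⟩ := hX (m' + m) (m' + n) (m' + n + 1) (by omega) rfl
      (comp rfl e.b f) (HIso.d_comp_closed _ _ _ (e.d_b _) hf _)
    have := e.h
    refine ⟨sgn k n' • comp (by omega) e.a u, ?_⟩
    rw [map_smul, d_comp_left (e.d_a rfl) (m := m' + n) (by omega) h _ (by omega), hu, smul_smul,
      sgn_mul_self, one_smul, ← act_inj]
    simp [act_comp]
  ext {Y Z X} e hY hX m n l h h' f hf := by
    obtain rfl : n + 1 = l := h'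
    obtain ⟨u, hu⟩ := hX m n (n + 1) h rfl (comp (zero_add n) e.π f) (by
      rw [d_comp_left_zero e.d_π rfl _ (zero_add _), hf, map_zero])
    -- Subtracting the boundary of `s u` kills the image of the cocycle in `X`; what remains comes
    -- from `Y`.
    let f₁ := f - d h (comp (zero_add m) e.s u)
    have hf₁ : d rfl f₁ = 0 := by
      rw [map_sub, hf, zero_sub, neg_eq_zero]
      exact DGCategory.d_d _ _ _
    have h₁ : comp (zero_add n) e.π f₁ = 0 := by
      have h₂ : d h (comp (zero_add m) e.π (comp (zero_add m) e.s u)) = d h u := by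
        congr 1
        rw [← act_inj]
        simp [act_comp]
      rw [d_comp_left_zero e.d_π h _ (zero_add n)] at h₂
      rw [map_sub, h₂, hu, sub_self]
    have h₃ : comp (zero_add n) e.i (comp (zero_add n) e.r f₁) = f₁ := by
      rw [← act_inj, act_comp] at h₁ ⊢
      rw [act_comp, Category.assoc, e.act_r_i, Preadditive.comp_sub, reassoc_of% h₁]
      simp [act_zero]
    obtain ⟨w, hw⟩ := hY m n (n + 1) h rfl (comp (zero_add n) e.r f₁) (by
      -- Although `r` is not closed, `r f₁` is a cocycle: `i` is closed and has a graded retraction,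
      -- and `i r f₁ = f₁`.
      have h₄ : comp (zero_add _) e.i (d rfl (comp (zero_add n) e.r f₁)) = 0 := by
        rw [← d_comp_left_zero e.d_i rfl (zero_add n), h₃, hf₁]
      have h₅ := congrArg (comp (zero_add _) e.r) h₄
      rw [map_zero, ← act_inj] at h₅
      rw [← act_inj]
      simpa [act_comp] using h₅)
    refine ⟨comp (zero_add m) e.s u + comp (zero_add m) e.i w, ?_⟩
    rw [map_add, d_comp_left_zero e.d_i h _ (zero_add n), hw, h₃]
    simp [f₁]

/-- Acyclicity of the complexes of morphisms to a fixed object. -/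
theorem extClosed_acyclicHom' (V : C) :
    ExtClosed (fun X : Ho k C => AcyclicHom k X.as.obj V) :=
  (extClosed_acyclicHom (k := k) (C := DGOp C) ⟨V⟩).unop

/-- A cocycle of degree `n` on `X` is a closed morphism of degree `0` on a shift of `X`, which is
again in `Q`; orthogonality provides a homotopy, and shifting back gives the primitive. -/
theorem acyclicHom_of_rightOrthogonal (hC : SPretr k C) {Q : ObjectProperty (Ho k C)}
    (hQ : ExtClosed Q) {X L : C} (hX : Q ⟨⟨X⟩⟩) (hL : Q.rightOrthogonal ⟨⟨L⟩⟩) :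
    AcyclicHom k X L := by
  intro m n l h h' f hf
  obtain rfl : n + 1 = l := h'
  obtain ⟨S, ⟨e⟩⟩ := hC.shift X n (-n) (by omega)
  have c : d (zero_add 1) (comp (add_neg_cancel n) f e.b) = 0 :=
    HIso.d_comp_closed _ _ _ hf (e.d_b _) _
  obtain ⟨u, hu⟩ := hm_eq_iff.1 ((hL (hm _ c) (hQ.shift e hX)).trans (hm_zero _ _).symm)
  refine ⟨comp (by omega : -1 + n = m) u e.a, ?_⟩
  rw [d_comp_right (e.d_a rfl) (neg_add_cancel 1) h _ (zero_add n), hu, ← act_inj]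
  simp [act_comp]

theorem hm_eq_zero_of_acyclicHom {X L : C} (h : AcyclicHom k X L)
    (f : (⟨⟨X⟩⟩ : Ho k C) ⟶ ⟨⟨L⟩⟩) : f = 0 := by
  obtain ⟨f, hf, rfl⟩ := hm_surjective f
  obtain ⟨u, hu⟩ := h (-1) 0 1 (neg_add_cancel 1) (zero_add 1) f hf
  rw [← hm_zero]
  exact hm_eq_iff.2 ⟨u, by rw [hu, sub_zero]⟩

/-- Objects to which the quotient of an extension has no morphisms are local for its inclusion. -/
theorem Ext.bijective_of_acyclicHom {Y Z X L : C} (e : Ext k Y Z X) (h : AcyclicHom k X L) :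
    Function.Bijective (fun g : (⟨⟨Z⟩⟩ : Ho k C) ⟶ ⟨⟨L⟩⟩ => hm e.i e.d_i ≫ g) := by
  constructor
  · intro g g' hg
    rw [← sub_eq_zero]
    have hg' : hm e.i e.d_i ≫ (g - g') = 0 := by
      rw [Preadditive.comp_sub, sub_eq_zero]
      exact hg
    generalize g - g' = g at hg'
    obtain ⟨g, cg, rfl⟩ := hm_surjective g
    rw [hm_comp, ← hm_zero] at hg'
    obtain ⟨u, hu⟩ := act_of_hm_eq hg'
    have cg' := (closed_zero_iff _ _).1 cg
    simp only [act_comp, act_zero, sub_zero] at hu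
    -- A null-homotopy `u` of `g i` makes `g` on the complement `X` closed after subtracting `u δ`;
    -- by acyclicity this is a boundary, and `u`, `w` form a null-homotopy of `g`.
    have c : d (zero_add 1) (comp (zero_add 0) g e.s - comp (neg_add_cancel 1) u e.δ) = 0 := by
      rw [closed_zero_iff]
      simp [act_comp, act_sub, cg', hu]
      abel
    obtain ⟨w, hw⟩ := h (-1) 0 1 (neg_add_cancel 1) (zero_add 1) _ c
    rw [← act_inj, act_d_neg_one, ← eq_sub_iff_add_eq] at hw
    rw [← hm_zero]
    refine hm_eq_of_act (comp (add_zero (-1)) u e.r + comp (add_zero (-1)) w e.π) ?_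
    simp [act_comp, act_sub, act_add, act_zero, hu, hw]
    abel
  · intro f
    obtain ⟨f, hf, rfl⟩ := hm_surjective f
    have hf' := (closed_zero_iff _ _).1 hf
    -- The obstruction to extending `f` is the cocycle `f δ`; a primitive of it serves as the
    -- component of the extension on `X`.
    obtain ⟨u, hu⟩ := h 0 1 2 (zero_add 1) (by norm_num) (comp (zero_add 1) f e.δ)
      (HIso.d_comp_closed _ _ _ hf (e.d_δ _) _)
    rw [← act_inj, act_d_zero, act_comp, sub_eq_iff_eq_add] at hu
    have c : d (zero_add 1) (comp (zero_add 0) f e.r + comp (zero_add 0) u e.π) = 0 := by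
      rw [closed_zero_iff]
      simp [act_add, act_comp, hf', hu]
      abel
    refine ⟨hm _ c, ?_⟩
    dsimp only
    rw [hm_comp]
    exact hm_eq_of_act 0 (by simp [act_add, act_comp, act_zero])

end acyclic
end DG

namespace DG

/-! ### Morphisms with cone in a given class: locality, Ore condition, fractions -/

section localization

variable {k : Type w} [CommRing k] {C : Type u} [DGCategory.{v} k C]

/-- The morphisms of the homotopy category that are isomorphic to the inclusion of an extension
with quotient in `Q`. -/
def extW (Q : ObjectProperty (Ho k C)) : MorphismProperty (Ho k C) := fun U V u =>
  ∃ (Y Z X : C) (e : Ext k Y Z X) (a : U ≅ ⟨⟨Y⟩⟩) (b : V ≅ ⟨⟨Z⟩⟩),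
    u ≫ b.hom = a.hom ≫ hm e.i e.d_i ∧ Q ⟨⟨X⟩⟩

/-- The morphisms of the homotopy category that are isomorphic to the projection of an extension
with subobject in `Q`. -/
def coextW (Q : ObjectProperty (Ho k C)) : MorphismProperty (Ho k C) := fun U V u =>
  ∃ (Y Z X : C) (e : Ext k Y Z X) (a : U ≅ ⟨⟨Z⟩⟩) (b : V ≅ ⟨⟨X⟩⟩),
    u ≫ b.hom = a.hom ≫ hm e.π e.d_π ∧ Q ⟨⟨Y⟩⟩

theorem extW_i {Q : ObjectProperty (Ho k C)} {X Y Z : C} (e : Ext k Y Z X) (h : Q ⟨⟨X⟩⟩) :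
    extW Q (hm e.i e.d_i) :=
  ⟨Y, Z, X, e, Iso.refl _, Iso.refl _, by simp, h⟩

theorem bijective_comp_of_extW {Q : ObjectProperty (Ho k C)} {U V : Ho k C} {u : U ⟶ V}
    (hu : extW Q u) (L : C) (hL : ∀ X : C, Q ⟨⟨X⟩⟩ → AcyclicHom k X L) :
    Function.Bijective (fun g : V ⟶ ⟨⟨L⟩⟩ => u ≫ g) := by
  obtain ⟨Y, Z, X, e, a, b, h, hX⟩ := hu
  have h' : u = a.hom ≫ hm e.i e.d_i ≫ b.inv := by
    rw [← Category.assoc, ← h, Category.assoc, b.hom_inv_id, Category.comp_id]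
  have : (fun g : V ⟶ ⟨⟨L⟩⟩ => u ≫ g) =
      (fun g => a.hom ≫ g) ∘ (fun g => hm e.i e.d_i ≫ g) ∘ (fun g => b.inv ≫ g) := by
    funext g
    simp [h']
  rw [this]
  refine Function.Bijective.comp ?_ ((e.bijective_of_acyclicHom (hL X hX)).comp ?_)
  · exact ⟨fun x y h => (cancel_epi a.hom).1 h, fun x => ⟨a.inv ≫ x, by simp⟩⟩
  · exact ⟨fun x y h => (cancel_epi b.inv).1 h, fun x => ⟨b.hom ≫ x, by simp⟩⟩

/-- Orthogonality at the level of homotopy classes must first be upgraded to acyclicity in all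
degrees, because the obstruction to extending a map has degree `1`. -/
theorem rightOrthogonal_le_isLocal (hC : SPretr k C) {Q : ObjectProperty (Ho k C)}
    (hQ : ExtClosed Q) : Q.rightOrthogonal ≤ (extW Q).isLocal := fun L hL _ _ _ hu =>
  bijective_comp_of_extW hu L.as.obj fun _ hX => acyclicHom_of_rightOrthogonal hC hQ hX hL

/-- The square is the pushout of the extension along `f`: its class is `f δ`, and its quotient is
the same object of `Q`. -/
theorem oreCondition_extW (hC : SPretr k C) (Q : ObjectProperty (Ho k C)) :
    Localization.OreCondition (extW Q) := by
  rintro U V X' u f ⟨Y, Z, X, e, a, b, h, hX⟩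
  obtain ⟨⟨X'⟩⟩ := X'
  obtain ⟨f', hf', ef⟩ := hm_surjective (a.inv ≫ f)
  obtain ⟨Z', e', he'⟩ := hC.ext X X' (comp (zero_add 1) f' e.δ)
    (HIso.d_comp_closed _ _ _ hf' (e.d_δ _) _)
  obtain ⟨z, hz, h₁, -⟩ := e.exists_map e' f' (idd k X) hf' (d_id _ _) 0 (by
    simp [act_zero, act_idd, he', act_comp])
  refine ⟨⟨⟨Z'⟩⟩, hm e'.i e'.d_i, b.hom ≫ hm z hz, extW_i e' hX, ?_⟩
  have h₂ : hm e.i e.d_i ≫ hm z hz = hm f' hf' ≫ hm e'.i e'.d_i := by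
    rw [hm_comp, hm_comp]
    exact hm_eq_of_act 0 (by simp [act_zero, act_comp, h₁])
  rw [reassoc_of% h, h₂, ← ef]
  simp

variable {D₀ : Type u'} [DGCategory.{v'} k D₀] {D : Type u} [DGCategory.{v} k D]

/-- The image of a morphism in `extW`. -/
theorem extW_map (Φ : DGFunctor k D₀ D) {Q₀ : ObjectProperty (Ho k D₀)}
    {Q : ObjectProperty (Ho k D)} (hQ : Q₀ ≤ Q.inverseImage Φ.ho) {U V : Ho k D₀} {u : U ⟶ V}
    (hu : extW Q₀ u) : extW Q (Φ.ho.map u) := by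
  obtain ⟨Y, Z, X, e, a, b, h, hX⟩ := hu
  refine ⟨_, _, _, e.map Φ, Φ.ho.mapIso a, Φ.ho.mapIso b, ?_, hQ _ hX⟩
  have := congrArg Φ.ho.map h
  rw [Functor.map_comp, Functor.map_comp] at this
  exact this

/-- Each morphism from the image of `Φ` to an object of `Q` factors through the image of an object
of `Q₀`. -/
def FactorsThrough (Φ : DGFunctor k D₀ D) (Q₀ : ObjectProperty (Ho k D₀))
    (Q : ObjectProperty (Ho k D)) : Prop :=
  ∀ (X : D₀) (Z : D) (f : Hom k (Φ.obj X) Z 0), d (zero_add 1) f = 0 → Q ⟨⟨Z⟩⟩ →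
    ∃ (Z₀ : D₀) (x : Hom k X Z₀ 0) (z : Hom k (Φ.obj Z₀) Z 0) (κ : Hom k (Φ.obj X) Z (-1)),
      Q₀ ⟨⟨Z₀⟩⟩ ∧ d (zero_add 1) x = 0 ∧ d (zero_add 1) z = 0 ∧
        d (neg_add_cancel 1) κ = f - comp (zero_add 0) z (Φ.map x)

section criterion

variable {Φ : DGFunctor k D₀ D} {Q₀ : ObjectProperty (Ho k D₀)} {Q : ObjectProperty (Ho k D)}

/-- The composite of `f` with the projection to `K` factors up to homotopy through some `Z₀` in
`Q₀`. The pullback of the extension to `Z₀` has its class between objects in the image of `Φ`, so it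
comes from an extension `Y → Y' → Z₀` in `D₀`, and `f` factors through `Y'`. This is the source of
fullness. -/
theorem exists_lift_of_factorsThrough (hΦ : Φ.FF) (hD₀ : SPretr k D₀) (hF : FactorsThrough Φ Q₀ Q)
    {Y : D₀} {L K : D} (e : Ext k (Φ.obj Y) L K) (hK : Q ⟨⟨K⟩⟩) {X : D₀}
    (f : Φ.ho.obj ⟨⟨X⟩⟩ ⟶ ⟨⟨L⟩⟩) (η : Φ.ho.obj ⟨⟨Y⟩⟩ ⟶ ⟨⟨L⟩⟩) (hη : η = hm e.i e.d_i) :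
    ∃ (Y' : Ho k D₀) (s : (⟨⟨Y⟩⟩ : Ho k D₀) ⟶ Y') (g : (⟨⟨X⟩⟩ : Ho k D₀) ⟶ Y')
      (h : Φ.ho.obj Y' ⟶ ⟨⟨L⟩⟩),
      extW Q₀ s ∧ Φ.ho.map s ≫ h = η ∧ Φ.ho.map g ≫ h = f := by
  subst hη
  obtain ⟨f, hf, rfl⟩ := hm_surjective (X := Φ.obj X) f
  have cf := (closed_zero_iff _ _).1 hf
  obtain ⟨Z₀, x, z, κ, hZ₀, hx, hz, hκ⟩ := hF X K (comp (zero_add 0) e.π f) (closed_comp e.d_π hf) hK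
  rw [← act_inj, act_d_neg_one, act_sub, act_comp, act_comp, ← eq_sub_iff_add_eq] at hκ
  have cz := (closed_zero_iff _ _).1 hz
  have cx := (closed_zero_iff _ _).1 hx
  have cΦx := (closed_zero_iff (zero_add 1) (Φ.map x)).1 (by rw [← Φ.map_d, hx, map_zero])
  obtain ⟨w, hw⟩ := (hΦ Z₀ Y 1).2 (comp (add_zero 1) e.δ z)
  obtain ⟨Y', e₁, rfl⟩ := hD₀.ext Z₀ Y w (hΦ.d_eq_zero _ (by
    rw [hw]; exact HIso.d_comp_closed _ _ _ (e.d_δ _) hz _))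
  have hw' : act (e₁.map Φ).δ = act z ≫ act e.δ := by
    rw [← act_comp (add_zero 1), ← hw]; rfl
  -- The `Y`-component of `f`, corrected by the homotopy `κ` so that together with `x` it is a
  -- closed map to `Y'`.
  obtain ⟨y, hy⟩ := (hΦ X Y 0).2 (comp (zero_add 0) e.r f - comp (add_neg_cancel 1) e.δ κ)
  have hy' : act (Φ.map y) = act f ≫ act e.r - act κ ≫ act e.δ := by
    rw [hy, act_sub, act_comp, act_comp]
  have hg : d (zero_add 1) (comp (zero_add 0) e₁.i y + comp (zero_add 0) e₁.s x) = 0 := by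
    refine hΦ.d_eq_zero _ ?_
    rw [map_add, Φ.map_comp, Φ.map_comp, closed_zero_iff]
    change act (comp _ (e₁.map Φ).i _ + comp _ (e₁.map Φ).s _) ≫ _ =
      _ ≫ act (comp _ (e₁.map Φ).i _ + comp _ (e₁.map Φ).s _)
    simp [act_comp, act_add, hy', hw', reassoc_of% cf, reassoc_of% cΦx, reassoc_of% hκ]
    abel
  have hh : d (zero_add 1) (comp (zero_add 0) e.i (e₁.map Φ).r +
      comp (zero_add 0) e.s (comp (zero_add 0) z (e₁.map Φ).π)) = 0 := by
    rw [closed_zero_iff]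
    simp [act_comp, act_add, hw', reassoc_of% cz]
  refine ⟨⟨⟨Y'⟩⟩, hm e₁.i e₁.d_i, hm _ hg, hm _ hh, extW_i e₁ hZ₀, ?_, ?_⟩
  · change hm (e₁.map Φ).i (e₁.map Φ).d_i ≫ _ = _
    rw [hm_comp]
    exact hm_eq_of_act 0 (by simp [act_zero, act_comp, act_add])
  · change hm (Φ.map (comp (zero_add 0) e₁.i y + comp (zero_add 0) e₁.s x))
      (by rw [← Φ.map_d, hg, map_zero]) ≫ _ = _
    rw [hm_comp]
    refine (hm_eq_of_act (comp (zero_add (-1)) e.s κ) ?_).symm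
    rw [act_comp (zero_add 0), map_add, Φ.map_comp, Φ.map_comp]
    change _ = _ - act (comp _ (e₁.map Φ).i _ + comp _ (e₁.map Φ).s _) ≫ _
    simp [act_comp, act_add, hy', reassoc_of% hκ]
    abel

/-- A homotopy `κ` between `f` and `g` in `L` projects to a closed map of degree `-1` to `K`, that
is, to a map to a shift of `K`. Its factorization through `Z₀` in `Q₀` shows that `f - g` factors up
to homotopy through `Z₀ → Y`, and the inclusion of `Y` into the cone of that map equalizes `f` and
`g`. This is the source of faithfulness. -/
theorem exists_coequalizing_of_factorsThrough (hΦ : Φ.FF) (hD₀ : SPretr k D₀) (hD : SPretr k D)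
    (hQ₀ : ExtClosed Q₀) (hQ : ExtClosed Q) (hF : FactorsThrough Φ Q₀ Q)
    {Y : D₀} {L K : D} (e : Ext k (Φ.obj Y) L K) (hK : Q ⟨⟨K⟩⟩) {X : D₀}
    (f g : (⟨⟨X⟩⟩ : Ho k D₀) ⟶ ⟨⟨Y⟩⟩)
    (hfg : Φ.ho.map f ≫ hm e.i e.d_i = Φ.ho.map g ≫ hm e.i e.d_i) :
    ∃ (Y' : Ho k D₀) (s : ⟨⟨Y⟩⟩ ⟶ Y'), extW Q₀ s ∧ f ≫ s = g ≫ s := by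
  obtain ⟨f, hf, rfl⟩ := hm_surjective f
  obtain ⟨g, hg, rfl⟩ := hm_surjective g
  obtain ⟨κ, hκ⟩ := act_of_hm_eq (show hm (comp (zero_add 0) e.i (Φ.map f)) _ =
    hm (comp (zero_add 0) e.i (Φ.map g)) _ from hfg)
  rw [act_comp, act_comp] at hκ
  have cf := (closed_zero_iff (zero_add 1) (Φ.map f)).1 (by rw [← Φ.map_d, hf, map_zero])
  have cg := (closed_zero_iff (zero_add 1) (Φ.map g)).1 (by rw [← Φ.map_d, hg, map_zero])
  obtain ⟨K₁, ⟨a⟩⟩ := hD.shift K 1 (-1) (by norm_num)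
  have a₁ := a.act_a_d
  have a₂ := a.act_b_d
  simp at a₁ a₂
  -- `d κ` is a difference of maps that factor through `i`, and `π i = 0`.
  have c₁ : d (zero_add 1) (comp (add_neg_cancel 1) a.a (comp (zero_add (-1)) e.π κ)) = 0 := by
    rw [closed_zero_iff]
    simp [act_comp, a₁, reassoc_of% hκ]
  obtain ⟨Z₀, x, z, l, hZ₀, hx, hz, hl⟩ := hF X K₁ _ c₁ (hQ.shift a hK)
  rw [← act_inj, act_d_neg_one, act_sub, act_comp, act_comp, act_comp, ← eq_sub_iff_add_eq] at hl
  have cz := (closed_zero_iff _ _).1 hz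
  have cx := (closed_zero_iff _ _).1 hx
  obtain ⟨w, hw⟩ := (hΦ Z₀ Y 0).2 (comp (by norm_num) e.δ (comp (add_zero (-1)) a.b z))
  have hw' : act (Φ.map w) = act z ≫ act a.b ≫ act e.δ := by
    rw [hw, act_comp, act_comp, Category.assoc]
  have cw' : d (zero_add 1) w = 0 := by
    refine hΦ.d_eq_zero _ ?_
    rw [closed_zero_iff, hw']
    simp [reassoc_of% a₂, reassoc_of% cz]
  have cw := (closed_zero_iff _ _).1 cw'
  -- The boundary of `r κ` is `f - g - δ π κ`. The second term replaces `δ π κ` by `w x`, so `θ` is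
  -- a homotopy from `f - g` to `w x`.
  obtain ⟨θ, hθ⟩ := (hΦ X Y (-1)).2 (comp (zero_add (-1)) e.r κ +
    comp (by norm_num) e.δ (comp (by norm_num : -1 + -1 = (-2 : ℤ)) a.b l))
  have hθ' : d (neg_add_cancel 1) θ = f - g - comp (zero_add 0) w x := by
    apply (hΦ X Y 0).1
    rw [Φ.map_d, hθ, map_sub, map_sub, Φ.map_comp, ← act_inj, act_d_neg_one]
    simp [act_add, act_sub, act_comp, hw', reassoc_of% hκ, reassoc_of% a₂, reassoc_of% hl]
    abel
  rw [← act_inj, act_d_neg_one, act_sub, act_sub, act_comp, ← eq_sub_iff_add_eq] at hθ'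
  obtain ⟨Z₁, ⟨σ⟩⟩ := hD₀.shift Z₀ (-1) 1 (by norm_num)
  have s₁ := σ.act_a_d
  have s₂ := σ.act_b_d
  simp at s₁ s₂
  -- With `w`, precomposed by a shift, as class, `Y'` is the cone of `w`; hence `w` becomes
  -- null-homotopic in it.
  obtain ⟨Y', e₁, he₁⟩ := hD₀.ext Z₁ Y (comp (zero_add 1) w σ.b)
    (HIso.d_comp_closed _ _ _ cw' (σ.d_b _) _)
  have he₁' : act e₁.δ = act σ.b ≫ act w := by rw [he₁, act_comp]
  refine ⟨⟨⟨Y'⟩⟩, hm e₁.i e₁.d_i, extW_i e₁ (hQ₀.shift σ hZ₀), ?_⟩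
  rw [hm_comp, hm_comp]
  refine hm_eq_of_act (comp (zero_add (-1)) e₁.i θ +
    comp (zero_add (-1)) e₁.s (comp (add_zero (-1)) σ.a x)) ?_
  simp [act_add, act_comp, he₁', reassoc_of% hθ', reassoc_of% s₁, reassoc_of% cx]
  try abel

end criterion

end localization
end DG

namespace DG

/-! ### Duality between inclusions and projections -/

section opposite

variable {T T' : Type*} [Category T] [Category T']

theorem full_unop (G : Tᵒᵖ ⥤ T'ᵒᵖ) [G.Full] : G.unop.Full where
  map_surjective {X Y} f := by
    obtain ⟨g, hg⟩ := G.map_surjective (X := Opposite.op Y) (Y := Opposite.op X) f.op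
    exact ⟨g.unop, congrArg Quiver.Hom.unop hg⟩

theorem faithful_unop (G : Tᵒᵖ ⥤ T'ᵒᵖ) [G.Faithful] : G.unop.Faithful where
  map_injective {X Y} f g h := by
    have := G.map_injective (X := Opposite.op Y) (Y := Opposite.op X) (a₁ := f.op) (a₂ := g.op)
      (congrArg Quiver.Hom.op h)
    exact congrArg Quiver.Hom.unop this

theorem isEquivalence_of_op {F : T ⥤ T'} (h : F.op.IsEquivalence) : F.IsEquivalence where
  faithful := faithful_unop F.op
  full := full_unop F.op
  essSurj := ⟨fun Y => ⟨(F.op.objPreimage (Opposite.op Y)).unop,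
    ⟨(F.op.objObjPreimageIso (Opposite.op Y)).unop.symm⟩⟩⟩

end opposite

section duality

variable {k : Type w} [CommRing k] {C : Type u} [DGCategory.{v} k C]

variable (k C) in
/-- The homotopy category of the dual DG category is the opposite of the homotopy category. -/
def opHo : Ho k (DGOp C) ⥤ (Ho k C)ᵒᵖ :=
  CategoryTheory.Quotient.lift _
    { obj := fun X => Opposite.op ⟨⟨X.obj.unop⟩⟩
      map := fun {X Y} f => (hm (X := Y.obj.unop) (Y := X.obj.unop) f.1 f.2).op
      map_id := fun X => rfl
      map_comp := fun {X Y Z} f g => by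
        refine congrArg (fun x : (⟨Z.obj.unop⟩ : Z0 k C) ⟶ ⟨X.obj.unop⟩ =>
          ((CategoryTheory.Quotient.functor (homotopic k C)).map x).op) (Subtype.ext ?_)
        exact Ext.op_comp_zero_left _ _ _ } (by
    rintro X Y f g ⟨h, hh⟩
    exact congrArg Quiver.Hom.op (hm_eq_iff.2 ⟨h, hh⟩))

instance : (opHo k C).Full where
  map_surjective {X Y} u := by
    obtain ⟨⟨⟨X⟩⟩⟩ := X
    obtain ⟨⟨⟨Y⟩⟩⟩ := Y
    obtain ⟨f, hf, e⟩ := hm_surjective (X := Y) (Y := X) u.unop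
    exact ⟨hm (X := (⟨X⟩ : DGOp C)) (Y := ⟨Y⟩) f hf, congrArg Quiver.Hom.op e.symm⟩

instance : (opHo k C).Faithful where
  map_injective {X Y} a b hab := by
    obtain ⟨⟨⟨X⟩⟩⟩ := X
    obtain ⟨⟨⟨Y⟩⟩⟩ := Y
    obtain ⟨f, hf, rfl⟩ := hm_surjective a
    obtain ⟨g, hg, rfl⟩ := hm_surjective b
    obtain ⟨h, hh⟩ := hm_eq_iff.1 (Quiver.Hom.op_inj
      (show (hm (X := Y) (Y := X) f hf).op = (hm (X := Y) (Y := X) g hg).op from hab))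
    exact hm_eq_iff.2 ⟨h, hh⟩

instance : (opHo k C).EssSurj where
  mem_essImage X := ⟨⟨⟨⟨X.unop.as.obj⟩⟩⟩, ⟨Iso.refl _⟩⟩

instance : (opHo k C).IsEquivalence where

/-- The functors induced by a DG functor and by its dual correspond. -/
def opHoCompIso {D : Type u'} [DGCategory.{v'} k D] (F : DGFunctor k C D) :
    F.op.ho ⋙ opHo k D ≅ opHo k C ⋙ F.ho.op :=
  NatIso.ofComponents (fun _ => Iso.refl _) (by
    rintro ⟨⟨⟨X⟩⟩⟩ ⟨⟨⟨Y⟩⟩⟩ u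
    obtain ⟨f, hf, rfl⟩ := hm_surjective u
    exact (Category.comp_id _).trans (Category.id_comp _).symm)

/-- The dual of an extension exchanges inclusion and projection, and also subobject and quotient. -/
theorem coextW_of_extW_opProp {Q : ObjectProperty (Ho k C)} {U V : Ho k (DGOp C)} {u : U ⟶ V}
    (hu : extW (opProp Q) u) : coextW Q ((opHo k C).map u).unop := by
  obtain ⟨Y, Z, X, e, a, b, h, hX⟩ := hu
  refine ⟨X.unop, Z.unop, Y.unop, e.unop, ((opHo k C).mapIso b).unop.symm,
    ((opHo k C).mapIso a).unop.symm, ?_, hX⟩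
  have h' := congrArg (fun x => ((opHo k C).map x).unop) h
  simp only [Functor.map_comp, unop_comp] at h'
  change _ ≫ ((opHo k C).map a.inv).unop = ((opHo k C).map b.inv).unop ≫ _
  have h₂ : hm e.unop.π e.unop.d_π = ((opHo k C).map (hm e.i e.d_i)).unop := rfl
  have h₃ : ((opHo k C).map a.hom).unop ≫ ((opHo k C).map a.inv).unop = 𝟙 _ := by
    rw [← unop_comp, ← Functor.map_comp, a.inv_hom_id]; simp
  have h₄ : ((opHo k C).map b.inv).unop ≫ ((opHo k C).map b.hom).unop = 𝟙 _ := by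
    rw [← unop_comp, ← Functor.map_comp, b.hom_inv_id]; simp
  rw [h₂, ← Category.comp_id (((opHo k C).map (hm e.i e.d_i)).unop)]
  have h₅ := congrArg (fun x => ((opHo k C).map b.inv).unop ≫ x ≫ ((opHo k C).map a.inv).unop) h'
  simp only [Category.assoc] at h₅
  rw [h₃, ← Category.assoc, h₄, Category.id_comp] at h₅
  exact h₅

theorem extW_opProp_of_coextW {Q : ObjectProperty (Ho k C)} {U V : Ho k C} {u : U ⟶ V}
    (hu : coextW Q u) : extW (opProp Q) ((opHo k C).inv.map u.op) := by
  obtain ⟨Y, Z, X, e, a, b, h, hY⟩ := hu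
  let E := (opHo k C).asEquivalence
  let a' : E.inverse.obj (Opposite.op V) ≅ (⟨⟨⟨X⟩⟩⟩ : Ho k (DGOp C)) :=
    (opHo k C).preimageIso (E.counitIso.app _ ≪≫ b.op.symm)
  let b' : E.inverse.obj (Opposite.op U) ≅ (⟨⟨⟨Z⟩⟩⟩ : Ho k (DGOp C)) :=
    (opHo k C).preimageIso (E.counitIso.app _ ≪≫ a.op.symm)
  refine ⟨⟨X⟩, ⟨Z⟩, ⟨Y⟩, e.op, a', b', (opHo k C).map_injective ?_, hY⟩
  have hn := E.counitIso.hom.naturality u.op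
  have h' : u.op ≫ a.inv.op = b.inv.op ≫ (hm e.π e.d_π).op := by
    rw [← op_comp, ← op_comp]
    congr 1
    rw [Iso.inv_comp_eq, ← Category.assoc, ← h]
    simp
  have ha : (opHo k C).map a'.hom = E.counitIso.hom.app _ ≫ b.inv.op :=
    (opHo k C).map_preimage _
  have hb : (opHo k C).map b'.hom = E.counitIso.hom.app _ ≫ a.inv.op :=
    (opHo k C).map_preimage _
  refine ((opHo k C).map_comp _ _).trans (Eq.trans ?_ ((opHo k C).map_comp _ _).symm)
  refine (congrArg ((opHo k C).map ((opHo k C).inv.map u.op) ≫ ·) hb).trans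
    (Eq.trans ?_ (congrArg (· ≫ (opHo k C).map (hm e.op.i e.op.d_i)) ha).symm)
  refine (Category.assoc _ _ _).symm.trans ((congrArg (· ≫ a.inv.op) hn).trans ?_)
  refine (Category.assoc _ _ _).trans ((congrArg (E.counitIso.hom.app (Opposite.op V) ≫ ·) h').trans ?_)
  exact (Category.assoc _ _ _).symm

/-- This turns each statement about localization at inclusions for the dual DG category into one
about localization at projections; the left-hand criteria below rest on it. -/
theorem isLocalization_opHo {E : Type*} [Category E] {Q : ObjectProperty (Ho k C)} (L : Ho k C ⥤ E)
    [L.IsLocalization (coextW Q)] : (opHo k C ⋙ L.op).IsLocalization (extW (opProp Q)) := by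
  refine Functor.IsLocalization.of_equivalence_source L.op (coextW Q).op (opHo k C ⋙ L.op) _
    (opHo k C).asEquivalence.symm ?_ ?_ ?_
  · intro U V u hu
    exact MorphismProperty.le_isoClosure _ _ (extW_opProp_of_coextW hu)
  · intro U V u hu
    have := Localization.inverts L (coextW Q) _ (coextW_of_extW_opProp hu)
    exact inferInstanceAs (IsIso (L.map ((opHo k C).map u).unop).op)
  · exact Functor.isoWhiskerRight (opHo k C).asEquivalence.counitIso L.op ≪≫ Functor.leftUnitor _

end duality

/-! ### Criteria for quotients in terms of orthogonal resolutions -/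

section criteria

variable {k : Type w} [CommRing k] {D : Type u} [DGCategory.{v} k D]

/-- Each object embeds into a right orthogonal object with quotient in `Q`. -/
def EnoughRight (Q : ObjectProperty (Ho k D)) : Prop :=
  ∀ X : D, ∃ (Z Y : D) (_ : Ext k X Z Y), Q ⟨⟨Y⟩⟩ ∧ Q.rightOrthogonal ⟨⟨Z⟩⟩

/-- Each object is a quotient of a left orthogonal object by a subobject in `Q`. -/
def EnoughLeft (Q : ObjectProperty (Ho k D)) : Prop :=
  ∀ X : D, ∃ (Z Y : D) (_ : Ext k Y Z X), Q ⟨⟨Y⟩⟩ ∧ Q.leftOrthogonal ⟨⟨Z⟩⟩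

theorem rightOrthogonal_opProp_iff {Q : ObjectProperty (Ho k D)} (Z : Ho k (DGOp D)) :
    (opProp Q).rightOrthogonal Z ↔ Q.leftOrthogonal ⟨⟨Z.as.obj.unop⟩⟩ := by
  obtain ⟨⟨⟨Z⟩⟩⟩ := Z
  constructor
  · intro h X f hX
    obtain ⟨⟨X⟩⟩ := X
    obtain ⟨f, hf, rfl⟩ := hm_surjective f
    obtain ⟨u, hu⟩ := hm_eq_iff.1 ((h (hm (X := (⟨X⟩ : DGOp D)) (Y := ⟨Z⟩) f hf) hX).trans
      (hm_zero _ _).symm)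
    rw [← hm_zero]
    exact hm_eq_iff.2 ⟨u, hu⟩
  · intro h X f hX
    obtain ⟨⟨⟨X⟩⟩⟩ := X
    obtain ⟨f, hf, rfl⟩ := hm_surjective f
    obtain ⟨u, hu⟩ := hm_eq_iff.1 ((h (hm (X := Z) (Y := X) f hf) hX).trans (hm_zero _ _).symm)
    rw [← hm_zero]
    exact hm_eq_iff.2 ⟨u, hu⟩

theorem EnoughLeft.op {Q : ObjectProperty (Ho k D)} (h : EnoughLeft Q) : EnoughRight (opProp Q) := by
  intro X
  obtain ⟨Z, Y, e, hY, hZ⟩ := h X.unop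
  exact ⟨⟨Z⟩, ⟨Y⟩, e.op, hY, (rightOrthogonal_opProp_iff _).2 hZ⟩

theorem EnoughRight.exists_extW {Q : ObjectProperty (Ho k D)} (h : EnoughRight Q) (X : Ho k D) :
    ∃ (K : Ho k D) (η : X ⟶ K), Q.rightOrthogonal K ∧ extW Q η := by
  obtain ⟨Z, Y, e, hY, hZ⟩ := h X.as.obj
  exact ⟨⟨⟨Z⟩⟩, hm e.i e.d_i, hZ, extW_i e hY⟩

theorem isEquivalence_of_enoughRight (hD : SPretr k D) {Q : ObjectProperty (Ho k D)}
    (hQ : ExtClosed Q) (h : EnoughRight Q) {T' E : Type*} [Category T'] [Category E]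
    (N : T' ⥤ Ho k D) [N.Full] [N.Faithful] (hN : N.essImage = Q.rightOrthogonal)
    (L : Ho k D ⥤ E) [L.IsLocalization (extW Q)] : (N ⋙ L).IsEquivalence :=
  Localization.isEquivalence_of_local _ (extW Q) N hN (rightOrthogonal_le_isLocal hD hQ)
    h.exists_extW L

variable {D₀ : Type u'} [DGCategory.{v'} k D₀]

/-- The resolution `Φ Y → L` with `L` right orthogonal serves as the local model of `Φ Y`; lifting
to fractions and coequalizing are the two consequences of `FactorsThrough`. -/
theorem exists_fullyFaithful_of_enoughRight (hD₀ : SPretr k D₀) (hD : SPretr k D)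
    {Φ : DGFunctor k D₀ D} (hΦ : Φ.FF) {Q₀ : ObjectProperty (Ho k D₀)} {Q : ObjectProperty (Ho k D)}
    (hQ₀ : ExtClosed Q₀) (hQ : ExtClosed Q) (hQQ : Q₀ ≤ Q.inverseImage Φ.ho)
    (hF : FactorsThrough Φ Q₀ Q) (h : EnoughRight Q) {E₀ E : Type*} [Category E₀] [Category E]
    (L₀ : Ho k D₀ ⥤ E₀) [L₀.IsLocalization (extW Q₀)] (L : Ho k D ⥤ E)
    [L.IsLocalization (extW Q)] :
    ∃ G : E₀ ⥤ E, Nonempty (L₀ ⋙ G ≅ Φ.ho ⋙ L) ∧ G.Full ∧ G.Faithful := by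
  refine Localization.exists_fullyFaithful_lift Φ.ho (extW Q₀) (extW Q) Q.rightOrthogonal L₀ L
    (rightOrthogonal_le_isLocal hD hQ) h.exists_extW (fun U V u hu L hL => ?_)
    (oreCondition_extW hD₀ Q₀) fun Y => ?_
  · exact bijective_comp_of_extW (extW_map Φ hQQ hu) L.as.obj fun _ hX =>
      acyclicHom_of_rightOrthogonal hD hQ hX hL
  · obtain ⟨⟨Y⟩⟩ := Y
    obtain ⟨L, K, e, hK, hL⟩ := h (Φ.obj Y)
    refine ⟨⟨⟨L⟩⟩, hm e.i e.d_i, hL, extW_i e hK, fun X f => ?_, fun X f g hfg => ?_⟩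
    · exact exists_lift_of_factorsThrough hΦ hD₀ hF e hK (X := X.as.obj) f _ rfl
    · exact exists_coequalizing_of_factorsThrough hΦ hD₀ hD hQ₀ hQ hF e hK (X := X.as.obj) f g hfg

/-- The right-hand criterion is applied to the dual DG category; an equivalence of opposite
categories is then dualized back. -/
theorem isEquivalence_of_enoughLeft (hD : SPretr k D) {Q : ObjectProperty (Ho k D)}
    (hQ : ExtClosed Q) (h : EnoughLeft Q) {T' E : Type*} [Category T'] [Category E]
    (N : T' ⥤ Ho k D) [N.Full] [N.Faithful] (hN : N.essImage = Q.leftOrthogonal)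
    (L : Ho k D ⥤ E) [L.IsLocalization (coextW Q)] : (N ⋙ L).IsEquivalence := by
  have := isLocalization_opHo (Q := Q) L
  have h₁ := isEquivalence_of_enoughRight hD.op hQ.op h.op (N.op ⋙ (opHo k D).inv) (by
    ext X
    rw [rightOrthogonal_opProp_iff, ← hN]
    constructor
    · rintro ⟨Y, ⟨e⟩⟩
      exact ⟨Y.unop, ⟨(((opHo k D).asEquivalence.counitIso.app _).symm ≪≫
        (opHo k D).mapIso e).unop.symm⟩⟩
    · rintro ⟨Y, ⟨e⟩⟩
      refine ⟨Opposite.op Y, ⟨(opHo k D).preimageIso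
        ((opHo k D).asEquivalence.counitIso.app _ ≪≫ e.symm.op)⟩⟩) (opHo k D ⋙ L.op)
  have e : (N.op ⋙ (opHo k D).inv) ⋙ (opHo k D ⋙ L.op) ≅ (N ⋙ L).op :=
    Functor.isoWhiskerLeft N.op (Functor.isoWhiskerRight (opHo k D).asEquivalence.counitIso L.op)
  have h₂ := Functor.isEquivalence_of_iso e
  exact isEquivalence_of_op h₂

theorem exists_fullyFaithful_of_enoughLeft (hD₀ : SPretr k D₀) (hD : SPretr k D)
    {Φ : DGFunctor k D₀ D} (hΦ : Φ.FF) {Q₀ : ObjectProperty (Ho k D₀)} {Q : ObjectProperty (Ho k D)}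
    (hQ₀ : ExtClosed Q₀) (hQ : ExtClosed Q) (hQQ : Q₀ ≤ Q.inverseImage Φ.ho)
    (hF : FactorsThrough Φ.op (opProp Q₀) (opProp Q)) (h : EnoughLeft Q)
    {E₀ E : Type*} [Category E₀] [Category E]
    (L₀ : Ho k D₀ ⥤ E₀) [L₀.IsLocalization (coextW Q₀)] (L : Ho k D ⥤ E)
    [L.IsLocalization (coextW Q)] :
    ∃ G : E₀ ⥤ E, Nonempty (L₀ ⋙ G ≅ Φ.ho ⋙ L) ∧ G.Full ∧ G.Faithful := by
  have := isLocalization_opHo (Q := Q) L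
  have := isLocalization_opHo (Q := Q₀) L₀
  obtain ⟨G, ⟨i⟩, hG₁, hG₂⟩ := exists_fullyFaithful_of_enoughRight hD₀.op hD.op hΦ.op hQ₀.op hQ.op
    (fun X hX => hQQ _ hX) hF h.op (opHo k D₀ ⋙ L₀.op) (opHo k D ⋙ L.op)
  let j : opHo k D₀ ⋙ (L₀.op ⋙ G) ≅ opHo k D₀ ⋙ (Φ.ho.op ⋙ L.op) := i ≪≫
    Functor.isoWhiskerRight (opHoCompIso Φ) L.op
  -- The equivalence `opHo` is cancelled on the left by inserting its inverse.
  let j' : L₀.op ⋙ G ≅ Φ.ho.op ⋙ L.op :=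
    (Functor.leftUnitor _).symm ≪≫
    Functor.isoWhiskerRight (opHo k D₀).asEquivalence.counitIso.symm (L₀.op ⋙ G) ≪≫
    Functor.isoWhiskerLeft (opHo k D₀).inv j ≪≫
    Functor.isoWhiskerRight (opHo k D₀).asEquivalence.counitIso (Φ.ho.op ⋙ L.op) ≪≫
    Functor.leftUnitor _
  refine ⟨G.unop, ⟨?_⟩, full_unop G, faithful_unop G⟩
  exact NatIso.removeOp (show (Φ.ho ⋙ L).op ≅ (L₀ ⋙ G.unop).op from j'.symm)

end criteria
end DG

namespace DG

/-! ### Transport of degrees, and row and column selection in twisted complexes -/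

section transport

variable {k : Type w} [CommRing k] {C : Type u} [DGCategory.{v} k C]

theorem HIso.act_b_d_zero {X S : C} (e : HIso k 0 0 X S) :
    act e.b ≫ dOp k X = dOp k S ≫ act e.b := (closed_zero_iff (zero_add 1) _).1 (e.d_b _)

/-- Replacing the quotient of an extension by an isomorphic object. -/
def Ext.ofHIso {Y Z X X' : C} (e : Ext k Y Z X) (a : HIso k 0 0 X X') : Ext k Y Z X' where
  i := e.i
  π := comp (zero_add 0) a.a e.π
  r := e.r
  s := comp (zero_add 0) e.s a.b
  δ := comp (add_zero 1) e.δ a.b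
  d_i := e.d_i
  d_π := HIso.d_comp_closed _ _ _ (a.d_a _) e.d_π _
  d_s := by
    rw [← act_inj, act_d_zero]
    simp [act_comp, reassoc_of% a.act_b_d_zero]
  d_r := by
    rw [← act_inj, act_d_zero]
    simp [act_comp, act_neg]
  i_r := e.i_r
  s_π := by rw [← act_inj]; simp [act_comp, act_idd]
  i_π := by rw [← act_inj]; simp [act_comp, act_zero]
  s_r := by rw [← act_inj]; simp [act_comp, act_zero]
  sum := by rw [← act_inj]; simp [act_comp, act_add, act_idd]

variable (k) in
/-- Change of the degree of a homogeneous morphism along an equality. -/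
def degCast {X Y : C} {n m : ℤ} (h : n = m) : Hom k X Y n →ₗ[k] Hom k X Y m :=
  h ▸ LinearMap.id

theorem degCast_rfl {X Y : C} {n : ℤ} (f : Hom k X Y n) : degCast k rfl f = f := rfl

theorem d_degCast {X Y : C} {n m n' m' : ℤ} (h : n + 1 = m) (h' : n' + 1 = m') (hn : n = n')
    (hm : m = m') (f : Hom k X Y n) : d h' (degCast k hn f) = degCast k hm (d h f) := by
  subst hn hm; rfl

theorem comp_degCast {X Y Z : C} {n m n' m' p p' : ℤ} (h : n + m = p) (h' : n' + m' = p')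
    (hn : n = n') (hm : m = m') (hp : p = p') (g : Hom k Y Z n) (f : Hom k X Y m) :
    comp h' (degCast k hn g) (degCast k hm f) = degCast k hp (comp h g f) := by
  subst hn hm hp; rfl

end transport

section selection

variable {k : Type w} [CommRing k] {C : Type u} [DGCategory.{v} k C]

/-- The tuple of the objects with indices given by `α`, with shifts `sh'`. -/
abbrev Tuple.comap (Z : Tuple C) {κ : Type} [Fintype κ] [LinearOrder κ] (α : κ → Z.ι) (sh' : κ → ℤ) :
    Tuple C := ⟨κ, fun i => Z.obj (α i), sh'⟩

variable (Z : Tuple C) {κ : Type} [Fintype κ] [LinearOrder κ] (α : κ → Z.ι) {sh' : κ → ℤ}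

variable (k) in
/-- The inclusion of the objects with indices given by `α`. -/
def selIn {n : ℤ} (h : ∀ j, sh' j = Z.sh (α j) + n) : Mat k (Z.comap α sh') Z n := fun i j p =>
  if e : α j = i then by
    subst e
    exact idAt (Z.obj (α j)) (show p.1 = 0 by
      have h₁ : p.1 + sh' j = Z.sh (α j) + n := p.2
      have := h j
      omega)
  else 0

variable (k) in
/-- The projection to the objects with indices given by `α`. -/
def selOut {m : ℤ} (h : ∀ j, Z.sh (α j) = sh' j + m) : Mat k Z (Z.comap α sh') m := fun i j p =>
  if e : α i = j then by
    subst e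
    exact idAt (Z.obj (α i)) (show p.1 = 0 by
      have h₁ : p.1 + Z.sh (α i) = sh' i + m := p.2
      have := h i
      omega)
  else 0

variable {Z α}

section

variable {n : ℤ} (h : ∀ j, sh' j = Z.sh (α j) + n)

theorem selIn_self (j : κ) (p : EntryDeg (Z.comap α sh') Z n (α j) j) (hp : p.1 = 0) :
    selIn k Z α h (α j) j p = idAt (Z.obj (α j)) hp := by
  simp [selIn]

theorem selIn_ne {i : Z.ι} {j : κ} (hij : α j ≠ i) (p : EntryDeg (Z.comap α sh') Z n i j) :
    selIn k Z α h i j p = 0 := by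
  simp [selIn, hij]

/-- One summand of the matrix product survives. The degrees of the two entries agree only up to a
proof, hence the cast. -/
theorem mul_selIn {W : Tuple C} {q r : ℤ} (hq : q + n = r) (f : Mat k Z W q) (i : W.ι) (j : κ)
    (c : EntryDeg (Z.comap α sh') W r i j) (c' : EntryDeg Z W q i (α j)) (hc : c'.1 = c.1) :
    matMul hq f (selIn k Z α h) i j c = degCast k hc (f i (α j) c') := by
  obtain ⟨c, hc₀⟩ := c
  obtain ⟨c', hc₁⟩ := c'
  dsimp only at hc
  subst hc
  refine (matMul_apply hq _ _ _ _ _ (fun s => entryDeg _ _ _ _ _) (fun s => entryDeg _ _ _ _ _)).trans ?_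
  rw [Finset.sum_eq_single (α j)]
  · have e : entryDeg Z W q i (α j) = ⟨c', hc₁⟩ := Subsingleton.elim _ _
    rw [selIn_self h _ _ (by have := h j; simp [entryDeg]; omega)]
    have : ∀ (p : EntryDeg Z W q i (α j)) (hp : p = ⟨c', hc₁⟩) (m : ℤ) (hm : p.1 + m = c') (h0 : m = 0),
        comp hm (f i (α j) p) (idAt (k := k) (Z.obj (α j)) h0) = f i (α j) ⟨c', hc₁⟩ := by
      rintro p rfl m hm rfl
      exact comp_idAt _ _ _
    exact this _ e _ _ _
  · intro s _ hs
    rw [selIn_ne h hs.symm, map_zero]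
  · simp

theorem selIn_mul (hα : Function.Injective α) {W : Tuple C} {q r : ℤ} (hq : n + q = r)
    (f : Mat k W (Z.comap α sh') q) (i : κ) (j : W.ι)
    (c : EntryDeg W Z r (α i) j) (c' : EntryDeg W (Z.comap α sh') q i j) (hc : c'.1 = c.1) :
    matMul hq (selIn k Z α h) f (α i) j c = degCast k hc (f i j c') := by
  obtain ⟨c, hc₀⟩ := c
  obtain ⟨c', hc₁⟩ := c'
  dsimp only at hc
  subst hc
  refine (matMul_apply hq _ _ _ _ _ (fun s => entryDeg _ _ _ _ _) (fun s => entryDeg _ _ _ _ _)).trans ?_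
  rw [Finset.sum_eq_single i]
  · have e : entryDeg W (Z.comap α sh') q i j = ⟨c', hc₁⟩ := Subsingleton.elim _ _
    rw [selIn_self h _ _ (by have := h i; simp [entryDeg]; omega)]
    have : ∀ (p : EntryDeg W (Z.comap α sh') q i j) (hp : p = ⟨c', hc₁⟩) (m : ℤ) (hm : m + p.1 = c')
        (h0 : m = 0),
        comp hm (idAt (k := k) (Z.obj (α i)) h0) (f i j p) = f i j ⟨c', hc₁⟩ := by
      rintro p rfl m hm rfl
      exact idAt_comp _ _ _
    exact this _ e _ _ _
  · intro s _ hs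
    rw [selIn_ne h (fun e => hs (hα e)), LinearMap.map_zero₂]
  · simp

theorem selIn_mul_of_notMem {W : Tuple C} {q r : ℤ} (hq : n + q = r)
    (f : Mat k W (Z.comap α sh') q) (i : Z.ι) (hi : ∀ s, α s ≠ i) (j : W.ι)
    (c : EntryDeg W Z r i j) :
    matMul hq (selIn k Z α h) f i j c = 0 := by
  rw [matMul_apply hq _ _ _ j _ (fun s => entryDeg _ _ _ _ _) (fun s => entryDeg _ _ _ _ _)]
  exact Finset.sum_eq_zero fun s _ => by rw [selIn_ne h (hi s), LinearMap.map_zero₂]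

theorem dNaive_selIn {m : ℤ} (hm : n + 1 = m) : dNaive hm (selIn k Z α h) = 0 := by
  funext i j c
  have hc : c.1 + sh' j = Z.sh i + m := c.2
  rw [dNaive_apply hm _ i j c (entryDeg _ _ _ _ _) (by simp [entryDeg]; omega)]
  by_cases hij : α j = i
  · subst hij
    rw [selIn_self h _ _ (by have := h j; simp [entryDeg]; omega), d_idAt, smul_zero]
    rfl
  · rw [selIn_ne h hij, map_zero, smul_zero]
    rfl

end

section

variable {m : ℤ} (h : ∀ j, Z.sh (α j) = sh' j + m)

theorem selOut_self (j : κ) (p : EntryDeg Z (Z.comap α sh') m j (α j)) (hp : p.1 = 0) :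
    selOut k Z α h j (α j) p = idAt (Z.obj (α j)) hp := by
  simp [selOut]

theorem selOut_ne {i : κ} {j : Z.ι} (hij : α i ≠ j) (p : EntryDeg Z (Z.comap α sh') m i j) :
    selOut k Z α h i j p = 0 := by
  simp [selOut, hij]

theorem selOut_mul {W : Tuple C} {q r : ℤ} (hq : m + q = r) (f : Mat k W Z q) (i : κ) (j : W.ι)
    (c : EntryDeg W (Z.comap α sh') r i j) (c' : EntryDeg W Z q (α i) j) (hc : c'.1 = c.1) :
    matMul hq (selOut k Z α h) f i j c = degCast k hc (f (α i) j c') := by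
  obtain ⟨c, hc₀⟩ := c
  obtain ⟨c', hc₁⟩ := c'
  dsimp only at hc
  subst hc
  refine (matMul_apply hq _ _ _ _ _ (fun s => entryDeg _ _ _ _ _) (fun s => entryDeg _ _ _ _ _)).trans ?_
  rw [Finset.sum_eq_single (α i)]
  · have e : entryDeg W Z q (α i) j = ⟨c', hc₁⟩ := Subsingleton.elim _ _
    rw [selOut_self h _ _ (by have := h i; simp [entryDeg]; omega)]
    have : ∀ (p : EntryDeg W Z q (α i) j) (hp : p = ⟨c', hc₁⟩) (m : ℤ) (hm : m + p.1 = c') (h0 : m = 0),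
        comp hm (idAt (k := k) (Z.obj (α i)) h0) (f (α i) j p) = f (α i) j ⟨c', hc₁⟩ := by
      rintro p rfl m hm rfl
      exact idAt_comp _ _ _
    exact this _ e _ _ _
  · intro s _ hs
    rw [selOut_ne h hs.symm, LinearMap.map_zero₂]
  · simp

theorem mul_selOut (hα : Function.Injective α) {W : Tuple C} {q r : ℤ} (hq : q + m = r)
    (f : Mat k (Z.comap α sh') W q) (i : W.ι) (j : κ)
    (c : EntryDeg Z W r i (α j)) (c' : EntryDeg (Z.comap α sh') W q i j) (hc : c'.1 = c.1) :
    matMul hq f (selOut k Z α h) i (α j) c = degCast k hc (f i j c') := by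
  obtain ⟨c, hc₀⟩ := c
  obtain ⟨c', hc₁⟩ := c'
  dsimp only at hc
  subst hc
  refine (matMul_apply hq _ _ _ _ _ (fun s => entryDeg _ _ _ _ _) (fun s => entryDeg _ _ _ _ _)).trans ?_
  rw [Finset.sum_eq_single j]
  · have e : entryDeg (Z.comap α sh') W q i j = ⟨c', hc₁⟩ := Subsingleton.elim _ _
    rw [selOut_self h _ _ (by have := h j; simp [entryDeg]; omega)]
    have : ∀ (p : EntryDeg (Z.comap α sh') W q i j) (hp : p = ⟨c', hc₁⟩) (m : ℤ) (hm : p.1 + m = c')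
        (h0 : m = 0),
        comp hm (f i j p) (idAt (k := k) (Z.obj (α j)) h0) = f i j ⟨c', hc₁⟩ := by
      rintro p rfl m hm rfl
      exact comp_idAt _ _ _
    exact this _ e _ _ _
  · intro s _ hs
    rw [selOut_ne h (fun e => hs (hα e)), map_zero]
  · simp

theorem mul_selOut_of_notMem {W : Tuple C} {q r : ℤ} (hq : q + m = r)
    (f : Mat k (Z.comap α sh') W q) (i : W.ι) (j : Z.ι) (hj : ∀ s, α s ≠ j)
    (c : EntryDeg Z W r i j) :
    matMul hq f (selOut k Z α h) i j c = 0 := by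
  rw [matMul_apply hq _ _ _ j _ (fun s => entryDeg _ _ _ _ _) (fun s => entryDeg _ _ _ _ _)]
  exact Finset.sum_eq_zero fun s _ => by rw [selOut_ne h (hj s), map_zero]

theorem dNaive_selOut {l : ℤ} (hl : m + 1 = l) : dNaive hl (selOut k Z α h) = 0 := by
  funext i j c
  have hc : c.1 + Z.sh j = sh' i + l := c.2
  rw [dNaive_apply hl _ i j c (entryDeg _ _ _ _ _) (by simp [entryDeg]; omega)]
  by_cases hij : α i = j
  · subst hij
    rw [selOut_self h _ _ (by have := h i; simp [entryDeg]; omega), d_idAt, smul_zero]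
    rfl
  · rw [selOut_ne h hij, map_zero, smul_zero]
    rfl

end

section

variable {n m : ℤ} (h : ∀ j, sh' j = Z.sh (α j) + n) (h' : ∀ j, Z.sh (α j) = sh' j + m)

theorem degCast_idAt (X : C) {n m : ℤ} (h : n = m) (hn : n = 0) (hm : m = 0) :
    degCast k h (idAt (k := k) X hn) = idAt X hm := by
  subst h; rfl

theorem selOut_mul_selIn (hα : Function.Injective α) (hm : m + n = 0) :
    matMul hm (selOut k Z α h') (selIn k Z α h) = matId (Z.comap α sh') := by
  funext i j c
  have hc : c.1 + sh' j = sh' i + 0 := c.2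
  rw [selOut_mul h' hm _ i j c ⟨c.1, by have := h' i; simp; omega⟩ rfl]
  by_cases e : i = j
  · subst e
    rw [selIn_self h _ _ (by simp; omega), matId_self (hp := by omega)]
    rfl
  · rw [selIn_ne h (fun e' => e (hα e').symm), matId_ne _ e, map_zero]

theorem selIn_mul_selOut_self (hα : Function.Injective α) (hm : n + m = 0) (i : κ) (j : Z.ι) (c) :
    matMul hm (selIn k Z α h) (selOut k Z α h') (α i) j c = matId (k := k) Z (α i) j c := by
  have hc : c.1 + Z.sh j = Z.sh (α i) + 0 := c.2
  rw [selIn_mul h hα hm _ i j c ⟨c.1, by have := h i; simp; omega⟩ rfl]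
  by_cases e : α i = j
  · subst e
    rw [selOut_self h' _ _ (by simp; omega), matId_self (hp := by omega)]
    rfl
  · rw [selOut_ne h' e, matId_ne _ e, map_zero]

theorem selOut_mul_selIn_of_disjoint {κ' : Type} [Fintype κ'] [LinearOrder κ'] {β : κ' → Z.ι}
    {sh'' : κ' → ℤ} (h'' : ∀ j, Z.sh (β j) = sh'' j + m) (hβ : ∀ i j, β i ≠ α j) (hm : m + n = 0) :
    matMul hm (selOut k Z β h'') (selIn k Z α h) = 0 := by
  funext i j c
  have hc : c.1 + sh' j = sh'' i + 0 := c.2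
  rw [selOut_mul h'' hm _ i j c ⟨c.1, by have := h'' i; simp; omega⟩ rfl,
    selIn_ne h (hβ i j).symm, map_zero]
  rfl

end

end selection

namespace Pretr

section selection

variable {k : Type w} [CommRing k] {C : Type u} [DGCategory.{v} k C]

variable (Z : Pretr k C) {κ : Type} [Fintype κ] [LinearOrder κ] (α : κ → Z.ι) {sh' : κ → ℤ}
  (q' : Mat k (Z.toTuple.comap α sh') (Z.toTuple.comap α sh') 1)
  (tr : ∀ i j p, j ≤ i → q' i j p = 0)
  (mc : dNaive one_add_one_eq_two q' + matMul one_add_one_eq_two q' q' = 0)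

/-- The naive differential of a selection matrix vanishes, so closedness compares `q` with `q'`: the
selected terms span a subcomplex (`hq'`) on which `q` restricts to `q'`, up to the sign due to the
degree (`hq`). -/
theorem d_selIn {n : ℤ} (h : ∀ j, sh' j = Z.sh (α j) + n) (hα : Function.Injective α)
    (hq : ∀ i j p p' (hp : p'.1 = p.1), Z.q (α i) (α j) p = sgn k n • degCast k hp (q' i j p'))
    (hq' : ∀ i j p, (∀ s, α s ≠ i) → Z.q i (α j) p = 0) {l : ℤ} (hl : n + 1 = l) :
    d (k := k) (X := (⟨Z.toTuple.comap α sh', q', tr, mc⟩ : Pretr k C)) (Y := Z) hl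
      (selIn k Z.toTuple α h) = 0 := by
  refine (diff_apply hl (by omega) _).trans ?_
  rw [dNaive_selIn, zero_add, sub_eq_zero]
  funext i j c
  have hc : c.1 + sh' j = Z.sh i + l := c.2
  rw [mul_selIn h _ Z.q i j c ⟨c.1, by have := h j; omega⟩ rfl]
  refine Eq.trans ?_ (show _ = sgn k n • (matMul hl (selIn k Z.toTuple α h) q' i j c) from rfl)
  by_cases hi : ∃ s, α s = i
  · obtain ⟨s, rfl⟩ := hi
    rw [selIn_mul h hα hl q' s j c ⟨c.1, by have := h s; simp; omega⟩ rfl,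
      hq s j ⟨c.1, _⟩ ⟨c.1, by have := h s; simp; omega⟩ rfl]
    rfl
  · have hi' : ∀ s, α s ≠ i := fun s hs => hi ⟨s, hs⟩
    rw [selIn_mul_of_notMem h hl q' i hi' j c, hq' i j _ hi', map_zero, smul_zero]

/-- Dually, the selected terms form a quotient complex: no entry of `q` leads to them from the other
terms. -/
theorem d_selOut {m : ℤ} (h : ∀ j, Z.sh (α j) = sh' j + m) (hα : Function.Injective α)
    (hq : ∀ i j p p' (hp : p'.1 = p.1), Z.q (α i) (α j) p = sgn k m • degCast k hp (q' i j p'))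
    (hq' : ∀ i j p, (∀ s, α s ≠ j) → Z.q (α i) j p = 0) {l : ℤ} (hl : m + 1 = l) :
    d (k := k) (X := Z) (Y := (⟨Z.toTuple.comap α sh', q', tr, mc⟩ : Pretr k C)) hl
      (selOut k Z.toTuple α h) = 0 := by
  refine (diff_apply hl (by omega) _).trans ?_
  rw [dNaive_selOut, zero_add, sub_eq_zero]
  funext i j c
  have hc : c.1 + Z.sh j = sh' i + l := c.2
  refine Eq.trans ?_ (show _ = sgn k m • (matMul hl (selOut k Z.toTuple α h) Z.q i j c) from rfl)
  rw [selOut_mul h _ Z.q i j c ⟨c.1, by have := h i; omega⟩ rfl]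
  by_cases hj : ∃ s, α s = j
  · obtain ⟨s, rfl⟩ := hj
    rw [mul_selOut h hα (by omega) q' i s c ⟨c.1, by have := h s; simp; omega⟩ rfl,
      hq i s ⟨c.1, _⟩ ⟨c.1, by have := h s; simp; omega⟩ rfl]
    change _ = sgn k m • sgn k m • q' i s _
    rw [smul_smul, sgn_mul_self, one_smul]
  · have hj' : ∀ s, α s ≠ j := fun s hs => hj ⟨s, hs⟩
    rw [mul_selOut_of_notMem h (by omega) q' i j hj' c, hq' i j _ hj', map_zero, smul_zero]

/-- Reindexing and shifting all terms of a twisted complex. -/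
def selHIso {n m : ℤ} (h : ∀ j, sh' j = Z.sh (α j) + n) (hnm : n + m = 0) (hα : Function.Bijective α)
    (hq : ∀ i j p p' (hp : p'.1 = p.1), Z.q (α i) (α j) p = sgn k n • degCast k hp (q' i j p')) :
    HIso k n m (⟨Z.toTuple.comap α sh', q', tr, mc⟩ : Pretr k C) Z where
  a := selIn k Z.toTuple α h
  b := selOut k Z.toTuple α (fun j => by have := h j; omega)
  h := hnm
  d_a := d_selIn Z α q' tr mc h hα.1 hq fun i _ _ hi => absurd (hα.2 i) (by push Not; exact hi)
  d_b := d_selOut Z α q' tr mc _ hα.1 (fun i j p p' hp => by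
      rw [hq i j p p' hp]
      congr 1
      obtain rfl : m = -n := by omega
      simp [sgn]) fun _ j _ hj => absurd (hα.2 j) (by push Not; exact hj)
  a_b := selOut_mul_selIn _ _ hα.1 _
  b_a := by
    funext i j c
    obtain ⟨i, rfl⟩ := hα.2 i
    exact selIn_mul_selOut_self _ _ hα.1 _ i j c

/-- The extension given by a decomposition of the index set. -/
def selExt {κ' : Type} [Fintype κ'] [LinearOrder κ'] (β : κ' → Z.ι)
    (q'' : Mat k (Z.toTuple.comap β fun i => Z.sh (β i)) (Z.toTuple.comap β fun i => Z.sh (β i)) 1)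
    (tr' : ∀ i j p, j ≤ i → q'' i j p = 0)
    (mc' : dNaive one_add_one_eq_two q'' + matMul one_add_one_eq_two q'' q'' = 0)
    (q' : Mat k (Z.toTuple.comap α fun i => Z.sh (α i)) (Z.toTuple.comap α fun i => Z.sh (α i)) 1)
    (tr : ∀ i j p, j ≤ i → q' i j p = 0)
    (mc : dNaive one_add_one_eq_two q' + matMul one_add_one_eq_two q' q' = 0)
    (hα : Function.Injective α) (hβ : Function.Injective β) (hd : ∀ i j, α i ≠ β j)
    (hu : ∀ i, (∃ j, α j = i) ∨ ∃ j, β j = i)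
    (hq : ∀ i j p, Z.q (α i) (α j) p = q' i j p) (hq' : ∀ i j p, Z.q (β i) (β j) p = q'' i j p)
    (hz : ∀ i j p, Z.q (β i) (α j) p = 0) :
    Ext k (⟨Z.toTuple.comap α fun i => Z.sh (α i), q', tr, mc⟩ : Pretr k C) Z
      (⟨Z.toTuple.comap β fun i => Z.sh (β i), q'', tr', mc'⟩ : Pretr k C) :=
  Ext.ofSplit (selIn k Z.toTuple α fun _ => (add_zero _).symm)
    (selOut k Z.toTuple β fun _ => (add_zero _).symm)
    (selOut k Z.toTuple α fun _ => (add_zero _).symm)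
    (selIn k Z.toTuple β fun _ => (add_zero _).symm)
    (d_selIn Z α q' tr mc _ hα (fun i j p p' hp => by
      obtain rfl : p = p' := Subsingleton.elim _ _
      rw [hq, sgn_zero, one_smul]; rfl) (fun i j p hi => by
        obtain ⟨s, rfl⟩ := (hu i).resolve_left (by push Not; exact hi)
        exact hz _ _ _) _)
    (d_selOut Z β q'' tr' mc' _ hβ (fun i j p p' hp => by
      obtain rfl : p = p' := Subsingleton.elim _ _
      rw [hq', sgn_zero, one_smul]; rfl) (fun i j p hj => by
        obtain ⟨s, rfl⟩ := (hu j).resolve_right (by push Not; exact hj)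
        exact hz _ _ _) _)
    (selOut_mul_selIn _ _ hα _)
    (selOut_mul_selIn _ _ hβ _)
    (selOut_mul_selIn_of_disjoint _ _ (fun i j => (hd j i).symm) _)
    (selOut_mul_selIn_of_disjoint _ _ hd _)
    (by
      funext i j c
      refine (show _ = matMul (zero_add 0) (selIn k Z.toTuple α fun _ => (add_zero _).symm)
        (selOut k Z.toTuple α fun _ => (add_zero _).symm) i j c +
        matMul (zero_add 0) (selIn k Z.toTuple β fun _ => (add_zero _).symm)
        (selOut k Z.toTuple β fun _ => (add_zero _).symm) i j c from rfl).trans ?_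
      rcases hu i with ⟨i, rfl⟩ | ⟨i, rfl⟩
      · exact (congrArg₂ (· + ·) (selIn_mul_selOut_self _ _ hα _ i j c)
          (selIn_mul_of_notMem _ _ _ _ (fun s => (hd i s).symm) j c)).trans (add_zero _)
      · exact (congrArg₂ (· + ·) (selIn_mul_of_notMem _ _ _ _ (fun s => hd s i) j c)
          (selIn_mul_selOut_self _ _ hβ _ i j c)).trans (zero_add _))

end selection

end Pretr
end DG

namespace DG

/-! ### Cones, shifts and finite generation of twisted complexes -/

namespace Pretr

section

variable {k : Type w} [CommRing k] {C : Type u} [DGCategory.{v} k C]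

/-- The extension given by the cone of a closed morphism. -/
def coneExt {X Y : Pretr k C} (f : Hom k X Y 0) (hf : d (zero_add 1) f = 0) :
    Ext k Y (cone f hf) X.shift :=
  selExt (cone f hf) (Sum.inl : Y.ι → (cone f hf).ι) (Sum.inr : X.ι → (cone f hf).ι) X.shift.q
    X.shift.triangular X.shift.maurerCartan Y.q Y.triangular Y.maurerCartan
    Sum.inl_injective Sum.inr_injective (fun _ _ h => by cases h)
    (by rintro (i | i); exacts [Or.inl ⟨i, rfl⟩, Or.inr ⟨i, rfl⟩])
    (fun _ _ _ => rfl) (fun _ _ _ => rfl) (fun _ _ _ => rfl)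

/-- The canonical morphism of degree `1` from the shift. -/
def shiftHIso (X : Pretr k C) : HIso k 1 (-1) X.shift X :=
  selHIso X (id : X.ι → X.ι) (sh' := fun i => X.sh i + 1) X.shift.q
    X.shift.triangular X.shift.maurerCartan (fun _ => rfl) (by norm_num) Function.bijective_id
    (fun i j p p' hp => by
      obtain ⟨p, h⟩ := p
      obtain ⟨p', h'⟩ := p'
      dsimp only at hp
      subst hp
      rw [show sgn k 1 = -1 by simp [sgn], neg_one_smul]
      exact (neg_neg _).symm)

/-- The class is the `Y`-component of the differential of the section of `X[1]`. Its naive part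
vanishes, and precomposing the section with `q` of `X[1]` has no component in `Y`; what is left is
the block `f` of the cone. -/
theorem coneExt_δ {X Y : Pretr k C} (f : Hom k X Y 0) (hf : d (zero_add 1) f = 0) :
    (coneExt f hf).δ = comp (zero_add 1) f (shiftHIso X).a := by
  funext i j c
  have hc : c.1 + (X.sh j + 1) = Y.sh i + 1 := c.2
  have h₁ := selOut_mul (Z := (cone f hf).toTuple) (α := (Sum.inl : Y.ι → (cone f hf).ι))
    (sh' := Y.sh) (fun _ => (add_zero _).symm) (zero_add 1)
    (d (k := k) (X := X.shift) (Y := cone f hf) (zero_add 1) (selIn k (cone f hf).toTuple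
      (Sum.inr : X.ι → (cone f hf).ι) (fun _ => (add_zero _).symm))) i j c ⟨c.1, c.2⟩ rfl
  have h₂ := mul_selIn (Z := X.toTuple) (α := id) (sh' := fun i => X.sh i + 1) (fun _ => rfl)
    (zero_add 1) f i j c ⟨c.1, by
      show c.1 + X.sh j = Y.sh i + 0
      omega⟩ rfl
  refine h₁.trans (Eq.trans ?_ h₂.symm)
  rw [degCast_rfl, degCast_rfl]
  have h₃ := mul_selIn (Z := (cone f hf).toTuple) (α := (Sum.inr : X.ι → (cone f hf).ι))
    (sh' := X.shift.sh) (fun _ => (add_zero _).symm) (add_zero 1) (cone f hf).q (.inl i) j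
    ⟨c.1, c.2⟩ ⟨c.1, c.2⟩ rfl
  have h₄ := selIn_mul_of_notMem (Z := (cone f hf).toTuple) (α := (Sum.inr : X.ι → (cone f hf).ι))
    (sh' := X.shift.sh) (fun _ => (add_zero _).symm) (zero_add 1) X.shift.q (.inl i)
    (fun s h => by cases h) j ⟨c.1, c.2⟩
  have h₅ := dNaive_selIn (k := k) (Z := (cone f hf).toTuple)
    (α := (Sum.inr : X.ι → (cone f hf).ι)) (sh' := X.shift.sh) (fun _ => (add_zero _).symm)
    (zero_add 1)
  have h₆ := congrFun (congrFun (congrFun (diff_apply (X := X.shift) (Y := cone f hf) (zero_add 1)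
    (add_zero 1) (selIn k (cone f hf).toTuple (Sum.inr : X.ι → (cone f hf).ι)
      (fun _ => (add_zero _).symm))) (Sum.inl i)) j) ⟨c.1, c.2⟩
  have h₇ := congrFun (congrFun (congrFun h₅ (Sum.inl i)) j) ⟨c.1, c.2⟩
  have key : ∀ x y z w : Hom k (X.obj j) (Y.obj i) c.1, x = 0 → y = w → z = 0 →
      x + y - sgn k 0 • z = w := by
    rintro x y z w rfl rfl rfl
    rw [smul_zero, sub_zero, zero_add]
  exact h₆.trans (key _ _ _ _ h₇ h₃ h₄)

theorem exists_hIso (X : Pretr k C) (n m : ℤ) (hnm : n + m = 0) :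
    ∃ S : Pretr k C, Nonempty (HIso k n m X S) := by
  let sh' : X.ι → ℤ := fun i => X.sh i + m
  -- A shift by `m` multiplies the naive differential by `(-1)^m`, so `q` needs the same sign for
  -- the Maurer–Cartan equation.
  let q' : Mat k (X.toTuple.comap id sh') (X.toTuple.comap id sh') 1 := fun i j p =>
    sgn k m • X.q i j ⟨p.1, by
      have h : p.1 + (X.sh j + m) = X.sh i + m + 1 := p.2
      show p.1 + X.sh j = X.sh i + 1
      omega⟩
  have tr : ∀ i j p, j ≤ i → q' i j p = 0 := fun i j p h => by
    simp only [q']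
    rw [X.triangular i j _ h, smul_zero]
  have mc : dNaive one_add_one_eq_two q' + matMul one_add_one_eq_two q' q' = 0 := by
    funext i j p
    have hp : p.1 + (X.sh j + m) = X.sh i + m + 2 := p.2
    have h := maurerCartan_apply X i j (n := p.1) ⟨p.1 - 1, by omega⟩ (by simp)
      (fun s => ⟨X.sh i + m + 1 - (X.sh s + m), by omega⟩)
      (fun s => ⟨X.sh s + m + 1 - (X.sh j + m), by omega⟩) (fun s => by simp; omega)
    refine (congrArg₂ (· + ·) (dNaive_apply _ q' i j p ⟨p.1 - 1, by
      show p.1 - 1 + (X.sh j + m) = X.sh i + m + 1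
      omega⟩ (by simp)) (matMul_apply _ q' q' i j p (fun s => entryDeg _ _ _ _ _)
        (fun s => entryDeg _ _ _ _ _))).trans ?_
    refine Eq.trans ?_ h
    refine congrArg₂ (· + ·) ?_ (Finset.sum_congr rfl fun s _ => ?_)
    · simp only [q', sh', map_smul, smul_smul, sgn_add, mul_assoc, sgn_mul_self, mul_one]
    · simp only [q', map_smul, LinearMap.smul_apply, smul_smul, sgn_mul_self, one_smul]
      rfl
  exact ⟨⟨_, q', tr, mc⟩, ⟨(selHIso X id q' tr mc (fun _ => rfl) (by omega) Function.bijective_id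
    (fun i j p p' hp => by
      obtain ⟨p, h⟩ := p
      obtain ⟨p', h'⟩ := p'
      dsimp only at hp
      subst hp
      rw [degCast_rfl]
      simp only [q', smul_smul, sgn_mul_self, one_smul]
      rfl)).symm⟩⟩

theorem idd_eq_zero_of_isEmpty (X : Pretr k C) [IsEmpty X.ι] : idd k X = 0 := by
  funext i
  exact isEmptyElim i

-- The extension of class `δ : X → Y` is the cone of `δ` read as a morphism of degree `0` from a
-- shift `S` of `X`; the quotient `S[1]` is then identified with `X`.
variable (k C) in
theorem sPretr : SPretr k (Pretr k C) where
  zero := ⟨⟨⟨PEmpty.{1}, PEmpty.elim, PEmpty.elim⟩, fun i => i.elim, fun i => i.elim,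
    funext fun i => i.elim⟩, funext fun i => i.elim⟩
  shift := exists_hIso
  ext X Y δ hδ := by
    obtain ⟨S, ⟨e⟩⟩ := exists_hIso X 1 (-1) (by norm_num)
    have hf : d (zero_add 1) (comp (add_neg_cancel 1) δ e.b) = 0 :=
      HIso.d_comp_closed _ _ _ hδ (e.d_b _) _
    let a : HIso k 0 0 S.shift X := (shiftHIso S).trans e.symm (by norm_num) (by norm_num)
    refine ⟨_, (coneExt _ hf).ofHIso a, ?_⟩
    rw [← act_inj]
    simp only [Ext.ofHIso, coneExt_δ, a, HIso.trans, HIso.symm, act_comp, Category.assoc]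
    simp

/-- A twisted complex with a single term. -/
def single (c : C) : Pretr k C where
  toTuple := ⟨Unit, fun _ => c, fun _ => 0⟩
  q := 0
  triangular _ _ _ _ := rfl
  maurerCartan := by simp

variable (k C) in
/-- The fully faithful DG functor of twisted complexes with a single term. -/
def singleFunctor : DGFunctor k C (Pretr k C) where
  obj := single
  map {X Y n} :=
    { toFun := fun f _ _ p => degCast k (by have h : p.1 + 0 = 0 + n := p.2; omega) f
      map_add' := fun f g => by funext i j p; exact map_add _ _ _
      map_smul' := fun c f => by funext i j p; exact map_smul _ _ _ }
  map_d {X Y m n} h f := by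
    refine Eq.trans ?_ (diff_apply h (add_comm 1 m ▸ h) _).symm
    rw [show (single Y : Pretr k C).q = 0 from rfl, show (single X : Pretr k C).q = 0 from rfl,
      map_zero, LinearMap.zero_apply, map_zero, smul_zero, add_zero, sub_zero]
    funext i j p
    have hp : p.1 + 0 = 0 + n := p.2
    refine Eq.trans ?_ (dNaive_apply h _ i j p ⟨m, by show m + 0 = 0 + m; omega⟩ (by show m + 1 = p.1; omega)).symm
    refine Eq.trans ?_ ((one_smul k _).symm.trans (congrArg (· • _) (sgn_zero k).symm))
    exact (d_degCast h _ rfl _ f).symm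
  map_id X := by
    funext i j p
    have hp : p.1 + 0 = 0 + 0 := p.2
    exact (degCast_idAt X (by omega) rfl (by omega)).trans (matId_self _ i p (by omega)).symm
  map_comp {X Y Z q p r} h g f := by
    funext i j c
    have hc : c.1 + 0 = 0 + r := c.2
    have hr : r = c.1 := by omega
    refine Eq.trans ?_ (matMul_apply h _ _ i j c (fun s => ⟨q, by show q + 0 = 0 + q; omega⟩)
      (fun s => ⟨p, by show p + 0 = 0 + p; omega⟩)).symm
    refine Eq.trans ?_ (Fintype.sum_unique (ι := Unit) _).symm
    exact (comp_degCast h _ rfl rfl hr g f).symm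

theorem singleFunctor_ff : (singleFunctor k C).FF := by
  intro X Y n
  have hp : ∀ (i j) (p : EntryDeg (single (k := k) X).toTuple (single (k := k) Y).toTuple n i j),
      n = p.1 := fun i j p => by have h : p.1 + 0 = 0 + n := p.2; omega
  constructor
  · intro f g h
    exact congrFun (congrFun (congrFun h ()) ()) ⟨n, by show n + 0 = 0 + n; omega⟩
  · intro f
    refine ⟨f () () ⟨n, by show n + 0 = 0 + n; omega⟩, ?_⟩
    funext i j p
    obtain ⟨p, h⟩ := p
    obtain rfl : n = p := hp i j ⟨p, h⟩
    rfl

/-- A twisted complex with one term is a shift of that term. -/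
def uniqueHIso (X : Pretr k C) (t : X.ι) (ht : ∀ i, t = i) :
    HIso k (-X.sh t) (X.sh t) (single (X.obj t)) X :=
  selHIso X (fun _ : Unit => t) (sh' := fun _ => 0) (single (X.obj t)).q
    (single (X.obj t)).triangular (single (X.obj t)).maurerCartan (fun _ => by simp) (by simp)
    ⟨fun _ _ _ => rfl, fun i => ⟨(), ht i⟩⟩ (fun i j p p' hp => by
      rw [X.triangular _ _ _ le_rfl]
      exact ((congrArg (sgn k (-X.sh t) • ·) (map_zero (degCast k hp))).trans (smul_zero _)).symm)

/-- Induction on the number of terms of a twisted complex. -/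
theorem induction {P : Pretr k C → Prop} (zero : ∀ X, idd k X = 0 → P X)
    (single : ∀ X c n m, HIso k n m (single c) X → P X)
    (ext : ∀ Y Z X, Ext k Y Z X → P Y → P X → P Z) (X : Pretr k C) : P X := by
  induction h : Fintype.card X.ι generalizing X with
  | zero =>
    have := Fintype.card_eq_zero_iff.1 h
    exact zero X X.idd_eq_zero_of_isEmpty
  | succ n ih =>
    have : Nonempty X.ι := Fintype.card_pos_iff.1 (by omega)
    let t : X.ι := Finset.univ.max' Finset.univ_nonempty
    have ht : ∀ i, i ≤ t := fun i => Finset.le_max' _ _ (Finset.mem_univ i)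
    let α : {i : X.ι // i ≠ t} → X.ι := Subtype.val
    let β : Unit → X.ι := fun _ => t
    -- As `q` is strictly upper triangular, nothing maps to the term with the largest index. So the
    -- other terms form a subcomplex `Y`, with the single term `T` as quotient.
    have hq : ∀ j p, X.q t j p = 0 := fun j p => X.triangular _ _ _ (ht j)
    let qY : Mat k (X.toTuple.comap α fun i => X.sh (α i))
      (X.toTuple.comap α fun i => X.sh (α i)) 1 := fun i j p => X.q (α i) (α j) p
    let Y : Pretr k C :=
      { toTuple := X.toTuple.comap α fun i => X.sh (α i)
        q := qY
        triangular := fun i j p h => X.triangular _ _ _ h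
        maurerCartan := by
          funext i j p
          have h := maurerCartan_apply X (α i) (α j) (n := p.1) ⟨p.1 - 1, by
              have h : p.1 + X.sh (α j) = X.sh (α i) + 2 := p.2
              omega⟩ (by simp)
            (fun s => entryDeg _ _ _ _ _) (fun s => entryDeg _ _ _ _ _)
            (fun s => entryDeg_add one_add_one_eq_two _ _ _ p)
          rw [← Fintype.sum_subtype_add_sum_subtype (fun s => s ≠ t)] at h
          refine Eq.trans ?_ h
          refine (congrArg₂ (· + ·) (dNaive_apply _ qY i j p ⟨p.1 - 1, by
              have h : p.1 + X.sh (α j) = X.sh (α i) + 2 := p.2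
              show p.1 - 1 + X.sh (α j) = X.sh (α i) + 1
              omega⟩ (by simp)) (matMul_apply _ qY qY i j p
                (fun s => entryDeg _ _ _ _ _) (fun s => entryDeg _ _ _ _ _))).trans ?_
          refine congrArg₂ (· + ·) rfl ((add_zero _).symm.trans (congrArg₂ (· + ·) rfl ?_))
          refine (Finset.sum_eq_zero fun s _ => ?_).symm
          obtain ⟨s, hs⟩ := s
          obtain rfl : s = t := not_not.1 hs
          dsimp only
          rw [hq, map_zero] }
    let T : Pretr k C :=
      { toTuple := X.toTuple.comap β fun i => X.sh (β i)
        q := 0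
        triangular := fun _ _ _ _ => rfl
        maurerCartan := by simp }
    refine ext Y X T (selExt X α β T.q T.triangular T.maurerCartan Y.q Y.triangular Y.maurerCartan
      Subtype.val_injective (fun _ _ _ => rfl) (fun i _ => i.2)
      (fun i => if h : i = t then Or.inr ⟨(), h.symm⟩ else Or.inl ⟨⟨i, h⟩, rfl⟩)
      (fun _ _ _ => rfl) (fun _ _ _ => hq _ _) (fun _ _ _ => hq _ _)) (ih Y ?_)
      (single T _ _ _ (uniqueHIso T () fun _ => rfl))
    have : Fintype.card {i : X.ι // i ≠ t} = Fintype.card X.ι - 1 := by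
      rw [Fintype.card_subtype_compl, Fintype.card_subtype_eq]
    change Fintype.card {i : X.ι // i ≠ t} = n
    omega

/-- An extension closed class of objects that contains the objects of `C` contains everything. -/
theorem prop_of_single {Q : ObjectProperty (Ho k (Pretr k C))} (hQ : ExtClosed Q)
    (h : ∀ c : C, Q ⟨⟨single c⟩⟩) (X : Pretr k C) : Q ⟨⟨X⟩⟩ :=
  induction (P := fun X => Q ⟨⟨X⟩⟩) (fun _ => hQ.zero) (fun _ c _ _ e => hQ.shift e (h c))
    (fun _ _ _ => hQ.ext) X

/-- When `C` itself has shifts and extensions, the essential image of the single-term complexes is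
closed under extensions, hence everything. -/
theorem exists_iso_single (hC : SPretr k C) (X : Pretr k C) :
    ∃ c : C, Nonempty ((⟨⟨single c⟩⟩ : Ho k (Pretr k C)) ≅ ⟨⟨X⟩⟩) := by
  obtain ⟨⟨⟨c⟩⟩, ⟨e⟩⟩ := prop_of_single (ExtClosed.essImage singleFunctor_ff hC)
    (fun c => (singleFunctor k C).ho.obj_mem_essImage ⟨⟨c⟩⟩) X
  exact ⟨c, ⟨e⟩⟩

end

section

variable {k : Type w} [CommRing k] {C : Type u} [DGCategory.{v} k C] {D : Type u'}
  [DGCategory.{v'} k D]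

theorem _root_.DG.DGFunctor.FF.pretr {F : DGFunctor k C D} (hF : F.FF) : F.pretr.FF := by
  intro X Y n
  constructor
  · intro f g h
    funext i j p
    exact (hF _ _ _).1 (congrFun (congrFun (congrFun h i) j) p)
  · intro g
    choose f hf using fun i j (p : EntryDeg X.toTuple Y.toTuple n i j) => (hF _ _ _).2 (g i j p)
    exact ⟨f, funext fun i => funext fun j => funext fun p => hf i j p⟩

theorem pretr_obj_single (F : DGFunctor k C D) (c : C) :
    F.pretr.obj (single c) = single (F.obj c) := by
  have H : ∀ {t : Tuple D} {q q' : Mat k t t 1} (_ : q = q') (h₁ h₂ h₁' h₂'),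
      (⟨t, q, h₁, h₂⟩ : Pretr k D) = ⟨t, q', h₁', h₂'⟩ := by
    rintro t q _ rfl h₁ h₂ h₁' h₂'
    rfl
  exact H (map_zero (Mat.map (k := k) F)) _ _ _ _

end
end Pretr
end DG

namespace DG

/-! ### Distinguished triangles in terms of extensions -/

namespace Tr

variable {k : Type w} [CommRing k] {C : Type u} [DGCategory.{v} k C] {Q : ObjectProperty (Tr k C)}

/-- A morphism isomorphic to the class of a closed morphism extends to a distinguished triangle. -/
theorem exists_distinguished {U V : Tr k C} {X Y : Pretr k C} (u : U ⟶ V) (f : Hom k X Y 0)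
    (hf : d (zero_add 1) f = 0) (a : U ≅ ⟨⟨X⟩⟩) (b : V ≅ ⟨⟨Y⟩⟩) (h : u ≫ b.hom = a.hom ≫ hm f hf) :
    ∃ (v : V ⟶ ⟨⟨Pretr.cone f hf⟩⟩) (t : (⟨⟨Pretr.cone f hf⟩⟩ : Tr k C) ⟶ (shift k C).obj U),
      Distinguished u v t := by
  let p : (⟨⟨Pretr.cone f hf⟩⟩ : Tr k C) ⟶ (shift k C).obj ⟨⟨X⟩⟩ := mk _ (Pretr.d_coneOut f hf)
  refine ⟨b.hom ≫ mk _ (Pretr.d_coneIn f hf), p ≫ (shift k C).map a.inv, X, Y, f, hf, a, b,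
    Iso.refl _, h, Category.comp_id _, ?_⟩
  change _ = 𝟙 _ ≫ p
  rw [Category.assoc, ← Functor.map_comp, a.inv_hom_id, CategoryTheory.Functor.map_id, Category.comp_id,
    Category.id_comp]

/-- Up to homotopy equivalence of the target, a closed `f : X → Y` is the inclusion of `X` into its
mapping cylinder, whose quotient is the cone. Conversely, the cone of an inclusion is the quotient.
-/
theorem isoMod_eq_extW (hQ : ExtClosed Q) : isoMod Q = extW Q := by
  ext U V u
  constructor
  · rintro ⟨Z, v, t, ⟨X, Y, f, hf, a, b, c, h, -, -⟩, hZ⟩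
    have hσ := HIso.d_comp_closed (add_zero 1) (Pretr.shiftHIso X).a
      (Pretr.coneExt f hf).π ((Pretr.shiftHIso X).d_a _) (Pretr.coneExt f hf).d_π one_add_one_eq_two
    obtain ⟨S, e', he'⟩ := (Pretr.sPretr k C).ext (Pretr.cone f hf) X
      (-comp (add_zero 1) (Pretr.shiftHIso X).a (Pretr.coneExt f hf).π) (by
        rw [map_neg, hσ, neg_zero])
    obtain ⟨s, hs⟩ := exists_iso_inclusion (Pretr.shiftHIso X) (Pretr.coneExt f hf) f hf
      (Pretr.coneExt_δ f hf) e' he'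
    refine ⟨X, S, _, e', a, b ≪≫ s, ?_, hQ.iso c hZ⟩
    rw [Iso.trans_hom, reassoc_of% h, ← hs]
  · rintro ⟨Y, Z, X, e, a, b, h, hX⟩
    obtain ⟨v, t, H⟩ := exists_distinguished u e.i e.d_i a b h
    obtain ⟨c⟩ := nonempty_iso_of_cone_inclusion e (Pretr.shiftHIso Y) (Pretr.coneExt e.i e.d_i)
      (Pretr.coneExt_δ _ _)
    exact ⟨_, v, t, H, hQ.iso c.symm hX⟩

/-- Up to homotopy equivalence of the source, `f` is a projection whose subobject is a shift of the
cone; conversely, the cone of a projection is a shift of its subobject. `Q` is stable under shifts.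
-/
theorem isoMod_eq_coextW (hQ : ExtClosed Q) : isoMod Q = coextW Q := by
  ext U V u
  constructor
  · rintro ⟨Z, v, t, ⟨X, Y, f, hf, a, b, c, h, -, -⟩, hZ⟩
    obtain ⟨K, ⟨ρ⟩⟩ := (Pretr.sPretr k C).shift (Pretr.cone f hf) 1 (-1) (by norm_num)
    obtain ⟨S, e', he'⟩ := (Pretr.sPretr k C).ext Y K
      (comp (add_zero 1) ρ.a (Pretr.coneExt f hf).i)
      (HIso.d_comp_closed _ _ _ (ρ.d_a _) (Pretr.coneExt f hf).d_i _)
    obtain ⟨s, hs⟩ := exists_iso_projection (Pretr.shiftHIso X) ρ (Pretr.coneExt f hf) f hf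
      (Pretr.coneExt_δ f hf) e' he'
    refine ⟨K, S, _, e', a ≪≫ s, b, ?_, hQ.shift ρ (hQ.iso c hZ)⟩
    rw [Iso.trans_hom, Category.assoc, hs]
    exact h
  · rintro ⟨Y, Z, X, e, a, b, h, hY⟩
    obtain ⟨v, t, H⟩ := exists_distinguished u e.π e.d_π a b h
    obtain ⟨c⟩ := nonempty_iso_of_cone_projection e (Pretr.shiftHIso Z) (Pretr.shiftHIso Y)
      (Pretr.coneExt e.π e.d_π) (Pretr.coneExt_δ _ _)
    exact ⟨_, v, t, H, hQ.iso c.symm (hQ.shift (Pretr.shiftHIso Y).symm hY)⟩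

theorem isLocalization_extW (hQ : ExtClosed Q) : (verdierQ Q).IsLocalization (extW Q) := by
  rw [← isoMod_eq_extW hQ]
  infer_instance

theorem isLocalization_coextW (hQ : ExtClosed Q) : (verdierQ Q).IsLocalization (coextW Q) := by
  rw [← isoMod_eq_coextW hQ]
  infer_instance

theorem isTriangulatedSubcategory (hQ : ExtClosed Q) : IsTriangulatedSubcategory Q where
  nonempty := by
    obtain ⟨X, hX⟩ := (Pretr.sPretr k C).zero
    exact ⟨⟨⟨X⟩⟩, hQ.zero hX⟩
  iso := hQ.iso
  shift_iff X := ⟨fun h => hQ.shift (Pretr.shiftHIso X.as.obj) h,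
    fun h => hQ.shift (Pretr.shiftHIso X.as.obj).symm h⟩
  cone := by
    rintro U V W u v t ⟨X, Y, f, hf, a, b, c, -, -, -⟩ hU hV
    exact hQ.iso c.symm (hQ.ext (Pretr.coneExt f hf) (hQ.iso b hV)
      (hQ.shift (Pretr.shiftHIso X).symm (hQ.iso a hU)))

/-- The resolution `X → Z → Y` is rotated backwards: its class is a morphism to `X` from a shift of
`Y`, and the cone of that morphism is `Z`. -/
theorem rightAdmissible (hQ : ExtClosed Q) (h : EnoughRight Q) : RightAdmissible Q where
  triangulated := isTriangulatedSubcategory hQ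
  exists_triangle := by
    rintro ⟨⟨X⟩⟩
    obtain ⟨Z, Y, e, hY, hZ⟩ := h X
    obtain ⟨X', ⟨τ⟩⟩ := (Pretr.sPretr k C).shift Y 1 (-1) (by norm_num)
    let f : Hom k X' X 0 := comp (add_neg_cancel 1) e.δ τ.b
    have hf : d (zero_add 1) f = 0 := HIso.d_comp_closed _ _ _ (e.d_δ _) (τ.d_b _) _
    obtain ⟨v, t, H⟩ := exists_distinguished (hm f hf) f hf (Iso.refl _) (Iso.refl _)
      ((Category.comp_id _).trans (Category.id_comp _).symm)
    let ρ := τ.trans (Pretr.shiftHIso X').symm (neg_add_cancel 1) (neg_add_cancel 1)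
    obtain ⟨c⟩ := e.nonempty_iso_of_conj (Pretr.coneExt f hf) (Category.comp_id (𝟙 _))
      (Category.comp_id (𝟙 _)) ρ.iso.hom_inv_id ρ.iso.inv_hom_id (by
        rw [Pretr.coneExt_δ, act_idd]
        simp [f, ρ, HIso.trans, HIso.symm, act_comp])
    exact ⟨⟨⟨X'⟩⟩, _, _, v, t, H, hQ.shift τ hY,
      Q.rightOrthogonal.prop_of_iso c hZ⟩

/-- The triangle starts with the projection `Z → X` of the resolution; its cone is a shift of the
subobject in `Q`. -/
theorem leftAdmissible (hQ : ExtClosed Q) (h : EnoughLeft Q) : LeftAdmissible Q where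
  triangulated := isTriangulatedSubcategory hQ
  exists_triangle := by
    rintro ⟨⟨X⟩⟩
    obtain ⟨Z, Y, e, hY, hZ⟩ := h X
    obtain ⟨v, t, H⟩ := exists_distinguished (hm e.π e.d_π) e.π e.d_π (Iso.refl _) (Iso.refl _)
      ((Category.comp_id _).trans (Category.id_comp _).symm)
    obtain ⟨c⟩ := nonempty_iso_of_cone_projection e (Pretr.shiftHIso Z) (Pretr.shiftHIso Y)
      (Pretr.coneExt e.π e.d_π) (Pretr.coneExt_δ _ _)
    exact ⟨⟨⟨Z⟩⟩, _, _, v, t, H, hZ, hQ.iso c.symm (hQ.shift (Pretr.shiftHIso Y).symm hY)⟩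

end Tr
end DG

namespace DG

open scoped DirectSum

section modules

variable {k : Type w} [CommRing k] {A : Type u} [DGCategory.{u} k A]

namespace DGModule

/-! ### The Yoneda lemma -/

/-- The morphism `f ↦ x f` from a representable module given by an element `x`. -/
def yo (M : DGModule k A) {X : A} {n : ℤ} : M.obj X n →ₗ[k] homs (repr (k := k) X) M n where
  toFun x := ⟨fun Y p q => M.act (show n + p = q.1 by have := q.2; omega) x,
    fun _ _ _ _ _ _ _ _ _ _ _ y a => (M.act_act _ _ _ _ x y a).symm⟩
  map_add' x y := by
    apply homs_ext
    intro Y p q hpq f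
    exact LinearMap.map_add₂ (M.act _) x y f
  map_smul' c x := by
    apply homs_ext
    intro Y p q hpq f
    exact LinearMap.map_smul₂ (M.act _) c x f

theorem yo_idd (M : DGModule k A) {X : A} {n : ℤ} (x : M.obj X n) (h : 0 + n = n) :
    (M.yo x).1 X 0 ⟨n, h⟩ (idd k X) = x := M.act_id _ _

theorem eq_yo (M : DGModule k A) {X : A} {n : ℤ} (φ : homs (repr (k := k) X) M n) :
    φ = M.yo (φ.1 X 0 ⟨n, zero_add n⟩ (idd k X)) := by
  apply homs_ext
  intro Y p q hpq f
  refine Eq.trans ?_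
    (homs_act φ (p := 0) (s := p) (zero_add n) (zero_add p) hpq (by omega) (idd k X) f)
  exact congrArg _ (DGCategory.id_comp _ _).symm

theorem yo_injective (M : DGModule k A) {X : A} {n : ℤ} {x y : M.obj X n}
    (h : M.yo x = M.yo y) : x = y := by
  rw [← M.yo_idd x (zero_add n), h, yo_idd]

theorem d_yo (M : DGModule k A) {X : A} {n m : ℤ} (h : n + 1 = m) (x : M.obj X n) :
    homsD h (M.yo x) = M.yo (M.d h x) := by
  apply homs_ext
  intro Y p q hpq f
  refine (homsD_apply (s := p + n) (t := p + 1) h _ hpq rfl (by omega) rfl (by omega) _).trans ?_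
  refine sub_eq_of_eq_add ?_
  exact M.d_act (add_comm n p) (by omega) h rfl (by omega) (by omega) x f

theorem comp_yo {M N : DGModule k A} {X : A} {q p r : ℤ} (h : q + p = r) (g : homs M N q)
    (x : M.obj X p) (h' : p + q = r) : homsComp h g (M.yo x) = N.yo (g.1 X p ⟨r, h'⟩ x) := by
  apply homs_ext
  intro Y a b hab f
  refine (homsComp_apply (b := a + p) h _ _ hab rfl (by omega) _).trans ?_
  exact homs_act g h' (add_comm p a) (by omega) (by omega) x f

/-- The complex of morphisms from a representable module. -/
theorem acyclicHom_repr_iff (X : A) (M : DGModule k A) : AcyclicHom k (repr (k := k) X) M ↔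
    ∀ (m n l : ℤ) (h : m + 1 = n) (h' : n + 1 = l) (x : M.obj X n), M.d h' x = 0 →
      ∃ y : M.obj X m, M.d h y = x := by
  constructor
  · intro H m n l h h' x hx
    obtain ⟨g, hg⟩ := H m n l h h' (M.yo x) (by
      refine (d_yo M h' x).trans ?_
      rw [hx, map_zero])
    have hg' : homsD h g = M.yo x := hg
    rw [eq_yo M g, d_yo] at hg'
    exact ⟨_, M.yo_injective hg'⟩
  · intro H m n l h h' f hf
    have hf' : homsD h' f = 0 := hf
    rw [eq_yo M f, d_yo] at hf'
    obtain ⟨y, hy⟩ := H m n l h h' _ (M.yo_injective (hf'.trans (map_zero _).symm))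
    refine ⟨M.yo y, (d_yo M h y).trans ?_⟩
    rw [hy, ← eq_yo]

end DGModule

variable (k A) in
theorem toInd_ff : (toInd k A).FF := by
  intro X Y n
  have h : ∀ f : Hom k X Y n, (toInd k A).map f = (repr (k := k) Y).yo f := fun f => rfl
  constructor
  · intro f g e
    exact DGModule.yo_injective (repr (k := k) Y) e
  · intro g
    exact ⟨_, (DGModule.eq_yo (repr (k := k) Y) g).symm⟩

/-! ### Coordinates with respect to a semi-free basis -/

namespace SemiFreeBasis

variable {M : DGModule k A} (S : SemiFreeBasis M)

/-- The coefficient of a basis element. -/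
noncomputable def coord (j : S.ι) {X : A} {n q : ℤ} (h : S.deg j + q = n) :
    M.obj X n →ₗ[k] Hom k X (S.pt j) q :=
  degCast k (by omega) ∘ₗ DirectSum.component k S.ι (fun i => Hom k X (S.pt i) (n - S.deg i)) j ∘ₗ
    (Ind.coord S X n).symm.toLinearMap

theorem coord_linComb (j : S.ι) {X : A} {n : ℤ} (c : ⨁ i, Hom k X (S.pt i) (n - S.deg i)) :
    S.coord j (add_sub_cancel _ _) (linComb M S.pt S.deg S.e X n c) = c j :=
  congrArg (fun x => x j) ((Ind.coord S X n).symm_apply_apply c)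

open Classical in
theorem coord_act_aux (i j : S.ι) {X : A} {n q : ℤ} (h' : S.deg j + q = n)
    (c : Hom k X (S.pt i) (n - S.deg i)) :
    S.coord j h' (M.act (add_sub_cancel (S.deg i) n) (S.e i) c) = degCast k (by omega)
      ((DirectSum.lof k S.ι (fun i => Hom k X (S.pt i) (n - S.deg i)) i c) j) := by
  rw [← Ind.coord_lof]
  exact congrArg (fun x => degCast k (by omega) (DirectSum.component k S.ι
    (fun i => Hom k X (S.pt i) (n - S.deg i)) j x)) ((Ind.coord S X n).symm_apply_apply _)

theorem coord_act_self (j : S.ι) {X : A} {n q : ℤ} (h h' : S.deg j + q = n)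
    (c : Hom k X (S.pt j) q) : S.coord j h (M.act h' (S.e j) c) = c := by
  classical
  obtain rfl : q = n - S.deg j := by omega
  rw [coord_act_aux]
  refine (degCast_rfl _).trans ?_
  convert DirectSum.lof_apply k (M := fun i => Hom k X (S.pt i) (n - S.deg i)) j c

theorem coord_act_ne {i j : S.ι} (hij : i ≠ j) {X : A} {n q q' : ℤ} (h : S.deg i + q = n)
    (h' : S.deg j + q' = n) (c : Hom k X (S.pt i) q) : S.coord j h' (M.act h (S.e i) c) = 0 := by
  classical
  obtain rfl : q = n - S.deg i := by omega
  rw [coord_act_aux]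
  refine (congrArg _ ?_).trans (map_zero _)
  exact DirectSum.of_eq_of_ne (β := fun i => Hom k X (S.pt i) (n - S.deg i)) i j c hij.symm

theorem ext_coord {X : A} {n : ℤ} {x y : M.obj X n}
    (h : ∀ (j) (q) (hq : S.deg j + q = n), S.coord j hq x = S.coord j hq y) : x = y := by
  refine (Ind.coord S X n).symm.injective (DFinsupp.ext fun j => ?_)
  exact h j _ (add_sub_cancel _ _)

/-- Elements of a semi-free module are sums of multiples of basis elements. -/
theorem induction {X : A} {n : ℤ} {p : M.obj X n → Prop} (zero : p 0)
    (add : ∀ x y, p x → p y → p (x + y))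
    (act : ∀ i q (h : S.deg i + q = n) (c : Hom k X (S.pt i) q), p (M.act h (S.e i) c))
    (x : M.obj X n) : p x := by
  classical
  obtain ⟨c, rfl⟩ := (Ind.coord S X n).surjective x
  induction c using DirectSum.induction_on with
  | zero => rwa [map_zero]
  | of i c =>
    exact (Ind.coord_lof S X n i c).symm ▸ act i _ (add_sub_cancel _ _) c
  | add x y hx hy =>
    rw [map_add]
    exact add _ _ hx hy

theorem linearMap_ext {L : Type*} [AddCommGroup L] [Module k L] {X : A} {n : ℤ}
    {φ ψ : M.obj X n →ₗ[k] L} (h : ∀ i q (h : S.deg i + q = n) (c : Hom k X (S.pt i) q),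
      φ (M.act h (S.e i) c) = ψ (M.act h (S.e i) c)) : φ = ψ := by
  ext x
  induction x using S.induction with
  | zero => simp
  | add x y hx hy => rw [map_add, map_add, hx, hy]
  | act i q h' c => exact h i q h' c

theorem coord_act (j : S.ι) {X Y : A} {n n' p q q' : ℤ} (x : M.obj X n) (f : Hom k Y X p)
    (h : n + p = n') (h₁ : S.deg j + q = n) (h₂ : S.deg j + q' = n') (h₃ : q + p = q') :
    S.coord j h₂ (M.act h x f) = comp h₃ (S.coord j h₁ x) f := by
  suffices H : S.coord j h₂ ∘ₗ (M.act h).flip f = (comp h₃).flip f ∘ₗ S.coord j h₁ from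
    LinearMap.congr_fun H x
  refine S.linearMap_ext fun i r hr c => ?_
  simp only [LinearMap.comp_apply, LinearMap.flip_apply]
  rw [M.act_act (pq := r + p) _ _ rfl (by omega)]
  by_cases e : i = j
  · subst e
    obtain rfl : r = q := by omega
    subst h₃
    rw [coord_act_self, coord_act_self]
  · rw [coord_act_ne _ e, coord_act_ne _ e, LinearMap.map_zero₂]

theorem exists_finset {X : A} {n : ℤ} (x : M.obj X n) :
    ∃ s : Finset S.ι, ∀ j ∉ s, ∀ q (h : S.deg j + q = n), S.coord j h x = 0 := by
  classical
  induction x using S.induction with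
  | zero => exact ⟨∅, fun j _ q h => map_zero _⟩
  | add x y hx hy =>
    obtain ⟨s, hs⟩ := hx
    obtain ⟨t, ht⟩ := hy
    refine ⟨s ∪ t, fun j hj q h => ?_⟩
    rw [Finset.notMem_union] at hj
    rw [map_add, hs j hj.1, ht j hj.2, add_zero]
  | act i q h c =>
    refine ⟨{i}, fun j hj q' h' => S.coord_act_ne ?_ _ _ _⟩
    rintro rfl
    exact hj (Finset.mem_singleton_self _)

theorem sum_coord {X : A} {n : ℤ} (x : M.obj X n) (s : Finset S.ι)
    (hs : ∀ j ∉ s, ∀ q (h : S.deg j + q = n), S.coord j h x = 0) :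
    ∑ j ∈ s, M.act (add_sub_cancel (S.deg j) n) (S.e j) (S.coord j (add_sub_cancel _ _) x) = x := by
  refine S.ext_coord fun j q hq => ?_
  obtain rfl : q = n - S.deg j := by omega
  rw [map_sum]
  by_cases hj : j ∈ s
  · rw [Finset.sum_eq_single_of_mem j hj fun i _ hij => S.coord_act_ne hij _ _ _, coord_act_self]
  · rw [hs j hj]
    exact Finset.sum_eq_zero fun i hi => S.coord_act_ne (fun e : i = j => hj (e ▸ hi)) _ _ _

theorem level_lt {i j : S.ι} {q : ℤ} (h : S.deg j + q = S.deg i + 1)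
    (hq : S.coord j h (M.d rfl (S.e i)) ≠ 0) : S.level j < S.level i := by
  obtain ⟨c, hc, hl⟩ := S.d_e i
  refine hl j fun h0 => hq ?_
  obtain rfl : q = S.deg i + 1 - S.deg j := by omega
  rw [hc]
  exact (S.coord_linComb j c).trans h0

/-- A semi-free basis is determined by its coordinate functions. -/
noncomputable def ofCoord {ι : Type u} (pt : ι → A) (deg : ι → ℤ) (level : ι → ℕ)
    (e : ∀ i, M.obj (pt i) (deg i))
    (coord : ∀ (j : ι) (X : A) (n q : ℤ), deg j + q = n → (M.obj X n →ₗ[k] Hom k X (pt j) q))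
    (coord_self : ∀ (j X n q) (h : deg j + q = n) (c : Hom k X (pt j) q),
      coord j X n q h (M.act h (e j) c) = c)
    (coord_ne : ∀ (i j) (X n q q') (h : deg i + q = n) (h' : deg j + q' = n)
      (c : Hom k X (pt i) q), i ≠ j → coord j X n q' h' (M.act h (e i) c) = 0)
    (span : ∀ (X n) (p : Submodule k (M.obj X n)),
      (∀ i q (h : deg i + q = n) (c : Hom k X (pt i) q), M.act h (e i) c ∈ p) → ∀ x, x ∈ p)
    (lt : ∀ i j q (h : deg j + q = deg i + 1), coord j _ _ q h (M.d rfl (e i)) ≠ 0 →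
      level j < level i) : SemiFreeBasis M :=
  have key : ∀ (X n) (c : ⨁ i, Hom k X (pt i) (n - deg i)) (j),
      coord j X n _ (add_sub_cancel _ _) (linComb M pt deg e X n c) = c j := by
    classical
    intro X n c j
    induction c using DirectSum.induction_on with
    | zero => rw [map_zero, map_zero, DirectSum.zero_apply]
    | of i c =>
      have h := linComb_lof M pt deg e X n i c
      have h' : linComb M pt deg e X n (DirectSum.of (fun i => Hom k X (pt i) (n - deg i)) i c) =
        M.act (add_sub_cancel (deg i) n) (e i) c := h
      rw [h']
      by_cases hij : i = j
      · subst hij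
        rw [coord_self, DirectSum.of_eq_same]
      · rw [coord_ne _ _ _ _ _ _ _ _ _ hij, DirectSum.of_eq_of_ne _ _ _ (Ne.symm hij)]
    | add x y hx hy => rw [map_add, map_add, hx, hy, DirectSum.add_apply]
  have surj : ∀ X n, Function.Surjective (linComb M pt deg e X n) := by
    classical
    intro X n x
    refine span X n (LinearMap.range (linComb M pt deg e X n)) (fun i q h c => ?_) x
    obtain rfl : q = n - deg i := by omega
    refine ⟨_, (linComb_lof M pt deg e X n i c)⟩
  { ι := ι
    pt := pt
    deg := deg
    level := level
    e := e
    bijective := fun X n => ⟨fun c c' h => DFinsupp.ext fun j => by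
      rw [← key X n c j, h, key], surj X n⟩
    d_e := fun i => by
      obtain ⟨c, hc⟩ := surj _ _ (M.d rfl (e i))
      refine ⟨c, hc.symm, fun j hj => lt i j _ (add_sub_cancel _ _) ?_⟩
      rwa [← hc, key] }

/-- The morphism with prescribed values on a semi-free basis, in one degree. -/
noncomputable def descAux (N : DGModule k A) {n : ℤ} (y : ∀ i, N.obj (S.pt i) (S.deg i + n))
    (X : A) (p q : ℤ) (hpq : p + n = q) : M.obj X p →ₗ[k] N.obj X q :=
  open Classical in
  DirectSum.toModule k S.ι (N.obj X q)
    (fun i => N.act (show S.deg i + n + (p - S.deg i) = q by omega) (y i)) ∘ₗ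
    (Ind.coord S X p).symm.toLinearMap

theorem descAux_act (N : DGModule k A) {n : ℤ} (y : ∀ i, N.obj (S.pt i) (S.deg i + n))
    (X : A) (p q : ℤ) (hpq : p + n = q) (i : S.ι) {r : ℤ} (h : S.deg i + r = p)
    (h' : S.deg i + n + r = q) (c : Hom k X (S.pt i) r) :
    S.descAux N y X p q hpq (M.act h (S.e i) c) = N.act h' (y i) c := by
  classical
  obtain rfl : r = p - S.deg i := by omega
  rw [← Ind.coord_lof, descAux, LinearMap.comp_apply]
  refine (congrArg _ ((Ind.coord S X p).symm_apply_apply _)).trans ?_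
  exact DirectSum.toModule_lof ..

/-- The morphism with prescribed values on a semi-free basis. -/
noncomputable def desc (N : DGModule k A) {n : ℤ} (y : ∀ i, N.obj (S.pt i) (S.deg i + n)) :
    DGModule.homs M N n :=
  ⟨fun X p q => S.descAux N y X p q.1 q.2, by
    intro X Y p q s t r hq ht hr hr' x a
    suffices H : S.descAux N y X t r hr ∘ₗ (M.act ht).flip a =
        (N.act hr').flip a ∘ₗ S.descAux N y Y p q hq from LinearMap.congr_fun H x
    refine S.linearMap_ext fun i l hl c => ?_
    simp only [LinearMap.comp_apply, LinearMap.flip_apply]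
    rw [M.act_act (pq := l + s) _ _ rfl (by omega),
      S.descAux_act N y X t r hr i _ (by omega), S.descAux_act N y Y p q hq i hl (by omega),
      N.act_act (pq := l + s) _ _ rfl (by omega)]⟩

theorem desc_act (N : DGModule k A) {n : ℤ} (y : ∀ i, N.obj (S.pt i) (S.deg i + n)) {X : A}
    {p q r : ℤ} (hpq : p + n = q) (i : S.ι) (h : S.deg i + r = p)
    (h' : S.deg i + n + r = q) (c : Hom k X (S.pt i) r) :
    (S.desc N y).1 X p ⟨q, hpq⟩ (M.act h (S.e i) c) = N.act h' (y i) c :=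
  S.descAux_act N y X p q hpq i h h' c

theorem desc_e (N : DGModule k A) {n : ℤ} (y : ∀ i, N.obj (S.pt i) (S.deg i + n)) (i : S.ι) :
    (S.desc N y).1 (S.pt i) (S.deg i) ⟨_, rfl⟩ (S.e i) = y i := by
  rw [← M.act_id (add_zero _) (S.e i), desc_act (h' := add_zero _), N.act_id]

theorem homs_ext {N : DGModule k A} {n : ℤ} {φ ψ : DGModule.homs M N n}
    (h : ∀ i, φ.1 (S.pt i) (S.deg i) ⟨_, rfl⟩ (S.e i) = ψ.1 (S.pt i) (S.deg i) ⟨_, rfl⟩ (S.e i)) :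
    φ = ψ := by
  apply DGModule.homs_ext
  intro X p q hpq x
  induction x using S.induction with
  | zero => rw [map_zero, map_zero]
  | add x y hx hy => rw [map_add, map_add, hx, hy]
  | act i r hr c =>
    rw [DGModule.homs_act φ (q := S.deg i + n) rfl hr hpq (by omega),
      DGModule.homs_act ψ (q := S.deg i + n) rfl hr hpq (by omega), h i]

/-- The coefficient of a basis element as a morphism to a representable module. -/
noncomputable def proj (j : S.ι) {n : ℤ} (h : S.deg j + n = 0) :
    DGModule.homs M (repr (k := k) (S.pt j)) n :=
  ⟨fun X p q => S.coord j (by have := q.2; omega), fun X Y p q s t r hq ht hr hr' x a =>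
    S.coord_act j x a ht (by omega) (by omega) hr'⟩

end SemiFreeBasis
end modules
end DG

namespace DG

/-! ### Semi-free modules have a zero object, shifts and extensions -/

section constructions

variable {k : Type w} [CommRing k] {A : Type u} [DGCategory.{u} k A]

namespace DGModule

variable (k A) in
/-- The zero module. -/
def zero : DGModule k A where
  obj _ _ := PUnit
  d _ := 0
  act _ := 0
  d_d _ _ _ := rfl
  act_id _ _ := rfl
  act_act _ _ _ _ _ _ _ := rfl
  d_act _ _ _ _ _ _ _ _ := rfl

variable (k A) in
theorem isSemiFree_zero : IsSemiFree (zero k A) :=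
  ⟨SemiFreeBasis.ofCoord (ι := PEmpty) (fun i => i.elim) (fun i => i.elim) (fun i => i.elim)
    (fun i => i.elim) (fun i => i.elim) (fun i => i.elim) (fun i => i.elim)
    (fun _ _ p _ _ => p.zero_mem) (fun i => i.elim)⟩

/-- Transport along an equality of degrees. -/
def tr (M : DGModule k A) {X : A} {p q : ℤ} (h : p = q) : M.obj X p →ₗ[k] M.obj X q :=
  h ▸ LinearMap.id

section transport

variable (M : DGModule k A)

theorem tr_tr {X : A} {p q r : ℤ} (h : p = q) (h' : q = r) (x : M.obj X p) :
    M.tr h' (M.tr h x) = M.tr (h.trans h') x := by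
  subst h h'; rfl

theorem act_tr {X Y : A} {p p' q r : ℤ} (e : p = p') (h : p + q = r) (h' : p' + q = r)
    (x : M.obj Y p) (f : Hom k X Y q) : M.act h' (M.tr e x) f = M.act h x f := by
  subst e; rfl

theorem tr_act {X Y : A} {p q r r' : ℤ} (e : r = r') (h : p + q = r) (h' : p + q = r')
    (x : M.obj Y p) (f : Hom k X Y q) : M.tr e (M.act h x f) = M.act h' x f := by
  subst e; rfl

theorem d_tr {X : A} {p p' q q' : ℤ} (e : p = p') (h : p + 1 = q) (h' : p' + 1 = q')
    (e' : q = q') (x : M.obj X p) : M.d h' (M.tr e x) = M.tr e' (M.d h x) := by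
  subst e e'; rfl

end transport

/-- The shift of a right DG module, with `M[n] (X)^p = M (X)^{p + n}`. -/
def shift (M : DGModule k A) (n : ℤ) : DGModule k A where
  obj X p := M.obj X (p + n)
  d h := sgn k n • M.d (by omega)
  act h := M.act (by omega)
  d_d h h' x := by
    simp only [LinearMap.smul_apply, map_smul, M.d_d, smul_zero]
  act_id _ x := M.act_id _ x
  act_act _ _ _ _ x g f := M.act_act _ _ _ _ x g f
  d_act {X Y q p r q' p' s} h hr hq hp h₁ h₂ x f := by
    simp only [LinearMap.smul_apply, map_smul]
    rw [M.d_act (q' := q' + n) (p' := p') _ _ (by omega) hp (by omega) (by omega), smul_add,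
      smul_smul, sgn_add]
    congr 2
    rw [mul_comm, mul_assoc, sgn_mul_self, mul_one]

theorem isSemiFree_shift {M : DGModule k A} (hM : IsSemiFree M) (n : ℤ) :
    IsSemiFree (M.shift n) := by
  obtain ⟨S⟩ := hM
  have coord_tr : ∀ {X : A} {p p' q : ℤ} (e : p = p') (j : S.ι) (h : S.deg j + q = p)
      (h' : S.deg j + q = p') (x : M.obj X p), S.coord j h' (M.tr e x) = S.coord j h x := by
    rintro X p _ q rfl j h h' x
    rfl
  refine ⟨SemiFreeBasis.ofCoord (ι := S.ι) S.pt (fun i => S.deg i - n) S.level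
    (fun i => M.tr (sub_add_cancel _ n).symm (S.e i))
    (fun j X p q h => S.coord j (show S.deg j + q = p + n by omega)) ?_ ?_ ?_ ?_⟩
  · intro j X p q h c
    refine (congrArg (S.coord j _) (M.act_tr _ (by omega) _ _ c)).trans ?_
    exact S.coord_act_self _ _ _ _
  · intro i j X p q q' h h' c hij
    refine (congrArg (S.coord j _) (M.act_tr _ (by omega) _ _ c)).trans ?_
    exact S.coord_act_ne hij _ _ _
  · intro X p W hW x
    induction x using S.induction with
    | zero => exact W.zero_mem
    | add x y hx hy => exact W.add_mem hx hy
    | act i q h c =>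
      refine (M.act_tr (sub_add_cancel (S.deg i) n).symm h (by omega) (S.e i) c) ▸ hW i q (by omega) c
  · intro i j q h hq
    refine S.level_lt (i := i) (j := j) (q := q) (by omega) fun h0 => hq ?_
    refine (map_smul (S.coord j _) (sgn k n) _).trans ?_
    refine (congrArg (sgn k n • S.coord j _ ·) (M.d_tr (sub_add_cancel _ n).symm rfl _ (by omega) (S.e i))).trans ?_
    rw [coord_tr (h := by omega), h0, smul_zero]

/-- The identity as a morphism from a module to its shift. -/
def shiftHIso (M : DGModule k A) {n m : ℤ} (h : m + n = 0) : HIso k m n M (M.shift n) where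
  a := ⟨fun X p q => M.tr (show p = q.1 + n by have := q.2; omega), by
    intro X Y p q s t r hq ht hr hr' x a
    exact (M.tr_act _ _ (show p + s = r + n by omega) x a).trans (M.act_tr _ _ _ x a).symm⟩
  b := ⟨fun X p q => M.tr (show p + n = q.1 by have := q.2; omega), by
    intro X Y p q s t r hq ht hr hr' x a
    exact (M.tr_act _ _ (show p + n + s = r by omega) x a).trans (M.act_tr _ _ _ x a).symm⟩
  h := h
  d_a {l} hl := by
    apply homs_ext
    intro X p q hpq x
    refine (homsD_apply (s := p + m) (t := p + 1) hl _ hpq rfl (by omega) rfl (by omega) _).trans ?_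
    refine sub_eq_zero_of_eq ?_
    have e : sgn k m = sgn k n := by
      have := sgn_add k m n
      rw [h, sgn_zero] at this
      rw [← mul_one (sgn k m), ← sgn_mul_self k n, ← mul_assoc, ← this, one_mul]
    rw [e]
    exact congrArg (sgn k n • ·) (M.d_tr _ rfl _ (show p + 1 = q + n by omega) x)
  d_b {l} hl := by
    apply homs_ext
    intro X p q hpq x
    refine (homsD_apply (s := p + n) (t := p + 1) hl _ hpq rfl (by omega) rfl (by omega) _).trans ?_
    refine sub_eq_zero_of_eq ?_
    refine (M.d_tr (show p + n = p + n from rfl) (show p + n + 1 = p + 1 + n by omega)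
      (show p + n + 1 = q by omega) (show p + 1 + n = q by omega) x).trans ?_
    refine Eq.trans ?_ (congrArg (sgn k n • ·) (map_smul (M.tr (show p + 1 + n = q by omega))
      (sgn k n) (M.d (show p + n + 1 = p + 1 + n by omega) x)).symm)
    rw [smul_smul, sgn_mul_self, one_smul]
  a_b := by
    apply homs_ext
    intro X p q hpq x
    obtain rfl : p = q := by omega
    exact (homsComp_apply (b := p + m) _ _ _ hpq rfl (by omega) x).trans (M.tr_tr _ _ x)
  b_a := by
    apply homs_ext
    intro X p q hpq x
    obtain rfl : p = q := by omega
    refine (homsComp_apply (M := M.shift n) (L := M.shift n) (b := p + n) h _ _ hpq rfl (by omega)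
      x).trans ?_
    exact M.tr_tr (show p + n = p + n from rfl) rfl x

/-- The extension of `N` by `M` with a given class. -/
def ext {M N : DGModule k A} (δ : homs M N 1) (hδ : homsD one_add_one_eq_two δ = 0) :
    DGModule k A where
  obj X n := N.obj X n × M.obj X n
  d {X m n} h := LinearMap.prod
    (N.d h ∘ₗ LinearMap.fst k _ _ + δ.1 X m ⟨n, h⟩ ∘ₗ LinearMap.snd k _ _)
    (M.d h ∘ₗ LinearMap.snd k _ _)
  act h := LinearMap.mk₂ k (fun x f => (N.act h x.1 f, M.act h x.2 f))
    (fun x y f => by simp) (fun c x f => by simp) (fun x f g => by simp) (fun c x f => by simp)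
  d_d {X m n l} h h' x := by
    have e := congrArg (fun φ : homs M N 2 => φ.1 X m ⟨l, by omega⟩ x.2) hδ
    dsimp only at e
    rw [homsD_apply (s := n) (t := n) _ _ _ h h' h h', show sgn k 1 = -1 by simp [sgn],
      neg_one_smul, sub_neg_eq_add] at e
    refine Prod.ext ?_ (M.d_d h h' x.2)
    change N.d h' (N.d h x.1 + δ.1 X m ⟨n, h⟩ x.2) + δ.1 X n ⟨l, h'⟩ (M.d h x.2) = 0
    rw [map_add, N.d_d, zero_add]
    exact e
  act_id h x := Prod.ext (N.act_id h x.1) (M.act_id h x.2)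
  act_act h₁ h₂ h₃ h₄ x g f := Prod.ext (N.act_act h₁ h₂ h₃ h₄ x.1 g f)
    (M.act_act h₁ h₂ h₃ h₄ x.2 g f)
  d_act {X Y q p r q' p' s} h hr hq hp h₁ h₂ x f := by
    refine Prod.ext ?_ (M.d_act h hr hq hp h₁ h₂ x.2 f)
    change N.d hr (N.act h x.1 f) + δ.1 X r ⟨s, hr⟩ (M.act h x.2 f) =
      N.act h₁ (N.d hq x.1 + δ.1 Y q ⟨q', hq⟩ x.2) f + sgn k q • N.act h₂ x.1 (DG.d hp f)
    rw [N.d_act h hr hq hp h₁ h₂, homs_act δ (q := q') hq h hr h₁, map_add, LinearMap.add_apply]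
    abel

theorem ext_d {M N : DGModule k A} (δ : homs M N 1) (hδ : homsD one_add_one_eq_two δ = 0) {X : A}
    {m n : ℤ} (h : m + 1 = n) (y : N.obj X m) (x : M.obj X m) :
    (ext δ hδ).d h (y, x) = (N.d h y + δ.1 X m ⟨n, h⟩ x, M.d h x) := rfl

/-- A function that increases along a relation and is bounded below by a given function. -/
def boundedLevel {ι : Type*} (level : ι → ℕ) (s : ι → Finset ι)
    (hs : ∀ i, ∀ j ∈ s i, level j < level i) (f : ι → ℕ) (i : ι) : ℕ :=
  f i + 1 + ∑ j : s i, boundedLevel level s hs f j.1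
termination_by level i
decreasing_by exact hs i j.1 j.2

theorem lt_boundedLevel {ι : Type*} (level : ι → ℕ) (s : ι → Finset ι)
    (hs : ∀ i, ∀ j ∈ s i, level j < level i) (f : ι → ℕ) (i : ι) :
    f i < boundedLevel level s hs f i := by
  rw [boundedLevel]
  omega

theorem boundedLevel_lt {ι : Type*} (level : ι → ℕ) (s : ι → Finset ι)
    (hs : ∀ i, ∀ j ∈ s i, level j < level i) (f : ι → ℕ) {i j : ι} (h : j ∈ s i) :
    boundedLevel level s hs f j < boundedLevel level s hs f i := by
  rw [boundedLevel.eq_1 level s hs f i]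
  have := Finset.single_le_sum (f := fun j : s i => boundedLevel level s hs f j.1)
    (fun _ _ => Nat.zero_le _) (Finset.mem_univ ⟨j, h⟩)
  dsimp only at this
  omega

/-- The union of the two bases works, but the levels need care: those of `N` may be unbounded, so
the basis of `M` cannot simply be placed after that of `N`. Since `δ` and `d` of a basis element
have finite support, new natural numbers can be chosen by recursion on the old level, above all
levels that occur. -/
theorem isSemiFree_ext {M N : DGModule k A} (hM : IsSemiFree M) (hN : IsSemiFree N)
    (δ : homs M N 1) (hδ : homsD one_add_one_eq_two δ = 0) : IsSemiFree (ext δ hδ) := by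
  classical
  obtain ⟨S⟩ := hM
  obtain ⟨T⟩ := hN
  choose s hs using fun i => T.exists_finset (δ.1 _ _ ⟨_, rfl⟩ (S.e i))
  choose t ht using fun i => S.exists_finset (M.d rfl (S.e i))
  -- The filter loses no index that occurs in `d (e i)`; it makes the recursion on the level
  -- well-founded.
  let t' : S.ι → Finset S.ι := fun i => (t i).filter fun j => S.level j < S.level i
  let l := boundedLevel S.level t' (fun i j hj => (Finset.mem_filter.1 hj).2)
    fun i => (s i).sup T.level
  refine ⟨SemiFreeBasis.ofCoord (ι := T.ι ⊕ S.ι) (Sum.elim T.pt S.pt) (Sum.elim T.deg S.deg)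
    (Sum.elim T.level l) (fun i => match i with
      | .inl i => (T.e i, 0)
      | .inr i => (0, S.e i))
    (fun i X n q h => match i, h with
      | .inl i, h => T.coord i h ∘ₗ LinearMap.fst k _ _
      | .inr i, h => S.coord i h ∘ₗ LinearMap.snd k _ _) ?_ ?_ ?_ ?_⟩
  · rintro (j | j) X n q h c
    · exact T.coord_act_self j h h c
    · exact S.coord_act_self j h h c
  · rintro (i | i) (j | j) X n q q' h h' c hij
    · exact T.coord_act_ne (fun e => hij (congrArg _ e)) h h' c
    · exact (congrArg (S.coord j h') (LinearMap.map_zero₂ (M.act h) c)).trans (map_zero _)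
    · exact (congrArg (T.coord j h') (LinearMap.map_zero₂ (N.act h) c)).trans (map_zero _)
    · exact S.coord_act_ne (fun e => hij (congrArg _ e)) h h' c
  · rintro X n W hW ⟨y, x⟩
    have hy : (y, 0) ∈ W := by
      induction y using T.induction with
      | zero => exact W.zero_mem
      | add x y hx hy =>
        have : (x + y, 0 + 0) ∈ W := W.add_mem hx hy
        rwa [add_zero] at this
      | act i q h c =>
        have : (N.act h (T.e i) c, M.act h 0 c) ∈ W := hW (.inl i) q h c
        rwa [LinearMap.map_zero₂] at this
    have hx : (0, x) ∈ W := by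
      induction x using S.induction with
      | zero => exact W.zero_mem
      | add x y hx hy =>
        have : (0 + 0, x + y) ∈ W := W.add_mem hx hy
        rwa [add_zero] at this
      | act i q h c =>
        have : (N.act h 0 c, M.act h (S.e i) c) ∈ W := hW (.inr i) q h c
        rwa [LinearMap.map_zero₂] at this
    have : (y + 0, 0 + x) ∈ W := W.add_mem hy hx
    rwa [add_zero, zero_add] at this
  · rintro (i | i) (j | j) q h hq
    · have h1 : T.coord j h ((ext δ hδ).d rfl (T.e i, 0)).1 ≠ 0 := hq
      rw [ext_d, map_zero, add_zero] at h1
      exact T.level_lt h h1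
    · have h1 : S.coord j h ((ext δ hδ).d rfl (T.e i, 0)).2 ≠ 0 := hq
      exact absurd ((congrArg (S.coord j h) (map_zero (M.d rfl))).trans (map_zero _)) h1
    · have h1 : T.coord j h ((ext δ hδ).d rfl (0, S.e i)).1 ≠ 0 := hq
      rw [ext_d, map_zero, zero_add] at h1
      have hj : j ∈ s i := by
        by_contra h0
        exact h1 (hs i j h0 q h)
      have h2 := lt_boundedLevel S.level t' (fun i j hj => (Finset.mem_filter.1 hj).2)
        (fun i => (s i).sup T.level) i
      exact lt_of_le_of_lt (Finset.le_sup (f := T.level) hj) h2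
    · have h1 : S.coord j h ((ext δ hδ).d rfl (0, S.e i)).2 ≠ 0 := hq
      rw [ext_d] at h1
      refine boundedLevel_lt _ _ _ _ (Finset.mem_filter.2 ⟨?_, S.level_lt h h1⟩)
      by_contra h0
      exact h1 (ht i j h0 q h)

/-- A family of linear maps that commutes with the action is a morphism of degree `0`. -/
def ofMaps {M N : DGModule k A} (φ : ∀ (X : A) (p : ℤ), M.obj X p →ₗ[k] N.obj X p)
    (hφ : ∀ (X Y : A) (p q r : ℤ) (h : p + q = r) (x : M.obj Y p) (f : Hom k X Y q),
      φ X r (M.act h x f) = N.act h (φ Y p x) f) : homs M N 0 :=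
  ⟨fun X p q => N.tr (by have := q.2; omega) ∘ₗ φ X p, by
    intro X Y p q s t r hq ht hr hr' x a
    obtain rfl : p = q := by omega
    obtain rfl : t = r := by omega
    exact hφ _ _ _ _ _ _ _ _⟩

theorem homs_ext_zero {M N : DGModule k A} {φ ψ : homs M N 0}
    (h : ∀ (X : A) (p : ℤ) (x : M.obj X p), φ.1 X p ⟨p, add_zero p⟩ x = ψ.1 X p ⟨p, add_zero p⟩ x) :
    φ = ψ := by
  apply homs_ext
  intro X p q hpq x
  obtain rfl : p = q := by omega
  exact h X p x

theorem homsD_zero_apply {M N : DGModule k A} (φ : homs M N 0) {X : A} {p q : ℤ} (h : p + 1 = q)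
    (x : M.obj X p) : (homsD (zero_add 1) φ).1 X p ⟨q, h⟩ x =
      N.d h (φ.1 X p ⟨p, add_zero p⟩ x) - φ.1 X q ⟨q, add_zero q⟩ (M.d h x) := by
  rw [homsD_apply (s := p) (t := q) _ _ h (add_zero p) h h (add_zero q), sgn_zero, one_smul]

/-- The graded split extension given by `ext`. -/
def extExt {M N : DGModule k A} (δ : homs M N 1) (hδ : homsD one_add_one_eq_two δ = 0) :
    Ext k N (ext δ hδ) M where
  i := ofMaps (N := ext δ hδ) (fun X p => LinearMap.inl k _ _)
    (fun X Y p q r h x f => Prod.ext rfl (LinearMap.map_zero₂ (M.act h) f).symm)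
  π := ofMaps (M := ext δ hδ) (fun X p => LinearMap.snd k _ _) (fun X Y p q r h x f => rfl)
  r := ofMaps (M := ext δ hδ) (fun X p => LinearMap.fst k _ _) (fun X Y p q r h x f => rfl)
  s := ofMaps (N := ext δ hδ) (fun X p => LinearMap.inr k _ _)
    (fun X Y p q r h x f => Prod.ext (LinearMap.map_zero₂ (N.act h) f).symm rfl)
  δ := δ
  d_i := by
    apply homs_ext
    intro X p q hpq x
    refine (homsD_zero_apply _ hpq x).trans (sub_eq_zero_of_eq ?_)
    refine Prod.ext ?_ (map_zero (M.d hpq))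
    change N.d hpq x + δ.1 X p ⟨q, hpq⟩ 0 = N.d hpq x
    rw [map_zero, add_zero]
  d_π := by
    apply homs_ext
    intro X p q hpq x
    exact (homsD_zero_apply (M := ext δ hδ) _ hpq x).trans (sub_eq_zero_of_eq rfl)
  d_s := by
    apply homs_ext
    intro X p q hpq x
    refine (homsD_zero_apply (N := ext δ hδ) _ hpq x).trans ?_
    refine Eq.trans ?_ (homsComp_apply (L := ext δ hδ) (b := q) _ _ δ _ hpq (add_zero q) x).symm
    refine Prod.ext ?_ (sub_self _)
    refine (sub_zero _).trans ?_
    exact (congrArg₂ (· + ·) (map_zero (N.d hpq)) rfl).trans (zero_add _)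
  d_r := by
    apply homs_ext
    intro X p q hpq x
    refine (homsD_zero_apply (M := ext δ hδ) _ hpq x).trans ?_
    refine Eq.trans ?_ (congrArg Neg.neg (homsComp_apply (M := ext δ hδ) (b := p) _ δ _ _ (add_zero p) hpq x)).symm
    exact (sub_add_cancel_left (N.d hpq x.1) (δ.1 X p ⟨q, hpq⟩ x.2))
  i_r := homs_ext_zero fun X p x =>
    homsComp_apply (N := ext δ hδ) (b := p) _ _ _ _ (add_zero p) (add_zero p) x
  s_π := homs_ext_zero fun X p x =>
    homsComp_apply (N := ext δ hδ) (b := p) _ _ _ _ (add_zero p) (add_zero p) x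
  i_π := homs_ext_zero fun X p x =>
    homsComp_apply (N := ext δ hδ) (b := p) _ _ _ _ (add_zero p) (add_zero p) x
  s_r := homs_ext_zero fun X p x =>
    homsComp_apply (N := ext δ hδ) (b := p) _ _ _ _ (add_zero p) (add_zero p) x
  sum := homs_ext_zero fun X p x => by
    have h₁ := homsComp_apply (M := ext δ hδ) (L := ext δ hδ) (zero_add 0)
      (ofMaps (N := ext δ hδ) (fun X p => LinearMap.inl k _ _)
        (fun X Y p q r h x f => Prod.ext rfl (LinearMap.map_zero₂ (M.act h) f).symm))
      (ofMaps (M := ext δ hδ) (fun X p => LinearMap.fst k _ _) (fun X Y p q r h x f => rfl))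
      (add_zero p) (add_zero p) (add_zero p) x
    have h₂ := homsComp_apply (M := ext δ hδ) (L := ext δ hδ) (zero_add 0)
      (ofMaps (N := ext δ hδ) (fun X p => LinearMap.inr k _ _)
        (fun X Y p q r h x f => Prod.ext (LinearMap.map_zero₂ (N.act h) f).symm rfl))
      (ofMaps (M := ext δ hδ) (fun X p => LinearMap.snd k _ _) (fun X Y p q r h x f => rfl))
      (add_zero p) (add_zero p) (add_zero p) x
    exact (congrArg₂ (· + ·) h₁ h₂).trans (Prod.ext (add_zero _) (zero_add _))

end DGModule

open DGModule

-- Semi-free modules form a full DG subcategory, so the constructions for modules are reinterpreted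
-- as they stand, once semi-freeness is known.
variable (k A) in
theorem sPretr_indCat : SPretr k (IndCat k A) where
  zero := ⟨⟨zero k A, isSemiFree_zero k A⟩, DGModule.homs_ext fun _ _ _ _ _ => rfl⟩
  shift M _ m h := ⟨⟨M.obj.shift m, isSemiFree_shift M.property m⟩,
    ⟨{ (shiftHIso M.obj h) with }⟩⟩
  ext M N δ hδ := ⟨⟨DGModule.ext δ hδ, isSemiFree_ext M.property N.property δ hδ⟩,
    { (extExt δ hδ) with }, rfl⟩

end constructions
end DG

namespace DG

section

variable {k : Type w} [CommRing k] {C : Type u} [DGCategory.{v} k C]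

/-- A closed invertible morphism has a closed inverse. -/
def HIso.ofClosed {X S : C} {n m : ℤ} (a : Hom k X S n) (b : Hom k S X m) (h : n + m = 0)
    (d_a : ∀ {l : ℤ} (h : n + 1 = l), d h a = 0)
    (a_b : comp (show m + n = 0 by omega) b a = idd k X) (b_a : comp h a b = idd k S) :
    HIso k n m X S where
  a := a
  b := b
  h := h
  d_a := d_a
  a_b := a_b
  b_a := b_a
  d_b := by
    rintro l rfl
    have h₁ := (congrArg (d (zero_add 1)) b_a).trans (d_id S (zero_add 1))
    -- From `a b = 1` and `d a = 0` follows `a (d b) = 0` up to sign; composing with `b` on the left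
    -- gives `d b = 0`.
    rw [DGCategory.d_comp h (zero_add 1) rfl rfl (by omega) (by omega), d_a rfl, map_zero,
      LinearMap.zero_apply, zero_add] at h₁
    have h₃ := congrArg (fun x => comp (rfl : m + 1 = m + 1) b
      (sgn k n • x)) h₁
    simp only [smul_zero, map_zero, smul_smul, sgn_mul_self, one_smul] at h₃
    rw [← DGCategory.assoc (show m + n = 0 by omega) (zero_add (m + 1)), a_b,
      DGCategory.id_comp] at h₃
    exact h₃

end

/-! ### Induction along a fully faithful functor -/

section induction

variable {k : Type w} [CommRing k] {B : Type u} [DGCategory.{u} k B] {A : Type u}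
  [DGCategory.{u} k A]

open scoped DirectSum

namespace Ind

variable (F : DGFunctor k B A) {N : DGModule k B}

/-- The canonical map `x ↦ x ⊗ id`. -/
noncomputable def unit {b : B} {n : ℤ} : N.obj b n →ₗ[k] (ind F N).obj (F.obj b) n :=
  (mk F N (add_zero n)).flip (idd k (F.obj b))

theorem act_unit {b : B} {Y : A} {n p q : ℤ} (x : N.obj b n) (h : n + p = q) (f : Hom k Y (F.obj b) p) :
    (ind F N).act h (unit F x) f = mk F N h x f := by
  refine (action_mk (t' := p) h (add_zero n) (zero_add p) h x _ f).trans ?_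
  rw [DGCategory.id_comp]

theorem unit_act {b b' : B} {n p q : ℤ} (x : N.obj b n) (h : n + p = q) (f : Hom k b' b p) :
    unit F (N.act h x f) = (ind F N).act h (unit F x) (F.map f) := by
  rw [act_unit]
  refine (mk_act (r := p) h (add_zero q) (add_zero p) h x f _).trans ?_
  rw [DGCategory.comp_id]

theorem d_unit {b : B} {n m : ℤ} (h : n + 1 = m) (x : N.obj b n) :
    (ind F N).d h (unit F x) = unit F (N.d h x) := by
  refine (diff_mk h (add_zero n) h (zero_add 1) (add_zero m) h x _).trans ?_
  rw [d_id, map_zero, smul_zero, add_zero]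
  rfl

theorem indMap_unit {N' : DGModule k B} {n : ℤ} (φ : DGModule.homs N N' n) {b : B} {p q : ℤ}
    (h : p + n = q) (x : N.obj b p) :
    (indMap F φ).1 (F.obj b) p ⟨q, h⟩ (unit F x) = unit F (φ.1 b p ⟨q, h⟩ x) :=
  indMapAux_mk φ h (add_zero p) h (add_zero q) x _

end Ind

open Ind

/-- The induced semi-free basis. -/
noncomputable def SemiFreeBasis.ind (F : DGFunctor k B A) {N : DGModule k B} (S : SemiFreeBasis N) :
    SemiFreeBasis (Ind.ind F N) where
  ι := S.ι
  pt i := F.obj (S.pt i)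
  deg := S.deg
  level := S.level
  e i := unit F (S.e i)
  bijective X n := Function.bijective_iff_has_inverse.2
    ⟨_, indCoord_linComb F S X n, linComb_indCoord F S X n⟩
  d_e i := by
    obtain ⟨c, hc, hl⟩ := S.d_e i
    refine ⟨DirectSum.lmap (fun j => F.map) c, ?_, fun j hj => hl j fun h0 => hj ?_⟩
    · rw [d_unit, hc]
      refine (linComb_pushCoord F S (add_zero _) c (idd k _)).symm.trans (congrArg _ ?_)
      clear hc hl
      classical
      induction c using DirectSum.induction_on with
      | zero => simp
      | of j c =>
        refine (pushCoord_lof _ _ _ _ _ _ (by omega)).trans ?_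
        rw [DGCategory.comp_id]
        exact (DirectSum.lmap_lof (R := k) (fun j => (F.map :
          Hom k (S.pt i) (S.pt j) (S.deg i + 1 - S.deg j) →ₗ[k] _)) j c).symm
      | add x y hx hy =>
        simp only [map_add, LinearMap.add_apply, hx, hy]
    · rw [DirectSum.lmap_apply, h0, map_zero]

theorem SemiFreeBasis.coord_ind_unit (F : DGFunctor k B A) {N : DGModule k B} (S : SemiFreeBasis N)
    (j : S.ι) {b : B} {n q : ℤ} (h : S.deg j + q = n) (x : N.obj b n) :
    (S.ind F).coord j h (unit F x) = F.map (S.coord j h x) := by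
  suffices H : (S.ind F).coord j h ∘ₗ unit F = F.map ∘ₗ S.coord j h from LinearMap.congr_fun H x
  refine S.linearMap_ext fun i r hr c => ?_
  refine Eq.trans (congrArg ((S.ind F).coord j h) (unit_act F (S.e i) hr c)) ?_
  by_cases e : i = j
  · subst e
    obtain rfl : r = q := by omega
    exact ((S.ind F).coord_act_self i h hr (F.map c)).trans
      (congrArg F.map (S.coord_act_self i h hr c)).symm
  · exact ((S.ind F).coord_act_ne e hr h (F.map c)).trans
      ((congrArg F.map (S.coord_act_ne e hr h c)).trans (map_zero _)).symm

/-- In coordinates with respect to a semi-free basis and the induced basis the map is `F` on each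
coefficient, so full faithfulness of `F` suffices. -/
theorem SemiFreeBasis.unit_bijective {F : DGFunctor k B A} (hF : F.FF) {N : DGModule k B}
    (S : SemiFreeBasis N) (b : B) (n : ℤ) :
    Function.Bijective (unit F : N.obj b n → (Ind.ind F N).obj (F.obj b) n) := by
  constructor
  · intro x y h
    refine S.ext_coord fun j q hq => (hF _ _ _).1 ?_
    rw [← coord_ind_unit, ← coord_ind_unit, h]
  · intro y
    induction y using (S.ind F).induction with
    | zero => exact ⟨0, map_zero _⟩
    | add x y hx hy =>
      obtain ⟨x, rfl⟩ := hx
      obtain ⟨y, rfl⟩ := hy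
      exact ⟨x + y, map_add _ _ _⟩
    | act i q h c =>
      obtain ⟨c, rfl⟩ := (hF b (S.pt i) q).2 c
      exact ⟨N.act h (S.e i) c, unit_act F _ h c⟩

/-- Induction along a fully faithful DG functor is fully faithful. -/
theorem indFunctor_ff {F : DGFunctor k B A} (hF : F.FF) : (indFunctor F).FF := by
  intro N N' n
  obtain ⟨S⟩ := N.property
  obtain ⟨T⟩ := N'.property
  constructor
  · intro φ ψ h
    refine S.homs_ext fun i => (T.unit_bijective hF _ _).1 ?_
    rw [← indMap_unit, ← indMap_unit]
    exact congrArg (fun χ : DGModule.homs (ind F N.obj) (ind F N'.obj) n =>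
      χ.1 _ _ ⟨S.deg i + n, rfl⟩ (unit F (S.e i))) h
  · intro φ
    choose y hy using fun i => (T.unit_bijective hF (S.pt i) (S.deg i + n)).2
      (φ.1 (F.obj (S.pt i)) (S.deg i) ⟨_, rfl⟩ (unit F (S.e i)))
    refine ⟨S.desc N'.obj y, (S.ind F).homs_ext fun i => ?_⟩
    refine (indMap_unit F (S.desc N'.obj y) rfl (S.e i)).trans ?_
    exact (congrArg (unit F) (S.desc_e N'.obj y i)).trans (hy i)

end induction

section representable

variable {k : Type w} [CommRing k] {A : Type u} [DGCategory.{u} k A]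

namespace SemiFreeBasis

/-- The basis of a representable module given by the identity. -/
noncomputable def repr (X : A) : SemiFreeBasis (DG.repr (k := k) X) :=
  ofCoord (ι := PUnit) (fun _ => X) (fun _ => 0) (fun _ => 0) (fun _ => idd k X)
    (fun _ Y n q h => degCast k (show n = q by omega))
    (fun _ Y n q h c => by
      obtain rfl : q = n := by omega
      exact DGCategory.id_comp _ _)
    (fun _ _ _ _ _ _ _ _ _ h => absurd rfl h)
    (fun Y n p hp x => by
      have := hp ⟨⟩ n (zero_add n) x
      rwa [show (DG.repr (k := k) X).act (zero_add n) (idd k X) x = x from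
        DGCategory.id_comp _ _] at this)
    (fun _ _ q h hq => by
      refine absurd ?_ hq
      refine (congrArg _ (show (DG.repr (k := k) X).d rfl (idd k X) = 0 from d_id X rfl)).trans
        (map_zero _))

variable {M : DGModule k A} (S : SemiFreeBasis M)

theorem proj_e_self (i : S.ι) {m : ℤ} (h : S.deg i + m = 0) :
    (S.proj i h).1 (S.pt i) (S.deg i) ⟨0, h⟩ (S.e i) = idd k (S.pt i) := by
  have := S.coord_act_self i (add_zero _) (add_zero _) (idd k (S.pt i))
  rw [M.act_id] at this
  exact this

theorem proj_e_ne {i j : S.ι} (hij : i ≠ j) {m q : ℤ} (h : S.deg j + m = 0) (hq : S.deg i + m = q) :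
    (S.proj j h).1 (S.pt i) (S.deg i) ⟨q, hq⟩ (S.e i) = 0 := by
  have := S.coord_act_ne hij (add_zero _) (show S.deg j + q = S.deg i by omega) (idd k (S.pt i))
  rw [M.act_id] at this
  exact this

theorem _root_.DG.DGModule.yo_id (X : A) :
    (DG.repr (k := k) X).yo (idd k X) = DGModule.homsId (DG.repr (k := k) X) := by
  refine DGModule.homs_ext fun Y p q hpq f => ?_
  obtain rfl : p = q := by omega
  exact DGCategory.id_comp _ _

theorem _root_.DG.DGModule.yo_idd_eq_homsId {X : A} {n q : ℤ} (x : M.obj X n) (h : 0 + n = q)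
    (h' : n + 0 = q) :
    (M.yo x).1 X 0 ⟨q, h⟩ (idd k X) = (DGModule.homsId M).1 X n ⟨q, h'⟩ x := by
  obtain rfl : n = q := by omega
  exact M.act_id _ _

/-- A module with one basis element, which is closed, is a shift of a representable module. -/
noncomputable def uniqueHIso (i : S.ι) (hi : ∀ j, j = i) (hd : M.d rfl (S.e i) = 0) {m : ℤ}
    (h : S.deg i + m = 0) : HIso k (S.deg i) m (DG.repr (k := k) (S.pt i)) M :=
  have a_b : DGModule.homsComp (show m + S.deg i = 0 by omega) (S.proj i h) (M.yo (S.e i)) =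
      DGModule.homsId (DG.repr (k := k) (S.pt i)) :=
    (DGModule.comp_yo (show m + S.deg i = 0 by omega) (S.proj i h) (S.e i) h).trans
      ((congrArg (DG.repr (k := k) (S.pt i)).yo (S.proj_e_self i h)).trans (DGModule.yo_id _))
  have b_a : DGModule.homsComp h (M.yo (S.e i)) (S.proj i h) = DGModule.homsId M := by
    refine S.homs_ext fun j => ?_
    obtain rfl : i = j := (hi j).symm
    refine (DGModule.homsComp_apply (b := 0) h (M.yo (S.e i)) (S.proj i h) rfl h (by omega)
      (S.e i)).trans ?_
    rw [proj_e_self]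
    exact DGModule.yo_idd_eq_homsId (S.e i) (by omega) rfl
  have d_a : ∀ {l : ℤ} (h : S.deg i + 1 = l), DGModule.homsD h (M.yo (S.e i)) = 0 := by
    rintro l rfl
    refine (DGModule.d_yo M rfl _).trans ?_
    rw [hd, map_zero]
  HIso.ofClosed (k := k) (C := DGModule k A) (M.yo (S.e i)) (S.proj i h) h d_a a_b b_a

end SemiFreeBasis
end representable
end DG

namespace DG

/-! ### Dévissage of acyclicity along the levels of a semi-free basis -/

section devissage

variable {k : Type w} [CommRing k] {A : Type u} [DGCategory.{u} k A]

open DGModule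

namespace SemiFreeBasis

variable {M : DGModule k A} (S : SemiFreeBasis M)

theorem apply_congr {N : DGModule k A} {n : ℤ} (φ ψ : homs M N n) {X : A} {p q : ℤ}
    (hpq : p + n = q) (x : M.obj X p)
    (h : ∀ j r (hr : S.deg j + r = p), S.coord j hr x ≠ 0 →
      φ.1 (S.pt j) (S.deg j) ⟨_, rfl⟩ (S.e j) = ψ.1 (S.pt j) (S.deg j) ⟨_, rfl⟩ (S.e j)) :
    φ.1 X p ⟨q, hpq⟩ x = ψ.1 X p ⟨q, hpq⟩ x := by
  obtain ⟨s, hs⟩ := S.exists_finset x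
  rw [← S.sum_coord x s hs, map_sum, map_sum]
  refine Finset.sum_congr rfl fun j _ => ?_
  rw [homs_act φ (q := S.deg j + n) rfl _ hpq (by omega),
    homs_act ψ (q := S.deg j + n) rfl _ hpq (by omega)]
  by_cases h0 : S.coord j (add_sub_cancel (S.deg j) p) x = 0
  · rw [h0, map_zero, map_zero]
  · rw [h j _ _ h0]

/-- Values of a primitive of `φ` on the basis elements. -/
noncomputable def primitive {Z : DGModule k A} {m n : ℤ} (hn : m + 1 = n) (φ : homs M Z n) (i : S.ι) :
    Z.obj (S.pt i) (S.deg i + m) :=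
  open Classical in
  let w := φ.1 (S.pt i) (S.deg i) ⟨S.deg i + n, rfl⟩ (S.e i) +
    sgn k m • (S.desc Z fun j => if _ : S.level j < S.level i then primitive hn φ j else 0).1
      (S.pt i) (S.deg i + 1) ⟨S.deg i + n, by omega⟩ (M.d rfl (S.e i))
  if h : ∃ y, Z.d (show S.deg i + m + 1 = S.deg i + n by omega) y = w then h.choose else 0
termination_by S.level i

/-- Replacing the truncated values of the recursion by the full ones changes nothing, because `d (e
i)` is supported on lower levels. -/
theorem primitive_spec {Z : DGModule k A} {m n : ℤ} (hn : m + 1 = n) (φ : homs M Z n) (i : S.ι)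
    (h : ∃ y, Z.d (show S.deg i + m + 1 = S.deg i + n by omega) y =
      φ.1 (S.pt i) (S.deg i) ⟨S.deg i + n, rfl⟩ (S.e i) + sgn k m •
        (S.desc Z (S.primitive hn φ)).1 (S.pt i) (S.deg i + 1) ⟨S.deg i + n, by omega⟩
          (M.d rfl (S.e i))) :
    Z.d (show S.deg i + m + 1 = S.deg i + n by omega) (S.primitive hn φ i) =
      φ.1 (S.pt i) (S.deg i) ⟨S.deg i + n, rfl⟩ (S.e i) + sgn k m •
        (S.desc Z (S.primitive hn φ)).1 (S.pt i) (S.deg i + 1) ⟨S.deg i + n, by omega⟩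
          (M.d rfl (S.e i)) := by
  classical
  have key : (S.desc Z fun j => if _ : S.level j < S.level i then S.primitive hn φ j else 0).1
      (S.pt i) (S.deg i + 1) ⟨S.deg i + n, by omega⟩ (M.d rfl (S.e i)) =
      (S.desc Z (S.primitive hn φ)).1 (S.pt i) (S.deg i + 1) ⟨S.deg i + n, by omega⟩
        (M.d rfl (S.e i)) := by
    refine S.apply_congr _ _ _ _ fun j r hr hj => ?_
    rw [desc_e, desc_e, dif_pos (S.level_lt hr hj)]
  rw [← key] at h ⊢
  rw [primitive, dif_pos h]
  exact h.choose_spec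

/-- If the complexes of morphisms from the generators of a semi-free module to `Z` are acyclic, then
so is the complex of morphisms from the module. -/
theorem acyclicHom {Z : DGModule k A} (H : ∀ i, AcyclicHom k (DG.repr (k := k) (S.pt i)) Z) :
    AcyclicHom k M Z := by
  intro m n l hn hl φ hφ
  refine ⟨S.desc Z (S.primitive hn φ), ?_⟩
  change homsD hn (S.desc Z (S.primitive hn φ)) = φ
  set ψ := S.desc Z (S.primitive hn φ) with hψ
  refine S.homs_ext fun i => ?_
  induction hi : S.level i using Nat.strong_induction_on generalizing i with
  | _ a ih =>
  subst hi
  -- By induction `d ψ` and `φ` agree on `d (e i)`. With `d² = 0` and `d φ = 0` this shows that the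
  -- required boundary is a cocycle, so acyclicity on the generator gives a primitive.
  have h₁ : (homsD hn ψ).1 (S.pt i) (S.deg i + 1) ⟨S.deg i + l, show S.deg i + 1 + n = _ by omega⟩ (M.d rfl (S.e i)) =
      φ.1 (S.pt i) (S.deg i + 1) ⟨S.deg i + l, show S.deg i + 1 + n = _ by omega⟩ (M.d rfl (S.e i)) :=
    S.apply_congr _ _ _ _ fun j r hr hj => ih _ (S.level_lt hr hj) j rfl
  have h₂ : (homsD hl (homsD hn ψ)).1 (S.pt i) (S.deg i) ⟨S.deg i + l, rfl⟩ (S.e i) = 0 := by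
    have : homsD hl (homsD hn ψ) = 0 := DGCategory.d_d (k := k) (C := DGModule k A) hn hl ψ
    rw [this]; rfl
  have h₃ : (homsD hl φ).1 (S.pt i) (S.deg i) ⟨S.deg i + l, rfl⟩ (S.e i) = 0 := by
    have : homsD hl φ = 0 := hφ
    rw [this]; rfl
  rw [homsD_apply hl _ rfl (show S.deg i + n = S.deg i + n from rfl)
    (show S.deg i + n + 1 = S.deg i + l by omega) (show S.deg i + 1 = S.deg i + 1 from rfl)
    (show S.deg i + 1 + n = S.deg i + l by omega)] at h₂ h₃
  have h₄ : (homsD hn ψ).1 (S.pt i) (S.deg i) ⟨S.deg i + n, rfl⟩ (S.e i) =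
      Z.d (show S.deg i + m + 1 = S.deg i + n by omega) (S.primitive hn φ i) -
        sgn k m • ψ.1 (S.pt i) (S.deg i + 1) ⟨S.deg i + n, by omega⟩ (M.d rfl (S.e i)) := by
    rw [homsD_apply hn _ rfl (show S.deg i + m = S.deg i + m from rfl)
      (show S.deg i + m + 1 = S.deg i + n by omega) (show S.deg i + 1 = S.deg i + 1 from rfl)
      (show S.deg i + 1 + m = S.deg i + n by omega), hψ, desc_e]
  rw [h₄, S.primitive_spec hn φ i, add_sub_cancel_right]
  refine (acyclicHom_repr_iff _ _).1 (H i) _ _ (S.deg i + l) _ (by omega) _ ?_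
  rw [h₄, map_sub, Z.d_d, zero_sub, h₁] at h₂
  rw [map_add]
  rw [sub_eq_iff_eq_add] at h₂ h₃
  rw [h₃, zero_add]
  rw [zero_add] at h₂
  rw [← h₂, neg_add_cancel]

end SemiFreeBasis

variable {B : Type u} [DGCategory.{u} k B]

/-- Induction takes representable modules to representable modules. -/
theorem Ind.nonempty_hIso_repr (F : DGFunctor k B A) (b : B) :
    Nonempty (HIso k 0 0 (DG.repr (k := k) (F.obj b)) (ind F (DG.repr (k := k) b))) :=
  have hd : (ind F (DG.repr (k := k) b)).d rfl (unit F (N := DG.repr (k := k) b) (idd k b)) = 0 :=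
    (d_unit F (N := DG.repr (k := k) b) rfl (idd k b)).trans
      ((congrArg (unit F (N := DG.repr (k := k) b)) (d_id b rfl)).trans (map_zero _))
  ⟨((SemiFreeBasis.repr (k := k) b).ind F).uniqueHIso ⟨⟩ (fun _ => rfl) hd
    (zero_add 0)⟩

end devissage
end DG

namespace DG

/-! ### Resolution by induced modules -/

section cells

variable {k : Type w} [CommRing k] {B : Type u} [DGCategory.{u} k B] {A : Type u}
  [DGCategory.{u} k A] (F : DGFunctor k B A) (M : DGModule k A)

open scoped DirectSum

/-- Cells at `b` of degree `n`, given by a boundary, which is a linear combination of cells, and an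
element of `M`. -/
inductive Cell : B → ℤ → Type u
  -- The boundary is stored as a finite list of cells with coefficients, so that the type is
  -- inductive. Nothing forces it to be a cocycle, because the differential is defined only once all
  -- cells exist; `Good` imposes this afterwards.
  | attach (b : B) (n : ℤ) (x : M.obj (F.obj b) (n + 1)) (m : ℕ) (a : Fin m → B) (l : Fin m → ℤ)
      (h : ∀ i, Hom k b (a i) (n + 1 - l i)) (c : ∀ i, Cell (a i) (l i)) : Cell b n

namespace Cell

/-- Indices of the summands of degree `p` of the free graded module on the cells. -/
structure Idx (p : ℤ) where
  b : B
  n : ℤ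
  cell : Cell F M b n
  q : ℤ
  h : n + q = p

/-- The free graded module on the cells. -/
abbrev Free (X : B) (p : ℤ) : Type u := ⨁ i : Idx F M p, Hom k X i.b i.q

variable {F M}

open Classical in
/-- The multiples of a cell. -/
noncomputable def of {X b : B} {n p q : ℤ} (c : Cell F M b n) (h : n + q = p) :
    Hom k X b q →ₗ[k] Free F M X p :=
  DirectSum.lof k (Idx F M p) (fun i => Hom k X i.b i.q) ⟨b, n, c, q, h⟩

open Classical in
/-- The linear map given by its values on the multiples of cells. -/
noncomputable def lift {X : B} {p : ℤ} {L : Type u} [AddCommGroup L] [Module k L]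
    (β : ∀ (b : B) (n q : ℤ) (_ : Cell F M b n), n + q = p → (Hom k X b q →ₗ[k] L)) :
    Free F M X p →ₗ[k] L :=
  DirectSum.toModule k _ L (fun i => β i.b i.n i.q i.cell i.h)

theorem lift_of {X : B} {p : ℤ} {L : Type u} [AddCommGroup L] [Module k L]
    (β : ∀ (b : B) (n q : ℤ) (_ : Cell F M b n), n + q = p → (Hom k X b q →ₗ[k] L)) {b : B} {n q : ℤ}
    (c : Cell F M b n) (h : n + q = p) (f : Hom k X b q) : lift β (of c h f) = β b n q c h f := by
  classical
  exact DirectSum.toModule_lof ..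

theorem hom_ext {X : B} {p : ℤ} {L : Type u} [AddCommGroup L] [Module k L]
    {φ ψ : Free F M X p →ₗ[k] L} (h : ∀ (b : B) (n q : ℤ) (c : Cell F M b n) (h : n + q = p)
      (f : Hom k X b q), φ (of c h f) = ψ (of c h f)) : φ = ψ := by
  classical
  refine DirectSum.linearMap_ext _ ?_
  rintro ⟨b, n, c, q, hq⟩
  exact LinearMap.ext fun f => h b n q c hq f

/-- The right action on the free graded module. -/
noncomputable def act {X Y : B} {p s r : ℤ} (h : p + s = r) :
    Free F M Y p →ₗ[k] Hom k X Y s →ₗ[k] Free F M X r :=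
  lift fun b n q c hq => (comp (k := k) (X := X) (Y := Y) (Z := b) (q := q) rfl).compr₂
    (of c (show n + (q + s) = r by omega))

theorem act_of {X Y b : B} {n p q s t r : ℤ} (c : Cell F M b n) (h : p + s = r) (hq : n + q = p)
    (ht : q + s = t) (h' : n + t = r) (f : Hom k Y b q) (g : Hom k X Y s) :
    act h (of c hq f) g = of c h' (comp ht f g) := by
  subst ht
  exact LinearMap.congr_fun (lift_of _ c hq f) g

/-- The boundary of a cell. -/
noncomputable def bd : ∀ {b : B} {n : ℤ}, Cell F M b n → Free F M b (n + 1)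
  | _, _, attach _ n _ _ _ _ h c => ∑ i, of (c i) (add_sub_cancel _ (n + 1)) (h i)

/-- The element of `M` assigned to a cell. -/
def val : ∀ {b : B} {n : ℤ}, Cell F M b n → M.obj (F.obj b) (n + 1)
  | _, _, attach _ _ x _ _ _ _ _ => x

/-- The level of a cell. -/
def level : ∀ {b : B} {n : ℤ}, Cell F M b n → ℕ
  | _, _, attach _ _ _ _ _ _ _ c => 1 + ∑ i, level (c i)

/-- The operator on the free graded module given by the boundaries of the cells. -/
noncomputable def diff {X : B} {p r : ℤ} (h : p + 1 = r) : Free F M X p →ₗ[k] Free F M X r :=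
  lift fun _ n q c hq => act (show n + 1 + q = r by omega) (bd c) +
    sgn k n • of c (show n + (q + 1) = r by omega) ∘ₗ d rfl

theorem diff_of {X b : B} {n p q r t : ℤ} (c : Cell F M b n) (h : p + 1 = r) (hq : n + q = p)
    (h₁ : n + 1 + q = r) (ht : q + 1 = t) (h₂ : n + t = r) (f : Hom k X b q) :
    diff h (of c hq f) = act h₁ (bd c) f + sgn k n • of c h₂ (d ht f) := by
  subst ht
  exact lift_of _ c hq f

/-- The map of degree `1` to `M` given by the values of the cells. -/
noncomputable def eval {X : B} {p r : ℤ} (h : p + 1 = r) :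
    Free F M X p →ₗ[k] M.obj (F.obj X) r :=
  lift fun _ n q c hq => M.act (show n + 1 + q = r by omega) (val c) ∘ₗ F.map

theorem eval_of {X b : B} {n p q r : ℤ} (c : Cell F M b n) (h : p + 1 = r) (hq : n + q = p)
    (h₁ : n + 1 + q = r) (f : Hom k X b q) :
    eval h (of c hq f) = M.act h₁ (val c) (F.map f) :=
  lift_of _ c hq f

theorem act_act {X Y Z : B} {p q r pq qr n : ℤ} (h₁ : r + q = qr) (h₂ : qr + p = n)
    (h₃ : q + p = pq) (h₄ : r + pq = n) (x : Free F M Z r) (g : Hom k Y Z q) (f : Hom k X Y p) :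
    act h₂ (act h₁ x g) f = act h₄ x (comp h₃ g f) := by
  suffices H : (act h₂).flip f ∘ₗ (act h₁).flip g =
    ((act h₄).flip (comp h₃ g f) : Free F M Z r →ₗ[k] _) from LinearMap.congr_fun H x
  refine hom_ext fun b s t c hst a => ?_
  simp only [LinearMap.comp_apply, LinearMap.flip_apply]
  rw [act_of (t := t + q) _ _ _ rfl (by omega), act_of (t := t + q + p) _ _ _ (by omega) (by omega),
    act_of (t := t + q + p) _ _ _ (by omega) (by omega), DGCategory.assoc]

theorem act_id {X : B} {p : ℤ} (h : p + 0 = p) (x : Free F M X p) : act h x (idd k X) = x := by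
  suffices H : (act h).flip (idd k X) = (LinearMap.id : Free F M X p →ₗ[k] _) from
    LinearMap.congr_fun H x
  refine hom_ext fun b s t c hst a => ?_
  rw [LinearMap.flip_apply, act_of (t := t) _ _ _ (by omega) (by omega), DGCategory.comp_id,
    LinearMap.id_apply]

theorem diff_act {X Y : B} {q p r q' p' s : ℤ} (h : q + p = r) (hr : r + 1 = s) (hq : q + 1 = q')
    (hp : p + 1 = p') (h₁ : q' + p = s) (h₂ : q + p' = s) (x : Free F M Y q) (f : Hom k X Y p) :
    diff hr (act h x f) = act h₁ (diff hq x) f + sgn k q • act h₂ x (d hp f) := by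
  suffices H : diff hr ∘ₗ (act h).flip f =
      (act h₁).flip f ∘ₗ diff hq + (sgn k q • (act h₂).flip (d hp f) :
        Free F M Y q →ₗ[k] _) from LinearMap.congr_fun H x
  refine hom_ext fun b n t c hst a => ?_
  subst hp
  have e : sgn k q = sgn k n * sgn k t := by rw [← sgn_add, hst]
  simp only [LinearMap.comp_apply, LinearMap.flip_apply, LinearMap.add_apply,
    LinearMap.smul_apply]
  rw [act_of (t := t + p) _ _ _ rfl (by omega),
    diff_of (t := t + p + 1) _ _ _ (by omega) rfl (by omega),
    diff_of (t := t + 1) _ _ _ (by omega) rfl (by omega), map_add, map_smul,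
    LinearMap.add_apply, LinearMap.smul_apply,
    act_act (pq := t + p) _ _ rfl (by omega),
    act_of (t := t + p + 1) _ _ _ (by omega) (by omega),
    act_of (t := t + p + 1) _ _ _ (by omega) (by omega),
    DGCategory.d_comp (q' := t + 1) (p' := p + 1) _ _ rfl rfl (by omega) (by omega), map_add,
    map_smul, e]
  module

theorem eval_act {X Y : B} {p s t q r : ℤ} (h : p + s = t) (ht : t + 1 = r) (hq : p + 1 = q)
    (h' : q + s = r) (x : Free F M Y p) (f : Hom k X Y s) :
    eval ht (act h x f) = M.act h' (eval hq x) (F.map f) := by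
  suffices H : eval ht ∘ₗ (act h).flip f =
      ((M.act h').flip (F.map f) ∘ₗ eval hq : Free F M Y p →ₗ[k] _) from LinearMap.congr_fun H x
  refine hom_ext fun b n l c hst a => ?_
  simp only [LinearMap.comp_apply, LinearMap.flip_apply]
  rw [act_of (t := l + s) _ _ _ rfl (by omega), eval_of _ _ _ (by omega),
    eval_of _ _ _ (by omega), F.map_comp, M.act_act (pq := l + s) _ _ rfl (by omega)]

/-- The cells all of whose iterated boundaries are cocycles of the cone of the map to `M`. -/
def Good : ∀ {b : B} {n : ℤ}, Cell F M b n → Prop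
  | _, _, attach b n x m a l h c => (∀ i, Good (c i)) ∧ diff rfl (bd (attach b n x m a l h c)) = 0 ∧
      M.d rfl x + eval rfl (bd (attach b n x m a l h c)) = 0

theorem Good.diff_bd {b : B} {n : ℤ} {c : Cell F M b n} (hc : Good c) :
    diff rfl (bd c) = 0 := by
  cases c
  rw [Good] at hc
  exact hc.2.1

theorem Good.d_val {b : B} {n : ℤ} {c : Cell F M b n} (hc : Good c) :
    M.d rfl (val c) + eval rfl (bd c) = 0 := by
  cases c
  rw [Good] at hc
  exact hc.2.2

variable (F M) in
/-- The span of the good cells. -/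
def goodSpan (X : B) (p : ℤ) : Submodule k (Free F M X p) :=
  Submodule.span k { x | ∃ (b : B) (n q : ℤ) (c : Cell F M b n) (h : n + q = p) (f : Hom k X b q),
    Good c ∧ x = of c h f }

theorem of_mem {X b : B} {n p q : ℤ} {c : Cell F M b n} (hc : Good c) (h : n + q = p)
    (f : Hom k X b q) : of c h f ∈ goodSpan F M X p :=
  Submodule.subset_span ⟨b, n, q, c, h, f, hc, rfl⟩

theorem good_induction {X : B} {p : ℤ} {P : Submodule k (Free F M X p)}
    (h : ∀ (b : B) (n q : ℤ) (c : Cell F M b n) (h : n + q = p) (f : Hom k X b q),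
      Good c → of c h f ∈ P) {x : Free F M X p} (hx : x ∈ goodSpan F M X p) : x ∈ P := by
  refine Submodule.span_le.2 ?_ hx
  rintro _ ⟨b, n, q, c, hq, f, hc, rfl⟩
  exact h b n q c hq f hc

theorem bd_mem {b : B} {n : ℤ} {c : Cell F M b n} (hc : Good c) : bd c ∈ goodSpan F M b (n + 1) := by
  cases c
  rw [Good] at hc
  rw [bd]
  exact Submodule.sum_mem _ fun i _ => of_mem (hc.1 i) _ _

theorem act_mem {X Y : B} {p s r : ℤ} (h : p + s = r) {x : Free F M Y p}
    (hx : x ∈ goodSpan F M Y p) (f : Hom k X Y s) : act h x f ∈ goodSpan F M X r := by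
  refine good_induction (P := (goodSpan F M X r).comap ((act h).flip f)) ?_ hx
  intro b n q c hq g hc
  rw [Submodule.mem_comap, LinearMap.flip_apply, act_of c h hq rfl (by omega)]
  exact of_mem hc _ _

theorem diff_mem {X : B} {p r : ℤ} (h : p + 1 = r) {x : Free F M X p}
    (hx : x ∈ goodSpan F M X p) : diff h x ∈ goodSpan F M X r := by
  refine good_induction (P := (goodSpan F M X r).comap (diff h)) ?_ hx
  intro b n q c hq g hc
  rw [Submodule.mem_comap, diff_of c h hq (by omega) rfl (by omega)]
  exact add_mem (act_mem _ (bd_mem hc) _) (Submodule.smul_mem _ _ (of_mem hc _ _))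

/-- The restriction to the good span is essential: the boundary of an arbitrary cell need not be a
cycle. -/
theorem diff_diff {X : B} {p r s : ℤ} (h : p + 1 = r) (h' : r + 1 = s) {x : Free F M X p}
    (hx : x ∈ goodSpan F M X p) : diff h' (diff h x) = 0 := by
  refine good_induction (P := LinearMap.ker (diff h' ∘ₗ diff h)) ?_ hx
  intro b n q c hq g hc
  rw [LinearMap.mem_ker, LinearMap.comp_apply, diff_of c h hq (by omega) rfl (by omega), map_add,
    map_smul, diff_act _ _ rfl rfl (by omega) (by omega), hc.diff_bd,
    diff_of c h' _ (by omega) rfl (by omega), DGCategory.d_d, map_zero, map_zero,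
    smul_zero, add_zero, LinearMap.zero_apply, zero_add, sgn_succ]
  module

/-- Closedness of a map of degree `1`, hence the plus sign. On a cell it is the second cocycle
condition in the definition of good cells. -/
theorem d_eval {X : B} {p r s : ℤ} (h : p + 1 = r) (h' : r + 1 = s) {x : Free F M X p}
    (hx : x ∈ goodSpan F M X p) : M.d h' (eval h x) + eval h' (diff h x) = 0 := by
  refine good_induction (P := LinearMap.ker (M.d h' ∘ₗ eval h + eval h' ∘ₗ diff h)) ?_ hx
  intro b n q c hq g hc
  rw [LinearMap.mem_ker, LinearMap.add_apply, LinearMap.comp_apply, LinearMap.comp_apply,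
    diff_of c h hq (by omega) rfl (by omega), map_add,
    map_smul, eval_act _ _ rfl (by omega), eval_of _ _ _ (by omega), eval_of _ _ _ (by omega),
    M.d_act (q' := n + 1 + 1) (p' := q + 1) _ _ rfl rfl (by omega) (by omega),
    eq_neg_of_add_eq_zero_left hc.d_val, map_neg, LinearMap.neg_apply, F.map_d, sgn_succ]
  module

variable (F M) in
/-- The DG module spanned by the good cells. -/
noncomputable def goodModule : DGModule k B where
  obj X p := goodSpan F M X p
  d h := (diff h).restrict fun _ hx => diff_mem h hx
  act h := LinearMap.mk₂ k (fun x f => ⟨act h x.1 f, act_mem h x.2 f⟩)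
    (fun _ _ _ => Subtype.ext (LinearMap.map_add₂ _ _ _ _))
    (fun _ _ _ => Subtype.ext (LinearMap.map_smul₂ _ _ _ _))
    (fun _ _ _ => Subtype.ext (map_add _ _ _))
    (fun _ _ _ => Subtype.ext (map_smul _ _ _))
  d_d h h' x := Subtype.ext (diff_diff h h' x.2)
  act_id h x := Subtype.ext (act_id h x.1)
  act_act h₁ h₂ h₃ h₄ x g f := Subtype.ext (act_act h₁ h₂ h₃ h₄ x.1 g f)
  d_act h hr hq hp h₁ h₂ x f := Subtype.ext (diff_act h hr hq hp h₁ h₂ x.1 f)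

variable (F M) in
/-- The good cells. -/
structure GoodIdx where
  b : B
  n : ℤ
  cell : Cell F M b n
  good : Good cell

open Classical in
/-- The coefficient of a cell. -/
noncomputable def coeff {X b : B} {n p q : ℤ} (c : Cell F M b n) (h : n + q = p) :
    Free F M X p →ₗ[k] Hom k X b q :=
  DirectSum.component k (Idx F M p) (fun i => Hom k X i.b i.q) ⟨b, n, c, q, h⟩

theorem coeff_of_self {X b : B} {n p q : ℤ} (c : Cell F M b n) (h : n + q = p) (f : Hom k X b q) :
    coeff c h (of c h f) = f := by
  classical
  exact DirectSum.lof_apply k (ι := Idx F M p) (M := fun i => Hom k X i.b i.q) ⟨b, n, c, q, h⟩ f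

theorem coeff_of_ne {X b b' : B} {n n' p q q' : ℤ} (c : Cell F M b n) (h : n + q = p)
    (c' : Cell F M b' n') (h' : n' + q' = p) (f : Hom k X b q)
    (hne : (⟨b, n, c⟩ : Σ b n, Cell F M b n) ≠ ⟨b', n', c'⟩) :
    coeff c' h' (of c h f) = 0 := by
  classical
  refine DirectSum.of_eq_of_ne (β := fun i : Idx F M p => Hom k X i.b i.q) ⟨b, n, c, q, h⟩
    ⟨b', n', c', q', h'⟩ f fun e => hne ?_
  cases e
  rfl

theorem level_lt {b b' : B} {n n' q : ℤ} (c : Cell F M b n) (c' : Cell F M b' n')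
    (h : n' + q = n + 1) (hc : coeff c' h (bd c) ≠ 0) : level c' < level c := by
  cases c with
  | attach b n x m a l f c =>
    by_contra hl
    refine hc ?_
    rw [bd, map_sum]
    refine Finset.sum_eq_zero fun i _ => coeff_of_ne _ _ _ _ _ ?_
    intro e
    cases e
    rw [level] at hl
    have := Finset.single_le_sum (f := fun i => level (c i)) (fun _ _ => Nat.zero_le _)
      (Finset.mem_univ i)
    omega

variable (F M) in
/-- The good cells form a semi-free basis. -/
noncomputable def goodBasis : SemiFreeBasis (goodModule F M) :=
  SemiFreeBasis.ofCoord (ι := GoodIdx F M) (fun i => i.b) (fun i => i.n) (fun i => level i.cell)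
    (fun i => ⟨of i.cell (add_zero _) (idd k i.b), of_mem i.good _ _⟩)
    (fun j X n q h => coeff j.cell h ∘ₗ (goodSpan F M X n).subtype)
    (fun j X n q h c => by
      refine Eq.trans (congrArg (coeff j.cell h)
        (act_of j.cell h (add_zero _) (zero_add q) h (idd k j.b) c)) ?_
      rw [coeff_of_self, DGCategory.id_comp])
    (fun i j X n q q' h h' c hij => by
      refine Eq.trans (congrArg (coeff j.cell h')
        (act_of i.cell h (add_zero _) (zero_add q) h (idd k i.b) c)) ?_
      refine coeff_of_ne _ _ _ _ _ fun e => hij ?_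
      obtain ⟨b, n, c, hc⟩ := i
      obtain ⟨b', n', c', hc'⟩ := j
      cases e
      rfl)
    (fun X n P hP x => by
      obtain ⟨x, hx⟩ := x
      have := good_induction (P := P.map (goodSpan F M X n).subtype) (fun b m q c h f hc => ?_) hx
      · obtain ⟨y, hy, rfl⟩ := this
        exact hy
      · refine ⟨_, hP ⟨b, m, c, hc⟩ q h f, ?_⟩
        refine (act_of c h (add_zero _) (zero_add q) h (idd k b) f).trans ?_
        rw [DGCategory.id_comp])
    (fun i j q h hq => level_lt i.cell j.cell h fun h0 => hq (by
      refine Eq.trans (congrArg (coeff j.cell h)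
        (diff_of i.cell rfl (add_zero _) (add_zero _) (zero_add 1) rfl (idd k i.b))) ?_
      rw [act_id, d_id, map_zero, smul_zero, add_zero, h0]))

/-- This brings an element of the good span into the form that the constructor of a cell requires;
scalars are absorbed into the coefficients. -/
theorem exists_eq_sum {X : B} {p : ℤ} {x : Free F M X p} (hx : x ∈ goodSpan F M X p) :
    ∃ (m : ℕ) (a : Fin m → B) (l : Fin m → ℤ) (h : ∀ i, Hom k X (a i) (p - l i))
      (c : ∀ i, Cell F M (a i) (l i)), (∀ i, Good (c i)) ∧
      x = ∑ i, of (c i) (add_sub_cancel _ _) (h i) := by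
  suffices H : ∃ (ι : Type) (_ : Fintype ι) (a : ι → B) (l : ι → ℤ)
      (h : ∀ i, Hom k X (a i) (p - l i)) (c : ∀ i, Cell F M (a i) (l i)), (∀ i, Good (c i)) ∧
      x = ∑ i, of (c i) (add_sub_cancel _ _) (h i) by
    obtain ⟨ι, _, a, l, h, c, hc, hx⟩ := H
    let e := (Fintype.equivFin ι).symm
    refine ⟨_, a ∘ e, l ∘ e, fun i => h (e i), fun i => c (e i), fun i => hc (e i), ?_⟩
    rw [hx]
    exact (Equiv.sum_comp e (fun i => of (c i) (add_sub_cancel _ _) (h i))).symm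
  refine Submodule.span_induction ?_ ?_ ?_ ?_ hx
  · rintro _ ⟨b, n, q, c, h, f, hc, rfl⟩
    obtain rfl : q = p - n := by omega
    exact ⟨Unit, inferInstance, fun _ => b, fun _ => n, fun _ => f, fun _ => c, fun _ => hc,
      by simp⟩
  · exact ⟨Empty, inferInstance, Empty.elim, Empty.elim, fun i => i.elim, fun i => i.elim,
      fun i => i.elim, by simp⟩
  · rintro x y _ _ ⟨ι, _, a, l, h, c, hc, rfl⟩ ⟨ι', _, a', l', h', c', hc', rfl⟩
    refine ⟨ι ⊕ ι', inferInstance, Sum.elim a a', Sum.elim l l',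
      fun i => match i with | .inl i => h i | .inr i => h' i,
      fun i => match i with | .inl i => c i | .inr i => c' i,
      fun i => match i with | .inl i => hc i | .inr i => hc' i, ?_⟩
    rw [Fintype.sum_sum_type]
    rfl
  · rintro t x _ ⟨ι, _, a, l, h, c, hc, rfl⟩
    refine ⟨ι, inferInstance, a, l, fun i => t • h i, c, hc, ?_⟩
    rw [Finset.smul_sum]
    exact Finset.sum_congr rfl fun i _ => (map_smul _ _ _).symm

/-- Each cocycle of the cone of the map from the induced module to `M` is the boundary of a good
cell. -/
theorem exists_good {b : B} {n : ℤ} (x : M.obj (F.obj b) (n + 1)) (y : Free F M b (n + 1))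
    (hy : y ∈ goodSpan F M b (n + 1)) (h₁ : diff rfl y = 0) (h₂ : M.d rfl x + eval rfl y = 0) :
    ∃ c : Cell F M b n, Good c ∧ val c = x ∧ bd c = y := by
  obtain ⟨m, a, l, h, c, hc, rfl⟩ := exists_eq_sum hy
  have e : bd (attach b n x m a l h c) = ∑ i, of (c i) (add_sub_cancel _ _) (h i) := by rw [bd]
  refine ⟨attach b n x m a l h c, ?_, rfl, e⟩
  rw [Good, e]
  exact ⟨hc, h₁, h₂⟩

end Cell
end cells
end DG

namespace DG

section

variable {k : Type w} [CommRing k] {C : Type u} [DGCategory.{v} k C]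

/-- `d (s x) = i δ x + s (d x)`, so `s x` is a primitive of `f` as soon as its two components match
those of `f`. -/
theorem Ext.d_s_comp {Y Z X W : C} (e : Ext k Y Z X) {m n : ℤ} (h : m + 1 = n) (f : Hom k W Z n)
    (x : Hom k W X m) (h₁ : comp (show 1 + m = n by omega) e.δ x = comp (zero_add n) e.r f)
    (h₂ : d h x = comp (zero_add n) e.π f) : d h (comp (zero_add m) e.s x) = f := by
  rw [DGCategory.d_comp (zero_add m) h (zero_add 1) h (by omega) (by omega), h₂, e.d_s,
    DGCategory.assoc (zero_add 1) _ (show 1 + m = n by omega) (zero_add n), h₁, sgn_zero, one_smul,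
    ← DGCategory.assoc (zero_add 0) (zero_add n), ← DGCategory.assoc (zero_add 0) (zero_add n),
    ← LinearMap.add_apply, ← map_add, e.sum, DGCategory.id_comp]

theorem Ext.d_comp_r {Y Z X W : C} (e : Ext k Y Z X) {m n : ℤ} (h : m + 1 = n) (f : Hom k W Z m)
    (hf : d h f = 0) : d h (comp (zero_add m) e.r f) =
      -comp (show 1 + m = n by omega) e.δ (comp (zero_add m) e.π f) := by
  rw [DGCategory.d_comp (zero_add m) h (zero_add 1) h (by omega) (by omega), hf, e.d_r, map_zero,
    smul_zero, add_zero, LinearMap.map_neg₂,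
    DGCategory.assoc (add_zero 1) _ (zero_add m) (show 1 + m = n by omega)]

theorem Ext.d_comp_π {Y Z X W : C} (e : Ext k Y Z X) {m n : ℤ} (h : m + 1 = n) (f : Hom k W Z m)
    (hf : d h f = 0) : d h (comp (zero_add m) e.π f) = 0 := by
  rw [DGCategory.d_comp (zero_add m) h (zero_add 1) h (by omega) (by omega), hf, e.d_π, map_zero,
    map_zero, smul_zero, LinearMap.zero_apply, add_zero]

end

section resolution

variable {k : Type w} [CommRing k] {B : Type u} [DGCategory.{u} k B] {A : Type u}
  [DGCategory.{u} k A] (F : DGFunctor k B A) (M : DGModule k A)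

namespace Cell

open Ind

variable {F M} in
theorem goodBasis_d_e {b : B} {n : ℤ} {c : Cell F M b n} (hc : Good c) :
    (goodModule F M).d rfl ((goodBasis F M).e ⟨b, n, c, hc⟩) = ⟨bd c, bd_mem hc⟩ := by
  refine Subtype.ext ?_
  refine (diff_of c rfl (add_zero _) (add_zero _) (zero_add 1) rfl (idd k b)).trans ?_
  rw [act_id, d_id, map_zero, smul_zero]
  exact add_zero _

theorem act_of_idd {X b : B} {n p q : ℤ} (c : Cell F M b n) (h : n + q = p) (f : Hom k X b q) :
    act h (of c (add_zero n) (idd k b)) f = of c h f := by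
  rw [act_of c h (add_zero n) (zero_add q) h, DGCategory.id_comp]

/-- The map of degree `1` from the module induced by the good cells to `M`. -/
noncomputable def evalMap : DGModule.homs (ind F (goodModule F M)) M 1 :=
  ((goodBasis F M).ind F).desc M fun i => val i.cell

variable {F M} in
theorem evalMap_unit {b : B} {p q : ℤ} (h : p + 1 = q) (x : (goodModule F M).obj b p) :
    (evalMap F M).1 (F.obj b) p ⟨q, h⟩ (unit F x) = eval h x.1 := by
  suffices H : (evalMap F M).1 (F.obj b) p ⟨q, h⟩ ∘ₗ unit F =
    eval h ∘ₗ (goodSpan F M b p).subtype from LinearMap.congr_fun H x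
  refine (goodBasis F M).linearMap_ext fun i r hr c => ?_
  refine (congrArg ((evalMap F M).1 (F.obj b) p ⟨q, h⟩)
    (unit_act F ((goodBasis F M).e i) hr c)).trans ?_
  refine (((goodBasis F M).ind F).desc_act M _ h i hr
    (show i.n + 1 + r = q by have : i.n + r = p := hr; omega) (F.map c)).trans ?_
  refine Eq.trans ?_ (congrArg (eval h) (act_of_idd F M i.cell hr c)).symm
  exact (eval_of i.cell h hr _ c).symm

theorem d_evalMap : DGModule.homsD one_add_one_eq_two (evalMap F M) = 0 := by
  refine ((goodBasis F M).ind F).homs_ext fun i => ?_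
  refine (DGModule.homsD_apply one_add_one_eq_two (evalMap F M) rfl (s := i.n + 1) (t := i.n + 1)
    rfl (show i.n + 1 + 1 = i.n + 2 by omega) rfl (show i.n + 1 + 1 = i.n + 2 by omega)
    (unit F ((goodBasis F M).e i))).trans ?_
  refine Eq.trans (congrArg₂ (· - sgn k 1 • ·) (congrArg _ (evalMap_unit rfl _))
    ((congrArg _ (d_unit F rfl ((goodBasis F M).e i))).trans (evalMap_unit _ _))) ?_
  have := d_eval (r := i.n + 1) (s := i.n + 2) rfl (by omega) ((goodBasis F M).e i).2
  have e : sgn k 1 = -1 := by rw [← zero_add 1, sgn_succ, sgn_zero]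
  rw [e, neg_one_smul, sub_neg_eq_add]
  exact this

end Cell

open Cell Ind DGModule in
/-- Each semi-free module fits into a graded split extension with an induced module and a module
whose values on the objects in the image of `F` are acyclic. -/
theorem exists_ext_acyclicHom (hF : F.FF) (M : IndCat k A) :
    ∃ (N : IndCat k B) (Z : IndCat k A) (_ : Ext k M Z ((indFunctor F).obj N)),
      ∀ b, AcyclicHom k ((toInd k A).obj (F.obj b)) Z := by
  obtain ⟨Z, e, he⟩ := (sPretr_indCat k A).ext
    ((indFunctor F).obj ⟨goodModule F M.obj, ⟨goodBasis F M.obj⟩⟩) M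
    (evalMap F M.obj) (d_evalMap F M.obj)
  refine ⟨_, Z, e, fun b m n l h h' f hf => ?_⟩
  subst h
  -- The only use of full faithfulness: an element of the induced module at `F b` is `y ⊗ 1` for a
  -- combination `y` of good cells at `b`.
  obtain ⟨y, hy⟩ : ∃ y : (goodModule F M.obj).obj b (m + 1),
      (ind F (goodModule F M.obj)).yo (unit F y) = comp (zero_add _) e.π f := by
    refine ⟨_, Eq.trans (congrArg _ (((goodBasis F M.obj).unit_bijective hF b (m + 1)).2
      _).choose_spec) (DGModule.eq_yo _ _).symm⟩
  obtain ⟨x, hx⟩ : ∃ x : M.obj.obj (F.obj b) (m + 1), M.obj.yo x = comp (zero_add _) e.r f :=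
    ⟨_, (DGModule.eq_yo _ _).symm⟩
  have hdy : (goodModule F M.obj).d h' y = 0 := by
    refine ((goodBasis F M.obj).unit_bijective hF b l).1 (DGModule.yo_injective _ ?_)
    have := e.d_comp_π h' f hf
    rw [← hy] at this
    rw [← d_unit, map_zero, map_zero]
    exact (DGModule.d_yo _ h' (unit F y)).symm.trans this
  have hdx : M.obj.d h' x + eval h' y.1 = 0 := by
    refine DGModule.yo_injective _ ?_
    have := e.d_comp_r h' f hf
    rw [← hy, ← hx, he] at this
    have h₁ := DGModule.comp_yo (show 1 + (m + 1) = l by omega) (evalMap F M.obj) (unit F y) h'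
    rw [map_add, map_zero, ← evalMap_unit h' y, ← h₁, ← DGModule.d_yo]
    exact eq_neg_iff_add_eq_zero.1 this
  subst h'
  -- The components `(x, y)` of the cocycle are the data of a new good cell, and the basis element
  -- of this cell is the primitive.
  obtain ⟨c, hc, rfl, hcy⟩ := exists_good x y.1 y.2 (congrArg Subtype.val hdy) hdx
  refine ⟨comp (zero_add m) e.s ((ind F (goodModule F M.obj)).yo
    (unit F ((goodBasis F M.obj).e ⟨b, m, c, hc⟩))), e.d_s_comp rfl f _ ?_ ?_⟩
  · rw [he, ← hx]
    refine (DGModule.comp_yo (show 1 + m = m + 1 by omega) (evalMap F M.obj) (unit F _) rfl).trans ?_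
    exact congrArg _ (((goodBasis F M.obj).ind F).desc_e _ _ ⟨b, m, c, hc⟩)
  · rw [← hy]
    refine (DGModule.d_yo _ rfl _).trans (congrArg _ ((d_unit F rfl _).trans (congrArg _ ?_)))
    exact (goodBasis_d_e hc).trans (Subtype.ext hcy)

end resolution
end DG

namespace DG

/-! ### Finite pieces of semi-free modules -/

section pieces

variable {k : Type w} [CommRing k] {C : Type u} [DGCategory.{v} k C]

/-- A graded idempotent whose image is an object of `K`, with closed inclusion. -/
def HasPiece (K : ObjectProperty (Ho k C)) {N : C} (p : Hom k N N 0) : Prop :=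
  ∃ (N' : C) (u : Hom k N' N 0) (r : Hom k N N' 0), K ⟨⟨N'⟩⟩ ∧ d (zero_add 1) u = 0 ∧
    comp (zero_add 0) r u = idd k N' ∧ comp (zero_add 0) u r = p

theorem hasPiece_zero (hC : SPretr k C) {K : ObjectProperty (Ho k C)} (hK : ExtClosed K) (N : C) :
    HasPiece K (0 : Hom k N N 0) := by
  obtain ⟨X, hX⟩ := hC.zero
  exact ⟨X, 0, 0, hK.zero hX, map_zero _, by rw [map_zero, hX], by rw [map_zero]⟩

/-- Attaching one cell: as `d ε` lies in the image of `p` by `hd`, it defines a class from `R` to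
the piece `N'`, and the extension of this class maps to `N` by a closed morphism built from `u` and
`ε`. -/
theorem HasPiece.add (hC : SPretr k C) {K : ObjectProperty (Ho k C)} (hK : ExtClosed K) {N R : C}
    {p : Hom k N N 0} (hp : HasPiece K p) (hR : K ⟨⟨R⟩⟩) (ε : Hom k R N 0) (ρ : Hom k N R 0)
    (hρε : comp (zero_add 0) ρ ε = idd k R) (hpε : comp (zero_add 0) p ε = 0)
    (hρp : comp (zero_add 0) ρ p = 0)
    (hd : comp (zero_add 1) p (d (zero_add 1) ε) = d (zero_add 1) ε) :
    HasPiece K (p + comp (zero_add 0) ε ρ) := by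
  obtain ⟨N', u, r, hN', hu, hru, rfl⟩ := hp
  have hu' := (closed_zero_iff _ _).1 hu
  have hε := act_d_zero (zero_add 1) ε
  rw [eq_sub_iff_add_eq] at hε
  simp only [← act_inj, act_comp, act_idd, act_zero, Category.assoc] at hru hρε hpε hρp hd
  have h₁ : act ε ≫ act r = 0 := by
    have := hpε =≫ act r
    simpa [hru] using this
  have h₂ : act u ≫ act ρ = 0 := by
    have := act u ≫= hρp
    simpa [reassoc_of% hru] using this
  obtain ⟨Z, e, he⟩ := hC.ext R N' (comp (zero_add 1) r (d (zero_add 1) ε)) (by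
    have hδ : d one_add_one_eq_two (comp (zero_add 1) u (comp (zero_add 1) r (d (zero_add 1) ε))) =
        0 := by
      rw [show comp (zero_add 1) u (comp (zero_add 1) r (d (zero_add 1) ε)) = d (zero_add 1) ε by
        rw [← act_inj, act_comp, act_comp, Category.assoc, hd], DGCategory.d_d]
    -- The class is closed although `r` need not be: composed with the closed split inclusion `u` it
    -- becomes `d ε`.
    rw [closed_one_iff] at hδ ⊢
    simp only [act_comp, Category.assoc] at hδ ⊢
    have := hδ =≫ act r
    simp only [Category.assoc, hu', Preadditive.neg_comp, hru, Category.comp_id] at this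
    exact this)
  have heδ : act e.δ = act (d (zero_add 1) ε) ≫ act r := by rw [he, act_comp]
  refine ⟨Z, comp (zero_add 0) u e.r + comp (zero_add 0) ε e.π,
    comp (zero_add 0) e.i r + comp (zero_add 0) e.s ρ, hK.ext e hN' hR, ?_, ?_, ?_⟩
  · rw [closed_zero_iff]
    simp only [act_comp, act_add, Preadditive.add_comp, Preadditive.comp_add, Category.assoc, hu',
      ← hε, e.act_r_d_assoc, e.act_π_d_assoc, heδ, hd]
    abel
  · simp only [← act_inj, act_comp, act_add, Preadditive.add_comp, Preadditive.comp_add,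
      Category.assoc, act_idd, reassoc_of% hru, reassoc_of% hρε, reassoc_of% h₁, reassoc_of% h₂,
      e.act_r_i, Limits.zero_comp, Limits.comp_zero]
    abel
  · simp only [← act_inj, act_comp, act_add, Preadditive.add_comp, Preadditive.comp_add,
      Category.assoc, e.act_i_r_assoc, e.act_s_r_assoc, e.act_i_π_assoc, e.act_s_π_assoc,
      Limits.comp_zero]
    abel

theorem HasPiece.map {D : Type u'} [DGCategory.{v'} k D] (F : DGFunctor k C D)
    {K : ObjectProperty (Ho k D)} {N : C} {p : Hom k N N 0} (hp : HasPiece (K.inverseImage F.ho) p) :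
    HasPiece K (F.map p) := by
  obtain ⟨N', u, r, hN', hu, hru, rfl⟩ := hp
  exact ⟨F.obj N', F.map u, F.map r, hN', by rw [← F.map_d, hu, map_zero],
    by rw [← F.map_comp, hru, F.map_id], by rw [F.map_comp]⟩

theorem ExtClosed.inverseImage {D : Type u'} [DGCategory.{v'} k D] (F : DGFunctor k C D)
    {K : ObjectProperty (Ho k D)} (hK : ExtClosed K) : ExtClosed (K.inverseImage F.ho) where
  zero h := hK.zero (by rw [← F.map_id, h, map_zero])
  iso e h := hK.iso (F.ho.mapIso e) h
  shift e h := hK.shift (e.map F) h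
  ext e h h' := hK.ext (e.map F) h h'

end pieces

section finite

variable {k : Type w} [CommRing k] {A : Type u} [DGCategory.{u} k A]

namespace SemiFreeBasis

/-- The Yoneda lemma for semi-free modules. -/
def yoneda (N : IndCat k A) {X : A} {n : ℤ} : N.obj.obj X n →ₗ[k] Hom k ((toInd k A).obj X) N n :=
  N.obj.yo

variable {N : IndCat k A} (S : SemiFreeBasis N.obj)

/-- The morphism from a representable module given by a basis element. -/
def inj (t : S.ι) : Hom k ((toInd k A).obj (S.pt t)) N (S.deg t) := yoneda N (S.e t)

/-- The coordinate at a basis element. -/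
noncomputable def prj (t : S.ι) : Hom k N ((toInd k A).obj (S.pt t)) (-S.deg t) :=
  S.proj t (add_neg_cancel _)

theorem prj_yo (t : S.ι) {X : A} {n q : ℤ} (x : N.obj.obj X n) (h : -S.deg t + n = q)
    (h' : S.deg t + q = n) :
    comp h (S.prj t) (yoneda N x) =
      (toInd k A).map (S.coord t h' x) :=
  DGModule.comp_yo h (S.proj t (add_neg_cancel _)) x (show n + -S.deg t = q by omega)

theorem prj_inj_self (t : S.ι) : comp (neg_add_cancel _) (S.prj t) (S.inj t) = idd k _ := by
  refine (S.prj_yo t (S.e t) _ (add_zero _)).trans ?_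
  rw [← (toInd k A).map_id]
  exact congrArg _ (S.proj_e_self t (add_neg_cancel _))

theorem prj_inj_ne {t j : S.ι} (h : j ≠ t) {q : ℤ} (hq : -S.deg t + S.deg j = q) :
    comp hq (S.prj t) (S.inj j) = 0 := by
  refine (S.prj_yo t (S.e j) _ (by omega)).trans ?_
  rw [← map_zero (toInd k A).map]
  exact congrArg _ (S.proj_e_ne h (add_neg_cancel _) (show S.deg j + -S.deg t = q by omega))

/-- The graded projection to the span of finitely many basis elements. -/
noncomputable def truncation (T : Finset S.ι) : Hom k N N 0 :=
  ∑ t ∈ T, comp (add_neg_cancel _) (S.inj t) (S.prj t)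

theorem truncation_yo (T : Finset S.ι) {X : A} {n : ℤ} (x : N.obj.obj X n)
    (hx : ∀ j ∉ T, ∀ q (h : S.deg j + q = n), S.coord j h x = 0) :
    comp (zero_add n) (S.truncation T) (yoneda N x) = yoneda N x := by
  have h : ∀ t, comp (zero_add n)
      (comp (add_neg_cancel _) (S.inj t) (S.prj t)) (yoneda N x) =
      yoneda N (N.obj.act (add_sub_cancel (S.deg t) n) (S.e t)
        (S.coord t (add_sub_cancel _ _) x)) := by
    intro t
    rw [DGCategory.assoc (pq := n - S.deg t) _ _ (by omega) (by omega),
      S.prj_yo t x _ (by omega)]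
    refine (DGModule.comp_yo (add_sub_cancel _ _) (N.obj.yo (S.e t)) (S.coord t _ x)
      (by omega)).trans ?_
    rfl
  rw [truncation, map_sum, LinearMap.sum_apply, Finset.sum_congr rfl fun t _ => h t]
  refine (map_sum (yoneda N) _ T).symm.trans (congrArg _ ?_)
  exact S.sum_coord x T hx

theorem truncation_inj_of_notMem {T : Finset S.ι} {t : S.ι} (ht : t ∉ T) :
    comp (zero_add _) (S.truncation T) (S.inj t) = 0 := by
  rw [truncation, map_sum, LinearMap.sum_apply]
  refine Finset.sum_eq_zero fun j hj => ?_
  rw [DGCategory.assoc _ _ (rfl : -S.deg j + S.deg t = _) (by omega), prj_inj_ne, map_zero]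
  rintro rfl
  exact ht hj

theorem prj_truncation_of_notMem {T : Finset S.ι} {t : S.ι} (ht : t ∉ T) :
    comp (add_zero _) (S.prj t) (S.truncation T) = 0 := by
  rw [truncation, map_sum]
  refine Finset.sum_eq_zero fun j hj => ?_
  rw [← DGCategory.assoc (rfl : -S.deg t + S.deg j = _) (by omega), prj_inj_ne,
    LinearMap.map_zero₂]
  rintro rfl
  exact ht hj

/-- A set of basis elements that spans a DG submodule. -/
def IsClosed {M : DGModule k A} (S : SemiFreeBasis M) (T : Finset S.ι) : Prop :=
  ∀ i ∈ T, ∀ j q (h : S.deg j + q = S.deg i + 1), S.coord j h (M.d rfl (S.e i)) ≠ 0 → j ∈ T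

-- The differential of a basis element has finite support at strictly lower levels, so induction on
-- the level terminates with a finite set.
open Classical in
theorem exists_isClosed {M : DGModule k A} (S : SemiFreeBasis M) (s : Finset S.ι) :
    ∃ T, s ⊆ T ∧ S.IsClosed T := by
  have H : ∀ i, ∃ T, i ∈ T ∧ S.IsClosed T := by
    intro i
    induction hi : S.level i using Nat.strong_induction_on generalizing i with
    | _ a ih =>
    subst hi
    obtain ⟨s, hs⟩ := S.exists_finset (M.d rfl (S.e i))
    choose! T hT hT' using ih
    refine ⟨insert i ((s.filter fun j => S.level j < S.level i).biUnion
      fun j => T (S.level j) j), Finset.mem_insert_self _ _, ?_⟩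
    intro i' hi' j q h hj
    rw [Finset.mem_insert] at hi'
    obtain rfl | hi' := hi'
    · have hl := S.level_lt h hj
      refine Finset.mem_insert_of_mem (Finset.mem_biUnion.2 ⟨j, Finset.mem_filter.2 ⟨?_, hl⟩,
        hT _ hl j rfl⟩)
      by_contra hjs
      exact hj (hs j hjs _ _)
    · obtain ⟨j', hj', hi'⟩ := Finset.mem_biUnion.1 hi'
      have hl := (Finset.mem_filter.1 hj').2
      exact Finset.mem_insert_of_mem (Finset.mem_biUnion.2 ⟨j', hj', hT' _ hl _ rfl i' hi' j q h hj⟩)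
  choose T hT hT' using H
  refine ⟨s.biUnion T, fun i hi => Finset.mem_biUnion.2 ⟨i, hi, hT i⟩, ?_⟩
  intro i hi j q h hj
  obtain ⟨i', hi', hi⟩ := Finset.mem_biUnion.1 hi
  exact Finset.mem_biUnion.2 ⟨i', hi', hT' i' i hi j q h hj⟩

/-- Removing an element of maximal level leaves a closed set, since no differential in the set
involves it. That element is then attached again as one cell, a shift of a representable module. -/
theorem hasPiece_truncation {K : ObjectProperty (Ho k (IndCat k A))} (hK : ExtClosed K)
    (h : ∀ t, K ⟨⟨(toInd k A).obj (S.pt t)⟩⟩) (T : Finset S.ι) (hT : S.IsClosed T) :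
    HasPiece K (S.truncation T) := by
  classical
  induction hn : T.card generalizing T with
  | zero =>
    obtain rfl := Finset.card_eq_zero.1 hn
    exact hasPiece_zero (sPretr_indCat k A) hK N
  | succ n ih =>
    obtain ⟨t, ht, hmax⟩ := T.exists_max_image S.level (Finset.card_pos.1 (by omega))
    have hlt : ∀ i ∈ T, ∀ j q (h : S.deg j + q = S.deg i + 1),
        S.coord j h (N.obj.d rfl (S.e i)) ≠ 0 → j ∈ T.erase t := by
      intro i hi j q h hj
      refine Finset.mem_erase.2 ⟨?_, hT i hi j q h hj⟩
      rintro rfl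
      exact absurd (S.level_lt h hj) (hmax i hi).not_gt
    have hp := ih (T.erase t) (fun i hi => hlt i (Finset.mem_of_mem_erase hi))
      (by rw [Finset.card_erase_of_mem ht, hn]; rfl)
    obtain ⟨R, ⟨e⟩⟩ := (sPretr_indCat k A).shift ((toInd k A).obj (S.pt t)) (S.deg t) (-S.deg t)
      (add_neg_cancel _)
    have := hp.add (sPretr_indCat k A) hK (hK.shift e (h t))
      (comp (add_neg_cancel _) (S.inj t) e.b) (comp (add_neg_cancel _) e.a (S.prj t)) ?_ ?_ ?_ ?_
    · convert this using 1
      rw [truncation, ← Finset.add_sum_erase _ _ ht, add_comm]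
      refine congrArg _ ?_
      have h₁ := e.act_a_b
      simp only [← act_inj, act_comp, Category.assoc, reassoc_of% h₁]
    · have h₁ := S.prj_inj_self t
      have h₂ := e.act_b_a
      simp only [← act_inj, act_comp, act_idd] at h₁ ⊢
      simp only [Category.assoc, reassoc_of% h₁, h₂]
    · have h₁ := S.truncation_inj_of_notMem (Finset.notMem_erase t T)
      simp only [← act_inj, act_comp, act_zero] at h₁ ⊢
      simp only [Category.assoc, h₁, Limits.comp_zero]
    · have h₁ := S.prj_truncation_of_notMem (Finset.notMem_erase t T)
      simp only [← act_inj, act_comp, act_zero] at h₁ ⊢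
      simp only [reassoc_of% h₁, Limits.zero_comp]
    · have h₁ : d rfl (S.inj t) = yoneda N (N.obj.d rfl (S.e t)) := DGModule.d_yo _ rfl _
      have h₂ := S.truncation_yo (T.erase t) (N.obj.d rfl (S.e t)) fun j hj q h => by
        by_contra h0
        exact hj (hlt t ht j q h h0)
      rw [← h₁] at h₂
      rw [DGCategory.d_comp (add_neg_cancel _) (zero_add 1) rfl rfl (by omega) (by omega), e.d_b,
        map_zero, smul_zero, add_zero]
      simp only [← act_inj, act_comp] at h₂ ⊢
      rw [Category.assoc, h₂]

/-- Morphisms of any degree from a representable module take values in the span of a finite closed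
set of basis elements. -/
theorem exists_truncation_comp {X : A} {n : ℤ} (g : Hom k ((toInd k A).obj X) N n) :
    ∃ s : Finset S.ι, ∀ T, s ⊆ T → comp (zero_add n) (S.truncation T) g = g := by
  obtain ⟨x, rfl⟩ : ∃ x : N.obj.obj X n, yoneda N x = g := ⟨_, (DGModule.eq_yo _ g).symm⟩
  obtain ⟨s, hs⟩ := S.exists_finset x
  exact ⟨s, fun T hT => S.truncation_yo T x fun j hj => hs j fun h => hj (hT h)⟩

end SemiFreeBasis
end finite
end DG

namespace DG

section transfer

variable {k : Type w} [CommRing k] {C : Type u} [DGCategory.{v} k C] {D : Type u'}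
  [DGCategory.{v'} k D]

theorem DGFunctor.FF.acyclicHom_iff {F : DGFunctor k C D} (hF : F.FF) {X Y : C} :
    AcyclicHom k (F.obj X) (F.obj Y) ↔ AcyclicHom k X Y := by
  constructor
  · intro H m n l h h' f hf
    obtain ⟨g, hg⟩ := H m n l h h' (F.map f) (by rw [← F.map_d, hf, map_zero])
    obtain ⟨g, rfl⟩ := (hF X Y m).2 g
    exact ⟨g, (hF X Y n).1 (by rw [F.map_d, hg])⟩
  · intro H m n l h h' f hf
    obtain ⟨f, rfl⟩ := (hF X Y n).2 f
    obtain ⟨g, rfl⟩ := H m n l h h' f (hF.d_eq_zero h' hf)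
    exact ⟨F.map g, (F.map_d h g).symm⟩

theorem nonempty_iso_op {X Y : C} (a : (⟨⟨X⟩⟩ : Ho k C) ≅ ⟨⟨Y⟩⟩) :
    Nonempty ((⟨⟨⟨X⟩⟩⟩ : Ho k (DGOp C)) ≅ ⟨⟨⟨Y⟩⟩⟩) :=
  nonempty_iso_unop (X := (⟨⟨X⟩⟩ : DGOp (DGOp C))) (Y := ⟨⟨Y⟩⟩) ((toOpOp k C).ho.mapIso a)

theorem EnoughRight.unop {Q : ObjectProperty (Ho k C)} (h : EnoughRight (opProp Q)) :
    EnoughLeft Q := by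
  intro X
  obtain ⟨Z, Y, e, hY, hZ⟩ := h ⟨X⟩
  exact ⟨Z.unop, Y.unop, e.unop, hY, (rightOrthogonal_opProp_iff _).1 hZ⟩

end transfer

/-! ### Compactness of finite twisted complexes -/

section compact

variable {k : Type w} [CommRing k] {A : Type u} [DGCategory.{u} k A] {E : Type u'}
  [DGCategory.{v'} k E] (J : DGFunctor k (IndCat k A) E)

/-- Morphisms of any degree from `X` to the image of a semi-free module take values in the span of a
finite set of basis elements. -/
def FinitelySupported (X : E) : Prop :=
  ∀ (N : IndCat k A) (S : SemiFreeBasis N.obj) (n : ℤ) (g : Hom k X (J.obj N) n),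
    ∃ s : Finset S.ι, ∀ T, s ⊆ T → comp (zero_add n) (J.map (S.truncation T)) g = g

variable {J}

theorem finitelySupported_of_idd {X : E} (h : idd k X = 0) : FinitelySupported J X := by
  intro N S n g
  have h₁ : ∀ {m : ℤ} (f : Hom k X (J.obj N) m), f = 0 := by
    intro m f
    have := DGCategory.comp_id (k := k) (add_zero m) f
    rw [show DGCategory.id (k := k) X = 0 from h, map_zero] at this
    exact this.symm
  exact ⟨∅, fun T _ => by rw [h₁ g, map_zero]⟩

theorem FinitelySupported.hIso {X Y : E} {n m : ℤ} (hX : FinitelySupported J X)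
    (e : HIso k n m X Y) : FinitelySupported J Y := by
  intro N S p g
  obtain ⟨s, hs⟩ := hX N S (p + n) (comp rfl g e.a)
  refine ⟨s, fun T hT => ?_⟩
  have h₁ := hs T hT
  have h₂ := e.act_b_a
  simp only [← act_inj, act_comp, Category.assoc] at h₁ ⊢
  have := act e.b ≫= h₁
  simp only [reassoc_of% h₂] at this
  exact this

-- A map on `Z` is determined by its restrictions along `i` and `s`; the union of two finite
-- supports works even though `s` is not closed.
open Classical in
theorem FinitelySupported.ext {X Y Z : E} (e : Ext k Y Z X) (hY : FinitelySupported J Y)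
    (hX : FinitelySupported J X) : FinitelySupported J Z := by
  intro N S p g
  obtain ⟨s, hs⟩ := hY N S p (comp (add_zero _) g e.i)
  obtain ⟨t, ht⟩ := hX N S p (comp (add_zero _) g e.s)
  refine ⟨s ∪ t, fun T hT => ?_⟩
  have h₁ := hs T (Finset.union_subset_left hT)
  have h₂ := ht T (Finset.union_subset_right hT)
  have h₃ : act g = act e.r ≫ act e.i ≫ act g + act e.π ≫ act e.s ≫ act g := by
    rw [e.act_r_i_assoc]; abel
  rw [← act_inj, act_comp, act_comp, Category.assoc] at h₁ h₂
  rw [← act_inj, act_comp, h₃, Preadditive.add_comp, Category.assoc, Category.assoc,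
    Category.assoc, Category.assoc, h₁, h₂]

theorem finitelySupported_repr (hJ : J.FF) (X : A) :
    FinitelySupported J (J.obj ((toInd k A).obj X)) := by
  intro N S n g
  obtain ⟨g, rfl⟩ := (hJ _ _ _).2 g
  obtain ⟨s, hs⟩ := S.exists_truncation_comp g
  exact ⟨s, fun T hT => by rw [← J.map_comp, hs T hT]⟩

end compact

/-! ### Orthogonality, resolution and factorization for induced modules -/

section induced

variable {k : Type w} [CommRing k] {B : Type u} [DGCategory.{u} k B] {A : Type u}
  [DGCategory.{u} k A] {E : Type u'} [DGCategory.{v'} k E] {F : DGFunctor k B A}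
  {J : DGFunctor k (IndCat k A) E}

/-- The objects of `E` that come from induced semi-free modules. -/
abbrev inducedProp (F : DGFunctor k B A) (J : DGFunctor k (IndCat k A) E) :
    ObjectProperty (Ho k E) := ((indFunctor F).trans J).ho.essImage

theorem extClosed_inducedProp (hF : F.FF) (hJ : J.FF) : ExtClosed (inducedProp F J) :=
  ExtClosed.essImage ((indFunctor_ff hF).trans hJ) (sPretr_indCat k B)

theorem acyclicHom_ind {Z : IndCat k A} (hZ : ∀ b, AcyclicHom k ((toInd k A).obj (F.obj b)) Z)
    (N : IndCat k B) : AcyclicHom k ((indFunctor F).obj N) Z := by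
  obtain ⟨S⟩ := N.property
  exact (S.ind F).acyclicHom fun i => hZ (S.pt i)

theorem hIso_toInd (F : DGFunctor k B A) (b : B) :
    Nonempty (HIso k 0 0 ((toInd k A).obj (F.obj b)) ((indFunctor F).obj ((toInd k B).obj b))) := by
  obtain ⟨e⟩ := Ind.nonempty_hIso_repr F b
  exact ⟨{ (e) with }⟩

/-- In one direction orthogonality is tested on modules induced from representables, which are
representable; the other direction is dévissage. -/
theorem rightOrthogonal_inducedProp_iff (hF : F.FF) (hJ : J.FF) (hE : SPretr k E)
    (Z : IndCat k A) : (inducedProp F J).rightOrthogonal ⟨⟨J.obj Z⟩⟩ ↔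
      ∀ b, AcyclicHom k ((toInd k A).obj (F.obj b)) Z := by
  constructor
  · intro h b
    obtain ⟨e⟩ := hIso_toInd F b
    refine (extClosed_acyclicHom' Z).shift e.symm ?_
    refine hJ.acyclicHom_iff.1 (acyclicHom_of_rightOrthogonal hE (extClosed_inducedProp hF hJ)
      ?_ h)
    exact ((indFunctor F).trans J).ho.obj_mem_essImage ⟨⟨(toInd k B).obj b⟩⟩
  · rintro h ⟨⟨X⟩⟩ f ⟨⟨⟨N⟩⟩, ⟨a⟩⟩
    have := hm_eq_zero_of_acyclicHom (hJ.acyclicHom_iff.2 (acyclicHom_ind h N)) (a.hom ≫ f)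
    exact (cancel_epi a.hom).1 (this.trans Limits.comp_zero.symm)

/-- `X` is only homotopy equivalent to some `J M`, so the class of the resolution of `M` is pushed
along this equivalence, which yields a genuine extension of `X`. -/
theorem enoughRight_inducedProp (hF : F.FF) (hJ : J.FF) (hE : SPretr k E)
    (hs : ∀ X : E, ∃ N, Nonempty ((⟨⟨J.obj N⟩⟩ : Ho k E) ≅ ⟨⟨X⟩⟩)) :
    EnoughRight (inducedProp F J) := by
  intro X
  obtain ⟨M, ⟨a⟩⟩ := hs X
  obtain ⟨f, g, hf, hg, -, -, h₁, h₂⟩ := exists_representatives a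
  obtain ⟨N, Z, e, hZ⟩ := exists_ext_acyclicHom F hF M
  obtain ⟨Z', e', he'⟩ := hE.ext (J.obj ((indFunctor F).obj N)) X
    (comp (zero_add 1) f (J.map e.δ)) (by
      have h : d one_add_one_eq_two (J.map e.δ) = 0 := by rw [← J.map_d, e.d_δ, map_zero]
      exact HIso.d_comp_closed _ _ _ hf h _)
  obtain ⟨c⟩ := Ext.nonempty_iso_of_conj (e.map J) e' (x := idd k _) (x' := idd k _)
    (hx := d_id _ _) (hx' := d_id _ _) h₁ h₂ (by rw [hm_id, Category.comp_id])
    (by rw [hm_id, Category.comp_id]) (by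
      rw [he', act_comp, act_idd, Category.id_comp]; rfl)
  exact ⟨Z', _, e', ((indFunctor F).trans J).ho.obj_mem_essImage ⟨⟨N⟩⟩,
    (inducedProp F J).rightOrthogonal.prop_of_iso c
      ((rightOrthogonal_inducedProp_iff hF hJ hE Z).2 hZ)⟩

/-- By finite support the morphism lands in the piece spanned by a finite closed set of basis
elements. That piece lies in the extension closed class `K` containing the representables from `B`,
hence comes from `Q₀`. -/
theorem factorsThrough_inducedProp
    {D₀ : Type u''} [DGCategory.{v''} k D₀] {Φ : DGFunctor k D₀ E} (hΦ : Φ.FF)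
    {Q₀ : ObjectProperty (Ho k D₀)} {K : ObjectProperty (Ho k E)} (hK : ExtClosed K)
    (hKF : ∀ b, K ⟨⟨J.obj ((toInd k A).obj (F.obj b))⟩⟩)
    (hKQ : ∀ X, K ⟨⟨X⟩⟩ → ∃ X₀, Q₀ ⟨⟨X₀⟩⟩ ∧ Nonempty ((⟨⟨Φ.obj X₀⟩⟩ : Ho k E) ≅ ⟨⟨X⟩⟩))
    (hc : ∀ X, FinitelySupported J (Φ.obj X)) : FactorsThrough Φ Q₀ (inducedProp F J) := by
  rintro X Z f hf ⟨⟨⟨N⟩⟩, ⟨a⟩⟩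
  obtain ⟨a, a', ha, ha', -, -, -, h₂⟩ := exists_representatives (X := J.obj ((indFunctor F).obj N)) a
  obtain ⟨S⟩ := N.property
  obtain ⟨s, hs⟩ := hc X ((indFunctor F).obj N) (S.ind F) 0 (comp (zero_add 0) a' f)
  obtain ⟨T, hsT, hT⟩ := (S.ind F).exists_isClosed s
  obtain ⟨N', p, r, hN', hp, hrp, hpr⟩ := HasPiece.map J ((S.ind F).hasPiece_truncation
    (N := (indFunctor F).obj N) (hK.inverseImage J) (fun t => hKF (S.pt t)) T hT)
  obtain ⟨Z₀, hZ₀, ⟨c⟩⟩ := hKQ N' hN'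
  obtain ⟨c, c', hc, hc', -, -, -, h₄⟩ := exists_representatives c
  have hT' := hs T hsT
  rw [← hpr] at hT'
  -- The graded retraction `r` is not closed, but `p` is, and `p` composed with this morphism is the
  -- closed morphism `a' f`; since `r p = 1`, closedness descends.
  have hx : d (zero_add 1) (comp (zero_add 0) r (comp (zero_add 0) a' f)) = 0 := by
    have h₁ := closed_comp ha' hf
    rw [closed_zero_iff] at h₁ hp ⊢
    simp only [← act_inj, act_comp, act_idd, Category.assoc] at hT' hrp h₁ ⊢
    have h₅ := hT' =≫ (dOp k _ ≫ act r)
    simp only [Category.assoc, reassoc_of% hp, hrp, Category.comp_id] at h₅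
    rw [h₅, reassoc_of% h₁]
  obtain ⟨x, hx'⟩ := (hΦ X Z₀ 0).2 (comp (zero_add 0) c'
    (comp (zero_add 0) r (comp (zero_add 0) a' f)))
  have hx₀ : d (zero_add 1) (Φ.map x) = 0 := by rw [hx']; exact closed_comp hc' hx
  have H : hm f hf = hm (Φ.map x) hx₀ ≫ hm c hc ≫ hm p hp ≫ hm a ha := by
    have e₁ : hm (Φ.map x) hx₀ = hm _ hx ≫ hm c' hc' := by
      rw [hm_comp]
      simp only [hx']
    have e₂ : hm _ hx ≫ hm p hp = hm f hf ≫ hm a' ha' := by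
      rw [hm_comp, hm_comp]
      have : comp (zero_add 0) p (comp (zero_add 0) r (comp (zero_add 0) a' f)) =
        comp (zero_add 0) a' f := by
        rw [← DGCategory.assoc (zero_add 0) (zero_add 0), hT']
      simp only [this]
    rw [e₁, Category.assoc, reassoc_of% h₄, reassoc_of% e₂, h₂, Category.comp_id]
  rw [hm_comp, hm_comp, hm_comp] at H
  obtain ⟨κ, hκ⟩ := hm_eq_iff.1 H
  exact ⟨Z₀, x, _, κ, hZ₀, hΦ.d_eq_zero _ hx₀, closed_comp (closed_comp ha hp) hc, hκ⟩

end induced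
end DG

namespace DG

/-! ### Reduction of twisted complexes to single terms -/

section pretr

variable {k : Type w} [CommRing k] {C : Type u} [DGCategory.{v} k C] {D : Type u'}
  [DGCategory.{v'} k D]

theorem FullSub.incl_ff (R : C → Prop) : (FullSub.incl k R).FF :=
  fun _ _ _ => Function.bijective_id

theorem prop_of_eq (K : ObjectProperty (Ho k C)) {X Y : C} (h : X = Y) (hX : K ⟨⟨X⟩⟩) : K ⟨⟨Y⟩⟩ :=
  h ▸ hX

theorem toOpOp_ff : (toOpOp k C).FF := fun _ _ _ => Function.bijective_id

namespace Pretr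

theorem essImage_tr (hC : SPretr k C) (G : DGFunctor k C D) (X : Pretr k D) :
    G.tr.essImage ⟨⟨X⟩⟩ ↔ ∃ c, Nonempty ((⟨⟨single (G.obj c)⟩⟩ : Tr k D) ≅ ⟨⟨X⟩⟩) := by
  constructor
  · rintro ⟨⟨⟨Y⟩⟩, ⟨a⟩⟩
    obtain ⟨c, ⟨e⟩⟩ := exists_iso_single hC Y
    exact ⟨c, ⟨eqToIso (by rw [← pretr_obj_single]; rfl) ≪≫ G.tr.mapIso e ≪≫ a⟩⟩
  · rintro ⟨c, ⟨e⟩⟩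
    exact ⟨⟨⟨single c⟩⟩, ⟨eqToIso (by rw [← pretr_obj_single]; rfl) ≪≫ e⟩⟩

/-- Complexes with terms in `R` lie in `K` because `K` is closed under extensions. Conversely, an
object of `K` is equivalent to a single term, which then satisfies `R`. -/
theorem essImage_incl (hC : SPretr k C) {R : C → Prop} {K : ObjectProperty (Tr k C)}
    (hK : ExtClosed K) (hR : ∀ c, K ⟨⟨single c⟩⟩ ↔ R c) : (FullSub.incl k R).tr.essImage = K := by
  ext X
  constructor
  · rintro ⟨⟨⟨Y⟩⟩, ⟨a⟩⟩
    refine hK.iso a (prop_of_single (hK.inverseImage (FullSub.incl k R).pretr) (fun c => ?_) Y)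
    have := pretr_obj_single (FullSub.incl k R) c
    exact prop_of_eq K this.symm ((hR c.obj).2 c.property)
  · obtain ⟨⟨X⟩⟩ := X
    intro h
    obtain ⟨c, ⟨e⟩⟩ := exists_iso_single hC X
    refine ⟨⟨⟨single ⟨c, (hR c).1 (hK.iso e.symm h)⟩⟩⟩, ⟨?_⟩⟩
    exact eqToIso (congrArg (fun X => (⟨⟨X⟩⟩ : Tr k C))
      (pretr_obj_single (FullSub.incl k R) _)) ≪≫ e

end Pretr

theorem extClosed_forall {ι : Sort*} {K : ι → ObjectProperty (Ho k C)} (h : ∀ i, ExtClosed (K i)) :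
    ExtClosed (fun X => ∀ i, K i X) where
  zero hX i := (h i).zero hX
  iso e hX i := (h i).iso e (hX i)
  shift e hX i := (h i).shift e (hX i)
  ext e hY hX i := (h i).ext e (hY i) (hX i)

end pretr

/-! ### The ind side -/

section ind

variable (k : Type w) [CommRing k] {A : Type u} [DGCategory.{u} k A] (P : A → Prop)

open Pretr

theorem inducedProp_toInd {B : Type u} [DGCategory.{u} k B] (F : DGFunctor k B A) {E : Type u'}
    [DGCategory.{v'} k E] (J : DGFunctor k (IndCat k A) E) (b : B) :
    inducedProp F J ⟨⟨J.obj ((toInd k A).obj (F.obj b))⟩⟩ := by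
  obtain ⟨e⟩ := hIso_toInd F b
  exact ⟨⟨⟨(toInd k B).obj b⟩⟩, ⟨(J.ho.mapIso e.iso).symm⟩⟩

/-- Semi-free `B`-modules already have shifts and cones, so twisted complexes of induced modules
reduce to single induced modules. -/
theorem subIndTr_eq : subIndTr k P = inducedProp (FullSub.incl k P) (singleFunctor k (IndCat k A)) := by
  ext ⟨⟨X⟩⟩
  refine (essImage_tr (sPretr_indCat k _) (indFunctor (FullSub.incl k P)) X).trans ⟨?_, ?_⟩
  · rintro ⟨N, ⟨e⟩⟩
    exact ⟨⟨⟨N⟩⟩, ⟨e⟩⟩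
  · rintro ⟨⟨⟨N⟩⟩, ⟨e⟩⟩
    exact ⟨N, ⟨e⟩⟩

theorem extClosed_subTr : ExtClosed (subTr k P) :=
  ExtClosed.essImage (FullSub.incl_ff P).pretr (sPretr k _)

theorem extClosed_subIndTr : ExtClosed (subIndTr k P) :=
  ExtClosed.essImage (indFunctor_ff (FullSub.incl_ff P)).pretr (sPretr k _)

theorem enoughRight_subIndTr : EnoughRight (subIndTr k P) := by
  rw [subIndTr_eq]
  exact enoughRight_inducedProp (FullSub.incl_ff P) (singleFunctor_ff) (sPretr k _)
    (exists_iso_single (sPretr_indCat k A))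

/-- Acyclicity against the objects of `B` is an extension closed condition on twisted complexes, so
both sides need only be compared on single terms. -/
theorem essImage_perp : (FullSub.incl k (perp k P)).tr.essImage = (subIndTr k P).rightOrthogonal := by
  have hK : ExtClosed (fun X : Tr k (IndCat k A) => ∀ b (_ : P b),
      AcyclicHom k (single ((toInd k A).obj b)) X.as.obj) :=
    extClosed_forall fun b => extClosed_forall fun _ => extClosed_acyclicHom _
  have hR : ∀ c : IndCat k A, (∀ b (_ : P b), AcyclicHom k (single ((toInd k A).obj b)) (single c)) ↔
      perp k P c := fun c => forall₂_congr fun b _ => singleFunctor_ff.acyclicHom_iff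
  rw [essImage_incl (sPretr_indCat k A) hK hR, subIndTr_eq]
  ext ⟨⟨X⟩⟩
  obtain ⟨N, ⟨e⟩⟩ := exists_iso_single (sPretr_indCat k A) X
  refine Iff.trans ⟨hK.iso e.symm, hK.iso e⟩ (Iff.trans (hR N) (Iff.trans ?_
    (ObjectProperty.prop_iff_of_iso _ e)))
  refine Iff.trans ?_ (rightOrthogonal_inducedProp_iff (FullSub.incl_ff P) singleFunctor_ff
    (sPretr k _) N).symm
  exact ⟨fun h b => h b.obj b.property, fun h b hb => h ⟨b, hb⟩⟩

/-- A twisted complex over `A` is a finite iterated extension of shifts of single terms, whose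
images are representable. -/
theorem finitelySupported_pretr_toInd (X : Pretr k A) :
    FinitelySupported (singleFunctor k (IndCat k A)) ((toInd k A).pretr.obj X) := by
  induction X using Pretr.induction with
  | zero X h => exact finitelySupported_of_idd (by rw [← DGFunctor.map_id, h, map_zero])
  | single X c n m e =>
    refine FinitelySupported.hIso ?_ (e.map (toInd k A).pretr)
    rw [pretr_obj_single]
    exact finitelySupported_repr singleFunctor_ff c
  | ext Y Z X e hY hX => exact FinitelySupported.ext (e.map (toInd k A).pretr) hY hX

theorem exists_fullyFaithful_ind :
    ∃ G : Tr.VerdierQuotient (subTr k P) ⥤ Tr.VerdierQuotient (subIndTr k P),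
      Nonempty (Tr.verdierQ (subTr k P) ⋙ G ≅ (toInd k A).tr ⋙ Tr.verdierQ (subIndTr k P)) ∧
        G.Full ∧ G.Faithful := by
  have := Tr.isLocalization_extW (extClosed_subTr k P)
  have := Tr.isLocalization_extW (extClosed_subIndTr k P)
  refine exists_fullyFaithful_of_enoughRight (sPretr k A) (sPretr k _) (toInd_ff k A).pretr
    (extClosed_subTr k P) (extClosed_subIndTr k P) ?_ ?_ (enoughRight_subIndTr k P) _ _
  · rintro X ⟨⟨⟨Y⟩⟩, ⟨a⟩⟩
    have hK := (extClosed_subIndTr k P).inverseImage (toInd k A).pretr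
    refine hK.iso a (prop_of_single (hK.inverseImage (FullSub.incl k P).pretr) (fun c => ?_) Y)
    rw [subIndTr_eq]
    have := (congrArg (toInd k A).pretr.obj (pretr_obj_single (FullSub.incl k P) c)).trans
      (pretr_obj_single (toInd k A) c.obj)
    exact prop_of_eq (inducedProp _ _) this.symm
      (inducedProp_toInd k (FullSub.incl k P) (singleFunctor k (IndCat k A)) c)
  · rw [subIndTr_eq]
    refine factorsThrough_inducedProp (toInd_ff k A).pretr
      (K := ((FullSub.incl k P).pretr.trans (toInd k A).pretr).ho.essImage)
      (ExtClosed.essImage ((FullSub.incl_ff P).pretr.trans (toInd_ff k A).pretr) (sPretr k _))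
      (fun b => ?_) ?_ (finitelySupported_pretr_toInd k)
    · have := (congrArg (toInd k A).pretr.obj (pretr_obj_single (FullSub.incl k P) b)).trans
        (pretr_obj_single (toInd k A) b.obj)
      exact prop_of_eq ((FullSub.incl k P).pretr.trans (toInd k A).pretr).ho.essImage this
        (((FullSub.incl k P).pretr.trans (toInd k A).pretr).ho.obj_mem_essImage ⟨⟨single b⟩⟩)
    · rintro X ⟨⟨⟨Y⟩⟩, ⟨a⟩⟩
      exact ⟨_, (FullSub.incl k P).tr.obj_mem_essImage ⟨⟨Y⟩⟩, ⟨a⟩⟩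

end ind

/-! ### The pro side, by duality -/

section pro

variable (k : Type w) [CommRing k] {A : Type u} [DGCategory.{u} k A] (P : A → Prop)

open Pretr

variable (A) in
/-- Semi-free modules over the dual DG category, as objects of the dual of the DG category of
twisted complexes of pro-objects. -/
abbrev proSingle : DGFunctor k (IndCat k (DGOp A)) (DGOp (Pretr k (ProCat k A))) :=
  (toOpOp k _).trans (singleFunctor k (ProCat k A)).op

theorem proSingle_ff : (proSingle k A).FF := toOpOp_ff.trans singleFunctor_ff.op

theorem sPretr_proCat : SPretr k (ProCat k A) := (sPretr_indCat k (DGOp A)).op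

theorem toPro_ff : (toPro k A).FF := toOpOp_ff.trans (toInd_ff k (DGOp A)).op

/-- The pro-objects induced from `B` are, after dualizing, the modules over `A°` induced from `B°`.
The target is the dual of a category of twisted complexes and not one itself, which is why the ind
arguments allow a general `J`. -/
theorem opProp_subProTr : opProp (subProTr k P) =
    inducedProp (FullSub.incl k P).op (proSingle k A) := by
  ext ⟨⟨⟨X⟩⟩⟩
  refine (essImage_tr (sPretr_proCat k) (proFunctor (FullSub.incl k P)) X).trans ⟨?_, ?_⟩
  · rintro ⟨⟨N⟩, ⟨e⟩⟩
    exact ⟨⟨⟨N⟩⟩, nonempty_iso_op e⟩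
  · rintro ⟨⟨⟨N⟩⟩, ⟨e⟩⟩
    exact ⟨⟨N⟩, nonempty_iso_unop (X := (proSingle k A).obj ((indFunctor _).obj N)) (Y := ⟨X⟩) e⟩

theorem extClosed_subProTr : ExtClosed (subProTr k P) :=
  ExtClosed.essImage (DGFunctor.FF.op (indFunctor_ff (FullSub.incl_ff P).op)).pretr (sPretr k _)

theorem exists_iso_proSingle (X : DGOp (Pretr k (ProCat k A))) :
    ∃ N, Nonempty ((⟨⟨(proSingle k A).obj N⟩⟩ : Ho k (DGOp (Pretr k (ProCat k A)))) ≅ ⟨⟨X⟩⟩) := by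
  obtain ⟨c, ⟨e⟩⟩ := exists_iso_single (sPretr_proCat k) X.unop
  exact ⟨c.unop, nonempty_iso_op e⟩

theorem enoughLeft_subProTr : EnoughLeft (subProTr k P) := by
  refine EnoughRight.unop ?_
  rw [opProp_subProTr]
  exact enoughRight_inducedProp (FullSub.incl_ff P).op (proSingle_ff k) (sPretr k _).op
    (exists_iso_proSingle k)

theorem essImage_coperp :
    (FullSub.incl k (coperp k P)).tr.essImage = (subProTr k P).leftOrthogonal := by
  have hK : ExtClosed (fun X : Tr k (ProCat k A) => ∀ b (_ : P b),
      AcyclicHom k X.as.obj (single ((toPro k A).obj b))) :=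
    extClosed_forall fun b => extClosed_forall fun _ => extClosed_acyclicHom' _
  have hR : ∀ c : ProCat k A, (∀ b (_ : P b), AcyclicHom k (single c) (single ((toPro k A).obj b))) ↔
      coperp k P c := fun c => forall₂_congr fun b _ => singleFunctor_ff.acyclicHom_iff
  rw [essImage_incl (sPretr_proCat k) hK hR]
  ext ⟨⟨X⟩⟩
  obtain ⟨N, ⟨e⟩⟩ := exists_iso_single (sPretr_proCat k) X
  refine Iff.trans ⟨hK.iso e.symm, hK.iso e⟩ (Iff.trans (hR N) (Iff.trans ?_
    (ObjectProperty.prop_iff_of_iso _ e)))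
  refine Iff.trans ?_ (rightOrthogonal_opProp_iff (⟨⟨⟨single N⟩⟩⟩ : Ho k (DGOp _)))
  rw [opProp_subProTr]
  refine Iff.trans ?_ (rightOrthogonal_inducedProp_iff (FullSub.incl_ff P).op (proSingle_ff k)
    (sPretr k _).op N.unop).symm
  exact ⟨fun h b => h b.unop.obj b.unop.property, fun h b hb => h ⟨⟨b, hb⟩⟩⟩

theorem finitelySupported_pretr_toPro (X : Pretr k A) :
    FinitelySupported (proSingle k A) ⟨(toPro k A).pretr.obj X⟩ := by
  induction X using Pretr.induction with
  | zero X h =>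
    refine finitelySupported_of_idd (Eq.trans ?_ (map_zero ((toPro k A).pretr.map)))
    exact ((toPro k A).pretr.map_id X).symm.trans (congrArg (toPro k A).pretr.map h)
  | single X c n m e =>
    refine FinitelySupported.hIso ?_ (e.map (toPro k A).pretr).op.symm
    rw [pretr_obj_single]
    exact finitelySupported_repr (proSingle_ff k) ⟨c⟩
  | ext Y Z X e hY hX => exact FinitelySupported.ext (e.map (toPro k A).pretr).op hX hY

/-- The factorization is verified in the dual categories: compactness there concerns morphisms from
a pro-object induced from `B` to a finite twisted complex, read backwards. -/
theorem exists_fullyFaithful_pro :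
    ∃ G : Tr.VerdierQuotient (subTr k P) ⥤ Tr.VerdierQuotient (subProTr k P),
      Nonempty (Tr.verdierQ (subTr k P) ⋙ G ≅ (toPro k A).tr ⋙ Tr.verdierQ (subProTr k P)) ∧
        G.Full ∧ G.Faithful := by
  have := Tr.isLocalization_coextW (extClosed_subTr k P)
  have := Tr.isLocalization_coextW (extClosed_subProTr k P)
  refine exists_fullyFaithful_of_enoughLeft (sPretr k A) (sPretr k _) (toPro_ff k).pretr
    (extClosed_subTr k P) (extClosed_subProTr k P) ?_ ?_ (enoughLeft_subProTr k P) _ _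
  · rintro X ⟨⟨⟨Y⟩⟩, ⟨a⟩⟩
    have hK := (extClosed_subProTr k P).inverseImage (toPro k A).pretr
    refine hK.iso a (prop_of_single (hK.inverseImage (FullSub.incl k P).pretr) (fun c => ?_) Y)
    have h₁ : opProp (subProTr k P) ⟨⟨⟨single ((toPro k A).obj c.obj)⟩⟩⟩ := by
      rw [opProp_subProTr]
      exact inducedProp_toInd k (FullSub.incl k P).op (proSingle k A) ⟨c⟩
    have := (congrArg (toPro k A).pretr.obj (pretr_obj_single (FullSub.incl k P) c)).trans
      (pretr_obj_single (toPro k A) c.obj)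
    exact prop_of_eq (subProTr k P) this.symm h₁
  · rw [opProp_subProTr]
    have hK := ExtClosed.essImage ((FullSub.incl_ff P).pretr.trans (toPro_ff (A := A) k).pretr)
      (sPretr k _)
    refine factorsThrough_inducedProp (toPro_ff k).pretr.op hK.op (fun b => ?_) ?_
      (fun X => finitelySupported_pretr_toPro k X.unop)
    · have := (congrArg (toPro k A).pretr.obj (pretr_obj_single (FullSub.incl k P) b.unop)).trans
        (pretr_obj_single (toPro k A) b.unop.obj)
      exact prop_of_eq ((FullSub.incl k P).pretr.trans (toPro k A).pretr).ho.essImage this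
        (((FullSub.incl k P).pretr.trans (toPro k A).pretr).ho.obj_mem_essImage ⟨⟨single b.unop⟩⟩)
    · rintro ⟨X⟩ ⟨⟨⟨Y⟩⟩, ⟨a⟩⟩
      exact ⟨⟨_⟩, (FullSub.incl k P).tr.obj_mem_essImage ⟨⟨Y⟩⟩, nonempty_iso_op a⟩

end pro
end DG

theorem proposition4p7 (k : Type w) [CommRing k] (A : Type u) [DG.DGCategory.{u} k A]
    (B : A → Prop) :
    -- (i)
    DG.Tr.RightAdmissible (DG.subIndTr k B) ∧
    -- (ii)
    ((DG.FullSub.incl k (DG.perp k B)).tr.Full ∧ (DG.FullSub.incl k (DG.perp k B)).tr.Faithful ∧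
      (DG.FullSub.incl k (DG.perp k B)).tr.essImage = (DG.subIndTr k B).rightOrthogonal) ∧
    -- (iii)
    ((DG.FullSub.incl k (DG.perp k B)).tr ⋙ DG.Tr.verdierQ (DG.subIndTr k B)).IsEquivalence ∧
    -- (iv)
    (∃ G : DG.Tr.VerdierQuotient (DG.subTr k B) ⥤ DG.Tr.VerdierQuotient (DG.subIndTr k B),
      Nonempty (DG.Tr.verdierQ (DG.subTr k B) ⋙ G ≅
        (DG.toInd k A).tr ⋙ DG.Tr.verdierQ (DG.subIndTr k B)) ∧ G.Full ∧ G.Faithful) ∧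
    -- (i°)
    DG.Tr.LeftAdmissible (DG.subProTr k B) ∧
    -- (ii°)
    ((DG.FullSub.incl k (DG.coperp k B)).tr.Full ∧
      (DG.FullSub.incl k (DG.coperp k B)).tr.Faithful ∧
      (DG.FullSub.incl k (DG.coperp k B)).tr.essImage = (DG.subProTr k B).leftOrthogonal) ∧
    -- (iii°)
    ((DG.FullSub.incl k (DG.coperp k B)).tr ⋙ DG.Tr.verdierQ (DG.subProTr k B)).IsEquivalence ∧
    -- (iv°)
    (∃ G : DG.Tr.VerdierQuotient (DG.subTr k B) ⥤ DG.Tr.VerdierQuotient (DG.subProTr k B),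
      Nonempty (DG.Tr.verdierQ (DG.subTr k B) ⋙ G ≅
        (DG.toPro k A).tr ⋙ DG.Tr.verdierQ (DG.subProTr k B)) ∧ G.Full ∧ G.Faithful) := by
  open DG in
  have h₁ := (FullSub.incl_ff (k := k) (perp k B)).pretr.full
  have h₂ := (FullSub.incl_ff (k := k) (perp k B)).pretr.faithful
  have h₃ := (FullSub.incl_ff (k := k) (coperp k B)).pretr.full
  have h₄ := (FullSub.incl_ff (k := k) (coperp k B)).pretr.faithful
  have h₅ := Tr.isLocalization_extW (extClosed_subIndTr k B)
  have h₆ := Tr.isLocalization_coextW (extClosed_subProTr k B)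
  exact ⟨Tr.rightAdmissible (extClosed_subIndTr k B) (enoughRight_subIndTr k B),
    ⟨h₁, h₂, essImage_perp k B⟩,
    isEquivalence_of_enoughRight (Pretr.sPretr k _) (extClosed_subIndTr k B)
      (enoughRight_subIndTr k B) _ (essImage_perp k B) _,
    exists_fullyFaithful_ind k B,
    Tr.leftAdmissible (extClosed_subProTr k B) (enoughLeft_subProTr k B),
    ⟨h₃, h₄, essImage_coperp k B⟩,
    isEquivalence_of_enoughLeft (Pretr.sPretr k _) (extClosed_subProTr k B)
      (enoughLeft_subProTr k B) _ (essImage_coperp k B) _,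
    exists_fullyFaithful_pro k B⟩
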